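/- **Setting.** For $m,n\ge 0$ let $\operatorname{Cob}^m_n$ be the following graded category. Its objects are formal shifts $q^k a$ ($k\in\mathbb Z$) of properly embedded compact 1-submanifolds $a\subset[0,1]^2$ with boundary $\{\tfrac{i}{m+1}:1\le i\le m\}\times\{1\}\ \cup\ \{\tfrac{j}{n+1}:1\le j\le n\}\times\{0\}$. Its morphisms are $\mathbb Z[\alpha]$-linear combinations of (nicely embedded) cobordisms in $[0,1]^2\times[0,1]$ decorated with finitely many dots, modulo isotopy fixing the boundary and the local relations: a sphere with $0,1,2,3$ dots equals $0,1,0,\alpha$ respectively; a cylinder equals the sum of the two surfaces obtained by cutting it, capping both ends with discs and putting a dot on one of the two discs (neck cutting); a sheet with a handle equals twice the sheet with a dot. Composition is stacking. A cobordism $S:q^ka\to q^lb$ with $d$ dots has $q$-degree $l-k-\chi(S)+\tfrac{m+n}{2}+2d$, and $\alpha$ has $q$-degree $4$. Let $\mathrm{BN}^m_n$ be the closure of $\operatorname{Cob}^m_n$ under finite direct sums (morphisms are matrices), and $(\mathrm{BN}^m_n)^\Pi$ its closure under countable direct products (morphisms are matrices $({}_jf_i:a_i\to b_j)$ such that for each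 $j$ only finitely many ${}_jf_i$ are non-zero). For chain complexes $A,B$ (indexed by $\mathbb Z$, differentials of homological degree $+1$), $\operatorname{Hom}^\bullet(A,B)$ is the complex with $\operatorname{Hom}^k(A,B)=\prod_i\operatorname{Hom}(A^i,B^{i+k})$ and differential $f\mapsto d_B f-(-1)^k f d_A$; a map has bidegree $(k,l)$ if it lies in $\operatorname{Hom}^k(A,B)$ and all its entries are homogeneous of $q$-degree $l$. For $f\in \operatorname{Hom}^{|f|}(A',A)$ and $g\in\operatorname{Hom}^{|g|}(B,B')$ put $R_f(z)=(-1)^{|z||f|}\,z\circ f$ and $L_g(z)=g\circ z$. The dual $a^\vee$ of a diagram is its reflection across the horizontal axis, with $(q^ka)^\vee=q^{-k}a^\vee$; on cobordisms $(\ )^\vee$ is induced by $(x,y,z)\mapsto(x,1-y,1-z)$, and on matrices one also transposes. For a chain complex $A$ over $\mathrm{BN}^m_n$, $A^\vee$ is the complex over $\mathrm{BN}^n_m$ with $(A^\vee)^k=(A^{-k})^\vee$, where for a homogeneous map $f$ of homological degree $k$ one sets $(f^\vee)_i=(-1)^{ik}(f_{-i-k})^\vee$, and the differential of $A^\vee$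 is $-(d_A)^\vee$. Let $a\otimes b$ denote the diagram $a$ stacked on top of $b$. For complexes $C,D$, $C\mathbin{\bar\otimes}D$ is the direct product total complex, $(C\mathbin{\bar\otimes}D)^k=\prod_{i+j=k}C^i\otimes D^j$, with differential $d_C\mathbin{\bar\otimes}1+1\mathbin{\bar\otimes}d_D$, where $(f\mathbin{\bar\otimes}g)|_{C^i\otimes D^j}=(-1)^{i|g|}f|_{C^i}\otimes g|_{D^j}$. Let $\operatorname{Tr}$ be the Markov trace, which closes up diagrams and cobordisms by parallel strands. **Theorem.** For all chain complexes $A,B$ over $\mathrm{BN}^m_n$ there are isomorphisms of chain complexes $$\phi_{A,B}:\ \operatorname{Hom}^\bullet_{\mathrm{BN}^m_n}(A,B)\ \xrightarrow{\ \cong\ }\ q^{(m+n)/2}\operatorname{Hom}^\bullet_{(\mathrm{BN}^0_0)^\Pi}\bigl(\emptyset,\operatorname{Tr}(B\mathbin{\bar\otimes}A^\vee)\bigr).$$ They respect both gradings: $z$ has bidegree $(k,l)$ if and only if $\phi_{A,B}(z)$, as a map $\emptyset\to\operatorname{Tr}(B\mathbin{\bar\otimes}A^\vee)$, has bidegree $(k,l-\tfrac{m+n}{2})$;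 in particular they identify the subgroups of finite sums of homogeneous maps. (If $m+n$ is odd, both sides are zero.) They are natural: for all homogeneous maps $f\in\operatorname{Hom}^{|f|}(A',A)$, $g\in\operatorname{Hom}^{|g|}(B,B')$ and $z\in\operatorname{Hom}^{k}(A,B)$, $$\phi_{A',B'}\bigl(L_g(R_f(z))\bigr)=\operatorname{Tr}(g\mathbin{\bar\otimes}f^\vee)\circ\phi_{A,B}(z).$$ -/

import Mathlib

open CategoryTheory

attribute [-instance] catToReflQuiver
namespace BarNatan

noncomputable section

/-! ### Geometry: tame curves in the square and tame surfaces in the cube -/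

/-- The plane, with coordinates `(x, y)`. -/
abbrev Plane := ℝ × ℝ

/-- Three-space, with coordinates `((x, y), z)`. -/
abbrev Space := Plane × ℝ

/-- The standard positions `i / (n + 1)`, `1 ≤ i ≤ n`, of `n` boundary points. -/
def pts (n : ℕ) : Set ℝ := {x | ∃ i : ℕ, 1 ≤ i ∧ i ≤ n ∧ x = (i : ℝ) / ((n : ℝ) + 1)}

/-- The interior of the cube `[0,1]³`. -/
def openCube : Set Space :=
  {p | (0 < p.1.1 ∧ p.1.1 < 1) ∧ (0 < p.1.2 ∧ p.1.2 < 1) ∧ 0 < p.2 ∧ p.2 < 1}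

/-- `T` is, near its point `p`, a locally flat submanifold of codimension one: some chart of the
ambient space around `p` carries `T` to the hyperplane on which the last coordinate vanishes. -/
def LocallyFlatAt {E : Type} [TopologicalSpace E] (T : Set (E × ℝ)) (p : E × ℝ) : Prop :=
  ∃ e : OpenPartialHomeomorph (E × ℝ) (E × ℝ), p ∈ e.source ∧ ∀ q ∈ e.source, q ∈ T ↔ (e q).2 = 0

/-- A properly embedded compact `1`-submanifold of the square `[0,1]²` with `m` standard boundary
points on the top edge and `n` on the bottom edge. It is straight near the boundary of the square,
so that gluing diagrams gives diagrams. -/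
@[ext]
structure Diagram (m n : ℕ) where
  carrier : Set Plane
  isClosed : IsClosed carrier
  mem_square : ∀ p ∈ carrier, 0 ≤ p.2 ∧ p.2 ≤ 1
  collar : ∃ ε : ℝ, 0 < ε ∧ ∀ p : Plane,
    ((p.1 < ε ∨ 1 - ε < p.1) → p ∉ carrier) ∧
    (0 ≤ p.2 → p.2 < ε → (p ∈ carrier ↔ p.1 ∈ pts n)) ∧
    (1 - ε < p.2 → p.2 ≤ 1 → (p ∈ carrier ↔ p.1 ∈ pts m))
  flat : ∀ p ∈ carrier, 0 < p.2 → p.2 < 1 → LocallyFlatAt carrier p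

/-- A dotted cobordism from `a` (at `z = 0`) to `b` (at `z = 1`): a properly embedded compact
locally flat surface in the cube `[0,1]³`, whose boundary consists of `a × {0}`, `b × {1}` and of
the vertical segments over the boundary points, which is a product near the boundary of the cube,
together with a finite set of dots in its interior. -/
@[ext]
structure Cobordism {m n : ℕ} (a b : Diagram m n) where
  carrier : Set Space
  dots : Set Space
  isClosed : IsClosed carrier
  mem_cube : ∀ p ∈ carrier, (0 ≤ p.1.2 ∧ p.1.2 ≤ 1) ∧ 0 ≤ p.2 ∧ p.2 ≤ 1
  collar : ∃ ε : ℝ, 0 < ε ∧ ∀ p : Space,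
    ((p.1.1 < ε ∨ 1 - ε < p.1.1) → p ∉ carrier) ∧
    (0 ≤ p.2 → p.2 ≤ 1 → 0 ≤ p.1.2 → p.1.2 < ε → (p ∈ carrier ↔ p.1.1 ∈ pts n)) ∧
    (0 ≤ p.2 → p.2 ≤ 1 → 1 - ε < p.1.2 → p.1.2 ≤ 1 → (p ∈ carrier ↔ p.1.1 ∈ pts m)) ∧
    (0 ≤ p.2 → p.2 < ε → (p ∈ carrier ↔ p.1 ∈ a.carrier)) ∧
    (1 - ε < p.2 → p.2 ≤ 1 → (p ∈ carrier ↔ p.1 ∈ b.carrier))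
  flat : ∀ p ∈ carrier, p ∈ openCube → LocallyFlatAt carrier p
  dots_subset : dots ⊆ carrier
  dots_finite : dots.Finite
  dots_interior : dots ⊆ openCube

section Topology

variable {E : Type} [TopologicalSpace E]

theorem LocallyFlatAt.congr {T T' : Set (E × ℝ)} {p : E × ℝ} (h : LocallyFlatAt T p)
    (hT : ∃ U : Set (E × ℝ), IsOpen U ∧ p ∈ U ∧ ∀ q ∈ U, q ∈ T' ↔ q ∈ T) :
    LocallyFlatAt T' p := by
  obtain ⟨e, hp, he⟩ := h
  obtain ⟨U, hU, hpU, hUT⟩ := hT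
  refine ⟨e.restrOpen U hU, ⟨hp, hpU⟩, ?_⟩
  rintro q ⟨hq, hqU⟩
  exact (hUT q hqU).trans (he q hq)

theorem LocallyFlatAt.image {T : Set (E × ℝ)} {p : E × ℝ} (f : E × ℝ ≃ₜ E × ℝ)
    (h : LocallyFlatAt T (f.symm p)) : LocallyFlatAt (f '' T) p := by
  obtain ⟨e, hp, he⟩ := h
  refine ⟨f.symm.toOpenPartialHomeomorph.trans e, ?_, ?_⟩
  · simpa using hp
  · intro q hq
    have hq' : f.symm q ∈ e.source := by simpa using hq
    rw [f.image_eq_preimage_symm]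
    exact he _ hq'

theorem LocallyFlatAt.prod {T : Set Plane} {p : Space} (h : LocallyFlatAt T p.1) :
    LocallyFlatAt {q : Space | q.1 ∈ T} p := by
  obtain ⟨e, hp, he⟩ := h
  let σ : (ℝ × ℝ) × ℝ ≃ₜ (ℝ × ℝ) × ℝ :=
    ((Homeomorph.prodAssoc ℝ ℝ ℝ).trans
      ((Homeomorph.refl ℝ).prodCongr (Homeomorph.prodComm ℝ ℝ))).trans
      (Homeomorph.prodAssoc ℝ ℝ ℝ).symm
  refine ⟨(e.prod (OpenPartialHomeomorph.refl ℝ)).trans σ.toOpenPartialHomeomorph, ?_, ?_⟩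
  · simpa using hp
  · intro q hq
    have hq' : q.1 ∈ e.source := by simpa using hq
    exact he _ hq'

/-- Vertical lines over a finite set are locally flat. -/
theorem locallyFlatAt_lines {F : Set ℝ} (hF : F.Finite) {p : Plane} (hp : p.1 ∈ F) :
    LocallyFlatAt {q : Plane | q.1 ∈ F} p := by
  have h : LocallyFlatAt {q : Plane | q.1 = p.1} p := by
    refine ⟨((Homeomorph.prodComm ℝ ℝ).trans ((Homeomorph.refl ℝ).prodCongr
      (Homeomorph.addRight (-p.1)))).toOpenPartialHomeomorph, by simp, ?_⟩
    intro q _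
    change q.1 = p.1 ↔ q.1 + -p.1 = 0
    constructor <;> intro h <;> linarith
  refine h.congr ⟨{q | q.1 ∉ F \ {p.1}}, ?_, by simp, ?_⟩
  · exact ((hF.subset Set.sdiff_subset).isClosed.preimage continuous_fst).isOpen_compl
  · intro q hq
    have hq' : ¬ (q.1 ∈ F ∧ q.1 ≠ p.1) := hq
    constructor
    · intro hqF
      by_contra hne
      exact hq' ⟨hqF, hne⟩
    · intro hqp
      have : q.1 = p.1 := hqp
      change q.1 ∈ F
      rwa [this]

end Topology

theorem pts_finite (n : ℕ) : (pts n).Finite := by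
  refine ((Finset.Icc 1 n).finite_toSet.image (fun i : ℕ => (i : ℝ) / ((n : ℝ) + 1))).subset ?_
  rintro x ⟨i, h1, h2, rfl⟩
  exact ⟨i, by simp [h1, h2], rfl⟩

theorem pts_pos {n : ℕ} {x : ℝ} (hx : x ∈ pts n) : 0 < x ∧ x < 1 := by
  obtain ⟨i, h1, h2, rfl⟩ := hx
  have h1' : (1 : ℝ) ≤ i := by exact_mod_cast h1
  have h2' : (i : ℝ) ≤ n := by exact_mod_cast h2
  constructor
  · positivity
  · rw [div_lt_one (by positivity)]; linarith

theorem Diagram.mem_x {m n : ℕ} (a : Diagram m n) {p : Plane} (hp : p ∈ a.carrier) :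
    0 < p.1 ∧ p.1 < 1 := by
  obtain ⟨ε, hε, h⟩ := a.collar
  constructor
  · by_contra hc
    exact (h p).1 (Or.inl (by linarith)) hp
  · by_contra hc
    exact (h p).1 (Or.inr (by linarith)) hp

theorem Cobordism.mem_x {m n : ℕ} {a b : Diagram m n} (S : Cobordism a b) {p : Space}
    (hp : p ∈ S.carrier) : 0 < p.1.1 ∧ p.1.1 < 1 := by
  obtain ⟨ε, hε, h⟩ := S.collar
  constructor
  · by_contra hc
    exact (h p).1 (Or.inl (by linarith)) hp
  · by_contra hc
    exact (h p).1 (Or.inr (by linarith)) hp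

theorem isOpen_openCube : IsOpen openCube := by
  have : openCube = ((Set.Ioo (0:ℝ) 1 ×ˢ Set.Ioo (0:ℝ) 1) ×ˢ Set.Ioo (0:ℝ) 1 : Set Space) := by
    ext p; simp only [openCube, Set.mem_ofPred_eq, Set.mem_prod, Set.mem_Ioo]; tauto
  rw [this]
  exact (isOpen_Ioo.prod isOpen_Ioo).prod isOpen_Ioo


/-! ### Affine maps used for gluing -/

/-- `(x, y, z) ↦ (x, y, z / 2)`: the lower half of the cube. -/
def lo : Space ≃ₜ Space where
  toFun p := (p.1, p.2 / 2)
  invFun p := (p.1, 2 * p.2)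
  left_inv p := by ext <;> simp; ring
  right_inv p := by ext <;> simp
  continuous_toFun := by fun_prop
  continuous_invFun := by fun_prop

/-- `(x, y, z) ↦ (x, y, (z + 1) / 2)`: the upper half of the cube. -/
def hi : Space ≃ₜ Space where
  toFun p := (p.1, (p.2 + 1) / 2)
  invFun p := (p.1, 2 * p.2 - 1)
  left_inv p := by ext <;> simp; ring
  right_inv p := by ext <;> simp
  continuous_toFun := by fun_prop
  continuous_invFun := by fun_prop

/-- `(x, y) ↦ (x, y / 2)`: the lower half of the square. -/
def dn : Plane ≃ₜ Plane where
  toFun p := (p.1, p.2 / 2)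
  invFun p := (p.1, 2 * p.2)
  left_inv p := by ext <;> simp; ring
  right_inv p := by ext <;> simp
  continuous_toFun := by fun_prop
  continuous_invFun := by fun_prop

/-- `(x, y) ↦ (x, (y + 1) / 2)`: the upper half of the square. -/
def up : Plane ≃ₜ Plane where
  toFun p := (p.1, (p.2 + 1) / 2)
  invFun p := (p.1, 2 * p.2 - 1)
  left_inv p := by ext <;> simp; ring
  right_inv p := by ext <;> simp
  continuous_toFun := by fun_prop
  continuous_invFun := by fun_prop

/-- The similarity from the unit square to the box `[1/8, 3/8] × [3/8, 5/8]`. -/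
def box : Plane ≃ₜ Plane where
  toFun p := ((p.1 + 1 / 2) / 4, (p.2 + 3 / 2) / 4)
  invFun p := (4 * p.1 - 1 / 2, 4 * p.2 - 3 / 2)
  left_inv p := by ext <;> simp <;> ring
  right_inv p := by ext <;> simp
  continuous_toFun := by fun_prop
  continuous_invFun := by fun_prop

/-- The reflection `(x, y) ↦ (x, 1 - y)` of the square. -/
def flip : Plane ≃ₜ Plane where
  toFun p := (p.1, 1 - p.2)
  invFun p := (p.1, 1 - p.2)
  left_inv p := by ext <;> simp
  right_inv p := by ext <;> simp
  continuous_toFun := by fun_prop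
  continuous_invFun := by fun_prop

/-- The map `(x, y, z) ↦ (x, 1 - y, 1 - z)` of the cube. -/
def turn : Space ≃ₜ Space where
  toFun p := ((p.1.1, 1 - p.1.2), 1 - p.2)
  invFun p := ((p.1.1, 1 - p.1.2), 1 - p.2)
  left_inv p := by ext <;> simp
  right_inv p := by ext <;> simp
  continuous_toFun := by fun_prop
  continuous_invFun := by fun_prop

/-- The product of a homeomorphism of the plane with the identity of the `z`-direction. -/
def thick (f : Plane ≃ₜ Plane) : Space ≃ₜ Space := f.prodCongr (Homeomorph.refl ℝ)

theorem mem_img {X : Type} [TopologicalSpace X] (f : X ≃ₜ X) (T : Set X) (p : X) :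
    p ∈ f '' T ↔ f.symm p ∈ T := by
  rw [f.image_eq_preimage_symm]; rfl

theorem mem_lo (T : Set Space) (p : Space) : p ∈ lo '' T ↔ (p.1, 2 * p.2) ∈ T := mem_img lo T p
theorem mem_hi (T : Set Space) (p : Space) : p ∈ hi '' T ↔ (p.1, 2 * p.2 - 1) ∈ T := mem_img hi T p
theorem mem_dn (T : Set Plane) (p : Plane) : p ∈ dn '' T ↔ (p.1, 2 * p.2) ∈ T := mem_img dn T p
theorem mem_up (T : Set Plane) (p : Plane) : p ∈ up '' T ↔ (p.1, 2 * p.2 - 1) ∈ T := mem_img up T p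
theorem mem_box (T : Set Plane) (p : Plane) :
    p ∈ box '' T ↔ (4 * p.1 - 1 / 2, 4 * p.2 - 3 / 2) ∈ T := mem_img box T p
theorem mem_flip (T : Set Plane) (p : Plane) : p ∈ flip '' T ↔ (p.1, 1 - p.2) ∈ T :=
  mem_img flip T p
theorem mem_turn (T : Set Space) (p : Space) :
    p ∈ turn '' T ↔ ((p.1.1, 1 - p.1.2), 1 - p.2) ∈ T := mem_img turn T p
theorem mem_thick_dn (T : Set Space) (p : Space) :
    p ∈ thick dn '' T ↔ ((p.1.1, 2 * p.1.2), p.2) ∈ T := mem_img (thick dn) T p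
theorem mem_thick_up (T : Set Space) (p : Space) :
    p ∈ thick up '' T ↔ ((p.1.1, 2 * p.1.2 - 1), p.2) ∈ T := mem_img (thick up) T p
theorem mem_thick_box (T : Set Space) (p : Space) :
    p ∈ thick box '' T ↔ ((4 * p.1.1 - 1 / 2, 4 * p.1.2 - 3 / 2), p.2) ∈ T :=
  mem_img (thick box) T p

theorem lo_mem {p : Space} (h : p ∈ openCube) : lo p ∈ openCube := by
  obtain ⟨h1, h2, h3, h4⟩ := h
  refine ⟨h1, h2, ?_, ?_⟩
  · change 0 < p.2 / 2; linarith
  · change p.2 / 2 < 1; linarith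

theorem hi_mem {p : Space} (h : p ∈ openCube) : hi p ∈ openCube := by
  obtain ⟨h1, h2, h3, h4⟩ := h
  refine ⟨h1, h2, ?_, ?_⟩
  · change 0 < (p.2 + 1) / 2; linarith
  · change (p.2 + 1) / 2 < 1; linarith

theorem turn_mem {p : Space} (h : p ∈ openCube) : turn p ∈ openCube := by
  obtain ⟨h1, ⟨h2, h2'⟩, h3, h4⟩ := h
  refine ⟨h1, ⟨?_, ?_⟩, ?_, ?_⟩
  · change 0 < 1 - p.1.2; linarith
  · change 1 - p.1.2 < 1; linarith
  · change 0 < 1 - p.2; linarith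
  · change 1 - p.2 < 1; linarith

theorem thick_dn_mem {p : Space} (h : p ∈ openCube) : thick dn p ∈ openCube := by
  obtain ⟨h1, ⟨h2, h2'⟩, h3⟩ := h
  refine ⟨h1, ⟨?_, ?_⟩, h3⟩
  · change 0 < p.1.2 / 2; linarith
  · change p.1.2 / 2 < 1; linarith

theorem thick_up_mem {p : Space} (h : p ∈ openCube) : thick up p ∈ openCube := by
  obtain ⟨h1, ⟨h2, h2'⟩, h3⟩ := h
  refine ⟨h1, ⟨?_, ?_⟩, h3⟩
  · change 0 < (p.1.2 + 1) / 2; linarith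
  · change (p.1.2 + 1) / 2 < 1; linarith

theorem thick_box_mem {p : Space} (h : p ∈ openCube) : thick box p ∈ openCube := by
  obtain ⟨⟨h1, h1'⟩, ⟨h2, h2'⟩, h3⟩ := h
  refine ⟨⟨?_, ?_⟩, ⟨?_, ?_⟩, h3⟩
  · change 0 < (p.1.1 + 1 / 2) / 4; linarith
  · change (p.1.1 + 1 / 2) / 4 < 1; linarith
  · change 0 < (p.1.2 + 3 / 2) / 4; linarith
  · change (p.1.2 + 3 / 2) / 4 < 1; linarith

/-! ### Identity, composition, vertical gluing, closure and reflection -/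

variable {m n k : ℕ}

/-- The identity cobordism `a × [0,1]`. -/
def Cobordism.refl (a : Diagram m n) : Cobordism a a where
  carrier := {p | p.1 ∈ a.carrier ∧ 0 ≤ p.2 ∧ p.2 ≤ 1}
  dots := ∅
  isClosed := (a.isClosed.preimage continuous_fst).inter (isClosed_Icc.preimage continuous_snd)
  mem_cube p hp := ⟨a.mem_square _ hp.1, hp.2⟩
  collar := by
    obtain ⟨ε, hε, h⟩ := a.collar
    refine ⟨min ε 1, lt_min hε one_pos, fun p => ?_⟩
    obtain ⟨hx, hy, hy'⟩ := h p.1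
    have e1 := min_le_left ε 1
    have e2 := min_le_right ε 1
    refine ⟨fun hp hm => hx ?_ hm.1, fun h0 h1 h2 h3 => ?_, fun h0 h1 h2 h3 => ?_,
      fun h0 h1 => ?_, fun h0 h1 => ?_⟩
    · rcases hp with hp | hp
      · left; linarith
      · right; linarith
    · exact (and_iff_left ⟨h0, h1⟩).trans (hy h2 (by linarith))
    · exact (and_iff_left ⟨h0, h1⟩).trans (hy' (by linarith) h3)
    · exact and_iff_left ⟨h0, by linarith⟩
    · exact and_iff_left ⟨by linarith, h1⟩
  flat p hp hc := by
    obtain ⟨h1, h2, h3⟩ := hc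
    refine (LocallyFlatAt.prod (a.flat p.1 hp.1 h2.1 h2.2)).congr
      ⟨{q | 0 < q.2 ∧ q.2 < 1}, isOpen_Ioo.preimage continuous_snd, h3, fun q hq => ?_⟩
    exact and_iff_left ⟨hq.1.le, hq.2.le⟩
  dots_subset := Set.empty_subset _
  dots_finite := Set.finite_empty
  dots_interior := Set.empty_subset _

/-- Stacking cobordisms: `S` in the lower half and `S'` in the upper half of the cube. -/
def Cobordism.comp {a b c : Diagram m n} (S : Cobordism a b) (S' : Cobordism b c) :
    Cobordism a c where
  carrier := lo '' S.carrier ∪ hi '' S'.carrier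
  dots := lo '' S.dots ∪ hi '' S'.dots
  isClosed := (lo.isClosedMap _ S.isClosed).union (hi.isClosedMap _ S'.isClosed)
  mem_cube p hp := by
    rw [Set.mem_union, mem_lo, mem_hi] at hp
    rcases hp with hp | hp
    · obtain ⟨h1, h2, h3⟩ := S.mem_cube _ hp
      simp only at h1 h2 h3
      exact ⟨h1, by linarith, by linarith⟩
    · obtain ⟨h1, h2, h3⟩ := S'.mem_cube _ hp
      simp only at h1 h2 h3
      exact ⟨h1, by linarith, by linarith⟩
  collar := by
    obtain ⟨ε, hε, h⟩ := S.collar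
    obtain ⟨ε', hε', h'⟩ := S'.collar
    obtain ⟨δ, hδ, d1, d2, d3⟩ : ∃ δ : ℝ, 0 < δ ∧ 2 * δ ≤ ε ∧ 2 * δ ≤ ε' ∧ 2 * δ ≤ 1 := by
      refine ⟨min (min ε ε') 1 / 2, by positivity, ?_, ?_, ?_⟩
      · have := min_le_left (min ε ε') 1; have := min_le_left ε ε'; linarith
      · have := min_le_left (min ε ε') 1; have := min_le_right ε ε'; linarith
      · have := min_le_right (min ε ε') 1; linarith
    refine ⟨δ, hδ, fun p => ?_⟩
    rw [Set.mem_union, mem_lo, mem_hi]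
    have m1 := S.mem_cube (p.1, 2 * p.2)
    have m2 := S'.mem_cube (p.1, 2 * p.2 - 1)
    obtain ⟨hx, hy, hy', hz, hz'⟩ := h (p.1, 2 * p.2)
    obtain ⟨kx, ky, ky', kz, kz'⟩ := h' (p.1, 2 * p.2 - 1)
    simp only at m1 m2 hx hy hy' hz hz' kx ky ky' kz kz'
    refine ⟨fun hp => ?_, fun h0 h1 h2 h3 => ?_, fun h0 h1 h2 h3 => ?_,
      fun h0 h1 => ?_, fun h0 h1 => ?_⟩
    · have hp1 : p.1.1 < ε ∨ 1 - ε < p.1.1 := hp.imp (by intro; linarith) (by intro; linarith)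
      have hp2 : p.1.1 < ε' ∨ 1 - ε' < p.1.1 := hp.imp (by intro; linarith) (by intro; linarith)
      exact not_or.2 ⟨hx hp1, kx hp2⟩
    · constructor
      · rintro (hm | hm)
        · obtain ⟨_, b1, b2⟩ := m1 hm
          exact (hy b1 b2 h2 (by linarith)).1 hm
        · obtain ⟨_, b1, b2⟩ := m2 hm
          exact (ky b1 b2 h2 (by linarith)).1 hm
      · intro hm
        rcases le_total p.2 (1 / 2) with hle | hle
        · exact Or.inl ((hy (by linarith) (by linarith) h2 (by linarith)).2 hm)
        · exact Or.inr ((ky (by linarith) (by linarith) h2 (by linarith)).2 hm)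
    · constructor
      · rintro (hm | hm)
        · obtain ⟨_, b1, b2⟩ := m1 hm
          exact (hy' b1 b2 (by linarith) h3).1 hm
        · obtain ⟨_, b1, b2⟩ := m2 hm
          exact (ky' b1 b2 (by linarith) h3).1 hm
      · intro hm
        rcases le_total p.2 (1 / 2) with hle | hle
        · exact Or.inl ((hy' (by linarith) (by linarith) (by linarith) h3).2 hm)
        · exact Or.inr ((ky' (by linarith) (by linarith) (by linarith) h3).2 hm)
    · rw [← hz (by linarith) (by linarith)]
      refine or_iff_left fun hm => ?_
      have := (m2 hm).2.1; linarith
    · rw [← kz' (by linarith) (by linarith)]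
      refine or_iff_right fun hm => ?_
      have := (m1 hm).2.2; linarith
  flat p hp hc := by
    obtain ⟨h1, h2, h3⟩ := hc
    rcases lt_trichotomy p.2 (1 / 2) with hlt | heq | hlt
    · have key : ∀ q : Space, q.2 < 1 / 2 →
          (q ∈ lo '' S.carrier ∪ hi '' S'.carrier ↔ q ∈ lo '' S.carrier) := by
        intro q hq
        refine or_iff_left fun hm => ?_
        rw [mem_hi] at hm
        have := (S'.mem_cube _ hm).2.1
        simp only at this; linarith
      have hp' := (mem_img lo _ p).1 ((key p hlt).1 hp)
      refine (LocallyFlatAt.image lo (S.flat _ hp' ⟨h1, h2, ?_, ?_⟩)).congr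
        ⟨{q | q.2 < 1 / 2}, isOpen_Iio.preimage continuous_snd, hlt, key⟩
      · change 0 < 2 * p.2; linarith
      · change 2 * p.2 < 1; linarith
    · obtain ⟨ε, hε, h⟩ := S.collar
      obtain ⟨ε', hε', h'⟩ := S'.collar
      have key : ∀ q : Space, 0 < q.2 → 1 / 2 - ε / 2 < q.2 → q.2 < 1 / 2 + ε' / 2 → q.2 < 1 →
          (q ∈ lo '' S.carrier ∪ hi '' S'.carrier ↔ q.1 ∈ b.carrier) := by
        intro q q0 q1 q2 q3
        rw [Set.mem_union, mem_lo, mem_hi]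
        have m1 := S.mem_cube (q.1, 2 * q.2)
        have m2 := S'.mem_cube (q.1, 2 * q.2 - 1)
        obtain ⟨-, -, -, -, hz'⟩ := h (q.1, 2 * q.2)
        obtain ⟨-, -, -, kz, -⟩ := h' (q.1, 2 * q.2 - 1)
        simp only at m1 m2 hz' kz
        constructor
        · rintro (hm | hm)
          · exact (hz' (by linarith) (m1 hm).2.2).1 hm
          · exact (kz (m2 hm).2.1 (by linarith)).1 hm
        · intro hm
          rcases le_total q.2 (1 / 2) with hle | hle
          · exact Or.inl ((hz' (by linarith) (by linarith)).2 hm)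
          · exact Or.inr ((kz (by linarith) (by linarith)).2 hm)
      have hpb := (key p h3.1 (by linarith) (by linarith) h3.2).1 hp
      refine (LocallyFlatAt.prod (b.flat p.1 hpb h2.1 h2.2)).congr
        ⟨{q | (0 < q.2 ∧ 1 / 2 - ε / 2 < q.2) ∧ (q.2 < 1 / 2 + ε' / 2 ∧ q.2 < 1)},
          ?_, ⟨⟨h3.1, by linarith⟩, by linarith, h3.2⟩,
          fun q hq => key q hq.1.1 hq.1.2 hq.2.1 hq.2.2⟩
      exact ((isOpen_Ioi.inter isOpen_Ioi).inter (isOpen_Iio.inter isOpen_Iio)).preimage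
        (continuous_snd : Continuous (Prod.snd : Space → ℝ))
    · have key : ∀ q : Space, 1 / 2 < q.2 →
          (q ∈ lo '' S.carrier ∪ hi '' S'.carrier ↔ q ∈ hi '' S'.carrier) := by
        intro q hq
        refine or_iff_right fun hm => ?_
        rw [mem_lo] at hm
        have := (S.mem_cube _ hm).2.2
        simp only at this; linarith
      have hp' := (mem_img hi _ p).1 ((key p hlt).1 hp)
      refine (LocallyFlatAt.image hi (S'.flat _ hp' ⟨h1, h2, ?_, ?_⟩)).congr
        ⟨{q | 1 / 2 < q.2}, isOpen_Ioi.preimage continuous_snd, hlt, key⟩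
      · change 0 < 2 * p.2 - 1; linarith
      · change 2 * p.2 - 1 < 1; linarith
  dots_subset := Set.union_subset_union (Set.image_mono S.dots_subset)
    (Set.image_mono S'.dots_subset)
  dots_finite := (S.dots_finite.image _).union (S'.dots_finite.image _)
  dots_interior := by
    rintro _ (⟨p, hp, rfl⟩ | ⟨p, hp, rfl⟩)
    · exact lo_mem (S.dots_interior hp)
    · exact hi_mem (S'.dots_interior hp)

/-- Vertical gluing of diagrams: `a` on top of `b`. -/
def Diagram.tens (a : Diagram m k) (b : Diagram k n) : Diagram m n where
  carrier := up '' a.carrier ∪ dn '' b.carrier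
  isClosed := (up.isClosedMap _ a.isClosed).union (dn.isClosedMap _ b.isClosed)
  mem_square p hp := by
    rw [Set.mem_union, mem_up, mem_dn] at hp
    rcases hp with hp | hp
    · have h := a.mem_square _ hp
      simp only at h
      constructor <;> linarith
    · have h := b.mem_square _ hp
      simp only at h
      constructor <;> linarith
  collar := by
    obtain ⟨ε, hε, h⟩ := a.collar
    obtain ⟨ε', hε', h'⟩ := b.collar
    obtain ⟨δ, hδ, d1, d2, d3⟩ : ∃ δ : ℝ, 0 < δ ∧ 2 * δ ≤ ε ∧ 2 * δ ≤ ε' ∧ 2 * δ ≤ 1 := by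
      refine ⟨min (min ε ε') 1 / 2, by positivity, ?_, ?_, ?_⟩
      · have := min_le_left (min ε ε') 1; have := min_le_left ε ε'; linarith
      · have := min_le_left (min ε ε') 1; have := min_le_right ε ε'; linarith
      · have := min_le_right (min ε ε') 1; linarith
    refine ⟨δ, hδ, fun p => ?_⟩
    rw [Set.mem_union, mem_up, mem_dn]
    have m1 := a.mem_square (p.1, 2 * p.2 - 1)
    have m2 := b.mem_square (p.1, 2 * p.2)
    obtain ⟨hx, hy, hy'⟩ := h (p.1, 2 * p.2 - 1)
    obtain ⟨kx, ky, ky'⟩ := h' (p.1, 2 * p.2)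
    simp only at m1 m2 hx hy hy' kx ky ky'
    refine ⟨fun hp => ?_, fun h0 h1 => ?_, fun h0 h1 => ?_⟩
    · have hp1 : p.1 < ε ∨ 1 - ε < p.1 := hp.imp (by intro; linarith) (by intro; linarith)
      have hp2 : p.1 < ε' ∨ 1 - ε' < p.1 := hp.imp (by intro; linarith) (by intro; linarith)
      exact not_or.2 ⟨hx hp1, kx hp2⟩
    · rw [← ky (by linarith) (by linarith)]
      refine or_iff_right fun hm => ?_
      have := (m1 hm).1; linarith
    · rw [← hy' (by linarith) (by linarith)]
      refine or_iff_left fun hm => ?_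
      have := (m2 hm).2; linarith
  flat p hp h0 h1 := by
    rcases lt_trichotomy p.2 (1 / 2) with hlt | heq | hlt
    · have key : ∀ q : Plane, q.2 < 1 / 2 →
          (q ∈ up '' a.carrier ∪ dn '' b.carrier ↔ q ∈ dn '' b.carrier) := by
        intro q hq
        refine or_iff_right fun hm => ?_
        rw [mem_up] at hm
        have := (a.mem_square _ hm).1
        simp only at this; linarith
      have hp' := (mem_img dn _ p).1 ((key p hlt).1 hp)
      refine (LocallyFlatAt.image dn (b.flat _ hp' ?_ ?_)).congr
        ⟨{q | q.2 < 1 / 2}, isOpen_Iio.preimage continuous_snd, hlt, key⟩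
      · change 0 < 2 * p.2; linarith
      · change 2 * p.2 < 1; linarith
    · obtain ⟨ε, hε, h⟩ := a.collar
      obtain ⟨ε', hε', h'⟩ := b.collar
      have key : ∀ q : Plane, 0 < q.2 → 1 / 2 - ε' / 2 < q.2 → q.2 < 1 / 2 + ε / 2 → q.2 < 1 →
          (q ∈ up '' a.carrier ∪ dn '' b.carrier ↔ q.1 ∈ pts k) := by
        intro q q0 q1 q2 q3
        rw [Set.mem_union, mem_up, mem_dn]
        have m1 := a.mem_square (q.1, 2 * q.2 - 1)
        have m2 := b.mem_square (q.1, 2 * q.2)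
        obtain ⟨-, hy, -⟩ := h (q.1, 2 * q.2 - 1)
        obtain ⟨-, -, ky'⟩ := h' (q.1, 2 * q.2)
        simp only at m1 m2 hy ky'
        constructor
        · rintro (hm | hm)
          · exact (hy (m1 hm).1 (by linarith)).1 hm
          · exact (ky' (by linarith) (m2 hm).2).1 hm
        · intro hm
          rcases le_total q.2 (1 / 2) with hle | hle
          · exact Or.inr ((ky' (by linarith) (by linarith)).2 hm)
          · exact Or.inl ((hy (by linarith) (by linarith)).2 hm)
      have hpb := (key p h0 (by linarith) (by linarith) h1).1 hp
      refine (locallyFlatAt_lines (pts_finite k) hpb).congr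
        ⟨{q | (0 < q.2 ∧ 1 / 2 - ε' / 2 < q.2) ∧ (q.2 < 1 / 2 + ε / 2 ∧ q.2 < 1)},
          ?_, ⟨⟨h0, by linarith⟩, by linarith, h1⟩,
          fun q hq => key q hq.1.1 hq.1.2 hq.2.1 hq.2.2⟩
      exact ((isOpen_Ioi.inter isOpen_Ioi).inter (isOpen_Iio.inter isOpen_Iio)).preimage
        (continuous_snd : Continuous (Prod.snd : Plane → ℝ))
    · have key : ∀ q : Plane, 1 / 2 < q.2 →
          (q ∈ up '' a.carrier ∪ dn '' b.carrier ↔ q ∈ up '' a.carrier) := by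
        intro q hq
        refine or_iff_left fun hm => ?_
        rw [mem_dn] at hm
        have := (b.mem_square _ hm).2
        simp only at this; linarith
      have hp' := (mem_img up _ p).1 ((key p hlt).1 hp)
      refine (LocallyFlatAt.image up (a.flat _ hp' ?_ ?_)).congr
        ⟨{q | 1 / 2 < q.2}, isOpen_Ioi.preimage continuous_snd, hlt, key⟩
      · change 0 < 2 * p.2 - 1; linarith
      · change 2 * p.2 - 1 < 1; linarith

/-- Vertical gluing of cobordisms: `S` on top of `S'` in the `y`-direction. -/
def Cobordism.tens {a a' : Diagram m k} {b b' : Diagram k n} (S : Cobordism a a')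
    (S' : Cobordism b b') : Cobordism (a.tens b) (a'.tens b') where
  carrier := thick up '' S.carrier ∪ thick dn '' S'.carrier
  dots := thick up '' S.dots ∪ thick dn '' S'.dots
  isClosed := ((thick up).isClosedMap _ S.isClosed).union ((thick dn).isClosedMap _ S'.isClosed)
  mem_cube p hp := by
    rw [Set.mem_union, mem_thick_up, mem_thick_dn] at hp
    rcases hp with hp | hp
    · obtain ⟨h1, h2⟩ := S.mem_cube _ hp
      simp only at h1 h2
      exact ⟨⟨by linarith, by linarith⟩, h2⟩
    · obtain ⟨h1, h2⟩ := S'.mem_cube _ hp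
      simp only at h1 h2
      exact ⟨⟨by linarith, by linarith⟩, h2⟩
  collar := by
    obtain ⟨ε, hε, h⟩ := S.collar
    obtain ⟨ε', hε', h'⟩ := S'.collar
    obtain ⟨δ, hδ, d1, d2, d3⟩ : ∃ δ : ℝ, 0 < δ ∧ 2 * δ ≤ ε ∧ 2 * δ ≤ ε' ∧ 2 * δ ≤ 1 := by
      refine ⟨min (min ε ε') 1 / 2, by positivity, ?_, ?_, ?_⟩
      · have := min_le_left (min ε ε') 1; have := min_le_left ε ε'; linarith
      · have := min_le_left (min ε ε') 1; have := min_le_right ε ε'; linarith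
      · have := min_le_right (min ε ε') 1; linarith
    refine ⟨δ, hδ, fun p => ?_⟩
    simp only [Diagram.tens]
    rw [Set.mem_union, mem_thick_up, mem_thick_dn, Set.mem_union, Set.mem_union, mem_up, mem_dn,
      mem_up, mem_dn]
    have m1 := S.mem_cube ((p.1.1, 2 * p.1.2 - 1), p.2)
    have m2 := S'.mem_cube ((p.1.1, 2 * p.1.2), p.2)
    obtain ⟨hx, hy, hy', hz, hz'⟩ := h ((p.1.1, 2 * p.1.2 - 1), p.2)
    obtain ⟨kx, ky, ky', kz, kz'⟩ := h' ((p.1.1, 2 * p.1.2), p.2)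
    simp only at m1 m2 hx hy hy' hz hz' kx ky ky' kz kz'
    refine ⟨fun hp => ?_, fun h0 h1 h2 h3 => ?_, fun h0 h1 h2 h3 => ?_,
      fun h0 h1 => ?_, fun h0 h1 => ?_⟩
    · have hp1 : p.1.1 < ε ∨ 1 - ε < p.1.1 := hp.imp (by intro; linarith) (by intro; linarith)
      have hp2 : p.1.1 < ε' ∨ 1 - ε' < p.1.1 := hp.imp (by intro; linarith) (by intro; linarith)
      exact not_or.2 ⟨hx hp1, kx hp2⟩
    · rw [← ky h0 h1 (by linarith) (by linarith)]
      refine or_iff_right fun hm => ?_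
      have := (m1 hm).1.1; linarith
    · rw [← hy' h0 h1 (by linarith) (by linarith)]
      refine or_iff_left fun hm => ?_
      have := (m2 hm).1.2; linarith
    · exact or_congr (hz h0 (by linarith)) (kz h0 (by linarith))
    · exact or_congr (hz' (by linarith) h1) (kz' (by linarith) h1)
  flat p hp hc := by
    obtain ⟨h1, h2, h3⟩ := hc
    have cy : Continuous (fun q : Space => q.1.2) := by fun_prop
    have cz : Continuous (fun q : Space => q.2) := by fun_prop
    rcases lt_trichotomy p.1.2 (1 / 2) with hlt | heq | hlt
    · have key : ∀ q : Space, q.1.2 < 1 / 2 →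
          (q ∈ thick up '' S.carrier ∪ thick dn '' S'.carrier ↔ q ∈ thick dn '' S'.carrier) := by
        intro q hq
        refine or_iff_right fun hm => ?_
        rw [mem_thick_up] at hm
        have := (S.mem_cube _ hm).1.1
        simp only at this; linarith
      have hp' := (mem_img (thick dn) _ p).1 ((key p hlt).1 hp)
      refine (LocallyFlatAt.image (thick dn) (S'.flat _ hp' ⟨h1, ⟨?_, ?_⟩, h3⟩)).congr
        ⟨{q | q.1.2 < 1 / 2}, isOpen_Iio.preimage cy, hlt, key⟩
      · change 0 < 2 * p.1.2; linarith
      · change 2 * p.1.2 < 1; linarith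
    · obtain ⟨ε, hε, h⟩ := S.collar
      obtain ⟨ε', hε', h'⟩ := S'.collar
      have key : ∀ q : Space, 1 / 2 - ε' / 2 < q.1.2 → q.1.2 < 1 / 2 + ε / 2 →
          0 < q.1.2 → q.1.2 < 1 → 0 < q.2 → q.2 < 1 →
          (q ∈ thick up '' S.carrier ∪ thick dn '' S'.carrier ↔ q.1.1 ∈ pts k) := by
        intro q q1 q2 q3 q4 q5 q6
        rw [Set.mem_union, mem_thick_up, mem_thick_dn]
        have m1 := S.mem_cube ((q.1.1, 2 * q.1.2 - 1), q.2)
        have m2 := S'.mem_cube ((q.1.1, 2 * q.1.2), q.2)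
        obtain ⟨-, hy, -, -, -⟩ := h ((q.1.1, 2 * q.1.2 - 1), q.2)
        obtain ⟨-, -, ky', -, -⟩ := h' ((q.1.1, 2 * q.1.2), q.2)
        simp only at m1 m2 hy ky'
        constructor
        · rintro (hm | hm)
          · exact (hy q5.le q6.le (m1 hm).1.1 (by linarith)).1 hm
          · exact (ky' q5.le q6.le (by linarith) (m2 hm).1.2).1 hm
        · intro hm
          rcases le_total q.1.2 (1 / 2) with hle | hle
          · exact Or.inr ((ky' q5.le q6.le (by linarith) (by linarith)).2 hm)
          · exact Or.inl ((hy q5.le q6.le (by linarith) (by linarith)).2 hm)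
      have hpb := (key p (by linarith) (by linarith) h2.1 h2.2 h3.1 h3.2).1 hp
      refine (LocallyFlatAt.prod (T := {q : Plane | q.1 ∈ pts k})
        (locallyFlatAt_lines (pts_finite k) hpb)).congr
        ⟨{q | (1 / 2 - ε' / 2 < q.1.2 ∧ q.1.2 < 1 / 2 + ε / 2) ∧ (0 < q.1.2 ∧ q.1.2 < 1) ∧
            0 < q.2 ∧ q.2 < 1}, ?_, ⟨⟨by linarith, by linarith⟩, h2, h3⟩,
          fun q hq => key q hq.1.1 hq.1.2 hq.2.1.1 hq.2.1.2 hq.2.2.1 hq.2.2.2⟩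
      exact (isOpen_Ioo.preimage cy).inter ((isOpen_Ioo.preimage cy).inter (isOpen_Ioo.preimage cz))
    · have key : ∀ q : Space, 1 / 2 < q.1.2 →
          (q ∈ thick up '' S.carrier ∪ thick dn '' S'.carrier ↔ q ∈ thick up '' S.carrier) := by
        intro q hq
        refine or_iff_left fun hm => ?_
        rw [mem_thick_dn] at hm
        have := (S'.mem_cube _ hm).1.2
        simp only at this; linarith
      have hp' := (mem_img (thick up) _ p).1 ((key p hlt).1 hp)
      refine (LocallyFlatAt.image (thick up) (S.flat _ hp' ⟨h1, ⟨?_, ?_⟩, h3⟩)).congr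
        ⟨{q | 1 / 2 < q.1.2}, isOpen_Ioi.preimage cy, hlt, key⟩
      · change 0 < 2 * p.1.2 - 1; linarith
      · change 2 * p.1.2 - 1 < 1; linarith
  dots_subset := Set.union_subset_union (Set.image_mono S.dots_subset)
    (Set.image_mono S'.dots_subset)
  dots_finite := (S.dots_finite.image _).union (S'.dots_finite.image _)
  dots_interior := by
    rintro _ (⟨p, hp, rfl⟩ | ⟨p, hp, rfl⟩)
    · exact thick_up_mem (S.dots_interior hp)
    · exact thick_dn_mem (S'.dots_interior hp)

/-- The reflection of a diagram. -/
def Diagram.dual (a : Diagram m n) : Diagram n m where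
  carrier := flip '' a.carrier
  isClosed := flip.isClosedMap _ a.isClosed
  mem_square p hp := by
    rw [mem_flip] at hp
    have h := a.mem_square _ hp
    simp only at h
    constructor <;> linarith
  collar := by
    obtain ⟨ε, hε, h⟩ := a.collar
    refine ⟨ε, hε, fun p => ?_⟩
    obtain ⟨hx, hy, hy'⟩ := h (p.1, 1 - p.2)
    rw [mem_flip]
    exact ⟨hx, fun h0 h1 => hy' (by simp only; linarith) (by simp only; linarith),
      fun h0 h1 => hy (by simp only; linarith) (by simp only; linarith)⟩
  flat p hp h0 h1 := by
    have hp' := (mem_img flip _ p).1 hp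
    refine LocallyFlatAt.image flip (a.flat _ hp' ?_ ?_)
    · change 0 < 1 - p.2; linarith
    · change 1 - p.2 < 1; linarith

/-- The image of a cobordism `a → b` under `(x, y, z) ↦ (x, 1 - y, 1 - z)`. -/
def Cobordism.dual {a b : Diagram m n} (S : Cobordism a b) : Cobordism b.dual a.dual where
  carrier := turn '' S.carrier
  dots := turn '' S.dots
  isClosed := turn.isClosedMap _ S.isClosed
  mem_cube p hp := by
    rw [mem_turn] at hp
    obtain ⟨h1, h2⟩ := S.mem_cube _ hp
    simp only at h1 h2
    refine ⟨⟨?_, ?_⟩, ?_, ?_⟩ <;> linarith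
  collar := by
    obtain ⟨ε, hε, h⟩ := S.collar
    refine ⟨ε, hε, fun p => ?_⟩
    obtain ⟨hx, hy, hy', hz, hz'⟩ := h ((p.1.1, 1 - p.1.2), 1 - p.2)
    simp only [Diagram.dual]
    rw [mem_turn, mem_flip, mem_flip]
    simp only at hx hy hy' hz hz'
    refine ⟨hx, fun h0 h1 h2 h3 => hy' ?_ ?_ ?_ ?_, fun h0 h1 h2 h3 => hy ?_ ?_ ?_ ?_,
      fun h0 h1 => hz' ?_ ?_, fun h0 h1 => hz ?_ ?_⟩ <;> linarith
  flat p hp hc := by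
    have hp' := (mem_img turn _ p).1 hp
    exact LocallyFlatAt.image turn (S.flat _ hp' (turn_mem hc))
  dots_subset := Set.image_mono S.dots_subset
  dots_finite := S.dots_finite.image _
  dots_interior := by
    rintro _ ⟨p, hp, rfl⟩
    exact turn_mem (S.dots_interior hp)

/-- The open box `(1/8, 3/8) × (3/8, 5/8)`. -/
def openBox : Set Plane := {q | (1 / 8 < q.1 ∧ q.1 < 3 / 8) ∧ 3 / 8 < q.2 ∧ q.2 < 5 / 8}

/-- The distance from the centre of the square in the maximum norm. -/
noncomputable def rad (q : Plane) : ℝ := max |q.1 - 1 / 2| |q.2 - 1 / 2|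

/-- The radii `3/8 - t/4`, for `t` in `pts n`. -/
def radii (n : ℕ) : Set ℝ := {r | ∃ t ∈ pts n, r = 3 / 8 - t / 4}

/-- The `n` nested closing arcs: the parts outside of the box of the `n` concentric squares whose
left sides pass vertically through the box, at the positions of the standard points. -/
def arcs (n : ℕ) : Set Plane := {q | q ∉ openBox ∧ rad q ∈ radii n}

theorem radii_finite (n : ℕ) : (radii n).Finite := by
  refine ((pts_finite n).image (fun t : ℝ => 3 / 8 - t / 4)).subset ?_
  rintro r ⟨t, ht, rfl⟩
  exact ⟨t, ht, rfl⟩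

theorem radii_bounds {n : ℕ} {r : ℝ} (hr : r ∈ radii n) : 1 / 8 < r ∧ r < 3 / 8 := by
  obtain ⟨t, ht, rfl⟩ := hr
  have := pts_pos ht
  constructor <;> linarith

theorem continuous_rad : Continuous rad := by unfold rad; fun_prop

theorem isOpen_openBox : IsOpen openBox :=
  (isOpen_Ioo.preimage continuous_fst).inter (isOpen_Ioo.preimage continuous_snd)

theorem isClosed_arcs (n : ℕ) : IsClosed (arcs n) :=
  isOpen_openBox.isClosed_compl.inter ((radii_finite n).isClosed.preimage continuous_rad)

theorem rad_lt {q : Plane} {r : ℝ} :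
    rad q < r ↔ (1 / 2 - r < q.1 ∧ q.1 < 1 / 2 + r) ∧ 1 / 2 - r < q.2 ∧ q.2 < 1 / 2 + r := by
  unfold rad
  rw [max_lt_iff, abs_lt, abs_lt]
  constructor
  · rintro ⟨⟨h1, h2⟩, h3, h4⟩; refine ⟨⟨?_, ?_⟩, ?_, ?_⟩ <;> linarith
  · rintro ⟨⟨h1, h2⟩, h3, h4⟩; refine ⟨⟨?_, ?_⟩, ?_, ?_⟩ <;> linarith

/-- `(x, y) ↦ (U - V, max U V - c)`, where `U = s (x - 1/2)` and `V = s' (y - 1/2)`. -/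
noncomputable def squareChart (s s' c : ℝ) (hs : s * s = 1) (hs' : s' * s' = 1) :
    Plane ≃ₜ Plane where
  toFun q := (s * (q.1 - 1 / 2) - s' * (q.2 - 1 / 2),
    max (s * (q.1 - 1 / 2)) (s' * (q.2 - 1 / 2)) - c)
  invFun w := (1 / 2 + s * (w.2 + c + min w.1 0), 1 / 2 + s' * (w.2 + c - max w.1 0))
  left_inv q := by
    have e1 : ∀ t : ℝ, s * (s * t) = t := fun t => by rw [← mul_assoc, hs, one_mul]
    have e2 : ∀ t : ℝ, s' * (s' * t) = t := fun t => by rw [← mul_assoc, hs', one_mul]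
    rcases le_total (s * (q.1 - 1 / 2)) (s' * (q.2 - 1 / 2)) with h | h
    · have h' : s * (q.1 - 1 / 2) - s' * (q.2 - 1 / 2) ≤ 0 := by linarith
      simp only [max_eq_right h, min_eq_left h', max_eq_right h']
      ext
      · simp only
        rw [show s' * (q.2 - 1 / 2) - c + c + (s * (q.1 - 1 / 2) - s' * (q.2 - 1 / 2)) =
          s * (q.1 - 1 / 2) by ring, e1]; ring
      · simp only
        rw [show s' * (q.2 - 1 / 2) - c + c - 0 = s' * (q.2 - 1 / 2) by ring, e2]; ring
    · have h' : 0 ≤ s * (q.1 - 1 / 2) - s' * (q.2 - 1 / 2) := by linarith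
      simp only [max_eq_left h, min_eq_right h', max_eq_left h']
      ext
      · simp only
        rw [show s * (q.1 - 1 / 2) - c + c + 0 = s * (q.1 - 1 / 2) by ring, e1]; ring
      · simp only
        rw [show s * (q.1 - 1 / 2) - c + c - (s * (q.1 - 1 / 2) - s' * (q.2 - 1 / 2)) =
          s' * (q.2 - 1 / 2) by ring, e2]; ring
  right_inv w := by
    have e1 : ∀ t : ℝ, s * (1 / 2 + s * t - 1 / 2) = t := fun t => by
      rw [show 1 / 2 + s * t - 1 / 2 = s * t by ring, ← mul_assoc, hs, one_mul]
    have e2 : ∀ t : ℝ, s' * (1 / 2 + s' * t - 1 / 2) = t := fun t => by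
      rw [show 1 / 2 + s' * t - 1 / 2 = s' * t by ring, ← mul_assoc, hs', one_mul]
    simp only [e1, e2]
    rcases le_total w.1 0 with h | h
    · simp only [min_eq_left h, max_eq_right h]
      rw [max_eq_right (by linarith)]
      ext <;> simp
    · simp only [min_eq_right h, max_eq_left h]
      rw [max_eq_left (by linarith)]
      ext <;> simp
  continuous_toFun := by fun_prop
  continuous_invFun := by fun_prop

theorem rad_eq_max {s s' : ℝ} (hs : s = 1 ∨ s = -1) (hs' : s' = 1 ∨ s' = -1) {q : Plane}
    (h : 0 < s * (q.1 - 1 / 2) + s' * (q.2 - 1 / 2)) :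
    rad q = max (s * (q.1 - 1 / 2)) (s' * (q.2 - 1 / 2)) := by
  have a1 : |q.1 - 1 / 2| = |s * (q.1 - 1 / 2)| := by rcases hs with rfl | rfl <;> simp [abs_sub_comm]
  have a2 : |q.2 - 1 / 2| = |s' * (q.2 - 1 / 2)| := by
    rcases hs' with rfl | rfl <;> simp [abs_sub_comm]
  unfold rad
  rw [a1, a2]
  generalize s * (q.1 - 1 / 2) = u at h ⊢
  generalize s' * (q.2 - 1 / 2) = v at h ⊢
  apply le_antisymm
  · refine max_le (abs_le.2 ⟨?_, le_max_left _ _⟩) (abs_le.2 ⟨?_, le_max_right _ _⟩)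
    · have := le_max_right u v; linarith
    · have := le_max_left u v; linarith
  · exact max_le_max (le_abs_self _) (le_abs_self _)

/-- Concentric squares are locally flat. -/
theorem locallyFlatAt_squares {R : Set ℝ} (hR : R.Finite) {p : Plane} (hp : rad p ∈ R)
    (h0 : 0 < rad p) : LocallyFlatAt {q : Plane | rad q ∈ R} p := by
  obtain ⟨s, s', hs, hs', h⟩ : ∃ s s' : ℝ, (s = 1 ∨ s = -1) ∧ (s' = 1 ∨ s' = -1) ∧
      0 < s * (p.1 - 1 / 2) + s' * (p.2 - 1 / 2) := by
    have hx : ∃ s : ℝ, (s = 1 ∨ s = -1) ∧ s * (p.1 - 1 / 2) = |p.1 - 1 / 2| := by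
      rcases abs_choice (p.1 - 1 / 2) with h | h
      · exact ⟨1, Or.inl rfl, by rw [h, one_mul]⟩
      · exact ⟨-1, Or.inr rfl, by rw [h]; ring⟩
    have hy : ∃ s : ℝ, (s = 1 ∨ s = -1) ∧ s * (p.2 - 1 / 2) = |p.2 - 1 / 2| := by
      rcases abs_choice (p.2 - 1 / 2) with h | h
      · exact ⟨1, Or.inl rfl, by rw [h, one_mul]⟩
      · exact ⟨-1, Or.inr rfl, by rw [h]; ring⟩
    obtain ⟨s, hs, e⟩ := hx
    obtain ⟨s', hs', e'⟩ := hy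
    refine ⟨s, s', hs, hs', ?_⟩
    rw [e, e']
    have := abs_nonneg (p.1 - 1 / 2)
    have := abs_nonneg (p.2 - 1 / 2)
    rcases lt_max_iff.1 h0 with h | h <;> linarith
  have sq : ∀ {t : ℝ}, t = 1 ∨ t = -1 → t * t = 1 := by rintro t (rfl | rfl) <;> norm_num
  have cont : Continuous fun q : Plane => s * (q.1 - 1 / 2) + s' * (q.2 - 1 / 2) := by fun_prop
  have hflat : LocallyFlatAt {q : Plane |
      max (s * (q.1 - 1 / 2)) (s' * (q.2 - 1 / 2)) = rad p} p := by
    refine ⟨(squareChart s s' (rad p) (sq hs) (sq hs')).toOpenPartialHomeomorph, by simp, ?_⟩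
    intro q _
    exact sub_eq_zero.symm
  refine hflat.congr ⟨{q | rad q ∉ R \ {rad p}} ∩ {q | 0 < s * (q.1 - 1 / 2) + s' * (q.2 - 1 / 2)},
    ?_, ⟨by simp, h⟩, ?_⟩
  · exact (((hR.subset Set.sdiff_subset).isClosed.preimage continuous_rad).isOpen_compl).inter
      (isOpen_Ioi.preimage cont)
  · rintro q ⟨hq, hq0⟩
    have hq' : ¬ (rad q ∈ R ∧ rad q ≠ rad p) := hq
    change rad q ∈ R ↔ max (s * (q.1 - 1 / 2)) (s' * (q.2 - 1 / 2)) = rad p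
    rw [← rad_eq_max hs hs' hq0]
    constructor
    · intro hqR
      by_contra hne
      exact hq' ⟨hqR, hne⟩
    · intro e; rwa [e]

/-- In the box, away from its top and bottom, the concentric squares are vertical. -/
theorem rad_of_mem_box {q : Plane} (h : 1 / 8 ≤ q.1 ∧ q.1 ≤ 3 / 8) (h' : 3 / 8 ≤ q.2 ∧ q.2 ≤ 5 / 8) :
    rad q = 1 / 2 - q.1 := by
  unfold rad
  rw [abs_of_nonpos (by linarith), max_eq_left]
  · ring
  · rw [abs_le]; constructor <;> linarith

theorem rad_mem_radii_iff {q : Plane} (h : 1 / 8 ≤ q.1 ∧ q.1 ≤ 3 / 8)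
    (h' : 3 / 8 ≤ q.2 ∧ q.2 ≤ 5 / 8) : rad q ∈ radii n ↔ 4 * q.1 - 1 / 2 ∈ pts n := by
  rw [rad_of_mem_box h h']
  constructor
  · rintro ⟨t, ht, e⟩
    rwa [show 4 * q.1 - 1 / 2 = t by linarith]
  · intro ht
    exact ⟨_, ht, by ring⟩

/-- A point of a box-shaped piece or an arc lies on an arc unless it is inside the open box; and
near such a point the glued set is a family of concentric squares. This is the planar geometry
behind closures, applied to diagrams and to horizontal slices of cobordisms. -/
theorem closure_local {T : Set Plane} {ε : ℝ} (hε : 0 < ε)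
    (hx : ∀ p ∈ T, (0 < p.1 ∧ p.1 < 1) ∧ 0 ≤ p.2 ∧ p.2 ≤ 1)
    (hc : ∀ p : Plane, ((p.1 < ε ∨ 1 - ε < p.1) → p ∉ T) ∧
      (0 ≤ p.2 → p.2 < ε → (p ∈ T ↔ p.1 ∈ pts n)) ∧
      (1 - ε < p.2 → p.2 ≤ 1 → (p ∈ T ↔ p.1 ∈ pts n)))
    {q : Plane} (hq : 4 * q.2 - 3 / 2 < ε ∨ 1 - ε < 4 * q.2 - 3 / 2 ∨ q ∉ openBox) :
    q ∈ box '' T ∪ arcs n ↔ rad q ∈ radii n := by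
  obtain ⟨-, hy, hy'⟩ := hc (4 * q.1 - 1 / 2, 4 * q.2 - 3 / 2)
  simp only at hy hy'
  have hx' := hx (4 * q.1 - 1 / 2, 4 * q.2 - 3 / 2)
  simp only at hx'
  rw [Set.mem_union, mem_box]
  constructor
  · rintro (h | h)
    · obtain ⟨⟨x1, x2⟩, y1, y2⟩ := hx' h
      rw [rad_mem_radii_iff ⟨by linarith, by linarith⟩ ⟨by linarith, by linarith⟩]
      rcases hq with hq | hq | hq
      · exact (hy y1 hq).1 h
      · exact (hy' hq y2).1 h
      · have : 4 * q.2 - 3 / 2 ≤ 0 ∨ 1 ≤ 4 * q.2 - 3 / 2 := by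
          by_contra hcon
          rw [not_or, not_le, not_le] at hcon
          exact hq ⟨⟨by linarith, by linarith⟩, by linarith [hcon.1], by linarith [hcon.2]⟩
        rcases this with hb | hb
        · exact (hy y1 (by linarith)).1 h
        · exact (hy' (by linarith) y2).1 h
    · exact h.2
  · intro h
    by_cases hb : q ∈ openBox
    · obtain ⟨⟨x1, x2⟩, y1, y2⟩ := hb
      left
      rw [rad_mem_radii_iff ⟨by linarith, by linarith⟩ ⟨by linarith, by linarith⟩] at h
      rcases hq with hq | hq | hq
      · exact (hy (by linarith) hq).2 h
      · exact (hy' hq (by linarith)).2 h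
      · exact absurd ⟨⟨x1, x2⟩, y1, y2⟩ hq
    · exact Or.inr ⟨hb, h⟩

/-- A neighbourhood on which `closure_local` applies. -/
theorem closure_nhd {ε : ℝ} (hε : 0 < ε) {p : Plane} (hp : p ∉ openBox)
    (hr : rad p ∈ radii n) :
    ∃ U : Set Plane, IsOpen U ∧ p ∈ U ∧
      ∀ q ∈ U, 4 * q.2 - 3 / 2 < ε ∨ 1 - ε < 4 * q.2 - 3 / 2 ∨ q ∉ openBox := by
  have cy : Continuous fun q : Plane => 4 * q.2 - 3 / 2 := by fun_prop
  by_cases h1 : 4 * p.2 - 3 / 2 < ε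
  · exact ⟨{q | 4 * q.2 - 3 / 2 < ε}, isOpen_Iio.preimage cy, h1, fun q hq => Or.inl hq⟩
  by_cases h2 : 1 - ε < 4 * p.2 - 3 / 2
  · exact ⟨{q | 1 - ε < 4 * q.2 - 3 / 2}, isOpen_Ioi.preimage cy, h2, fun q hq => Or.inr (Or.inl hq)⟩
  rw [not_lt] at h1 h2
  obtain ⟨r1, r2⟩ := radii_bounds hr
  have hy : 3 / 8 < p.2 ∧ p.2 < 5 / 8 := ⟨by linarith, by linarith⟩
  have hx : p.1 < 1 / 8 ∨ 3 / 8 < p.1 := by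
    by_contra hcon
    rw [not_or, not_lt, not_lt] at hcon
    have e := rad_of_mem_box hcon ⟨hy.1.le, hy.2.le⟩
    exact hp ⟨⟨by linarith, by linarith⟩, hy⟩
  rcases hx with hx | hx
  · exact ⟨{q | q.1 < 1 / 8}, isOpen_Iio.preimage continuous_fst, hx,
      fun q hq => Or.inr (Or.inr fun hb => absurd hb.1.1 (not_lt.2 (le_of_lt hq)))⟩
  · exact ⟨{q | 3 / 8 < q.1}, isOpen_Ioi.preimage continuous_fst, hx,
      fun q hq => Or.inr (Or.inr fun hb => absurd hb.1.2 (not_lt.2 (le_of_lt hq)))⟩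

theorem closure_bounds {T : Set Plane}
    (hx : ∀ p ∈ T, (0 < p.1 ∧ p.1 < 1) ∧ 0 ≤ p.2 ∧ p.2 ≤ 1) {p : Plane}
    (hp : p ∈ box '' T ∪ arcs n) :
    (1 / 8 < p.1 ∧ p.1 < 7 / 8) ∧ 1 / 8 < p.2 ∧ p.2 < 7 / 8 := by
  rw [Set.mem_union, mem_box] at hp
  rcases hp with hp | hp
  · obtain ⟨⟨h1, h2⟩, h3, h4⟩ := hx _ hp
    simp only at h1 h2 h3 h4
    refine ⟨⟨?_, ?_⟩, ?_, ?_⟩ <;> linarith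
  · have := rad_lt.1 (radii_bounds hp.2).2
    refine ⟨⟨?_, ?_⟩, ?_, ?_⟩ <;> linarith [this.1.1, this.1.2, this.2.1, this.2.2]

theorem mem_box_openBox {T : Set Plane} {p : Plane} (hp : p ∈ openBox) :
    p ∈ box '' T ∪ arcs n ↔ p ∈ box '' T := or_iff_left fun h => h.1 hp

theorem Diagram.bounds (a : Diagram m n) :
    ∀ p ∈ a.carrier, (0 < p.1 ∧ p.1 < 1) ∧ 0 ≤ p.2 ∧ p.2 ≤ 1 :=
  fun p hp => ⟨a.mem_x hp, a.mem_square p hp⟩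

theorem pts_zero (x : ℝ) : x ∉ pts 0 := by
  rintro ⟨i, h1, h2, -⟩; omega

/-- The closure (Markov trace) of a diagram: it is placed in the box, and the `n` points on top are
joined to the `n` points on the bottom by nested arcs passing to the right of the box. -/
def Diagram.tr (a : Diagram n n) : Diagram 0 0 where
  carrier := box '' a.carrier ∪ arcs n
  isClosed := (box.isClosedMap _ a.isClosed).union (isClosed_arcs n)
  mem_square p hp := by
    have := closure_bounds a.bounds hp
    constructor <;> linarith [this.2.1, this.2.2]
  collar := by
    refine ⟨1 / 8, by norm_num, fun p => ?_⟩
    have b := fun hp => closure_bounds (n := n) a.bounds (p := p) hp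
    refine ⟨fun h hp => ?_, fun h0 h1 => ⟨fun hp => ?_, fun hp => absurd hp (pts_zero _)⟩,
      fun h0 h1 => ⟨fun hp => ?_, fun hp => absurd hp (pts_zero _)⟩⟩
    · have := b hp
      rcases h with h | h <;> linarith [this.1.1, this.1.2]
    · have := b hp; linarith [this.2.1]
    · have := b hp; linarith [this.2.2]
  flat p hp _ _ := by
    obtain ⟨ε, hε, h⟩ := a.collar
    by_cases hb : p ∈ openBox
    · have hp' := (mem_img box _ p).1 ((mem_box_openBox hb).1 hp)
      refine (LocallyFlatAt.image box (a.flat _ hp' ?_ ?_)).congr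
        ⟨openBox, isOpen_openBox, hb, fun q hq => mem_box_openBox hq⟩
      · change 0 < 4 * p.2 - 3 / 2; linarith [hb.2.1]
      · change 4 * p.2 - 3 / 2 < 1; linarith [hb.2.2]
    · have hr := (closure_local hε a.bounds h (Or.inr (Or.inr hb))).1 hp
      obtain ⟨U, hU, hpU, hq⟩ := closure_nhd hε hb hr
      refine (locallyFlatAt_squares (radii_finite n) hr ?_).congr
        ⟨U, hU, hpU, fun q hqU => closure_local hε a.bounds h (hq q hqU)⟩
      linarith [(radii_bounds hr).1]

theorem mem_closure_slice (T : Set Space) (q : Plane) (z : ℝ) (hz : 0 ≤ z ∧ z ≤ 1) :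
    (q, z) ∈ thick box '' T ∪ {p | p.1 ∈ arcs n ∧ 0 ≤ p.2 ∧ p.2 ≤ 1} ↔
      q ∈ box '' {r | (r, z) ∈ T} ∪ arcs n := by
  rw [Set.mem_union, Set.mem_union, mem_thick_box, mem_box]
  exact or_congr Iff.rfl (and_iff_left hz)

/-- The closure of a cobordism: it is placed in `box × [0,1]`, and `arcs × [0,1]` is added. -/
def Cobordism.tr {a b : Diagram n n} (S : Cobordism a b) : Cobordism a.tr b.tr where
  carrier := thick box '' S.carrier ∪ {p | p.1 ∈ arcs n ∧ 0 ≤ p.2 ∧ p.2 ≤ 1}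
  dots := thick box '' S.dots
  isClosed := ((thick box).isClosedMap _ S.isClosed).union
    (((isClosed_arcs n).preimage continuous_fst).inter (isClosed_Icc.preimage continuous_snd))
  mem_cube p hp := by
    have hz : 0 ≤ p.2 ∧ p.2 ≤ 1 := by
      rw [Set.mem_union, mem_thick_box] at hp
      rcases hp with hp | hp
      · exact (S.mem_cube _ hp).2
      · exact hp.2
    have := closure_bounds (T := {r | (r, p.2) ∈ S.carrier})
      (fun r hr => ⟨S.mem_x hr, (S.mem_cube _ hr).1⟩) ((mem_closure_slice _ p.1 p.2 hz).1 hp)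
    exact ⟨⟨by linarith [this.2.1], by linarith [this.2.2]⟩, hz⟩
  collar := by
    obtain ⟨ε, hε, h⟩ := S.collar
    refine ⟨min ε (1 / 8), lt_min hε (by norm_num), fun p => ?_⟩
    have e1 := min_le_left ε (1 / 8)
    have e2 := min_le_right ε (1 / 8)
    have hz : p ∈ thick box '' S.carrier ∪ {p | p.1 ∈ arcs n ∧ 0 ≤ p.2 ∧ p.2 ≤ 1} →
        0 ≤ p.2 ∧ p.2 ≤ 1 := by
      rw [Set.mem_union, mem_thick_box]
      rintro (hp | hp)
      · exact (S.mem_cube _ hp).2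
      · exact hp.2
    have b := fun hp => closure_bounds (n := n) (T := {r | (r, p.2) ∈ S.carrier})
      (fun r hr => ⟨S.mem_x hr, (S.mem_cube _ hr).1⟩) ((mem_closure_slice _ p.1 p.2 (hz hp)).1 hp)
    obtain ⟨-, -, -, hz0, hz1⟩ := h ((4 * p.1.1 - 1 / 2, 4 * p.1.2 - 3 / 2), p.2)
    simp only at hz0 hz1
    refine ⟨fun h hp => ?_, fun _ _ h0 h1 => ⟨fun hp => ?_, fun hp => absurd hp (pts_zero _)⟩,
      fun _ _ h0 h1 => ⟨fun hp => ?_, fun hp => absurd hp (pts_zero _)⟩, fun h0 h1 => ?_,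
      fun h0 h1 => ?_⟩
    · have := b hp
      rcases h with h | h <;> linarith [this.1.1, this.1.2]
    · have := b hp; linarith [this.2.1]
    · have := b hp; linarith [this.2.2]
    · simp only [Diagram.tr]
      rw [Set.mem_union, Set.mem_union, mem_thick_box, mem_box]
      exact or_congr (hz0 h0 (by linarith)) (and_iff_left ⟨h0, by linarith⟩)
    · simp only [Diagram.tr]
      rw [Set.mem_union, Set.mem_union, mem_thick_box, mem_box]
      exact or_congr (hz1 (by linarith) h1) (and_iff_left ⟨by linarith, h1⟩)
  flat p hp hc := by
    obtain ⟨ε, hε, h⟩ := S.collar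
    obtain ⟨-, -, hz⟩ := hc
    have cz : IsOpen {q : Space | 0 < q.2 ∧ q.2 < 1} := isOpen_Ioo.preimage continuous_snd
    by_cases hb : p.1 ∈ openBox
    · have key : ∀ q : Space, q.1 ∈ openBox →
          (q ∈ thick box '' S.carrier ∪ {p | p.1 ∈ arcs n ∧ 0 ≤ p.2 ∧ p.2 ≤ 1} ↔
            q ∈ thick box '' S.carrier) := fun q hq => or_iff_left fun hq' => hq'.1.1 hq
      have hp' := (mem_img (thick box) _ p).1 ((key p hb).1 hp)
      refine (LocallyFlatAt.image (thick box) (S.flat _ hp' ⟨⟨?_, ?_⟩, ⟨?_, ?_⟩, hz⟩)).congr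
        ⟨{q | q.1 ∈ openBox}, isOpen_openBox.preimage continuous_fst, hb, key⟩
      · change 0 < 4 * p.1.1 - 1 / 2; linarith [hb.1.1]
      · change 4 * p.1.1 - 1 / 2 < 1; linarith [hb.1.2]
      · change 0 < 4 * p.1.2 - 3 / 2; linarith [hb.2.1]
      · change 4 * p.1.2 - 3 / 2 < 1; linarith [hb.2.2]
    · have key : ∀ q : Space, 0 < q.2 ∧ q.2 < 1 →
          (4 * q.1.2 - 3 / 2 < ε ∨ 1 - ε < 4 * q.1.2 - 3 / 2 ∨ q.1 ∉ openBox) →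
          (q ∈ thick box '' S.carrier ∪ {p | p.1 ∈ arcs n ∧ 0 ≤ p.2 ∧ p.2 ≤ 1} ↔
            rad q.1 ∈ radii n) := by
        intro q hqz hq
        refine (mem_closure_slice _ q.1 q.2 ⟨hqz.1.le, hqz.2.le⟩).trans
          (closure_local hε (fun r hr => ⟨S.mem_x hr, (S.mem_cube _ hr).1⟩) (fun r => ?_) hq)
        obtain ⟨h1, h2, h3, -, -⟩ := h (r, q.2)
        exact ⟨h1, h2 hqz.1.le hqz.2.le, h3 hqz.1.le hqz.2.le⟩
      have hr := (key p hz (Or.inr (Or.inr hb))).1 hp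
      obtain ⟨U, hU, hpU, hq⟩ := closure_nhd hε hb hr
      refine (LocallyFlatAt.prod (T := {q | rad q ∈ radii n})
        (locallyFlatAt_squares (radii_finite n) hr ?_)).congr
        ⟨{q | 0 < q.2 ∧ q.2 < 1} ∩ {q | q.1 ∈ U}, cz.inter (hU.preimage continuous_fst),
          ⟨hz, hpU⟩, fun q hqU => key q hqU.1 (hq q.1 hqU.2)⟩
      linarith [(radii_bounds hr).1]
  dots_subset := (Set.image_mono S.dots_subset).trans Set.subset_union_left
  dots_finite := S.dots_finite.image _
  dots_interior := by
    rintro _ ⟨p, hp, rfl⟩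
    exact thick_box_mem (S.dots_interior hp)

/-- The empty diagram. -/
def Diagram.empty : Diagram 0 0 where
  carrier := ∅
  isClosed := isClosed_empty
  mem_square _ hp := hp.elim
  collar := ⟨1, one_pos, fun _ => ⟨fun _ h => h, fun _ _ => ⟨fun h => h.elim, fun h => pts_zero _ h⟩,
    fun _ _ => ⟨fun h => h.elim, fun h => pts_zero _ h⟩⟩⟩
  flat _ hp := hp.elim


section Skein

/-! ### Isotopy, local relations and morphism modules -/

variable {a b : Diagram m n}

/-- Ambient isotopy of dotted surfaces, fixed on the boundary of the cube (and outside of it). -/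
def Isotopic (S S' : Cobordism a b) : Prop :=
  ∃ H : unitInterval → Space → Space, Continuous (Function.uncurry H) ∧
    (∀ t, IsHomeomorph (H t)) ∧ (∀ t, ∀ p ∉ openCube, H t p = p) ∧ (∀ p, H 0 p = p) ∧
    H 1 '' S.carrier = S'.carrier ∧ H 1 '' S.dots = S'.dots

/-- The model ball `[-2,2]³`. -/
def modelBall : Set Space := {p | (|p.1.1| ≤ 2 ∧ |p.1.2| ≤ 2) ∧ |p.2| ≤ 2}

/-- A ball in the interior of the cube, parametrised by `e` restricted to the model ball. -/
def IsBallChart (e : Space → Space) : Prop :=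
  Topology.IsOpenEmbedding e ∧ ∀ p, e p ∈ openCube

/-- In the ball parametrised by `e`, the dotted surface `S` is the model surface `M` with the
model dots `D`. -/
def LooksLike (e : Space → Space) (S : Cobordism a b) (M D : Set Space) : Prop :=
  ∀ p ∈ modelBall, (e p ∈ S.carrier ↔ p ∈ M) ∧ (e p ∈ S.dots ↔ p ∈ D)

/-- `S` and `S'` agree outside of the ball parametrised by `e`. -/
def AgreeOff (e : Space → Space) (S S' : Cobordism a b) : Prop :=
  ∀ q ∉ e '' modelBall, (q ∈ S.carrier ↔ q ∈ S'.carrier) ∧ (q ∈ S.dots ↔ q ∈ S'.dots)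

/-- The round unit sphere. -/
def sphereModel : Set Space := {p | p.1.1 ^ 2 + p.1.2 ^ 2 + p.2 ^ 2 = 1}

/-- A cylinder. -/
def cylinderModel : Set Space := {p | p.1.1 ^ 2 + p.1.2 ^ 2 = 1}

/-- The cylinder cut along a compressing disc: the parts over `z ≥ 1` and `z ≤ -1` of the cylinder
are capped off by two discs. -/
def capsModel : Set Space :=
  {p | (p.1.1 ^ 2 + p.1.2 ^ 2 = 1 ∧ 1 ≤ |p.2|) ∨ (p.1.1 ^ 2 + p.1.2 ^ 2 ≤ 1 ∧ |p.2| = 1)}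

/-- A flat sheet. -/
def sheetModel : Set Space := {p | p.2 = 0}

/-- A sheet with a handle: two discs of radius `1/4` are removed from the sheet, and their boundary
circles are joined by half of a torus. -/
def handleModel : Set Space :=
  {p | (p.2 = 0 ∧ (1 / 4 : ℝ) ^ 2 ≤ (|p.1.1| - 1) ^ 2 + p.1.2 ^ 2) ∨
    (0 ≤ p.2 ∧ (Real.sqrt (p.1.1 ^ 2 + p.2 ^ 2) - 1) ^ 2 + p.1.2 ^ 2 = (1 / 4 : ℝ) ^ 2)}

/-- The value `0, 1, 0, α` of a sphere with `0, 1, 2, 3` dots. -/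
def sphereValue : Fin 4 → Polynomial ℤ := ![0, 1, 0, Polynomial.X]

open Finsupp in
/-- The relations between `ℤ[α]`-linear combinations of dotted cobordisms: isotopy, evaluation of
dotted spheres, neck cutting, and the handle relation. -/
inductive IsRelation : (Cobordism a b →₀ Polynomial ℤ) → Prop
  | isotopy (S S' : Cobordism a b) (h : Isotopic S S') :
      IsRelation (single S 1 - single S' 1)
  | sphere (e : Space → Space) (he : IsBallChart e) (S S' : Cobordism a b) (i : Fin 4)
      (D : Finset Space) (hD : ↑D ⊆ sphereModel) (hi : D.card = i) (hS : LooksLike e S sphereModel D)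
      (hS' : LooksLike e S' ∅ ∅) (h : AgreeOff e S S') :
      IsRelation (single S 1 - single S' (sphereValue i))
  | neck (e : Space → Space) (he : IsBallChart e) (S S₁ S₂ : Cobordism a b)
      (hS : LooksLike e S cylinderModel ∅) (hS₁ : LooksLike e S₁ capsModel {((0, 0), 1)})
      (hS₂ : LooksLike e S₂ capsModel {((0, 0), -1)}) (h₁ : AgreeOff e S S₁)
      (h₂ : AgreeOff e S S₂) :
      IsRelation (single S 1 - single S₁ 1 - single S₂ 1)
  | handle (e : Space → Space) (he : IsBallChart e) (S S' : Cobordism a b)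
      (hS : LooksLike e S handleModel ∅) (hS' : LooksLike e S' sheetModel {0})
      (h : AgreeOff e S S') :
      IsRelation (single S 1 - single S' 2)

variable (a b) in
/-- The submodule spanned by the relations. -/
def relations : Submodule (Polynomial ℤ) (Cobordism a b →₀ Polynomial ℤ) :=
  Submodule.span _ {r | IsRelation r}

variable (a b) in
/-- The module of `ℤ[α]`-linear combinations of dotted cobordisms, up to isotopy and modulo the
local relations. -/
abbrev Skein : Type := (Cobordism a b →₀ Polynomial ℤ) ⧸ relations a b

/-- The class of a dotted cobordism. -/
def cls (S : Cobordism a b) : Skein a b := (relations a b).mkQ (Finsupp.single S 1)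

theorem Skein.hom_ext {M : Type} [AddCommGroup M] [Module (Polynomial ℤ) M]
    {f g : Skein a b →ₗ[Polynomial ℤ] M} (h : ∀ S, f (cls S) = g (cls S)) : f = g := by
  apply Submodule.linearMap_qext
  apply Finsupp.lhom_ext'
  intro S
  apply LinearMap.ext_ring
  exact h S

/-! ### Placing cobordisms in a part of the cube -/

/-- `S'` is obtained from `S` by the embedding `E` of the cube in itself, adding a fixed surface
`F` with dots `D`, away from the interior of the image. -/
structure Placed {m' n' : ℕ} {c d : Diagram m' n'} (E : Space ≃ₜ Space) (F D : Set Space)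
    (G : Cobordism a b → Cobordism c d) : Prop where
  maps : ∀ p ∈ openCube, E p ∈ openCube
  disj : ∀ p ∈ openCube, E p ∉ F
  disj' : ∀ p ∈ openCube, E p ∉ D
  carrier : ∀ S, (G S).carrier = E '' S.carrier ∪ F
  dots : ∀ S, (G S).dots = E '' S.dots ∪ D

section Placed

variable {m' n' : ℕ} {c d : Diagram m' n'} {E : Space ≃ₜ Space} {F D : Set Space}
  {G : Cobordism a b → Cobordism c d}

theorem Placed.isotopic (hG : Placed E F D G) {S S' : Cobordism a b} (h : Isotopic S S') :
    Isotopic (G S) (G S') := by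
  obtain ⟨H, hc, hh, hf, h0, h1, h2⟩ := h
  have fix : ∀ t, ∀ p, (∀ q ∈ openCube, E q ≠ p) → E (H t (E.symm p)) = p := by
    intro t p hp
    rw [hf t _ fun hq => hp _ hq (E.apply_symm_apply p), E.apply_symm_apply]
  have img : ∀ T K T' : Set Space, (∀ p ∈ openCube, E p ∉ K) → H 1 '' T = T' →
      (fun p => E (H 1 (E.symm p))) '' (E '' T ∪ K) = E '' T' ∪ K := by
    rintro T K _ hK rfl
    rw [Set.image_union]
    congr 1
    · simp only [Set.image_image, E.symm_apply_apply]
    · refine (Set.image_congr fun p hp => fix 1 p ?_).trans (Set.image_id' K)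
      rintro q hq rfl
      exact hK q hq hp
  refine ⟨fun t p => E (H t (E.symm p)), ?_, ?_, ?_, ?_, ?_, ?_⟩
  · exact E.continuous.comp (hc.comp (continuous_fst.prodMk (E.symm.continuous.comp continuous_snd)))
  · intro t
    exact E.isHomeomorph.comp ((hh t).comp E.symm.isHomeomorph)
  · intro t p hp
    refine fix t p ?_
    rintro q hq rfl
    exact hp (hG.maps q hq)
  · intro p
    simp [h0]
  · rw [hG.carrier, hG.carrier]
    exact img _ _ _ hG.disj h1
  · rw [hG.dots, hG.dots]
    exact img _ _ _ hG.disj' h2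

theorem Placed.chart (hG : Placed E F D G) {e : Space → Space} (he : IsBallChart e) :
    IsBallChart (E ∘ e) :=
  ⟨E.isOpenEmbedding.comp he.1, fun p => hG.maps _ (he.2 p)⟩

theorem Placed.looksLike (hG : Placed E F D G) {e : Space → Space} (he : IsBallChart e)
    {S : Cobordism a b} {M D' : Set Space} (h : LooksLike e S M D') :
    LooksLike (E ∘ e) (G S) M D' := by
  intro p hp
  rw [hG.carrier, hG.dots]
  constructor
  · refine Iff.trans (or_iff_left (hG.disj _ (he.2 p))) (Iff.trans ?_ (h p hp).1)
    exact E.injective.mem_set_image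
  · refine Iff.trans (or_iff_left (hG.disj' _ (he.2 p))) (Iff.trans ?_ (h p hp).2)
    exact E.injective.mem_set_image

theorem Placed.agreeOff (hG : Placed E F D G) {e : Space → Space}
    {S S' : Cobordism a b} (h : AgreeOff e S S') :
    AgreeOff (E ∘ e) (G S) (G S') := by
  intro q hq
  have hq' : E.symm q ∉ e '' modelBall := by
    rintro ⟨p, hp, hpq⟩
    exact hq ⟨p, hp, by simp [hpq]⟩
  rw [hG.carrier, hG.dots, hG.carrier, hG.dots]
  constructor
  · refine or_congr ?_ Iff.rfl
    rw [mem_img, mem_img]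
    exact (h _ hq').1
  · refine or_congr ?_ Iff.rfl
    rw [mem_img, mem_img]
    exact (h _ hq').2

theorem Placed.relations_le (hG : Placed E F D G) :
    relations a b ≤ (relations c d).comap (Finsupp.lmapDomain (Polynomial ℤ) (Polynomial ℤ) G) := by
  refine Submodule.span_le.2 ?_
  intro r hr
  refine Submodule.subset_span ?_
  change IsRelation (Finsupp.lmapDomain (Polynomial ℤ) (Polynomial ℤ) G r)
  cases hr with
  | isotopy S S' h =>
    simp only [map_sub, Finsupp.lmapDomain_apply, Finsupp.mapDomain_single]
    exact .isotopy _ _ (hG.isotopic h)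
  | sphere e he S S' i D hD hi hS hS' h =>
    simp only [map_sub, Finsupp.lmapDomain_apply, Finsupp.mapDomain_single]
    exact .sphere (E ∘ e) (hG.chart he) _ _ i D hD hi (hG.looksLike he hS) (hG.looksLike he hS')
      (hG.agreeOff h)
  | neck e he S S₁ S₂ hS hS₁ hS₂ h₁ h₂ =>
    simp only [map_sub, Finsupp.lmapDomain_apply, Finsupp.mapDomain_single]
    exact .neck (E ∘ e) (hG.chart he) _ _ _ (hG.looksLike he hS) (hG.looksLike he hS₁)
      (hG.looksLike he hS₂) (hG.agreeOff h₁) (hG.agreeOff h₂)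
  | handle e he S S' hS hS' h =>
    simp only [map_sub, Finsupp.lmapDomain_apply, Finsupp.mapDomain_single]
    exact .handle (E ∘ e) (hG.chart he) _ _ (hG.looksLike he hS) (hG.looksLike he hS')
      (hG.agreeOff h)

/-- The linear map induced by placing cobordisms. -/
def Placed.map (hG : Placed E F D G) : Skein a b →ₗ[Polynomial ℤ] Skein c d :=
  Submodule.mapQ _ _ (Finsupp.lmapDomain (Polynomial ℤ) (Polynomial ℤ) G) hG.relations_le

theorem Placed.map_cls (hG : Placed E F D G) (S : Cobordism a b) : hG.map (cls S) = cls (G S) := by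
  simp [Placed.map, cls]

end Placed

section Bilinear

variable {m' n' m'' n'' : ℕ} {c d : Diagram m' n'} {a' b' : Diagram m'' n''}

/-- The bilinear map induced by an operation `G` placing two cobordisms. -/
def bilin (G : Cobordism a b → Cobordism c d → Cobordism a' b')
    {E E' : Space ≃ₜ Space} {F D : Cobordism c d → Set Space} {F' D' : Cobordism a b → Set Space}
    (h : ∀ S', Placed E (F S') (D S') fun S => G S S')
    (h' : ∀ S, Placed E' (F' S) (D' S) fun S' => G S S') :
    Skein c d →ₗ[Polynomial ℤ] Skein a b →ₗ[Polynomial ℤ] Skein a' b' :=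
  (relations c d).liftQ (Finsupp.linearCombination (Polynomial ℤ) fun S' => (h S').map) <| by
    intro r hr
    rw [LinearMap.mem_ker]
    refine Skein.hom_ext fun S => ?_
    have key : (LinearMap.applyₗ (cls S)).comp
        (Finsupp.linearCombination (Polynomial ℤ) fun S' => (h S').map) =
        (h' S).map.comp (relations c d).mkQ := by
      apply Finsupp.lhom_ext'
      intro S'
      apply LinearMap.ext_ring
      have e : cls (G S S') = (h' S).map (cls S') := ((h' S).map_cls S').symm
      simp only [LinearMap.comp_apply, Finsupp.lsingle_apply, LinearMap.applyₗ_apply_apply,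
        Finsupp.linearCombination_single, one_smul, Placed.map_cls]
      exact e
    have key' := LinearMap.congr_fun key r
    simp only [LinearMap.comp_apply, LinearMap.applyₗ_apply_apply] at key'
    rw [key', LinearMap.zero_apply, show (relations c d).mkQ r = 0 by simpa using hr, map_zero]

theorem bilin_cls (G : Cobordism a b → Cobordism c d → Cobordism a' b')
    {E E' : Space ≃ₜ Space} {F D : Cobordism c d → Set Space} {F' D' : Cobordism a b → Set Space}
    (h : ∀ S', Placed E (F S') (D S') fun S => G S S')
    (h' : ∀ S, Placed E' (F' S) (D' S) fun S' => G S S') (S : Cobordism a b)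
    (S' : Cobordism c d) : bilin G h h' (cls S') (cls S) = cls (G S S') := by
  have : bilin G h h' (cls S') = (h S').map := by
    simp [bilin, cls]
  rw [this, Placed.map_cls]


end Bilinear


/-! ### The operations on morphisms -/

section Operations

variable {a b c : Diagram m n}

theorem lo_disj {p : Space} (hp : p ∈ openCube) {b c : Diagram m n} (S : Cobordism b c) :
    lo p ∉ hi '' S.carrier := by
  rw [mem_hi]
  intro h
  have h1 : 0 ≤ 2 * (p.2 / 2) - 1 := (S.mem_cube _ h).2.1
  linarith [hp.2.2.2]

theorem hi_disj {p : Space} (hp : p ∈ openCube) {b c : Diagram m n} (S : Cobordism b c) :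
    hi p ∉ lo '' S.carrier := by
  rw [mem_lo]
  intro h
  have h1 : 2 * ((p.2 + 1) / 2) ≤ 1 := (S.mem_cube _ h).2.2
  linarith [hp.2.2.1]

theorem dn_disj {p : Space} (hp : p ∈ openCube) {b c : Diagram m n} (S : Cobordism b c) :
    thick dn p ∉ thick up '' S.carrier := by
  rw [mem_thick_up]
  intro h
  have h1 : 0 ≤ 2 * (p.1.2 / 2) - 1 := (S.mem_cube _ h).1.1
  linarith [hp.2.1.2]

theorem up_disj {p : Space} (hp : p ∈ openCube) {b c : Diagram m n} (S : Cobordism b c) :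
    thick up p ∉ thick dn '' S.carrier := by
  rw [mem_thick_dn]
  intro h
  have h1 : 2 * ((p.1.2 + 1) / 2) ≤ 1 := (S.mem_cube _ h).1.2
  linarith [hp.2.1.1]

/-- Composition of morphisms: stacking in the `z`-direction, extended bilinearly. -/
def Skein.comp (f : Skein a b) (g : Skein b c) : Skein a c :=
  bilin Cobordism.comp (E := lo) (E' := hi) (F := fun S' => hi '' S'.carrier)
    (D := fun S' => hi '' S'.dots) (F' := fun S => lo '' S.carrier) (D' := fun S => lo '' S.dots)
    (fun S' => ⟨fun _ => lo_mem, fun _ hp => lo_disj hp S',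
      fun _ hp h => lo_disj hp S' (Set.image_mono S'.dots_subset h), fun _ => rfl, fun _ => rfl⟩)
    (fun S => ⟨fun _ => hi_mem, fun _ hp => hi_disj hp S,
      fun _ hp h => hi_disj hp S (Set.image_mono S.dots_subset h),
      fun _ => Set.union_comm _ _, fun _ => Set.union_comm _ _⟩) g f

/-- Gluing of morphisms in the `y`-direction, extended bilinearly. -/
def Skein.tens {a a' : Diagram m k} {b b' : Diagram k n} (f : Skein a a') (g : Skein b b') :
    Skein (a.tens b) (a'.tens b') :=
  bilin Cobordism.tens (E := thick up) (E' := thick dn) (F := fun S' => thick dn '' S'.carrier)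
    (D := fun S' => thick dn '' S'.dots) (F' := fun S => thick up '' S.carrier)
    (D' := fun S => thick up '' S.dots)
    (fun S' => ⟨fun _ => thick_up_mem, fun _ hp => up_disj hp S',
      fun _ hp h => up_disj hp S' (Set.image_mono S'.dots_subset h), fun _ => rfl, fun _ => rfl⟩)
    (fun S => ⟨fun _ => thick_dn_mem, fun _ hp => dn_disj hp S,
      fun _ hp h => dn_disj hp S (Set.image_mono S.dots_subset h),
      fun _ => Set.union_comm _ _, fun _ => Set.union_comm _ _⟩) g f

theorem tr_placed {a b : Diagram n n} : Placed (thick box)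
    {p | p.1 ∈ arcs n ∧ 0 ≤ p.2 ∧ p.2 ≤ 1} ∅ (Cobordism.tr : Cobordism a b → _) where
  maps _ := thick_box_mem
  disj p hp h := by
    obtain ⟨⟨h1, h1'⟩, ⟨h2, h2'⟩, -⟩ := hp
    refine h.1.1 ⟨⟨?_, ?_⟩, ?_, ?_⟩
    · change 1 / 8 < (p.1.1 + 1 / 2) / 4; linarith
    · change (p.1.1 + 1 / 2) / 4 < 3 / 8; linarith
    · change 3 / 8 < (p.1.2 + 3 / 2) / 4; linarith
    · change (p.1.2 + 3 / 2) / 4 < 5 / 8; linarith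
  disj' _ _ h := h
  carrier _ := rfl
  dots _ := (Set.union_empty _).symm

/-- Closure of morphisms. -/
def Skein.tr {a b : Diagram n n} : Skein a b →ₗ[Polynomial ℤ] Skein a.tr b.tr := tr_placed.map

theorem dual_placed : Placed turn ∅ ∅ (Cobordism.dual : Cobordism a b → _) where
  maps _ := turn_mem
  disj _ _ h := h
  disj' _ _ h := h
  carrier _ := (Set.union_empty _).symm
  dots _ := (Set.union_empty _).symm

/-- Duality on morphisms. -/
def Skein.dual : Skein a b →ₗ[Polynomial ℤ] Skein b.dual a.dual := dual_placed.map

theorem Skein.comp_cls (S : Cobordism a b) (S' : Cobordism b c) :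
    Skein.comp (cls S) (cls S') = cls (S.comp S') := bilin_cls _ _ _ _ _

theorem Skein.tens_cls {a a' : Diagram m k} {b b' : Diagram k n} (S : Cobordism a a')
    (S' : Cobordism b b') : Skein.tens (cls S) (cls S') = cls (S.tens S') := bilin_cls _ _ _ _ _

theorem Skein.tr_cls {a b : Diagram n n} (S : Cobordism a b) : Skein.tr (cls S) = cls S.tr :=
  tr_placed.map_cls S

theorem Skein.dual_cls (S : Cobordism a b) : Skein.dual (cls S) = cls S.dual :=
  dual_placed.map_cls S

@[simp] theorem Skein.comp_add (f : Skein a b) (g g' : Skein b c) :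
    f.comp (g + g') = f.comp g + f.comp g' := by simp [Skein.comp]
@[simp] theorem Skein.add_comp (f f' : Skein a b) (g : Skein b c) :
    (f + f').comp g = f.comp g + f'.comp g := by simp [Skein.comp]
@[simp] theorem Skein.comp_smul (r : Polynomial ℤ) (f : Skein a b) (g : Skein b c) :
    f.comp (r • g) = r • f.comp g := by simp [Skein.comp]
@[simp] theorem Skein.smul_comp (r : Polynomial ℤ) (f : Skein a b) (g : Skein b c) :
    (r • f).comp g = r • f.comp g := by simp [Skein.comp]
@[simp] theorem Skein.comp_zero (f : Skein a b) : f.comp (0 : Skein b c) = 0 := by simp [Skein.comp]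
@[simp] theorem Skein.zero_comp (g : Skein b c) : (0 : Skein a b).comp g = 0 := by simp [Skein.comp]

section
variable {a a' : Diagram m k} {b b' : Diagram k n}
@[simp] theorem Skein.tens_add (f : Skein a a') (g g' : Skein b b') :
    f.tens (g + g') = f.tens g + f.tens g' := by simp [Skein.tens]
@[simp] theorem Skein.add_tens (f f' : Skein a a') (g : Skein b b') :
    (f + f').tens g = f.tens g + f'.tens g := by simp [Skein.tens]
@[simp] theorem Skein.tens_smul (r : Polynomial ℤ) (f : Skein a a') (g : Skein b b') :
    f.tens (r • g) = r • f.tens g := by simp [Skein.tens]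
@[simp] theorem Skein.smul_tens (r : Polynomial ℤ) (f : Skein a a') (g : Skein b b') :
    (r • f).tens g = r • f.tens g := by simp [Skein.tens]
@[simp] theorem Skein.tens_zero (f : Skein a a') : f.tens (0 : Skein b b') = 0 := by
  simp [Skein.tens]
@[simp] theorem Skein.zero_tens (g : Skein b b') : (0 : Skein a a').tens g = 0 := by
  simp [Skein.tens]
end

theorem Skein.induction {P : Skein a b → Prop} (h0 : P 0) (hadd : ∀ f g, P f → P g → P (f + g))
    (hsmul : ∀ (r : Polynomial ℤ) f, P f → P (r • f)) (hc : ∀ S, P (cls S)) (f : Skein a b) :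
    P f := by
  obtain ⟨f, rfl⟩ := (relations a b).mkQ_surjective f
  induction f using Finsupp.induction_linear with
  | zero => simpa using h0
  | add f g hf hg => simpa using hadd _ _ hf hg
  | single S r =>
    have := hsmul r _ (hc S)
    rwa [cls, ← map_smul, Finsupp.smul_single, smul_eq_mul, mul_one] at this

theorem Skein.tens_comp {a a' a'' : Diagram m k} {b b' b'' : Diagram k n} (f : Skein a a')
    (f' : Skein a' a'') (g : Skein b b') (g' : Skein b' b'') :
    (f.comp f').tens (g.comp g') = (f.tens g).comp (f'.tens g') := by
  induction f using Skein.induction with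
  | h0 => simp
  | hadd f₁ f₂ h₁ h₂ => simp [h₁, h₂]
  | hsmul r f h => simp [h]
  | hc S =>
  induction f' using Skein.induction with
  | h0 => simp
  | hadd f₁ f₂ h₁ h₂ => simp [h₁, h₂]
  | hsmul r f h => simp [h]
  | hc S' =>
  induction g using Skein.induction with
  | h0 => simp
  | hadd f₁ f₂ h₁ h₂ => simp [h₁, h₂]
  | hsmul r f h => simp [h]
  | hc T =>
  induction g' using Skein.induction with
  | h0 => simp
  | hadd f₁ f₂ h₁ h₂ => simp [h₁, h₂]
  | hsmul r f h => simp [h]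
  | hc T' =>
  simp only [Skein.comp_cls, Skein.tens_cls]
  congr 1
  have e : ∀ X Y Z W : Set Space, thick up '' (lo '' X ∪ hi '' Y) ∪ thick dn '' (lo '' Z ∪ hi '' W) =
      lo '' (thick up '' X ∪ thick dn '' Z) ∪ hi '' (thick up '' Y ∪ thick dn '' W) := by
    intro X Y Z W
    ext p
    simp only [Set.mem_union, mem_lo, mem_hi, mem_thick_up, mem_thick_dn]
    tauto
  ext1
  · exact e _ _ _ _
  · exact e _ _ _ _

theorem Skein.tr_comp {a b c : Diagram n n} (f : Skein a b) (g : Skein b c) :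
    (f.comp g).tr = f.tr.comp g.tr := by
  induction f using Skein.induction with
  | h0 => simp
  | hadd f₁ f₂ h₁ h₂ => simp [h₁, h₂]
  | hsmul r f h => simp [h]
  | hc S =>
  induction g using Skein.induction with
  | h0 => simp
  | hadd f₁ f₂ h₁ h₂ => simp [h₁, h₂]
  | hsmul r f h => simp [h]
  | hc S' =>
  simp only [Skein.comp_cls, Skein.tr_cls]
  congr 1
  ext p
  · simp only [Cobordism.tr, Cobordism.comp, Set.mem_union, mem_lo, mem_hi, mem_thick_box,
      Set.mem_ofPred_eq]
    constructor
    · rintro ((h | h) | ⟨h, h0, h1⟩)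
      · exact Or.inl (Or.inl h)
      · exact Or.inr (Or.inl h)
      · rcases le_total p.2 (1 / 2) with hle | hle
        · exact Or.inl (Or.inr ⟨h, by linarith, by linarith⟩)
        · exact Or.inr (Or.inr ⟨h, by linarith, by linarith⟩)
    · rintro ((h | ⟨h, h0, h1⟩) | (h | ⟨h, h0, h1⟩))
      · exact Or.inl (Or.inl h)
      · exact Or.inr ⟨h, by linarith, by linarith⟩
      · exact Or.inl (Or.inr h)
      · exact Or.inr ⟨h, by linarith, by linarith⟩
  · simp only [Cobordism.tr, Cobordism.comp, Set.mem_union, mem_lo, mem_hi, mem_thick_box]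

theorem Skein.tr_refl (a : Diagram n n) :
    Skein.tr (cls (Cobordism.refl a)) = cls (Cobordism.refl a.tr) := by
  rw [Skein.tr_cls]
  congr 1
  ext p
  · simp only [Cobordism.tr, Cobordism.refl, Diagram.tr, Set.mem_union, mem_thick_box, mem_box,
      Set.mem_ofPred_eq]
    tauto
  · simp [Cobordism.tr, Cobordism.refl]

theorem Skein.dual_comp (f : Skein a b) (g : Skein b c) :
    (f.comp g).dual = g.dual.comp f.dual := by
  induction f using Skein.induction with
  | h0 => simp
  | hadd f₁ f₂ h₁ h₂ => simp [h₁, h₂]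
  | hsmul r f h => simp [h]
  | hc S =>
  induction g using Skein.induction with
  | h0 => simp
  | hadd f₁ f₂ h₁ h₂ => simp [h₁, h₂]
  | hsmul r f h => simp [h]
  | hc S' =>
  simp only [Skein.comp_cls, Skein.dual_cls]
  congr 1
  have e : ∀ X Y : Set Space, turn '' (lo '' X ∪ hi '' Y) = lo '' (turn '' Y) ∪ hi '' (turn '' X) := by
    intro X Y
    ext p
    simp only [Set.mem_union, mem_lo, mem_hi, mem_turn]
    rw [show 2 * (1 - p.2) = 1 - (2 * p.2 - 1) by ring,
      show 1 - (2 * p.2 - 1) - 1 = 1 - 2 * p.2 by ring]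
    tauto
  ext1
  · exact e _ _
  · exact e _ _

/-! ### The category laws -/

/-- The distance from the boundary of the square, cut off at `δ` and normalised. -/
def bump (δ : ℝ) (q : Plane) : ℝ :=
  max 0 (min 1 (min (min q.1 (1 - q.1)) (min q.2 (1 - q.2)) / δ))

theorem bump_mem (δ : ℝ) (q : Plane) : 0 ≤ bump δ q ∧ bump δ q ≤ 1 :=
  ⟨le_max_left _ _, max_le zero_le_one (min_le_left _ _)⟩

theorem bump_eq_one {δ : ℝ} (hδ : 0 < δ) {q : Plane} (h1 : δ ≤ q.1) (h2 : δ ≤ 1 - q.1)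
    (h3 : δ ≤ q.2) (h4 : δ ≤ 1 - q.2) : bump δ q = 1 := by
  have : 1 ≤ min (min q.1 (1 - q.1)) (min q.2 (1 - q.2)) / δ := by
    rw [le_div_iff₀ hδ, one_mul]
    exact le_min (le_min h1 h2) (le_min h3 h4)
  rw [bump, min_eq_left this]
  exact max_eq_right zero_le_one

theorem bump_eq_zero {δ : ℝ} (hδ : 0 < δ) {q : Plane}
    (h : ¬ ((0 < q.1 ∧ q.1 < 1) ∧ 0 < q.2 ∧ q.2 < 1)) : bump δ q = 0 := by
  refine max_eq_left (min_le_of_right_le (div_nonpos_of_nonpos_of_nonneg ?_ hδ.le))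
  by_contra hc
  rw [not_le, lt_min_iff, lt_min_iff, lt_min_iff] at hc
  exact h ⟨⟨hc.1.1, by linarith [hc.1.2]⟩, hc.2.1, by linarith [hc.2.2]⟩

theorem continuous_bump (δ : ℝ) : Continuous (bump δ) := by unfold bump; fun_prop

/-- A continuous bijection of space fixing the complement of the open cube is a homeomorphism. -/
theorem isHomeomorph_of_bijective {f : Space → Space} (hc : Continuous f)
    (hb : Function.Bijective f) (hf : ∀ p ∉ openCube, f p = p) : IsHomeomorph f := by
  have hK : IsCompact ((Set.Icc (0 : ℝ) 1 ×ˢ Set.Icc (0 : ℝ) 1) ×ˢ Set.Icc (0 : ℝ) 1 : Set Space) :=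
    (isCompact_Icc.prod isCompact_Icc).prod isCompact_Icc
  set K : Set Space := (Set.Icc (0 : ℝ) 1 ×ˢ Set.Icc (0 : ℝ) 1) ×ˢ Set.Icc (0 : ℝ) 1 with hKdef
  have hsub : openCube ⊆ K := fun p hp =>
    ⟨⟨⟨hp.1.1.le, hp.1.2.le⟩, ⟨hp.2.1.1.le, hp.2.1.2.le⟩⟩, ⟨hp.2.2.1.le, hp.2.2.2.le⟩⟩
  refine isHomeomorph_iff_continuous_isClosedMap_bijective.2 ⟨hc, fun C hC => ?_, hb⟩
  have : f '' C = f '' (C ∩ K) ∪ (C ∩ openCubeᶜ) := by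
    ext p
    constructor
    · rintro ⟨q, hq, rfl⟩
      by_cases h : q ∈ openCube
      · exact Or.inl ⟨q, ⟨hq, hsub h⟩, rfl⟩
      · rw [hf q h]; exact Or.inr ⟨hq, h⟩
    · rintro (⟨q, hq, rfl⟩ | ⟨h1, h2⟩)
      · exact ⟨q, hq.1, rfl⟩
      · exact ⟨p, h1, hf p h2⟩
  rw [this]
  exact ((hK.inter_left hC).image hc).isClosed.union (hC.inter isOpen_openCube.isClosed_compl)

/-- Reparametrising the `z`-direction by an increasing homeomorphism gives isotopic surfaces. -/
theorem isotopic_of_reparam {a b : Diagram m n} {S S' : Cobordism a b} (ρ : ℝ ≃o ℝ)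
    (h0 : ∀ z ≤ 0, ρ z = z) (h1 : ∀ z, 1 ≤ z → ρ z = z)
    (hS : ∀ q z, (q, z) ∈ S.carrier ↔ (q, ρ z) ∈ S'.carrier)
    (hD : ∀ q z, (q, z) ∈ S.dots ↔ (q, ρ z) ∈ S'.dots) : Isotopic S S' := by
  obtain ⟨ε, hε, hcol⟩ := S.collar
  obtain ⟨δ₀, hδ₀, hdots⟩ : ∃ δ : ℝ, 0 < δ ∧ ∀ p ∈ S.dots,
      (δ ≤ p.1.1 ∧ δ ≤ 1 - p.1.1) ∧ δ ≤ p.1.2 ∧ δ ≤ 1 - p.1.2 := by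
    suffices key : ∀ T : Set Space, T.Finite → T ⊆ openCube → ∃ δ : ℝ, 0 < δ ∧ ∀ p ∈ T,
        (δ ≤ p.1.1 ∧ δ ≤ 1 - p.1.1) ∧ δ ≤ p.1.2 ∧ δ ≤ 1 - p.1.2 from
      key _ S.dots_finite S.dots_interior
    intro T hT
    induction T, hT using Set.Finite.induction_on with
    | empty => exact fun _ => ⟨1, one_pos, fun p hp => hp.elim⟩
    | @insert p s _ _ ih =>
      intro hint
      obtain ⟨δ, hδ, h⟩ := ih fun q hq => hint (Set.mem_insert_of_mem _ hq)
      obtain ⟨⟨p1, p2⟩, ⟨p3, p4⟩, -⟩ := hint (Set.mem_insert p s)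
      refine ⟨min δ (min (min p.1.1 (1 - p.1.1)) (min p.1.2 (1 - p.1.2))), ?_, ?_⟩
      · refine lt_min hδ (lt_min (lt_min p1 (by linarith)) (lt_min p3 (by linarith)))
      · rintro q (rfl | hq)
        · simp
        · obtain ⟨⟨h1, h2⟩, h3, h4⟩ := h q hq
          exact ⟨⟨(min_le_left _ _).trans h1, (min_le_left _ _).trans h2⟩,
            (min_le_left _ _).trans h3, (min_le_left _ _).trans h4⟩
  set δ := min ε δ₀ with hδdef
  have hδ : 0 < δ := lt_min hε hδ₀
  have hρc : Continuous ρ := ρ.continuous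
  have hρ01 : ∀ z, 0 < z → z < 1 → 0 < ρ z ∧ ρ z < 1 := fun z hz hz' => by
    constructor
    · rw [← h0 0 le_rfl]; exact ρ.strictMono hz
    · rw [← h1 1 le_rfl]; exact ρ.strictMono hz'
  let c : unitInterval → Plane → ℝ := fun t q => (t : ℝ) * bump δ q
  have hc01 : ∀ t q, 0 ≤ c t q ∧ c t q ≤ 1 := fun t q =>
    ⟨mul_nonneg t.2.1 (bump_mem δ q).1, mul_le_one₀ t.2.2 (bump_mem δ q).1 (bump_mem δ q).2⟩
  let H : unitInterval → Space → Space := fun t p =>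
    (p.1, (1 - c t p.1) * p.2 + c t p.1 * ρ p.2)
  have hcont : Continuous (Function.uncurry H) := by
    have hb := continuous_bump δ
    have : Function.uncurry H = fun x : unitInterval × Space =>
      (x.2.1, (1 - (x.1 : ℝ) * bump δ x.2.1) * x.2.2 + (x.1 : ℝ) * bump δ x.2.1 * ρ x.2.2) := rfl
    rw [this]
    fun_prop
  have hfix : ∀ t, ∀ p ∉ openCube, H t p = p := by
    intro t p hp
    by_cases hq : (0 < p.1.1 ∧ p.1.1 < 1) ∧ 0 < p.1.2 ∧ p.1.2 < 1
    · have hz : p.2 ≤ 0 ∨ 1 ≤ p.2 := by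
        by_contra hcon
        rw [not_or, not_le, not_le] at hcon
        exact hp ⟨hq.1, hq.2, hcon⟩
      have hz' : ρ p.2 = p.2 := hz.elim (h0 _) (h1 _)
      ext1
      · rfl
      · simp only [H, hz']; ring
    · ext1
      · rfl
      · simp only [H, c, bump_eq_zero hδ hq]; ring
  have hmono : ∀ t q, StrictMono fun z => (1 - c t q) * z + c t q * ρ z := by
    intro t q z z' hz
    have := ρ.strictMono hz
    obtain ⟨c0, c1⟩ := hc01 t q
    rcases eq_or_lt_of_le c0 with h | h
    · simp only [← h]; linarith
    · have e1 : (1 - c t q) * z ≤ (1 - c t q) * z' := mul_le_mul_of_nonneg_left hz.le (by linarith)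
      have e2 : c t q * ρ z < c t q * ρ z' := mul_lt_mul_of_pos_left this h
      simp only; linarith
  have hsurj : ∀ t q, Function.Surjective fun z => (1 - c t q) * z + c t q * ρ z := by
    intro t q
    refine Continuous.surjective (by fun_prop) ?_ ?_
    · refine Filter.tendsto_id.congr' ?_
      filter_upwards [Filter.eventually_ge_atTop 1] with z hz
      rw [h1 z hz, id]; ring
    · refine Filter.tendsto_id.congr' ?_
      filter_upwards [Filter.eventually_le_atBot 0] with z hz
      rw [h0 z hz, id]; ring
  have hbij : ∀ t, Function.Bijective (H t) := by
    intro t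
    constructor
    · rintro ⟨q, z⟩ ⟨q', z'⟩ h
      obtain ⟨h1, h2⟩ := Prod.mk.inj h
      simp only at h1 h2
      subst h1
      have : z = z' := (hmono t q).injective h2
      rw [this]
    · rintro ⟨q, z⟩
      obtain ⟨w, hw⟩ := hsurj t q z
      exact ⟨(q, w), Prod.ext rfl hw⟩
  refine ⟨H, hcont, fun t => isHomeomorph_of_bijective (by fun_prop) (hbij t) (hfix t), hfix,
    fun p => by simp [H, c], ?_, ?_⟩
  · have key : ∀ p, p ∈ S.carrier ↔ H 1 p ∈ S'.carrier := by
      rintro ⟨q, z⟩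
      by_cases hb : (δ ≤ q.1 ∧ δ ≤ 1 - q.1) ∧ δ ≤ q.2 ∧ δ ≤ 1 - q.2
      · have : H 1 (q, z) = (q, ρ z) := by
          simp [H, c, bump_eq_one hδ hb.1.1 hb.1.2 hb.2.1 hb.2.2]
        rw [this]; exact hS q z
      · by_cases hz : 0 < z ∧ z < 1
        · have hcase : q.1 < ε ∨ 1 - ε < q.1 ∨ q.2 < ε ∨ 1 - ε < q.2 := by
            have e1 : δ ≤ ε := min_le_left _ _
            by_contra hcon
            simp only [not_or, not_lt] at hcon
            exact hb ⟨⟨by linarith, by linarith⟩, by linarith, by linarith⟩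
          set w := (1 - c 1 q) * z + c 1 q * ρ z with hw
          have hw01 : 0 < w ∧ w < 1 := by
            constructor
            · have := hmono 1 q hz.1
              simp only [h0 0 le_rfl] at this; linarith
            · have := hmono 1 q hz.2
              simp only [h1 1 le_rfl] at this; linarith
          change (q, z) ∈ S.carrier ↔ (q, w) ∈ S'.carrier
          obtain ⟨v, hv⟩ := ρ.surjective w
          rw [← hv, ← hS]
          have hv01 : 0 < v ∧ v < 1 := by
            rw [← hv] at hw01
            constructor
            · have := hw01.1
              rw [← h0 0 le_rfl] at this
              exact ρ.lt_iff_lt.1 this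
            · have := hw01.2
              rw [← h1 1 le_rfl] at this
              exact ρ.lt_iff_lt.1 this
          obtain ⟨x1, y1, y1', -, -⟩ := hcol (q, z)
          obtain ⟨x2, y2, y2', -, -⟩ := hcol (q, v)
          simp only at x1 y1 y1' x2 y2 y2'
          have hy : ∀ r, (q, r) ∈ S.carrier → 0 ≤ q.2 ∧ q.2 ≤ 1 := fun r hr => (S.mem_cube _ hr).1
          by_cases hqy : 0 ≤ q.2 ∧ q.2 ≤ 1
          · rcases hcase with h | h | h | h
            · exact iff_of_false (x1 (Or.inl h)) (x2 (Or.inl h))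
            · exact iff_of_false (x1 (Or.inr h)) (x2 (Or.inr h))
            · exact (y1 hz.1.le hz.2.le hqy.1 h).trans (y2 hv01.1.le hv01.2.le hqy.1 h).symm
            · exact (y1' hz.1.le hz.2.le h hqy.2).trans (y2' hv01.1.le hv01.2.le h hqy.2).symm
          · exact iff_of_false (fun hr => hqy (hy _ hr)) (fun hr => hqy (hy _ hr))
        · have hz' : z ≤ 0 ∨ 1 ≤ z := by
            by_contra hcon
            rw [not_or, not_le, not_le] at hcon
            exact hz hcon
          have e : ρ z = z := hz'.elim (h0 _) (h1 _)
          rw [hfix 1 (q, z) fun hp => hz hp.2.2, hS, e]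
    ext p
    constructor
    · rintro ⟨q, hq, rfl⟩
      exact (key q).1 hq
    · intro hp
      obtain ⟨q, rfl⟩ := (hbij 1).2 p
      exact ⟨q, (key q).2 hp, rfl⟩
  · have hH : ∀ p ∈ S.dots, H 1 p = (p.1, ρ p.2) := by
      intro p hp
      obtain ⟨⟨d1, d2⟩, d3, d4⟩ := hdots p hp
      have e1 : δ ≤ δ₀ := min_le_right _ _
      simp [H, c, bump_eq_one hδ (e1.trans d1) (e1.trans d2) (e1.trans d3) (e1.trans d4)]
    ext p
    constructor
    · rintro ⟨q, hq, rfl⟩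
      rw [hH q hq]
      exact (hD q.1 q.2).1 hq
    · intro hp
      obtain ⟨z, hz⟩ := ρ.surjective p.2
      have hq : (p.1, z) ∈ S.dots := (hD p.1 z).2 (by rw [hz]; exact hp)
      exact ⟨_, hq, by rw [hH _ hq]; exact Prod.ext rfl hz⟩

/-- An order automorphism of the real line fixing the complement of the unit interval. -/
theorem exists_orderIso {f : ℝ → ℝ} (hm : StrictMono f) (hc : Continuous f)
    (h0 : ∀ z ≤ 0, f z = z) (h1 : ∀ z, 1 ≤ z → f z = z) : ∃ ρ : ℝ ≃o ℝ, ∀ z, ρ z = f z := by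
  refine ⟨hm.orderIsoOfSurjective f (hc.surjective ?_ ?_), fun z => rfl⟩
  · refine Filter.tendsto_id.congr' ?_
    filter_upwards [Filter.eventually_ge_atTop 1] with z hz
    exact (h1 z hz).symm
  · refine Filter.tendsto_id.congr' ?_
    filter_upwards [Filter.eventually_le_atBot 0] with z hz
    exact (h0 z hz).symm

theorem cls_eq {S S' : Cobordism a b} (h : Isotopic S S') : cls S = cls S' := by
  refine sub_eq_zero.1 ?_
  rw [cls, cls, ← map_sub, Submodule.mkQ_apply, Submodule.Quotient.mk_eq_zero]
  exact Submodule.subset_span (IsRelation.isotopy S S' h)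

theorem exists_zcollar (S : Cobordism a b) : ∃ δ : ℝ, 0 < δ ∧ δ < 1 ∧
    (∀ q z, 0 ≤ z → z ≤ δ → ((q, z) ∈ S.carrier ↔ q ∈ a.carrier) ∧ (q, z) ∉ S.dots) ∧
    (∀ q z, 1 - δ ≤ z → z ≤ 1 → ((q, z) ∈ S.carrier ↔ q ∈ b.carrier) ∧ (q, z) ∉ S.dots) := by
  obtain ⟨ε, hε, hcol⟩ := S.collar
  obtain ⟨δ₀, hδ₀, hdots⟩ : ∃ δ : ℝ, 0 < δ ∧ ∀ p ∈ S.dots, δ ≤ p.2 ∧ δ ≤ 1 - p.2 := by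
    suffices key : ∀ T : Set Space, T.Finite → T ⊆ openCube → ∃ δ : ℝ, 0 < δ ∧ ∀ p ∈ T,
        δ ≤ p.2 ∧ δ ≤ 1 - p.2 from key _ S.dots_finite S.dots_interior
    intro T hT
    induction T, hT using Set.Finite.induction_on with
    | empty => exact fun _ => ⟨1, one_pos, fun p hp => hp.elim⟩
    | @insert p s _ _ ih =>
      intro hint
      obtain ⟨δ, hδ, h⟩ := ih fun q hq => hint (Set.mem_insert_of_mem _ hq)
      obtain ⟨-, -, p1, p2⟩ := hint (Set.mem_insert p s)
      refine ⟨min δ (min p.2 (1 - p.2)), lt_min hδ (lt_min p1 (by linarith)), ?_⟩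
      rintro q (rfl | hq)
      · simp
      · obtain ⟨h1, h2⟩ := h q hq
        exact ⟨(min_le_left _ _).trans h1, (min_le_left _ _).trans h2⟩
  have e0 : 0 < min (min ε δ₀) 1 := lt_min (lt_min hε hδ₀) one_pos
  have e1 : min (min ε δ₀) 1 ≤ ε := (min_le_left _ _).trans (min_le_left _ _)
  have e2 : min (min ε δ₀) 1 ≤ δ₀ := (min_le_left _ _).trans (min_le_right _ _)
  have e3 : min (min ε δ₀) 1 ≤ 1 := min_le_right _ _
  refine ⟨min (min ε δ₀) 1 / 2, by linarith, by linarith, fun q z h0 h1 => ?_, fun q z h0 h1 => ?_⟩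
  · refine ⟨(hcol (q, z)).2.2.2.1 h0 (by simp only; linarith), fun hd => ?_⟩
    have := (hdots _ hd).1
    simp only at this; linarith
  · refine ⟨(hcol (q, z)).2.2.2.2 (by simp only; linarith) h1, fun hd => ?_⟩
    have := (hdots _ hd).2
    simp only at this; linarith

theorem comp_refl_isotopic (S : Cobordism a b) : Isotopic S (S.comp (Cobordism.refl b)) := by
  obtain ⟨δ, hδ, hδ1, -, hcol⟩ := exists_zcollar S
  have hκ : 1 < (1 + δ) / (2 * δ) := by rw [lt_div_iff₀ (by linarith)]; linarith
  have hκδ : (1 + δ) / (2 * δ) * δ = (1 + δ) / 2 := by field_simp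
  set κ := (1 + δ) / (2 * δ) with hκdef
  let f : ℝ → ℝ := fun z => min z (max (z / 2) (1 + κ * (z - 1)))
  have f0 : ∀ z ≤ 0, f z = z := fun z hz =>
    min_eq_left (le_max_of_le_left (by linarith))
  have f1 : ∀ z, 1 ≤ z → f z = z := fun z hz =>
    min_eq_left (le_max_of_le_right (by nlinarith))
  have flow : ∀ z, 0 ≤ z → z ≤ 1 - δ → f z = z / 2 := fun z hz hz' => by
    have : 1 + κ * (z - 1) ≤ z / 2 := by nlinarith
    simp only [f]
    rw [max_eq_left this, min_eq_right (by linarith)]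
  have fhigh : ∀ z, 1 - δ ≤ z → z ≤ 1 → 1 - δ ≤ 2 * f z ∧ f z ≤ 1 := fun z hz hz' => by
    refine ⟨?_, (min_le_left _ _).trans hz'⟩
    have : (1 - δ) / 2 ≤ f z := le_min (by linarith) (le_max_of_le_left (by linarith))
    linarith
  have hm : StrictMono f := by
    intro z z' hz
    have hk : 1 + κ * (z - 1) < 1 + κ * (z' - 1) := by nlinarith
    exact min_lt_min hz (max_lt_max (by linarith) hk)
  obtain ⟨ρ, hρ⟩ := exists_orderIso hm (by fun_prop) f0 f1
  refine isotopic_of_reparam ρ (fun z hz => by rw [hρ, f0 z hz])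
    (fun z hz => by rw [hρ, f1 z hz]) (fun q z => ?_) (fun q z => ?_)
  · have hin := S.mem_cube (q, z)
    have hin' := S.mem_cube (q, 2 * f z)
    simp only at hin hin'
    rw [hρ]
    simp only [Cobordism.comp, Cobordism.refl, Set.mem_union, mem_lo, mem_hi, Set.mem_ofPred_eq]
    by_cases hz0 : 0 ≤ z
    swap
    · have e := f0 z (by linarith)
      rw [e] at hin' ⊢
      refine iff_of_false (fun h => ?_) ?_
      · linarith [(hin h).2.1]
      · rintro (h | h)
        · linarith [(hin' h).2.1]
        · linarith [h.2.1]
    by_cases hz1 : z ≤ 1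
    swap
    · have e := f1 z (by linarith)
      rw [e] at hin' ⊢
      refine iff_of_false (fun h => ?_) ?_
      · linarith [(hin h).2.2]
      · rintro (h | h)
        · linarith [(hin' h).2.2]
        · linarith [h.2.2]
    rcases le_total z (1 - δ) with hle | hle
    · rw [flow z hz0 hle, show 2 * (z / 2) = z by ring]
      refine (or_iff_left fun h => ?_).symm
      linarith [h.2.1]
    · obtain ⟨e1, e2⟩ := fhigh z hle hz1
      rw [(hcol q z hle hz1).1]
      constructor
      · intro h
        rcases le_total (2 * f z) 1 with hf | hf
        · exact Or.inl ((hcol q _ e1 hf).1.2 h)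
        · exact Or.inr ⟨h, by linarith, by linarith⟩
      · rintro (h | h)
        · exact (hcol q _ e1 (hin' h).2.2).1.1 h
        · exact h.1
  · rw [hρ]
    simp only [Cobordism.comp, Cobordism.refl, Set.mem_union, mem_lo, Set.image_empty,
      Set.mem_empty_iff_false, or_false]
    have hin := fun h : (q, z) ∈ S.dots => (S.dots_interior h).2.2
    have hin' := fun h : (q, 2 * f z) ∈ S.dots => (S.dots_interior h).2.2
    simp only at hin hin'
    by_cases hz0 : 0 ≤ z
    swap
    · have e := f0 z (by linarith)
      rw [e] at hin' ⊢
      exact iff_of_false (fun h => by linarith [(hin h).1]) (fun h => by linarith [(hin' h).1])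
    by_cases hz1 : z ≤ 1
    swap
    · have e := f1 z (by linarith)
      rw [e] at hin' ⊢
      exact iff_of_false (fun h => by linarith [(hin h).2]) (fun h => by linarith [(hin' h).2])
    rcases le_total z (1 - δ) with hle | hle
    · rw [flow z hz0 hle, show 2 * (z / 2) = z by ring]
    · obtain ⟨e1, e2⟩ := fhigh z hle hz1
      refine iff_of_false (hcol q z hle hz1).2 fun h => ?_
      exact (hcol q _ e1 (hin' h).2.le).2 h

theorem refl_comp_isotopic (S : Cobordism a b) : Isotopic S ((Cobordism.refl a).comp S) := by
  obtain ⟨δ, hδ, hδ1, hcol, -⟩ := exists_zcollar S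
  have hκ : 1 < (1 + δ) / (2 * δ) := by rw [lt_div_iff₀ (by linarith)]; linarith
  have hκδ : (1 + δ) / (2 * δ) * δ = (1 + δ) / 2 := by field_simp
  set κ := (1 + δ) / (2 * δ) with hκdef
  let f : ℝ → ℝ := fun z => max z (min ((z + 1) / 2) (κ * z))
  have f0 : ∀ z ≤ 0, f z = z := fun z hz =>
    max_eq_left (min_le_of_right_le (by nlinarith))
  have f1 : ∀ z, 1 ≤ z → f z = z := fun z hz =>
    max_eq_left (min_le_of_left_le (by linarith))
  have fhigh : ∀ z, δ ≤ z → z ≤ 1 → f z = (z + 1) / 2 := fun z hz hz' => by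
    have : (z + 1) / 2 ≤ κ * z := by nlinarith
    simp only [f]
    rw [min_eq_left this, max_eq_right (by linarith)]
  have flow : ∀ z, 0 ≤ z → z ≤ δ → 0 ≤ f z ∧ 2 * f z - 1 ≤ δ := fun z hz hz' => by
    refine ⟨hz.trans (le_max_left _ _), ?_⟩
    have : f z ≤ (1 + δ) / 2 := max_le (by linarith) (min_le_of_left_le (by linarith))
    linarith
  have hm : StrictMono f := by
    intro z z' hz
    have hk : κ * z < κ * z' := by nlinarith
    exact max_lt_max hz (min_lt_min (by linarith) hk)
  obtain ⟨ρ, hρ⟩ := exists_orderIso hm (by fun_prop) f0 f1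
  refine isotopic_of_reparam ρ (fun z hz => by rw [hρ, f0 z hz])
    (fun z hz => by rw [hρ, f1 z hz]) (fun q z => ?_) (fun q z => ?_)
  · have hin := S.mem_cube (q, z)
    have hin' := S.mem_cube (q, 2 * f z - 1)
    simp only at hin hin'
    rw [hρ]
    simp only [Cobordism.comp, Cobordism.refl, Set.mem_union, mem_lo, mem_hi, Set.mem_ofPred_eq]
    by_cases hz0 : 0 ≤ z
    swap
    · have e := f0 z (by linarith)
      rw [e] at hin' ⊢
      refine iff_of_false (fun h => ?_) ?_
      · linarith [(hin h).2.1]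
      · rintro (h | h)
        · linarith [h.2.1]
        · linarith [(hin' h).2.1]
    by_cases hz1 : z ≤ 1
    swap
    · have e := f1 z (by linarith)
      rw [e] at hin' ⊢
      refine iff_of_false (fun h => ?_) ?_
      · linarith [(hin h).2.2]
      · rintro (h | h)
        · linarith [h.2.2]
        · linarith [(hin' h).2.2]
    rcases le_total δ z with hle | hle
    · rw [fhigh z hle hz1, show 2 * ((z + 1) / 2) - 1 = z by ring]
      refine (or_iff_right fun h => ?_).symm
      linarith [h.2.2]
    · obtain ⟨e1, e2⟩ := flow z hz0 hle
      rw [(hcol q z hz0 hle).1]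
      constructor
      · intro h
        rcases le_total 0 (2 * f z - 1) with hf | hf
        · exact Or.inr ((hcol q _ hf e2).1.2 h)
        · exact Or.inl ⟨h, by linarith, by linarith⟩
      · rintro (h | h)
        · exact h.1
        · exact (hcol q _ (hin' h).2.1 e2).1.1 h
  · rw [hρ]
    simp only [Cobordism.comp, Cobordism.refl, Set.mem_union, mem_hi, Set.image_empty,
      Set.mem_empty_iff_false, false_or]
    have hin := fun h : (q, z) ∈ S.dots => (S.dots_interior h).2.2
    have hin' := fun h : (q, 2 * f z - 1) ∈ S.dots => (S.dots_interior h).2.2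
    simp only at hin hin'
    by_cases hz0 : 0 ≤ z
    swap
    · have e := f0 z (by linarith)
      rw [e] at hin' ⊢
      exact iff_of_false (fun h => by linarith [(hin h).1]) (fun h => by linarith [(hin' h).1])
    by_cases hz1 : z ≤ 1
    swap
    · have e := f1 z (by linarith)
      rw [e] at hin' ⊢
      exact iff_of_false (fun h => by linarith [(hin h).2]) (fun h => by linarith [(hin' h).2])
    rcases le_total δ z with hle | hle
    · rw [fhigh z hle hz1, show 2 * ((z + 1) / 2) - 1 = z by ring]
    · obtain ⟨e1, e2⟩ := flow z hz0 hle
      refine iff_of_false (hcol q z hz0 hle).2 fun h => ?_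
      exact (hcol q _ (hin' h).1.le e2).2 h

theorem comp_assoc_isotopic {d : Diagram m n} (S : Cobordism a b) (S' : Cobordism b c)
    (S'' : Cobordism c d) : Isotopic ((S.comp S').comp S'') (S.comp (S'.comp S'')) := by
  let f : ℝ → ℝ := fun z => max z (min (2 * z) (min (z + 1 / 4) ((z + 1) / 2)))
  have f0 : ∀ z ≤ 0, f z = z := fun z hz => max_eq_left (min_le_of_left_le (by linarith))
  have f1 : ∀ z, 1 ≤ z → f z = z := fun z hz =>
    max_eq_left (min_le_of_right_le (min_le_of_right_le (by linarith)))
  have c1 : ∀ z, 0 ≤ z → z ≤ 1 / 4 → f z = 2 * z := fun z h h' => by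
    have e : 2 * z ≤ min (z + 1 / 4) ((z + 1) / 2) := le_min (by linarith) (by linarith)
    simp only [f]; rw [min_eq_left e, max_eq_right (by linarith)]
  have c2 : ∀ z, 1 / 4 ≤ z → z ≤ 1 / 2 → f z = z + 1 / 4 := fun z h h' => by
    have e : z + 1 / 4 ≤ (z + 1) / 2 := by linarith
    simp only [f]; rw [min_eq_left e, min_eq_right (by linarith), max_eq_right (by linarith)]
  have c3 : ∀ z, 1 / 2 ≤ z → z ≤ 1 → f z = (z + 1) / 2 := fun z h h' => by
    have e : (z + 1) / 2 ≤ z + 1 / 4 := by linarith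
    simp only [f]; rw [min_eq_right e, min_eq_right (by linarith), max_eq_right (by linarith)]
  have hm : StrictMono f := fun z z' hz =>
    max_lt_max hz (min_lt_min (by linarith) (min_lt_min (by linarith) (by linarith)))
  obtain ⟨ρ, hρ⟩ := exists_orderIso hm (by fun_prop) f0 f1
  have key : ∀ X Y Z : Set Space, (∀ p ∈ X, 0 ≤ p.2 ∧ p.2 ≤ 1) → (∀ p ∈ Y, 0 ≤ p.2 ∧ p.2 ≤ 1) →
      (∀ p ∈ Z, 0 ≤ p.2 ∧ p.2 ≤ 1) → (∀ q, (q, 1) ∈ X ↔ (q, 0) ∈ Y) →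
      (∀ q, (q, 1) ∈ Y ↔ (q, 0) ∈ Z) → ∀ q z,
      ((q, z) ∈ lo '' (lo '' X ∪ hi '' Y) ∪ hi '' Z ↔
        (q, ρ z) ∈ lo '' X ∪ hi '' (lo '' Y ∪ hi '' Z)) := by
    intro X Y Z hX hY hZ hXY hYZ q z
    have iX : ∀ w, (q, w) ∈ X → 0 ≤ w ∧ w ≤ 1 := fun w h => hX _ h
    have iY : ∀ w, (q, w) ∈ Y → 0 ≤ w ∧ w ≤ 1 := fun w h => hY _ h
    have iZ : ∀ w, (q, w) ∈ Z → 0 ≤ w ∧ w ≤ 1 := fun w h => hZ _ h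
    rw [hρ]
    simp only [Set.mem_union, mem_lo, mem_hi]
    have nX : ∀ w, w < 0 ∨ 1 < w → ((q, w) ∈ X ↔ False) := fun w hw =>
      iff_false_intro fun h => by rcases hw with hw | hw <;> linarith [(iX w h).1, (iX w h).2]
    have nY : ∀ w, w < 0 ∨ 1 < w → ((q, w) ∈ Y ↔ False) := fun w hw =>
      iff_false_intro fun h => by rcases hw with hw | hw <;> linarith [(iY w h).1, (iY w h).2]
    have nZ : ∀ w, w < 0 ∨ 1 < w → ((q, w) ∈ Z ↔ False) := fun w hw =>
      iff_false_intro fun h => by rcases hw with hw | hw <;> linarith [(iZ w h).1, (iZ w h).2]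
    rcases lt_or_ge z 0 with hz | hz
    · rw [f0 z hz.le, nX _ (Or.inl (by linarith)), nY _ (Or.inl (by linarith)),
        nZ _ (Or.inl (by linarith)), nX _ (Or.inl (by linarith)), nY _ (Or.inl (by linarith)),
        nZ _ (Or.inl (by linarith))]
      simp
    rcases lt_or_ge 1 z with hz1 | hz1
    · rw [f1 z hz1.le, nX _ (Or.inr (by linarith)), nY _ (Or.inr (by linarith)),
        nZ _ (Or.inr (by linarith)), nX _ (Or.inr (by linarith)), nY _ (Or.inr (by linarith)),
        nZ _ (Or.inr (by linarith))]
      simp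
    rcases lt_trichotomy z (1 / 4) with h | h | h
    · rw [c1 z hz h.le, nY _ (Or.inl (by linarith)), nZ _ (Or.inl (by linarith)),
        nY _ (Or.inl (by linarith)), nZ _ (Or.inl (by linarith))]
      simp
    · subst h
      rw [c1 (1 / 4) hz le_rfl]
      norm_num
      rw [hXY q, nZ _ (Or.inl (by norm_num)), nZ _ (Or.inl (by norm_num))]
      tauto
    rcases lt_trichotomy z (1 / 2) with h' | h' | h'
    · rw [c2 z h.le h'.le, nX _ (Or.inr (by linarith)), nZ _ (Or.inl (by linarith)),
        nX _ (Or.inr (by linarith)), nZ _ (Or.inl (by linarith)),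
        show 2 * (2 * (z + 1 / 4) - 1) = 2 * (2 * z) - 1 by ring]
      simp
    · subst h'
      rw [c2 (1 / 2) h.le le_rfl]
      norm_num
      rw [nX _ (Or.inr (by norm_num)), nX _ (Or.inr (by norm_num))]
      tauto
    · rw [c3 z h'.le hz1, nX _ (Or.inr (by linarith)), nY _ (Or.inr (by linarith)),
        nX _ (Or.inr (by linarith)), nY _ (Or.inr (by linarith)),
        show 2 * (2 * ((z + 1) / 2) - 1) - 1 = 2 * z - 1 by ring]
      simp
  have bd : ∀ {a b : Diagram m n} (S : Cobordism a b), ∀ q,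
      ((q, 0) ∈ S.carrier ↔ q ∈ a.carrier) ∧ ((q, 1) ∈ S.carrier ↔ q ∈ b.carrier) := by
    intro a b S q
    obtain ⟨ε, hε, h⟩ := S.collar
    exact ⟨(h (q, 0)).2.2.2.1 le_rfl hε, (h (q, 1)).2.2.2.2 (by simpa using hε) le_rfl⟩
  have nd : ∀ {a b : Diagram m n} (S : Cobordism a b), ∀ q, (q, 0) ∉ S.dots ∧ (q, 1) ∉ S.dots :=
    fun S q => ⟨fun h => lt_irrefl _ (S.dots_interior h).2.2.1,
      fun h => lt_irrefl _ (S.dots_interior h).2.2.2⟩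
  refine isotopic_of_reparam ρ (fun z hz => by rw [hρ, f0 z hz])
    (fun z hz => by rw [hρ, f1 z hz]) ?_ ?_
  · exact key _ _ _ (fun p hp => (S.mem_cube p hp).2) (fun p hp => (S'.mem_cube p hp).2)
      (fun p hp => (S''.mem_cube p hp).2) (fun q => (bd S q).2.trans (bd S' q).1.symm)
      (fun q => (bd S' q).2.trans (bd S'' q).1.symm)
  · exact key _ _ _ (fun p hp => (S.mem_cube p (S.dots_subset hp)).2)
      (fun p hp => (S'.mem_cube p (S'.dots_subset hp)).2)
      (fun p hp => (S''.mem_cube p (S''.dots_subset hp)).2)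
      (fun q => iff_of_false (nd S q).2 (nd S' q).1)
      (fun q => iff_of_false (nd S' q).2 (nd S'' q).1)

theorem Skein.refl_comp (f : Skein a b) : (cls (Cobordism.refl a)).comp f = f := by
  induction f using Skein.induction with
  | h0 => simp
  | hadd f₁ f₂ h₁ h₂ => simp [h₁, h₂]
  | hsmul r f h => simp [h]
  | hc S => rw [Skein.comp_cls, ← cls_eq (refl_comp_isotopic S)]

theorem Skein.comp_refl (f : Skein a b) : f.comp (cls (Cobordism.refl b)) = f := by
  induction f using Skein.induction with
  | h0 => simp
  | hadd f₁ f₂ h₁ h₂ => simp [h₁, h₂]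
  | hsmul r f h => simp [h]
  | hc S => rw [Skein.comp_cls, ← cls_eq (comp_refl_isotopic S)]

theorem Skein.comp_assoc {d : Diagram m n} (f : Skein a b) (g : Skein b c) (h : Skein c d) :
    (f.comp g).comp h = f.comp (g.comp h) := by
  induction f using Skein.induction with
  | h0 => simp
  | hadd f₁ f₂ h₁ h₂ => simp [h₁, h₂]
  | hsmul r f h => simp [h]
  | hc S =>
  induction g using Skein.induction with
  | h0 => simp
  | hadd f₁ f₂ h₁ h₂ => simp [h₁, h₂]
  | hsmul r f h => simp [h]
  | hc S' =>
  induction h using Skein.induction with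
  | h0 => simp
  | hadd f₁ f₂ h₁ h₂ => simp [h₁, h₂]
  | hsmul r f h => simp [h]
  | hc S'' =>
  simp only [Skein.comp_cls]
  exact cls_eq (comp_assoc_isotopic S S' S'')

end Operations

end Skein

/-! ### The graded category of diagrams and dotted cobordisms -/

/-- The objects of `Cob`: formal `q`-shifts `q ^ shift` of diagrams with `m` points on top and `n`
points on the bottom. -/
structure Cob (m n : ℕ) where
  shift : ℤ
  diagram : Diagram m n

instance : Category (Cob m n) where
  Hom a b := Skein a.diagram b.diagram
  id a := cls (Cobordism.refl a.diagram)
  comp f g := Skein.comp f g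
  id_comp f := Skein.refl_comp f
  comp_id f := Skein.comp_refl f
  assoc f g h := Skein.comp_assoc f g h

instance : Preadditive (Cob m n) where
  homGroup a b := inferInstanceAs (AddCommGroup (Skein a.diagram b.diagram))
  add_comp _ _ _ f f' g := Skein.add_comp f f' g
  comp_add _ _ _ f g g' := Skein.comp_add f g g'

/-- `S` has Euler characteristic `χ`: it is homeomorphic to the space of a finite simplicial complex
whose alternating number of simplices is `χ`. -/
def HasEulerChar {E : Type} [TopologicalSpace E] (S : Set E) (χ : ℤ) : Prop :=
  ∃ (N : ℕ) (K : Geometry.SimplicialComplex ℝ (EuclideanSpace ℝ (Fin N)))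
    (F : Finset (Finset (EuclideanSpace ℝ (Fin N)))), K.faces = ↑F ∧ Nonempty (S ≃ₜ K.space) ∧
      χ = ∑ s ∈ F, (-1) ^ (s.card + 1)

/-- The morphisms `q^i a ⟶ q^j b` of `q`-degree `l`: the group generated by the `α^r S`, where `S` is
a cobordism decorated with `d` dots and `l = j - i - χ(S) + (m + n) / 2 + 2 d + 4 r`. -/
def Cob.homogeneous (a b : Cob m n) (l : ℤ) : AddSubgroup (a ⟶ b) :=
  AddSubgroup.closure {f | ∃ (S : Cobordism a.diagram b.diagram) (χ : ℤ) (r : ℕ),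
    HasEulerChar S.carrier χ ∧
    l = b.shift - a.shift - χ + ((m + n) / 2 : ℕ) + 2 * (S.dots.ncard : ℤ) + 4 * r ∧
    f = ((Polynomial.X ^ r : Polynomial ℤ) • cls S : Skein a.diagram b.diagram)}

/-- `a ⊗ b`: the object `a` on top of `b`. -/
def Cob.tens (a : Cob m k) (b : Cob k n) : Cob m n := ⟨a.shift + b.shift, a.diagram.tens b.diagram⟩

/-- `f ⊗ g` for morphisms of `Cob`. -/
def Cob.tensHom {a a' : Cob m k} {b b' : Cob k n} (f : a ⟶ a') (g : b ⟶ b') :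
    a.tens b ⟶ a'.tens b' := Skein.tens f g

/-- `aᵛ`: the diagram is reflected, and the `q`-shift is reversed. -/
def Cob.dual (a : Cob m n) : Cob n m := ⟨-a.shift, a.diagram.dual⟩

/-- `fᵛ` for morphisms of `Cob`. -/
def Cob.dualHom {a b : Cob m n} (f : a ⟶ b) : b.dual ⟶ a.dual := Skein.dual f

/-- The empty diagram, as an object. -/
def Cob.empty : Cob 0 0 := ⟨0, Diagram.empty⟩

/-- The Markov trace functor. -/
def Cob.tr (n : ℕ) : Cob n n ⥤ Cob 0 0 where
  obj a := ⟨a.shift, a.diagram.tr⟩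
  map f := Skein.tr f
  map_id a := Skein.tr_refl a.diagram
  map_comp f g := Skein.tr_comp f g

instance (n : ℕ) : (Cob.tr n).Additive where
  map_add {_ _} f g := map_add Skein.tr f g

section
variable {a a' a'' : Cob m k} {b b' b'' : Cob k n}

theorem Cob.tensHom_comp (f : a ⟶ a') (f' : a' ⟶ a'') (g : b ⟶ b') (g' : b' ⟶ b'') :
    tensHom (f ≫ f') (g ≫ g') = tensHom f g ≫ tensHom f' g' := Skein.tens_comp f f' g g'
theorem Cob.tensHom_add (f : a ⟶ a') (g g' : b ⟶ b') :
    tensHom f (g + g') = tensHom f g + tensHom f g' := Skein.tens_add f g g'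
theorem Cob.add_tensHom (f f' : a ⟶ a') (g : b ⟶ b') :
    tensHom (f + f') g = tensHom f g + tensHom f' g := Skein.add_tens f f' g
theorem Cob.tensHom_zero (f : a ⟶ a') : tensHom f (0 : b ⟶ b') = 0 := Skein.tens_zero f
theorem Cob.zero_tensHom (g : b ⟶ b') : tensHom (0 : a ⟶ a') g = 0 := Skein.zero_tens g

end

/-! ### Closure under finite direct sums and under countable direct products -/

/-- Bar-Natan's category: the closure of `Cob` under finite direct sums. -/
abbrev BN (m n : ℕ) : Type 1 := Mat_ (Cob m n)

/-- Objects of the closure of `C` under countable direct products: countable families. -/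
structure ProdMat (C : Type) [Category.{0} C] [Preadditive C] where
  ι : Type
  [countable : Countable ι]
  X : ι → C

attribute [instance] ProdMat.countable

namespace ProdMat

variable {C : Type} [Category.{0} C] [Preadditive C]

/-- Morphisms are matrices with finite rows: for each index `j` of the target only finitely many
entries `f i j` are non-zero. -/
@[ext]
structure Hom (M N : ProdMat C) : Type where
  entry : ∀ i j, M.X i ⟶ N.X j
  finite : ∀ j, {i | entry i j ≠ 0}.Finite

instance (M N : ProdMat C) : Zero (Hom M N) := ⟨⟨fun _ _ => 0, fun j => by simp⟩⟩

instance (M N : ProdMat C) : Add (Hom M N) :=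
  ⟨fun f g => ⟨fun i j => f.entry i j + g.entry i j,
    fun j => ((f.finite j).union (g.finite j)).subset fun i hi => by
      by_contra hc
      simp only [Set.mem_union, Set.mem_ofPred_eq, not_or, not_not] at hc
      exact hi (by rw [hc.1, hc.2, add_zero])⟩⟩

instance (M N : ProdMat C) : Neg (Hom M N) :=
  ⟨fun f => ⟨fun i j => -f.entry i j, fun j => by simpa using f.finite j⟩⟩

instance (M N : ProdMat C) : AddCommGroup (Hom M N) where
  add_assoc f g h := Hom.ext (funext fun i => funext fun j => add_assoc _ _ _)
  zero_add f := Hom.ext (funext fun i => funext fun j => zero_add _)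
  add_zero f := Hom.ext (funext fun i => funext fun j => add_zero _)
  add_comm f g := Hom.ext (funext fun i => funext fun j => add_comm _ _)
  neg_add_cancel f := Hom.ext (funext fun i => funext fun j => neg_add_cancel _)
  nsmul := nsmulRec
  zsmul := zsmulRec

theorem comp_finite {M N K : ProdMat C} (f : Hom M N) (g : Hom N K) (k : K.ι) :
    {i | ∑ j ∈ (g.finite k).toFinset, f.entry i j ≫ g.entry j k ≠ 0}.Finite := by
  refine ((g.finite k).biUnion fun j _ => f.finite j).subset fun i hi => ?_
  obtain ⟨j, hj, hne⟩ := Finset.exists_ne_zero_of_sum_ne_zero hi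
  refine Set.mem_biUnion ((g.finite k).mem_toFinset.1 hj) ?_
  intro h0
  exact hne (by rw [h0, Limits.zero_comp])

open scoped Classical in
instance : Category (ProdMat C) where
  Hom := Hom
  id M := ⟨fun i j => if h : i = j then eqToHom (congr_arg M.X h) else 0, fun j =>
    (Set.finite_singleton j).subset fun i hi => by
      by_contra hc
      exact hi (dif_neg hc)⟩
  comp f g := ⟨fun i k => ∑ j ∈ (g.finite k).toFinset, f.entry i j ≫ g.entry j k, comp_finite f g⟩
  id_comp {M N} f := by
    refine Hom.ext (funext fun i => funext fun k => ?_)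
    simp only
    by_cases h : f.entry i k = 0
    · refine (Finset.sum_eq_zero fun j _ => ?_).trans h.symm
      by_cases hij : i = j
      · subst hij; simp [h]
      · simp [hij]
    · rw [Finset.sum_eq_single i]
      · simp
      · intro j _ hj; simp [hj.symm]
      · intro hi; exact absurd ((f.finite k).mem_toFinset.2 h) hi
  comp_id {M N} f := by
    refine Hom.ext (funext fun i => funext fun k => ?_)
    simp only
    rw [Finset.sum_eq_single k]
    · simp
    · intro j _ hj; simp [hj]
    · intro hk
      have : (if h : k = k then eqToHom (congr_arg N.X h) else 0) = 0 := by
        by_contra hc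
        exact hk (Set.Finite.mem_toFinset _ |>.2 hc)
      rw [this, Limits.comp_zero]
  assoc {M N K L} f g h := by
    refine Hom.ext (funext fun i => funext fun l => ?_)
    simp only
    set J := ((h.finite l).biUnion fun k _ => g.finite k).toFinset with hJ
    have e1 : ∀ k ∈ (h.finite l).toFinset,
        (∑ j ∈ (g.finite k).toFinset, f.entry i j ≫ g.entry j k) ≫ h.entry k l =
          ∑ j ∈ J, f.entry i j ≫ g.entry j k ≫ h.entry k l := by
      intro k hk
      rw [Preadditive.sum_comp]
      simp only [Category.assoc]
      refine Finset.sum_subset (fun j hj => ?_) fun j _ hj => ?_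
      · rw [hJ, Set.Finite.mem_toFinset]
        exact Set.mem_biUnion ((h.finite l).mem_toFinset.1 hk) ((g.finite k).mem_toFinset.1 hj)
      · have : g.entry j k = 0 := by
          by_contra hc
          exact hj ((g.finite k).mem_toFinset.2 hc)
        simp [this]
    rw [Finset.sum_congr rfl e1, Finset.sum_comm]
    symm
    refine (Finset.sum_subset (fun j hj => ?_) fun j _ hj => ?_).trans
      (Finset.sum_congr rfl fun j _ => ?_)
    · have := (Set.Finite.mem_toFinset _).1 hj
      obtain ⟨k, hk, hne⟩ := Finset.exists_ne_zero_of_sum_ne_zero this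
      rw [hJ, Set.Finite.mem_toFinset]
      refine Set.mem_biUnion ((h.finite l).mem_toFinset.1 hk) ?_
      intro h0
      exact hne (by rw [h0, Limits.zero_comp])
    · have : ∑ k ∈ (h.finite l).toFinset, g.entry j k ≫ h.entry k l = 0 := by
        by_contra hc
        exact hj ((Set.Finite.mem_toFinset _).2 hc)
      rw [this, Limits.comp_zero]
    · rw [Preadditive.comp_sum]

@[ext]
theorem hom_ext {M N : ProdMat C} {f g : M ⟶ N} (h : ∀ i j, f.entry i j = g.entry i j) : f = g :=
  Hom.ext (funext fun i => funext fun j => h i j)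

theorem comp_entry {M N K : ProdMat C} (f : M ⟶ N) (g : N ⟶ K) (i : M.ι) (k : K.ι) :
    (f ≫ g).entry i k = ∑ j ∈ (g.finite k).toFinset, f.entry i j ≫ g.entry j k := rfl

/-- The sum over a larger set of indices. -/
theorem comp_entry_of_subset {M N K : ProdMat C} (f : M ⟶ N) (g : N ⟶ K) (i : M.ι) (k : K.ι)
    (s : Finset N.ι) (hs : ∀ j, g.entry j k ≠ 0 → j ∈ s) :
    (f ≫ g).entry i k = ∑ j ∈ s, f.entry i j ≫ g.entry j k := by
  rw [comp_entry]
  refine Finset.sum_subset (fun j hj => hs j ((g.finite k).mem_toFinset.1 hj)) fun j _ hj => ?_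
  have : g.entry j k = 0 := by
    by_contra hc
    exact hj ((g.finite k).mem_toFinset.2 hc)
  rw [this, Limits.comp_zero]

instance : Preadditive (ProdMat C) where
  homGroup M N := inferInstanceAs (AddCommGroup (Hom M N))
  add_comp M N K f f' g := by
    ext i k
    change (∑ j ∈ (g.finite k).toFinset, (f.entry i j + f'.entry i j) ≫ g.entry j k) =
      (∑ j ∈ (g.finite k).toFinset, f.entry i j ≫ g.entry j k) +
        ∑ j ∈ (g.finite k).toFinset, f'.entry i j ≫ g.entry j k
    simp only [Preadditive.add_comp, Finset.sum_add_distrib]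
  comp_add M N K f g g' := by
    ext i k
    classical
    let s := (g.finite k).toFinset ∪ (g'.finite k).toFinset
    have h1 : ∀ j, g.entry j k ≠ 0 → j ∈ s := fun j hj =>
      Finset.mem_union_left _ ((g.finite k).mem_toFinset.2 hj)
    have h2 : ∀ j, g'.entry j k ≠ 0 → j ∈ s := fun j hj =>
      Finset.mem_union_right _ ((g'.finite k).mem_toFinset.2 hj)
    have h3 : ∀ j, Hom.entry (show Hom N K from Add.add (α := Hom N K) g g') j k ≠ 0 → j ∈ s := by
      intro j hj
      by_contra hc
      have e1 : g.entry j k = 0 := by by_contra h; exact hc (h1 j h)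
      have e2 : g'.entry j k = 0 := by by_contra h; exact hc (h2 j h)
      refine hj ?_
      change g.entry j k + g'.entry j k = 0
      rw [e1, e2, add_zero]
    refine (comp_entry_of_subset f (show N ⟶ K from Add.add (α := Hom N K) g g') i k s h3).trans ?_
    change (∑ j ∈ s, f.entry i j ≫ (g.entry j k + g'.entry j k)) = (f ≫ g).entry i k + (f ≫ g').entry i k
    rw [comp_entry_of_subset f g i k s h1, comp_entry_of_subset f g' i k s h2]
    simp only [Preadditive.comp_add, Finset.sum_add_distrib]

@[simp] theorem zero_entry {M N : ProdMat C} (i : M.ι) (j : N.ι) :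
    (0 : M ⟶ N).entry i j = 0 := rfl
@[simp] theorem add_entry {M N : ProdMat C} (f g : M ⟶ N) (i : M.ι) (j : N.ι) :
    (f + g).entry i j = f.entry i j + g.entry i j := rfl
@[simp] theorem neg_entry {M N : ProdMat C} (f : M ⟶ N) (i : M.ι) (j : N.ι) :
    (-f).entry i j = -f.entry i j := rfl

theorem id_entry_self (M : ProdMat C) (i : M.ι) : (𝟙 M : M ⟶ M).entry i i = 𝟙 _ := by
  classical
  exact dif_pos rfl

theorem id_entry_ne (M : ProdMat C) {i j : M.ι} (h : i ≠ j) : (𝟙 M : M ⟶ M).entry i j = 0 := by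
  classical
  exact dif_neg h

variable (C) in
/-- The inclusion of the closure under finite direct sums. -/
def incl : Mat_ C ⥤ ProdMat C where
  obj M := ⟨M.ι, M.X⟩
  map f := ⟨f, fun _ => Set.toFinite _⟩
  map_id M := rfl
  map_comp {M N K} f g := by
    ext i k
    exact (comp_entry_of_subset (M := ⟨M.ι, M.X⟩) (N := ⟨N.ι, N.X⟩) (K := ⟨K.ι, K.X⟩)
      ⟨f, fun _ => Set.toFinite _⟩ ⟨g, fun _ => Set.toFinite _⟩ i k Finset.univ
      fun j _ => Finset.mem_univ j).symm

instance : (incl C).Additive where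
  map_add := rfl

section
variable {D : Type} [Category.{0} D] [Preadditive D] (Φ : C ⥤ D) [Φ.Additive]

/-- An additive functor applied to all entries of a matrix. -/
def mapHom {M N : ProdMat C} (f : M ⟶ N) :
    (⟨M.ι, fun i => Φ.obj (M.X i)⟩ : ProdMat D) ⟶ ⟨N.ι, fun i => Φ.obj (N.X i)⟩ :=
  Hom.mk (fun (i : M.ι) (j : N.ι) => Φ.map (f.entry i j)) fun (j : N.ι) => (f.finite j).subset
    fun (i : M.ι) (hi : Φ.map (f.entry i j) ≠ 0) (h0 : f.entry i j = 0) => hi (by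
      rw [h0, Φ.map_zero])

theorem mapHom_id (M : ProdMat C) : mapHom Φ (𝟙 M) = 𝟙 _ := by
  refine hom_ext fun (i : M.ι) (j : M.ι) => ?_
  change Φ.map ((𝟙 M : M ⟶ M).entry i j) = _
  by_cases h : i = j
  · subst h
    rw [id_entry_self, Φ.map_id]
    exact (id_entry_self (⟨M.ι, fun i => Φ.obj (M.X i)⟩ : ProdMat D) i).symm
  · rw [id_entry_ne _ h, Φ.map_zero]
    exact (id_entry_ne (⟨M.ι, fun i => Φ.obj (M.X i)⟩ : ProdMat D) h).symm

theorem mapHom_comp {M N K : ProdMat C} (f : M ⟶ N) (g : N ⟶ K) :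
    mapHom Φ (f ≫ g) = mapHom Φ f ≫ mapHom Φ g := by
  refine hom_ext fun (i : M.ι) (k : K.ι) => ?_
  refine Eq.trans ?_ (comp_entry_of_subset (mapHom Φ f) (mapHom Φ g) i k (g.finite k).toFinset
    fun (j : N.ι) hj => (g.finite k).mem_toFinset.2 fun h0 => hj ?_).symm
  · change Φ.map ((f ≫ g).entry i k) = ∑ j ∈ (g.finite k).toFinset,
      Φ.map (f.entry i j) ≫ Φ.map (g.entry j k)
    rw [comp_entry, Φ.map_sum]
    simp only [Φ.map_comp]
  · change Φ.map (g.entry j k) = 0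
    rw [h0, Φ.map_zero]

/-- The extension of an additive functor to countable products. -/
def mapFunctor : ProdMat C ⥤ ProdMat D where
  obj M := ⟨M.ι, fun i => Φ.obj (M.X i)⟩
  map f := mapHom Φ f
  map_id M := mapHom_id Φ M
  map_comp f g := mapHom_comp Φ f g

instance : (mapFunctor Φ).Additive where
  map_add {_ _} _ _ := hom_ext fun _ _ => Φ.map_add

end

end ProdMat

/-- The closure of `Cob` under countable direct products. -/
abbrev BNProd (m n : ℕ) : Type 1 := ProdMat (Cob m n)

/-! ### Chain complexes: duality, planar composition, trace -/

open CochainComplex CochainComplex.HomComplex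

/-- The dual of a finite direct sum of diagrams. -/
def BN.dual (M : BN m n) : BN n m := ⟨M.ι, fun i => (M.X i).dual⟩

/-- The dual of a matrix of cobordisms: the transpose of the matrix of the duals. -/
def BN.dualHom {M N : BN m n} (f : M ⟶ N) : BN.dual N ⟶ BN.dual M :=
  fun (i : N.ι) (j : M.ι) => Cob.dualHom (f j i)

theorem BN.dualHom_comp {M N K : BN m n} (f : M ⟶ N) (g : N ⟶ K) :
    BN.dualHom (f ≫ g) = BN.dualHom g ≫ BN.dualHom f := by
  refine Mat_.hom_ext _ _ fun (i : K.ι) (j : M.ι) => ?_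
  change Cob.dualHom (∑ l : N.ι, f j l ≫ g l i) = ∑ l : N.ι, Cob.dualHom (g l i) ≫ Cob.dualHom (f j l)
  refine (map_sum (Skein.dual (a := (M.X j).diagram) (b := (K.X i).diagram)) _ _).trans ?_
  exact Finset.sum_congr rfl fun l _ => Skein.dual_comp (f j l) (g l i)

theorem BN.dualHom_zero (M N : BN m n) : BN.dualHom (0 : M ⟶ N) = 0 :=
  Mat_.hom_ext _ _ fun (i : N.ι) (j : M.ι) =>
    map_zero (Skein.dual (a := (M.X j).diagram) (b := (N.X i).diagram))

/-- The dual complex: `(Aᵛ)^k = (A^{-k})ᵛ`, with differential `-(d_A)ᵛ`; the sign is the one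
in `dualCochain` below. -/
def dualComplex (A : CochainComplex (BN m n) ℤ) : CochainComplex (BN n m) ℤ where
  X i := BN.dual (A.X (-i))
  d i j := -(i.negOnePow • BN.dualHom (A.d (-j) (-i)))
  shape i j h := by
    have : A.d (-j) (-i) = 0 := A.shape _ _ fun h' => h (by
      simp only [ComplexShape.up_Rel] at h' ⊢; omega)
    rw [this, BN.dualHom_zero, smul_zero, neg_zero]
  d_comp_d' i j l _ _ := by
    have : BN.dualHom (A.d (-j) (-i)) ≫ BN.dualHom (A.d (-l) (-j)) = 0 := by
      rw [← BN.dualHom_comp, A.d_comp_d, BN.dualHom_zero]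
    simp [Linear.units_smul_comp, Linear.comp_units_smul, this]

/-- The dual of a homogeneous map `f` of degree `k`: its component in degree `p` is
`(-1)^{pk} (f_{-p-k})ᵛ`. -/
def dualCochain {A B : CochainComplex (BN m n) ℤ} {k : ℤ} (f : Cochain A B k) :
    Cochain (dualComplex B) (dualComplex A) k :=
  Cochain.mk fun p q h => (p * k).negOnePow • BN.dualHom (f.v (-q) (-p) (by omega))

theorem dualComplex_diff (A : CochainComplex (BN m n) ℤ) :
    Cochain.diff (dualComplex A) = -dualCochain (Cochain.diff A) := by
  refine Cochain.ext _ _ fun p q h => ?_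
  rw [Cochain.neg_v]
  simp only [dualCochain, Cochain.diff, dualComplex, Cochain.mk_v, mul_one]
  rfl

/-- The component `K^p ⟶ L^q` of a homogeneous map, which is zero unless `q - p` is the degree. -/
def coeff {C : Type 1} [Category.{0} C] [Preadditive C] {K L : CochainComplex C ℤ} {a : ℤ}
    (f : Cochain K L a) (p q : ℤ) : K.X p ⟶ L.X q := if h : p + a = q then f.v p q h else 0

theorem coeff_comp {C : Type 1} [Category.{0} C] [Preadditive C] {K L M : CochainComplex C ℤ}
    {a b c : ℤ} (f : Cochain K L a) (g : Cochain L M b) (h : a + b = c) (p q r : ℤ)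
    (hq : p + a = q) : coeff (f.comp g h) p r = coeff f p q ≫ coeff g q r := by
  unfold coeff
  by_cases hr : q + b = r
  · rw [dif_pos (by omega), dif_pos hq, dif_pos hr, Cochain.comp_v f g h p q r hq hr]
  · rw [dif_neg (by omega), dif_neg hr, Limits.comp_zero]

section Tensor

variable {K K' K'' : CochainComplex (BNProd m k) ℤ} {L L' L'' : CochainComplex (BNProd k n) ℤ}

/-- The degree `s` part `∏_{i + j = s} K^i ⊗ L^j` of the direct product total complex. -/
def totX (K : CochainComplex (BNProd m k) ℤ) (L : CochainComplex (BNProd k n) ℤ) (s : ℤ) :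
    BNProd m n where
  ι := Σ p : {p : ℤ × ℤ // p.1 + p.2 = s}, (K.X p.1.1).ι × (L.X p.1.2).ι
  X x := ((K.X x.1.1.1).X x.2.1).tens ((L.X x.1.1.2).X x.2.2)

/-- The component `K^i ⊗ L^j ⟶ K'^i' ⊗ L'^j'` of `f ⊗ g` for homogeneous maps, with the Koszul sign
`(-1)^{i |g|}`; it is zero unless `i' - i` and `j' - j` are the degrees of `f` and `g`. -/
def totEntry {a b : ℤ} (f : Cochain K K' a) (g : Cochain L L' b) (i j i' j' : ℤ)
    (u : (K.X i).ι) (v : (L.X j).ι) (u' : (K'.X i').ι) (v' : (L'.X j').ι) :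
    ((K.X i).X u).tens ((L.X j).X v) ⟶ ((K'.X i').X u').tens ((L'.X j').X v') :=
  (i * b).negOnePow • Cob.tensHom ((coeff f i i').entry u u') ((coeff g j j').entry v v')

theorem totEntry_eq_zero_left {a b : ℤ} (f : Cochain K K' a) (g : Cochain L L' b) (i j i' j' : ℤ)
    (u : (K.X i).ι) (v : (L.X j).ι) (u' : (K'.X i').ι) (v' : (L'.X j').ι)
    (h : (coeff f i i').entry u u' = 0) : totEntry f g i j i' j' u v u' v' = 0 := by
  rw [totEntry, h, Cob.zero_tensHom, smul_zero]

theorem totEntry_eq_zero_right {a b : ℤ} (f : Cochain K K' a) (g : Cochain L L' b) (i j i' j' : ℤ)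
    (u : (K.X i).ι) (v : (L.X j).ι) (u' : (K'.X i').ι) (v' : (L'.X j').ι)
    (h : (coeff g j j').entry v v' = 0) : totEntry f g i j i' j' u v u' v' = 0 := by
  rw [totEntry, h, Cob.tensHom_zero, smul_zero]

/-- `f ⊗ g` for homogeneous maps. -/
def totHom {a b : ℤ} (f : Cochain K K' a) (g : Cochain L L' b) (s t : ℤ) :
    totX K L s ⟶ totX K' L' t :=
  ProdMat.Hom.mk
    (fun x y => totEntry f g x.1.1.1 x.1.1.2 y.1.1.1 y.1.1.2 x.2.1 x.2.2 y.2.1 y.2.2)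
    fun y => by
      have hp : {p : {p : ℤ × ℤ // p.1 + p.2 = s} |
          p.1.1 + a = y.1.1.1 ∧ p.1.2 + b = y.1.1.2}.Finite := by
        refine Set.Subsingleton.finite fun p hp q hq => ?_
        ext
        · have h1 := hp.1; have h2 := hq.1; omega
        · have h1 := hp.2; have h2 := hq.2; omega
      refine (hp.biUnion fun p _ => (((coeff f p.1.1 y.1.1.1).finite y.2.1).prod
        ((coeff g p.1.2 y.1.1.2).finite y.2.2)).image (Sigma.mk p)).subset ?_
      rintro ⟨p, u, v⟩ hx
      have hu : (coeff f p.1.1 y.1.1.1).entry u y.2.1 ≠ 0 := fun h0 =>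
        hx (totEntry_eq_zero_left _ _ _ _ _ _ _ _ _ _ h0)
      have hv : (coeff g p.1.2 y.1.1.2).entry v y.2.2 ≠ 0 := fun h0 =>
        hx (totEntry_eq_zero_right _ _ _ _ _ _ _ _ _ _ h0)
      refine Set.mem_biUnion (x := p) ⟨?_, ?_⟩ ⟨(u, v), ⟨hu, hv⟩, rfl⟩
      · by_contra hc
        exact hu (by rw [coeff, dif_neg hc]; rfl)
      · by_contra hc
        exact hv (by rw [coeff, dif_neg hc]; rfl)

theorem totHom_zero_left {a b : ℤ} (g : Cochain L L' b) (s t : ℤ) :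
    totHom (0 : Cochain K K' a) g s t = 0 :=
  ProdMat.hom_ext fun x y => totEntry_eq_zero_left _ _ _ _ _ _ _ _ _ _ (by
    have : coeff (0 : Cochain K K' a) x.1.1.1 y.1.1.1 = 0 := by simp [coeff]
    rw [this]; rfl)

theorem totHom_zero_right {a b : ℤ} (f : Cochain K K' a) (s t : ℤ) :
    totHom f (0 : Cochain L L' b) s t = 0 :=
  ProdMat.hom_ext fun x y => totEntry_eq_zero_right _ _ _ _ _ _ _ _ _ _ (by
    have : coeff (0 : Cochain L L' b) x.1.1.2 y.1.1.2 = 0 := by simp [coeff]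
    rw [this]; rfl)

theorem units_smul_entry {C : Type} [Category.{0} C] [Preadditive C] {M N : ProdMat C} (e : ℤˣ)
    (f : M ⟶ N) (i : M.ι) (j : N.ι) : (e • f).entry i j = e • f.entry i j := by
  obtain rfl | rfl := Int.units_eq_one_or e
  · rw [one_smul, one_smul]
  · rw [Units.neg_smul, Units.neg_smul, one_smul, one_smul, ProdMat.neg_entry]

theorem coeff_of_ne {C : Type 1} [Category.{0} C] [Preadditive C] {K L : CochainComplex C ℤ}
    {a : ℤ} (f : Cochain K L a) {p q : ℤ} (h : p + a ≠ q) : coeff f p q = 0 := dif_neg h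

/-- `f ⊗ g` on the entries of two matrices. -/
theorem tensHom_entry_comp {M M' M'' : BNProd m k} {N N' N'' : BNProd k n}
    (f : M ⟶ M') (f' : M' ⟶ M'') (g : N ⟶ N') (g' : N' ⟶ N'') (u : M.ι) (u'' : M''.ι)
    (v : N.ι) (v'' : N''.ι) :
    Cob.tensHom ((f ≫ f').entry u u'') ((g ≫ g').entry v v'') =
      ∑ w ∈ (f'.finite u'').toFinset ×ˢ (g'.finite v'').toFinset,
        Cob.tensHom (f.entry u w.1) (g.entry v w.2) ≫
          Cob.tensHom (f'.entry w.1 u'') (g'.entry w.2 v'') := by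
  rw [ProdMat.comp_entry, ProdMat.comp_entry, Finset.sum_product]
  refine (map_sum (AddMonoidHom.mk' (fun x => Cob.tensHom x
    (∑ j ∈ (g'.finite v'').toFinset, g.entry v j ≫ g'.entry j v'')) fun x y =>
      Cob.add_tensHom x y _) _ _).trans ?_
  refine Finset.sum_congr rfl fun i _ => ?_
  refine (map_sum (AddMonoidHom.mk' (fun y => Cob.tensHom (f.entry u i ≫ f'.entry i u'') y)
    fun x y => Cob.tensHom_add _ x y) _ _).trans ?_
  exact Finset.sum_congr rfl fun j _ => Cob.tensHom_comp _ _ _ _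

theorem totEntry_comp {a b a' b' a'' b'' : ℤ} (f : Cochain K K' a) (g : Cochain L L' b)
    (f' : Cochain K' K'' a') (g' : Cochain L' L'' b') (ha : a + a' = a'') (hb : b + b' = b'')
    (i j i' j' i'' j'' : ℤ) (hi : i + a = i') (hj : j + b = j')
    (u : (K.X i).ι) (v : (L.X j).ι) (u'' : (K''.X i'').ι) (v'' : (L''.X j'').ι) :
    ∑ w ∈ ((coeff f' i' i'').finite u'').toFinset ×ˢ ((coeff g' j' j'').finite v'').toFinset,
        totEntry f g i j i' j' u v w.1 w.2 ≫ totEntry f' g' i' j' i'' j'' w.1 w.2 u'' v'' =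
      (a * b').negOnePow • totEntry (f.comp f' ha) (g.comp g' hb) i j i'' j'' u v u'' v'' := by
  rw [totEntry, coeff_comp f f' ha i i' i'' hi, coeff_comp g g' hb j j' j'' hj,
    tensHom_entry_comp, smul_smul, Finset.smul_sum]
  refine Finset.sum_congr rfl fun w _ => ?_
  rw [totEntry, totEntry, Linear.units_smul_comp, Linear.comp_units_smul, smul_smul,
    ← Int.negOnePow_add, ← Int.negOnePow_add]
  congr 1
  rw [Int.negOnePow_eq_iff, ← hi, ← hb]
  exact ⟨0, by ring⟩

theorem totHom_comp {a b a' b' a'' b'' : ℤ} (f : Cochain K K' a) (g : Cochain L L' b)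
    (f' : Cochain K' K'' a') (g' : Cochain L' L'' b') (ha : a + a' = a'') (hb : b + b' = b'')
    (s t u : ℤ) (ht : s + (a + b) = t) :
    totHom f g s t ≫ totHom f' g' t u =
      (a * b').negOnePow • totHom (f.comp f' ha) (g.comp g' hb) s u := by
  classical
  refine ProdMat.hom_ext fun (x : (totX K L s).ι) (z : (totX K'' L'' u).ι) => ?_
  let p : {p : ℤ × ℤ // p.1 + p.2 = t} := ⟨(x.1.1.1 + a, x.1.1.2 + b), by
    have := x.1.2; simp only; omega⟩
  let S : Finset (totX K' L' t).ι :=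
    (((coeff f' p.1.1 z.1.1.1).finite z.2.1).toFinset ×ˢ
      ((coeff g' p.1.2 z.1.1.2).finite z.2.2).toFinset).map ⟨Sigma.mk p, sigma_mk_injective⟩
  rw [ProdMat.comp_entry_of_subset _ _ _ _ (((totHom f' g' t u).finite z).toFinset ∪ S)
    fun y hy => Finset.mem_union_left _ (Set.Finite.mem_toFinset _ |>.2 hy)]
  rw [← Finset.sum_subset (Finset.subset_union_right (s₂ := S)) fun y _ hy => ?_]
  · rw [Finset.sum_map, units_smul_entry]
    exact totEntry_comp f g f' g' ha hb _ _ _ _ _ _ rfl rfl _ _ _ _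
  · obtain ⟨q, w⟩ := y
    by_cases hq : q = p
    · subst hq
      have h0 : (totHom f' g' t u).entry ⟨p, w⟩ z = 0 := by
        by_cases h1 : (coeff f' p.1.1 z.1.1.1).entry w.1 z.2.1 = 0
        · exact totEntry_eq_zero_left _ _ _ _ _ _ _ _ _ _ h1
        by_cases h2 : (coeff g' p.1.2 z.1.1.2).entry w.2 z.2.2 = 0
        · exact totEntry_eq_zero_right _ _ _ _ _ _ _ _ _ _ h2
        refine absurd ?_ hy
        refine Finset.mem_map.2 ⟨w, ?_, rfl⟩
        rw [Finset.mem_product, Set.Finite.mem_toFinset, Set.Finite.mem_toFinset]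
        exact ⟨h1, h2⟩
      rw [h0, Limits.comp_zero]
    · have h0 : (totHom f g s t).entry x ⟨q, w⟩ = 0 := by
        by_cases h1 : x.1.1.1 + a = q.1.1
        · refine totEntry_eq_zero_right _ _ _ _ _ _ _ _ _ _ ?_
          rw [coeff_of_ne g fun h2 => hq (Subtype.ext (Prod.ext h1.symm h2.symm))]
          rfl
        · refine totEntry_eq_zero_left _ _ _ _ _ _ _ _ _ _ ?_
          rw [coeff_of_ne f h1]
          rfl
      rw [h0, Limits.zero_comp]

/-- The direct product total complex of `K ⊗ L`. -/
def totComplex (K : CochainComplex (BNProd m k) ℤ) (L : CochainComplex (BNProd k n) ℤ) :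
    CochainComplex (BNProd m n) ℤ where
  X := totX K L
  d s t := totHom (Cochain.diff K) (Cochain.ofHom (𝟙 L)) s t +
    totHom (Cochain.ofHom (𝟙 K)) (Cochain.diff L) s t
  shape s t h := by
    refine ProdMat.hom_ext fun (x : (totX K L s).ι) (y : (totX K L t).ι) => ?_
    have hx := x.1.2
    have hy := y.1.2
    refine (congrArg₂ (· + ·)
      (?_ : totEntry (Cochain.diff K) (Cochain.ofHom (𝟙 L)) _ _ _ _ _ _ _ _ = 0)
      (?_ : totEntry (Cochain.ofHom (𝟙 K)) (Cochain.diff L) _ _ _ _ _ _ _ _ = 0)).trans (add_zero _)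
    · by_cases h1 : x.1.1.1 + 1 = y.1.1.1
      · refine totEntry_eq_zero_right _ _ _ _ _ _ _ _ _ _ ?_
        rw [coeff_of_ne _ fun h2 => h (by simp only [ComplexShape.up_Rel]; omega)]
        rfl
      · refine totEntry_eq_zero_left _ _ _ _ _ _ _ _ _ _ ?_
        rw [coeff_of_ne _ h1]
        rfl
    · by_cases h1 : x.1.1.1 + 0 = y.1.1.1
      · refine totEntry_eq_zero_right _ _ _ _ _ _ _ _ _ _ ?_
        rw [coeff_of_ne _ fun h2 => h (by simp only [ComplexShape.up_Rel]; omega)]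
        rfl
      · refine totEntry_eq_zero_left _ _ _ _ _ _ _ _ _ _ ?_
        rw [coeff_of_ne _ h1]
        rfl
  d_comp_d' s t u hst htu := by
    have ht : s + 1 = t := hst
    have dK : (Cochain.diff K).comp (Cochain.diff K) (by norm_num : (1 : ℤ) + 1 = 2) = 0 := by
      refine Cochain.ext _ _ fun p q hpq => ?_
      rw [Cochain.comp_v _ _ _ p (p + 1) q (by omega) (by omega)]
      simp [Cochain.diff]
    have dL : (Cochain.diff L).comp (Cochain.diff L) (by norm_num : (1 : ℤ) + 1 = 2) = 0 := by
      refine Cochain.ext _ _ fun p q hpq => ?_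
      rw [Cochain.comp_v _ _ _ p (p + 1) q (by omega) (by omega)]
      simp [Cochain.diff]
    rw [Preadditive.add_comp, Preadditive.comp_add, Preadditive.comp_add,
      totHom_comp _ _ _ _ (by norm_num : (1 : ℤ) + 1 = 2) (by norm_num : (0 : ℤ) + 0 = 0) _ _ _
        (by omega),
      totHom_comp _ _ _ _ (by norm_num : (1 : ℤ) + 0 = 1) (by norm_num : (0 : ℤ) + 1 = 1) _ _ _
        (by omega),
      totHom_comp _ _ _ _ (by norm_num : (0 : ℤ) + 1 = 1) (by norm_num : (1 : ℤ) + 0 = 1) _ _ _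
        (by omega),
      totHom_comp _ _ _ _ (by norm_num : (0 : ℤ) + 0 = 0) (by norm_num : (1 : ℤ) + 1 = 2) _ _ _
        (by omega), dK, dL, totHom_zero_left, totHom_zero_right]
    simp

/-- `f ⊗ g` for homogeneous maps of complexes. -/
def totCochain {a b c : ℤ} (f : Cochain K K' a) (g : Cochain L L' b) (_ : a + b = c) :
    Cochain (totComplex K L) (totComplex K' L') c := Cochain.mk fun p q _ => totHom f g p q

end Tensor

/-- The complex `∅` concentrated in degree `0`. -/
def emptyComplex : CochainComplex (BNProd 0 0) ℤ where
  X i := ⟨PLift (i = 0), fun _ => Cob.empty⟩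
  d _ _ := 0

/-- A complex over `BN` as a complex over its closure under countable products. -/
abbrev toProd (A : CochainComplex (BN m n) ℤ) : CochainComplex (BNProd m n) ℤ :=
  ((ProdMat.incl (Cob m n)).mapHomologicalComplex _).obj A

/-- The trace of a complex. -/
abbrev trComplex (K : CochainComplex (BNProd n n) ℤ) : CochainComplex (BNProd 0 0) ℤ :=
  ((ProdMat.mapFunctor (Cob.tr n)).mapHomologicalComplex _).obj K

/-- The complex `Tr (B ⊗ Aᵛ)`. -/
def dualityTarget (A B : CochainComplex (BN m n) ℤ) : CochainComplex (BNProd 0 0) ℤ :=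
  trComplex (totComplex (toProd B) (toProd (dualComplex A)))

/-- The map `Tr (g ⊗ fᵛ)`. -/
def dualityMap {A A' B B' : CochainComplex (BN m n) ℤ} {a b c : ℤ} (f : Cochain A' A a)
    (g : Cochain B B' b) (h : b + a = c) : Cochain (dualityTarget A B) (dualityTarget A' B') c :=
  (totCochain (g.map (ProdMat.incl (Cob m n))) ((dualCochain f).map (ProdMat.incl (Cob n m))) h).map
    (ProdMat.mapFunctor (Cob.tr m))

/-- Post-composition `L_g : z ↦ g ∘ z` with a homogeneous map. -/
def lMap {A B B' : CochainComplex (BN m n) ℤ} {b k l : ℤ} (g : Cochain B B' b) (z : Cochain A B k)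
    (h : k + b = l) : Cochain A B' l := z.comp g h

/-- Pre-composition `R_f : z ↦ (-1)^{|z||f|} z ∘ f` with a homogeneous map. -/
def rMap {A A' B : CochainComplex (BN m n) ℤ} {a k l : ℤ} (f : Cochain A' A a) (z : Cochain A B k)
    (h : a + k = l) : Cochain A' B l := (k * a).negOnePow • f.comp z h

/-- The maps `A ⟶ B` of bidegree `(k, l)` between complexes over `BN`: the families of morphisms
`A^p ⟶ B^(p+k)` all of whose entries have `q`-degree `l`. -/
def bidegree (A B : CochainComplex (BN m n) ℤ) (k l : ℤ) : AddSubgroup (Cochain A B k) where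
  carrier := {z | ∀ p q h i j, z.v p q h i j ∈ Cob.homogeneous _ _ l}
  zero_mem' _ _ _ _ _ := zero_mem (Cob.homogeneous _ _ l)
  add_mem' hz hw p q h i j := add_mem (S := AddSubgroup _) (hz p q h i j) (hw p q h i j)
  neg_mem' hz p q h i j := neg_mem (S := AddSubgroup _) (hz p q h i j)

/-- The maps `K ⟶ L` of bidegree `(k, l)` between complexes over the closure under countable
products. -/
def bidegreeProd (K L : CochainComplex (BNProd m n) ℤ) (k l : ℤ) : AddSubgroup (Cochain K L k) where
  carrier := {z | ∀ p q h i j, (z.v p q h).entry i j ∈ Cob.homogeneous _ _ l}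
  zero_mem' _ _ _ _ _ := zero_mem (Cob.homogeneous _ _ l)
  add_mem' hz hw p q h i j := add_mem (S := AddSubgroup _) (hz p q h i j) (hw p q h i j)
  neg_mem' hz p q h i j := neg_mem (S := AddSubgroup _) (hz p q h i j)

/-- The effect of an isomorphism of complexes of homomorphisms on a homogeneous map. -/
def evalIso {C D : Type 1} [Category.{0} C] [Preadditive C] [Category.{0} D] [Preadditive D]
    {F G : CochainComplex C ℤ} {F' G' : CochainComplex D ℤ}
    (φ : CochainComplex.HomComplex F G ≅ CochainComplex.HomComplex F' G') {k : ℤ}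
    (z : Cochain F G k) : Cochain F' G' k := (φ.hom.f k).hom z

end

end BarNatan

open BarNatan CochainComplex.HomComplex

/-!
A surface in the cube with bottom `a` and top `b` is bent into a surface whose bottom is empty and
whose top is `Tr (b ⊗ aᵛ)`. The homeomorphism `bend`, from the cube without its faces `x = 0` and
`x = 1` onto a bowl-shaped region of the cube, unfolds the rest of the boundary into the top face:
the top and the bottom of the cube become the two halves of the box in which `b` and `aᵛ` are
placed, the face `y = 0` is squeezed in between them, and the face `y = 1` becomes the region of
the closing arcs. A plane of constant `x` becomes a bowl whose rim is one of the concentric squares.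
The homeomorphism carries the interior of the cube onto the interior of the cube, so it transports
isotopies and all local relations (`Transports.map`), and it is a bijection on dotted surfaces
(`push_pull`, `pull_push`). Hence bending is an isomorphism `Skein.bend` of modules of morphisms.
As it does not change the surface or the number of dots, it changes the `q`-degree by a constant
(`map_homogeneous_bend`).

Naturality rests on two descriptions of a bent morphism `f : a → b`. With the coevaluation
`coev a : ∅ → Tr (a ⊗ aᵛ)`, the bent product cobordism, it is the composition of `coev a` with
`Tr (f ⊗ 1)` (`Skein.bend_eq_left`), and also the composition of `coev b` with `Tr (1 ⊗ fᵛ)`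
(`Skein.bend_eq_right`). For the former, add two product cobordisms below a surface that has been
moved to a good position (`exists_goodPosition`): what then remains to be done is to stretch the
vertical direction (`push_isotopic_comp`). The latter follows from the former, since reflecting the
cube in the `z`-direction before bending amounts to reflecting it in the `y`-direction afterwards
(`bend_reflZ`). Together with the category laws, the two descriptions show that the bent composition
of `f`, `z` and `g` is the bent `z` followed by `Tr (g ⊗ fᵛ)` (`Skein.bend_comp`).

For complexes, the isomorphism bends every entry of a homogeneous map (`bendCochain`). The signs in
the definitions of the dual and of the tensor product of homogeneous maps combine to the sign
of precomposition, which gives naturality (`bendCochain_natural`). The differential of the complex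
of homomorphisms and that of `Tr (B ⊗ Aᵛ)` are both expressed by pre- and postcomposition with the
differentials of `A` and `B`, so compatibility with the differentials is an instance of naturality.
-/

namespace BarNatan

noncomputable section

/-! ### Fibrewise increasing maps -/

/-- Strictly increasing bijections of the real line. -/
def Inc (f : ℝ → ℝ) : Prop := StrictMono f ∧ Function.Surjective f

theorem Inc.max {f g : ℝ → ℝ} (hf : Inc f) (hg : Inc g) : Inc fun z => max (f z) (g z) := by
  refine ⟨fun a b h => max_lt_max (hf.1 h) (hg.1 h), fun w => ?_⟩
  obtain ⟨a, ha⟩ := hf.2 w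
  obtain ⟨b, hb⟩ := hg.2 w
  rcases le_total a b with h | h
  · exact ⟨a, (max_eq_left ((hg.1.monotone h).trans (hb.trans ha.symm).le)).trans ha⟩
  · exact ⟨b, (max_eq_right ((hf.1.monotone h).trans (ha.trans hb.symm).le)).trans hb⟩

theorem Inc.min {f g : ℝ → ℝ} (hf : Inc f) (hg : Inc g) : Inc fun z => min (f z) (g z) := by
  refine ⟨fun a b h => min_lt_min (hf.1 h) (hg.1 h), fun w => ?_⟩
  obtain ⟨a, ha⟩ := hf.2 w
  obtain ⟨b, hb⟩ := hg.2 w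
  rcases le_total a b with h | h
  · exact ⟨b, (min_eq_right (hb.le.trans (ha.ge.trans (hf.1.monotone h)))).trans hb⟩
  · exact ⟨a, (min_eq_left (ha.le.trans (hb.ge.trans (hg.1.monotone h)))).trans ha⟩

theorem Inc.linear {k c : ℝ} (hk : 0 < k) {f : ℝ → ℝ} (hf : ∀ z, f z = k * z + c) : Inc f := by
  refine ⟨fun a b h => ?_, fun w => ⟨(w - c) / k, ?_⟩⟩
  · rw [hf, hf]
    have := mul_lt_mul_of_pos_left h hk
    linarith
  · rw [hf]; field_simp; ring

theorem Inc.id : Inc fun z => z := Inc.linear one_pos (c := 0) fun z => by ring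

theorem Inc.comp {f g : ℝ → ℝ} (hg : Inc g) (hf : Inc f) : Inc fun z => g (f z) :=
  ⟨hg.1.comp hf.1, hg.2.comp hf.2⟩

/-- A strictly increasing continuous function that is the identity outside of the unit interval. -/
theorem Inc.of_fix {f : ℝ → ℝ} (hm : StrictMono f) (hc : Continuous f) (h0 : ∀ z ≤ 0, f z = z)
    (h1 : ∀ z, 1 ≤ z → f z = z) : Inc f := by
  obtain ⟨ρ, hρ⟩ := exists_orderIso hm hc h0 h1
  refine ⟨hm, fun w => ?_⟩
  obtain ⟨z, hz⟩ := ρ.surjective w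
  exact ⟨z, by rw [← hρ, hz]⟩

/-- A continuous family of increasing bijections of the lines in the third coordinate direction is
a homeomorphism of space. -/
def fiberHomeo (f : Plane → ℝ → ℝ) (hc : Continuous (Function.uncurry f)) (hf : ∀ q, Inc (f q)) :
    Space ≃ₜ Space where
  toFun p := (p.1, f p.1 p.2)
  invFun p := (p.1, ((hf p.1).2 p.2).choose)
  left_inv p := Prod.ext rfl ((hf p.1).1.injective ((hf p.1).2 (f p.1 p.2)).choose_spec)
  right_inv p := Prod.ext rfl ((hf p.1).2 p.2).choose_spec
  continuous_toFun := continuous_fst.prodMk hc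
  continuous_invFun := by
    refine continuous_fst.prodMk (continuous_iff_continuousAt.2 fun p => ?_)
    have spec : ∀ p : Space, f p.1 ((hf p.1).2 p.2).choose = p.2 := fun p =>
      ((hf p.1).2 p.2).choose_spec
    refine tendsto_order.2 ⟨fun u hu => ?_, fun u hu => ?_⟩
    · have h0 : f p.1 u < p.2 := by rw [← spec p]; exact (hf p.1).1 hu
      have hcu : Continuous fun p : Space => f p.1 u :=
        hc.comp (continuous_fst.prodMk continuous_const)
      filter_upwards [hcu.continuousAt.eventually_lt continuous_snd.continuousAt h0] with p' h'
      rw [← spec p'] at h'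
      exact (hf p'.1).1.lt_iff_lt.1 h'
    · have h0 : p.2 < f p.1 u := by rw [← spec p]; exact (hf p.1).1 hu
      have hcu : Continuous fun p : Space => f p.1 u :=
        hc.comp (continuous_fst.prodMk continuous_const)
      filter_upwards [continuous_snd.continuousAt.eventually_lt hcu.continuousAt h0] with p' h'
      rw [← spec p'] at h'
      exact (hf p'.1).1.lt_iff_lt.1 h'

/-- The exchange of the second and the third coordinate. -/
def swapYZ : Space ≃ₜ Space where
  toFun p := ((p.1.1, p.2), p.1.2)
  invFun p := ((p.1.1, p.2), p.1.2)
  left_inv _ := rfl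
  right_inv _ := rfl
  continuous_toFun := by fun_prop
  continuous_invFun := by fun_prop

/-- The exchange of the first and the third coordinate. -/
def swapXZ : Space ≃ₜ Space where
  toFun p := ((p.2, p.1.2), p.1.1)
  invFun p := ((p.2, p.1.2), p.1.1)
  left_inv _ := rfl
  right_inv _ := rfl
  continuous_toFun := by fun_prop
  continuous_invFun := by fun_prop

/-! ### Isotopies and homeomorphisms -/

/-- The closed cube `[δ, 1 - δ]³`. -/
def core (δ : ℝ) : Set Space :=
  {p | (δ ≤ p.1.1 ∧ p.1.1 ≤ 1 - δ) ∧ (δ ≤ p.1.2 ∧ p.1.2 ≤ 1 - δ) ∧ δ ≤ p.2 ∧ p.2 ≤ 1 - δ}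

theorem isCompact_core (δ : ℝ) : IsCompact (core δ) := by
  have : core δ = (Set.Icc δ (1 - δ) ×ˢ Set.Icc δ (1 - δ)) ×ˢ Set.Icc δ (1 - δ) := by
    ext p; simp only [core, Set.mem_ofPred_eq, Set.mem_prod, Set.mem_Icc]; tauto
  rw [this]
  exact (isCompact_Icc.prod isCompact_Icc).prod isCompact_Icc

theorem core_subset {δ : ℝ} (hδ : 0 < δ) : core δ ⊆ openCube := by
  rintro p ⟨⟨h1, h2⟩, ⟨h3, h4⟩, h5, h6⟩
  exact ⟨⟨by linarith, by linarith⟩, ⟨by linarith, by linarith⟩, by linarith, by linarith⟩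

theorem core_mono {δ δ' : ℝ} (h : δ ≤ δ') : core δ' ⊆ core δ := by
  rintro p ⟨⟨h1, h2⟩, ⟨h3, h4⟩, h5, h6⟩
  exact ⟨⟨by linarith, by linarith⟩, ⟨by linarith, by linarith⟩, by linarith, by linarith⟩

/-- A positive continuous function on a compact set is bounded away from zero. -/
theorem exists_margin {X : Type} [TopologicalSpace X] {K : Set X} (hK : IsCompact K) {f : X → ℝ}
    (hf : ContinuousOn f K) (h : ∀ p ∈ K, 0 < f p) : ∃ δ : ℝ, 0 < δ ∧ ∀ p ∈ K, δ ≤ f p := by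
  rcases K.eq_empty_or_nonempty with rfl | hne
  · exact ⟨1, one_pos, fun p hp => hp.elim⟩
  · obtain ⟨p, hp, hmin⟩ := hK.exists_isMinOn hne hf
    exact ⟨f p, h p hp, fun q hq => hmin hq⟩

theorem exists_subset_core {K : Set Space} (hK : IsCompact K) (h : K ⊆ openCube) :
    ∃ δ : ℝ, 0 < δ ∧ K ⊆ core δ := by
  obtain ⟨δ, hδ, hm⟩ := exists_margin hK (f := fun p => min (min (min p.1.1 (1 - p.1.1))
    (min p.1.2 (1 - p.1.2))) (min p.2 (1 - p.2))) (by fun_prop) fun p hp => by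
      obtain ⟨⟨h1, h2⟩, ⟨h3, h4⟩, h5, h6⟩ := h hp
      simp only [lt_min_iff]
      exact ⟨⟨⟨h1, by linarith⟩, h3, by linarith⟩, h5, by linarith⟩
  refine ⟨δ, hδ, fun p hp => ?_⟩
  have := hm p hp
  simp only [le_min_iff] at this
  obtain ⟨⟨⟨h1, h2⟩, h3, h4⟩, h5, h6⟩ := this
  exact ⟨⟨h1, by linarith⟩, ⟨h3, by linarith⟩, h5, by linarith⟩

section

variable {m n : ℕ} {a b : Diagram m n}

/-- Two cobordisms with the same boundary agree outside of the open cube. -/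
theorem carrier_iff_off (S S' : Cobordism a b) {p : Space} (hp : p ∉ openCube) :
    p ∈ S.carrier ↔ p ∈ S'.carrier := by
  suffices key : ∀ S S' : Cobordism a b, p ∈ S.carrier → p ∈ S'.carrier from
    ⟨key S S', key S' S⟩
  intro S S' h
  obtain ⟨ε, hε, hc⟩ := S.collar
  obtain ⟨ε', hε', hc'⟩ := S'.collar
  obtain ⟨-, y0, y1, z0, z1⟩ := hc p
  obtain ⟨-, y0', y1', z0', z1'⟩ := hc' p
  have hx := S.mem_x h
  obtain ⟨hy, hz⟩ := S.mem_cube p h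
  have hcase : p.1.2 ≤ 0 ∨ 1 ≤ p.1.2 ∨ p.2 ≤ 0 ∨ 1 ≤ p.2 := by
    by_contra hcon
    simp only [not_or, not_le] at hcon
    exact hp ⟨hx, ⟨hcon.1, hcon.2.1⟩, hcon.2.2⟩
  rcases hcase with h' | h' | h' | h'
  · exact (y0' hz.1 hz.2 hy.1 (by linarith)).2 ((y0 hz.1 hz.2 hy.1 (by linarith)).1 h)
  · exact (y1' hz.1 hz.2 (by linarith) hy.2).2 ((y1 hz.1 hz.2 (by linarith) hy.2).1 h)
  · exact (z0' hz.1 (by linarith)).2 ((z0 hz.1 (by linarith)).1 h)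
  · exact (z1' (by linarith) hz.2).2 ((z1 (by linarith) hz.2).1 h)

/-- The Alexander trick: an ambient homeomorphism that fixes the complement of the open cube
yields an isotopy. -/
theorem isotopic_of_homeo {S S' : Cobordism a b} {h : Space → Space} (hh : IsHomeomorph h)
    (hfix : ∀ p ∉ openCube, h p = p) (hS : h '' S.carrier = S'.carrier)
    (hD : h '' S.dots = S'.dots) : Isotopic S S' := by
  have hc := hh.continuous
  let c : Space := ((1 / 2, 1 / 2), 1 / 2)
  let D : Space → Space := fun p => h p - p
  have hDc : Continuous D := hc.sub continuous_id
  obtain ⟨M, hM⟩ : ∃ M, ∀ p, ‖D p‖ ≤ M := by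
    obtain ⟨M, hM⟩ := (isCompact_core 0).exists_bound_of_continuousOn hDc.continuousOn
    refine ⟨max M 0, fun p => ?_⟩
    by_cases hp : p ∈ core 0
    · exact (hM p hp).trans (le_max_left _ _)
    · have : p ∉ openCube := fun h' => hp (by
        obtain ⟨⟨h1, h2⟩, ⟨h3, h4⟩, h5, h6⟩ := h'
        exact ⟨⟨h1.le, by linarith⟩, ⟨h3.le, by linarith⟩, h5.le, by linarith⟩)
      simp [D, hfix p this]
  let H : unitInterval → Space → Space := fun t p => p + (t : ℝ) • D (c + (t : ℝ)⁻¹ • (p - c))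
  have hcont : Continuous (Function.uncurry H) := by
    refine continuous_snd.add (continuous_iff_continuousAt.2 ?_)
    rintro ⟨t, p⟩
    by_cases ht : (t : ℝ) = 0
    · have h0 : Filter.Tendsto (fun x : unitInterval × Space => M * (x.1 : ℝ)) (nhds (t, p))
          (nhds 0) := by
        have : Continuous fun x : unitInterval × Space => M * (x.1 : ℝ) := by fun_prop
        have h1 := this.tendsto (t, p)
        simpa [ht] using h1
      unfold ContinuousAt
      simp only [ht, zero_smul]
      refine squeeze_zero_norm (fun x => ?_) h0
      rw [norm_smul, Real.norm_of_nonneg x.1.2.1, mul_comm]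
      exact mul_le_mul_of_nonneg_right (hM _) x.1.2.1
    · have h1 : ContinuousAt (fun x : unitInterval × Space => ((x.1 : ℝ))⁻¹) (t, p) :=
        (continuous_subtype_val.comp continuous_fst).continuousAt.inv₀ ht
      have h2 : ContinuousAt (fun x : unitInterval × Space => (x.1 : ℝ)) (t, p) :=
        (continuous_subtype_val.comp continuous_fst).continuousAt
      have h3 : ContinuousAt (fun x : unitInterval × Space =>
          c + (x.1 : ℝ)⁻¹ • (x.2 - c)) (t, p) :=
        continuousAt_const.add (h1.smul (continuous_snd.sub continuous_const).continuousAt)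
      exact h2.smul (ContinuousAt.comp (g := D) hDc.continuousAt h3)
  have hline : ∀ {s x : ℝ}, 1 ≤ s → 0 < 1 / 2 + s * (x - 1 / 2) → 1 / 2 + s * (x - 1 / 2) < 1 →
      0 < x ∧ x < 1 := by
    intro s x hs h0 h1
    constructor <;> by_contra hcon
    · nlinarith
    · nlinarith
  have hHfix : ∀ t, ∀ p ∉ openCube, H t p = p := by
    intro t p hp
    by_cases ht : (t : ℝ) = 0
    · simp [H, ht]
    have ht0 : 0 < (t : ℝ) := lt_of_le_of_ne t.2.1 (Ne.symm ht)
    have hs : 1 ≤ (t : ℝ)⁻¹ := (one_le_inv₀ ht0).2 t.2.2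
    have : c + (t : ℝ)⁻¹ • (p - c) ∉ openCube := by
      rintro ⟨⟨h1, h2⟩, ⟨h3, h4⟩, h5, h6⟩
      exact hp ⟨hline hs h1 h2, hline hs h3 h4, hline hs h5 h6⟩
    simp [H, D, hfix _ this]
  have hHbij : ∀ t, Function.Bijective (H t) := by
    intro t
    by_cases ht : (t : ℝ) = 0
    · have : H t = id := by funext p; simp [H, ht]
      rw [this]; exact Function.bijective_id
    have hH : H t = fun p => c + (t : ℝ) • (h (c + (t : ℝ)⁻¹ • (p - c)) - c) := by
      funext p
      simp only [H, D]
      have : p = c + (t : ℝ) • ((c + (t : ℝ)⁻¹ • (p - c)) - c) := by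
        rw [add_sub_cancel_left, smul_smul, mul_inv_cancel₀ ht, one_smul]; abel
      nth_rewrite 1 [this]
      rw [add_assoc, ← smul_add]
      congr 2
      abel
    rw [hH]
    constructor
    · intro p q hpq
      have h1 := smul_right_injective Space ht (add_left_cancel hpq)
      have h2 := add_left_cancel (hh.injective (sub_left_injective h1))
      exact sub_left_injective (smul_right_injective Space (inv_ne_zero ht) h2)
    · intro q
      obtain ⟨u, hu⟩ := hh.surjective (c + (t : ℝ)⁻¹ • (q - c))
      refine ⟨c + (t : ℝ) • (u - c), ?_⟩
      simp only [add_sub_cancel_left, smul_smul, inv_mul_cancel₀ ht, one_smul]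
      rw [show c + (u - c) = u by abel, hu]
      simp only [add_sub_cancel_left, smul_smul, mul_inv_cancel₀ ht, one_smul]
      abel
  have h1 : H 1 = h := by
    funext p
    simp [H, D]
  exact ⟨H, hcont, fun t => isHomeomorph_of_bijective (by fun_prop) (hHbij t) (hHfix t), hHfix,
    fun p => by simp [H], by rw [h1, hS], by rw [h1, hD]⟩

end

end

end BarNatan

namespace BarNatan

noncomputable section

/-! ### Collars and compactly supported isotopies -/

section

variable {m n : ℕ} {a b : Diagram m n}

/-- The cobordism `S` is a product in the collar of width `ε`. -/
def Cobordism.Collared (S : Cobordism a b) (ε : ℝ) : Prop :=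
  ∀ p : Space,
    ((p.1.1 < ε ∨ 1 - ε < p.1.1) → p ∉ S.carrier) ∧
    (0 ≤ p.2 → p.2 ≤ 1 → 0 ≤ p.1.2 → p.1.2 < ε → (p ∈ S.carrier ↔ p.1.1 ∈ pts n)) ∧
    (0 ≤ p.2 → p.2 ≤ 1 → 1 - ε < p.1.2 → p.1.2 ≤ 1 → (p ∈ S.carrier ↔ p.1.1 ∈ pts m)) ∧
    (0 ≤ p.2 → p.2 < ε → (p ∈ S.carrier ↔ p.1 ∈ a.carrier)) ∧
    (1 - ε < p.2 → p.2 ≤ 1 → (p ∈ S.carrier ↔ p.1 ∈ b.carrier))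

theorem Cobordism.Collared.mono {S : Cobordism a b} {ε δ : ℝ} (h : S.Collared ε) (hδ : δ ≤ ε) :
    S.Collared δ := by
  intro p
  obtain ⟨hx, hy, hy', hz, hz'⟩ := h p
  refine ⟨fun hp => hx (hp.imp ?_ ?_), fun h0 h1 h2 h3 => hy h0 h1 h2 (by linarith),
    fun h0 h1 h2 h3 => hy' h0 h1 (by linarith) h3, fun h0 h1 => hz h0 (by linarith),
    fun h0 h1 => hz' (by linarith) h1⟩ <;> intro <;> linarith

/-- Outside of the cube `[δ, 1 - δ]³`, a cobordism with collar `δ` is determined by its boundary. -/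
theorem Cobordism.Collared.iff_of_not_mem_core {S S' : Cobordism a b} {δ : ℝ} (h : S.Collared δ)
    (h' : S'.Collared δ) {p : Space} (hp : p ∉ core δ) : p ∈ S.carrier ↔ p ∈ S'.carrier := by
  suffices key : ∀ {S S' : Cobordism a b}, S.Collared δ → S'.Collared δ → p ∈ S.carrier →
    p ∈ S'.carrier from ⟨key h h', key h' h⟩
  intro S S' hS hS' hm
  obtain ⟨x, y0, y1, z0, z1⟩ := hS p
  obtain ⟨-, y0', y1', z0', z1'⟩ := hS' p
  obtain ⟨hy, hz⟩ := S.mem_cube p hm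
  by_contra hcon
  refine hp ⟨⟨?_, ?_⟩, ⟨?_, ?_⟩, ?_, ?_⟩ <;> by_contra hlt <;> rw [not_le] at hlt
  · exact x (Or.inl hlt) hm
  · exact x (Or.inr hlt) hm
  · exact hcon ((y0' hz.1 hz.2 hy.1 hlt).2 ((y0 hz.1 hz.2 hy.1 hlt).1 hm))
  · exact hcon ((y1' hz.1 hz.2 hlt hy.2).2 ((y1 hz.1 hz.2 hlt hy.2).1 hm))
  · exact hcon ((z0' hz.1 hlt).2 ((z0 hz.1 hlt).1 hm))
  · exact hcon ((z1' hlt hz.2).2 ((z1 hlt hz.2).1 hm))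

/-- An increasing map of the line onto itself that sends `[0, 1]` to `[δ, 1 - δ]` and fixes
`[2 δ, 1 - 2 δ]` pointwise. -/
def squeeze (δ t : ℝ) : ℝ := min (max t (δ + t / 2)) (1 / 2 - δ + t / 2)

theorem inc_squeeze (δ : ℝ) : Inc (squeeze δ) :=
  (Inc.id.max (Inc.linear (k := 1 / 2) (c := δ) (by norm_num) fun z => by ring)).min
    (Inc.linear (k := 1 / 2) (c := 1 / 2 - δ) (by norm_num) fun z => by ring)

theorem squeeze_eq {δ t : ℝ} (h0 : 2 * δ ≤ t) (h1 : t ≤ 1 - 2 * δ) : squeeze δ t = t := by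
  rw [squeeze, max_eq_left (by linarith), min_eq_left (by linarith)]

theorem squeeze_low {δ t : ℝ} (hδ : δ ≤ 1 / 8) (h1 : t ≤ 2 * δ) :
    squeeze δ t = δ + t / 2 := by
  rw [squeeze, max_eq_right (by linarith), min_eq_left (by linarith)]

theorem squeeze_high {δ t : ℝ} (h1 : 1 - 2 * δ ≤ t) :
    squeeze δ t = 1 / 2 - δ + t / 2 := by
  rw [squeeze, min_eq_right (le_max_of_le_left (by linarith))]

/-- A coordinatewise homeomorphism of space. -/
def coordHomeo (f : ℝ → ℝ) (hf : Inc f) : Space ≃ₜ Space :=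
  let g : ℝ ≃ₜ ℝ := (hf.1.orderIsoOfSurjective f hf.2).toHomeomorph
  (g.prodCongr g).prodCongr g

/-- The coordinatewise `squeeze`, a homeomorphism of space mapping the cube `[0, 1]³` to
`[δ, 1 - δ]³`. -/
def squeezeHomeo (δ : ℝ) : Space ≃ₜ Space :=
  coordHomeo (squeeze δ) (inc_squeeze δ)

theorem squeezeHomeo_apply (δ : ℝ) (p : Space) :
    squeezeHomeo δ p = ((squeeze δ p.1.1, squeeze δ p.1.2), squeeze δ p.2) := rfl

theorem squeeze_mem_iff {δ : ℝ} (h0 : 0 ≤ δ) (hδ : δ ≤ 1 / 8) (t : ℝ) :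
    (δ ≤ squeeze δ t ↔ 0 ≤ t) ∧ (squeeze δ t ≤ 1 - δ ↔ t ≤ 1) := by
  have e0 : squeeze δ 0 = δ := by rw [squeeze_low hδ (by linarith)]; ring
  have e1 : squeeze δ 1 = 1 - δ := by rw [squeeze_high (by linarith)]; ring
  constructor
  · nth_rewrite 1 [← e0]; exact (inc_squeeze δ).1.le_iff_le
  · rw [← e1]; exact (inc_squeeze δ).1.le_iff_le

theorem squeezeHomeo_mem_core {δ : ℝ} (h0 : 0 ≤ δ) (hδ : δ ≤ 1 / 8) (p : Space) :
    squeezeHomeo δ p ∈ core δ ↔ p ∈ core 0 := by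
  rw [squeezeHomeo_apply]
  simp only [core, Set.mem_ofPred_eq, (squeeze_mem_iff h0 hδ _).1, (squeeze_mem_iff h0 hδ _).2,
    sub_zero]

theorem squeezeHomeo_eq {δ : ℝ} {p : Space} (hp : p ∈ core (2 * δ)) : squeezeHomeo δ p = p := by
  obtain ⟨⟨h1, h2⟩, ⟨h3, h4⟩, h5, h6⟩ := hp
  rw [squeezeHomeo_apply, squeeze_eq h1 h2, squeeze_eq h3 h4, squeeze_eq h5 h6]

/-- Squeezing a cobordism into its collar truncates it. -/
theorem Cobordism.Collared.squeeze_iff {S : Cobordism a b} {δ : ℝ} (h0 : 0 < δ) (hδ : δ ≤ 1 / 8)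
    (h : S.Collared (2 * δ)) {p : Space} (hp : p ∈ core 0) :
    squeezeHomeo δ p ∈ S.carrier ↔ p ∈ S.carrier := by
  obtain ⟨⟨⟨x, y⟩, z⟩, rfl⟩ : ∃ q : Space, q = p := ⟨p, rfl⟩
  obtain ⟨⟨hx0, hx1⟩, ⟨hy0, hy1⟩, hz0, hz1⟩ := hp
  simp only [sub_zero] at hx0 hx1 hy0 hy1 hz0 hz1
  have sq : ∀ t : ℝ, 0 ≤ t → t ≤ 1 → squeeze δ t = t ∨
      (t < 2 * δ ∧ 0 ≤ squeeze δ t ∧ squeeze δ t < 2 * δ) ∨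
      (1 - 2 * δ < t ∧ 1 - 2 * δ < squeeze δ t ∧ squeeze δ t ≤ 1) := by
    intro t t0 t1
    rcases lt_or_ge t (2 * δ) with h | h
    · rw [squeeze_low hδ h.le]
      exact Or.inr (Or.inl ⟨h, by linarith, by linarith⟩)
    rcases lt_or_ge (1 - 2 * δ) t with h' | h'
    · rw [squeeze_high h'.le]
      exact Or.inr (Or.inr ⟨h', by linarith, by linarith⟩)
    · exact Or.inl (squeeze_eq h h')
  have bd : ∀ t : ℝ, 0 ≤ t → t ≤ 1 → 0 ≤ squeeze δ t ∧ squeeze δ t ≤ 1 := by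
    intro t t0 t1
    have e1 := (squeeze_mem_iff h0.le hδ t).1.2 t0
    have e2 := (squeeze_mem_iff h0.le hδ t).2.2 t1
    constructor <;> linarith
  have sx := bd x hx0 hx1
  have sy := bd y hy0 hy1
  rw [squeezeHomeo_apply]
  simp only
  -- the coordinates are moved one after the other
  have e1 : ((squeeze δ x, squeeze δ y), squeeze δ z) ∈ S.carrier ↔
      ((squeeze δ x, squeeze δ y), z) ∈ S.carrier := by
    rcases sq z hz0 hz1 with e | ⟨u1, u2, u3⟩ | ⟨u1, u2, u3⟩
    · rw [e]
    · exact ((h ((squeeze δ x, squeeze δ y), squeeze δ z)).2.2.2.1 u2 u3).trans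
        ((h ((squeeze δ x, squeeze δ y), z)).2.2.2.1 hz0 u1).symm
    · exact ((h ((squeeze δ x, squeeze δ y), squeeze δ z)).2.2.2.2 u2 u3).trans
        ((h ((squeeze δ x, squeeze δ y), z)).2.2.2.2 u1 hz1).symm
  have e2 : ((squeeze δ x, squeeze δ y), z) ∈ S.carrier ↔
      ((squeeze δ x, y), z) ∈ S.carrier := by
    rcases sq y hy0 hy1 with e | ⟨u1, u2, u3⟩ | ⟨u1, u2, u3⟩
    · rw [e]
    · exact ((h ((squeeze δ x, squeeze δ y), z)).2.1 hz0 hz1 u2 u3).trans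
        ((h ((squeeze δ x, y), z)).2.1 hz0 hz1 hy0 u1).symm
    · exact ((h ((squeeze δ x, squeeze δ y), z)).2.2.1 hz0 hz1 u2 u3).trans
        ((h ((squeeze δ x, y), z)).2.2.1 hz0 hz1 u1 hy1).symm
  have e3 : ((squeeze δ x, y), z) ∈ S.carrier ↔ ((x, y), z) ∈ S.carrier := by
    rcases sq x hx0 hx1 with e | ⟨u1, u2, u3⟩ | ⟨u1, u2, u3⟩
    · rw [e]
    · exact iff_of_false ((h ((squeeze δ x, y), z)).1 (Or.inl u3)) ((h ((x, y), z)).1 (Or.inl u1))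
    · exact iff_of_false ((h ((squeeze δ x, y), z)).1 (Or.inr u2)) ((h ((x, y), z)).1 (Or.inr u1))
  exact e1.trans (e2.trans e3)

theorem openCube_subset_core : openCube ⊆ core 0 := by
  rintro p ⟨⟨h1, h2⟩, ⟨h3, h4⟩, h5, h6⟩
  exact ⟨⟨h1.le, by linarith⟩, ⟨h3.le, by linarith⟩, h5.le, by linarith⟩

theorem Cobordism.subset_core (S : Cobordism a b) : S.carrier ⊆ core 0 := by
  intro p hp
  have hx := S.mem_x hp
  obtain ⟨hy, hz⟩ := S.mem_cube p hp
  exact ⟨⟨hx.1.le, by linarith⟩, ⟨hy.1, by linarith⟩, hz.1, by linarith⟩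

/-- A homeomorphism fixing the complement of a set preserves this set. -/
theorem mem_of_fix {U : Set Space} (h : Space ≃ₜ Space) (hf : ∀ p ∉ U, h p = p) {p : Space}
    (hp : p ∈ U) : h p ∈ U := by
  by_contra hc
  exact hc ((h.injective (hf _ hc)).symm ▸ hp)

theorem symm_fix {U : Set Space} (h : Space ≃ₜ Space) (hf : ∀ p ∉ U, h p = p) :
    ∀ p ∉ U, h.symm p = p := fun p hp => (h.symm_apply_eq).2 (hf p hp).symm

theorem symm_image_eq {h : Space ≃ₜ Space} {S S' : Set Space} (hS : h '' S = S') :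
    h.symm '' S' = S := by
  rw [← hS, Set.image_image]; simp

/-- An isotopy yields an ambient homeomorphism that is supported in a compact part of the open
cube. -/
theorem Isotopic.exists_homeo {S S' : Cobordism a b} (h : Isotopic S S') :
    ∃ (δ : ℝ) (h : Space ≃ₜ Space), 0 < δ ∧ (∀ p ∉ core δ, h p = p) ∧
      h '' S.carrier = S'.carrier ∧ h '' S.dots = S'.dots := by
  obtain ⟨H, -, hh, hf, -, hS, hD⟩ := h
  obtain ⟨g, hg⟩ : ∃ g : Space ≃ₜ Space, ∀ p, g p = H 1 p := ⟨(hh 1).homeomorph, fun _ => rfl⟩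
  have hg' : (g : Space → Space) = H 1 := funext hg
  rw [← hg'] at hS hD
  have gf : ∀ p ∉ openCube, g p = p := fun p hp => (hg p).trans (hf 1 p hp)
  obtain ⟨ε, hε, hc⟩ := S.collar
  obtain ⟨ε', hε', hc'⟩ := S'.collar
  obtain ⟨d, hd, hdS⟩ := exists_subset_core S.dots_finite.isCompact S.dots_interior
  obtain ⟨d', hd', hdS'⟩ := exists_subset_core S'.dots_finite.isCompact S'.dots_interior
  obtain ⟨δ, hδ, d1, d2, d3, d4, d5⟩ : ∃ δ : ℝ, 0 < δ ∧ 2 * δ ≤ ε ∧ 2 * δ ≤ ε' ∧ 2 * δ ≤ d ∧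
      2 * δ ≤ d' ∧ δ ≤ 1 / 8 := by
    refine ⟨min (min (ε / 2) (ε' / 2)) (min (min (d / 2) (d' / 2)) (1 / 8)), by positivity, ?_⟩
    have := min_le_left (min (ε / 2) (ε' / 2)) (min (min (d / 2) (d' / 2)) (1 / 8))
    have := min_le_right (min (ε / 2) (ε' / 2)) (min (min (d / 2) (d' / 2)) (1 / 8))
    have := min_le_left (min (d / 2) (d' / 2)) (1 / 8)
    have := min_le_right (min (d / 2) (d' / 2)) (1 / 8)
    have := min_le_left (d / 2) (d' / 2)
    have := min_le_right (d / 2) (d' / 2)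
    have := min_le_left (ε / 2) (ε' / 2)
    have := min_le_right (ε / 2) (ε' / 2)
    refine ⟨?_, ?_, ?_, ?_, ?_⟩ <;> linarith
  have cS : S.Collared (2 * δ) := Cobordism.Collared.mono hc d1
  have cS' : S'.Collared (2 * δ) := Cobordism.Collared.mono hc' d2
  have dS : S.dots ⊆ core (2 * δ) := hdS.trans (core_mono d3)
  have dS' : S'.dots ⊆ core (2 * δ) := hdS'.trans (core_mono d4)
  let κ := squeezeHomeo δ
  have sub : ∀ (g : Space ≃ₜ Space) {S S' : Cobordism a b}, (∀ p ∉ openCube, g p = p) →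
      S.Collared (2 * δ) → S'.Collared (2 * δ) → S.dots ⊆ core (2 * δ) → S'.dots ⊆ core (2 * δ) →
      g '' S.carrier = S'.carrier → g '' S.dots = S'.dots →
      (∀ p ∈ S.carrier, κ (g (κ.symm p)) ∈ S'.carrier) ∧
        ∀ p ∈ S.dots, κ (g (κ.symm p)) ∈ S'.dots := by
    intro g S S' gf cS cS' dS dS' hS hD
    constructor
    · intro p hp
      by_cases hpc : p ∈ core δ
      · obtain ⟨u, rfl⟩ := κ.surjective p
        have hu := (squeezeHomeo_mem_core hδ.le d5 u).1 hpc
        rw [κ.symm_apply_apply]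
        have hgu : g u ∈ S'.carrier := hS ▸ ⟨u, (cS.squeeze_iff hδ d5 hu).1 hp, rfl⟩
        exact (cS'.squeeze_iff hδ d5 (S'.subset_core hgu)).2 hgu
      · have hq : κ.symm p ∉ openCube := fun hq => hpc (by
          rw [← κ.apply_symm_apply p]
          exact (squeezeHomeo_mem_core hδ.le d5 _).2 (openCube_subset_core hq))
        rw [gf _ hq, κ.apply_symm_apply]
        exact ((cS.mono (by linarith)).iff_of_not_mem_core (cS'.mono (by linarith)) hpc).1 hp
    · intro p hp
      have e : κ.symm p = p := (κ.symm_apply_eq).2 (squeezeHomeo_eq (dS hp)).symm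
      have hgp : g p ∈ S'.dots := hD ▸ ⟨p, hp, rfl⟩
      rw [e, show κ (g p) = g p from squeezeHomeo_eq (dS' hgp)]
      exact hgp
  let h' : Space ≃ₜ Space := κ.symm.trans (g.trans κ)
  have s1 := sub g gf cS cS' dS dS' hS hD
  have s2 := sub g.symm (symm_fix g gf) cS' cS dS' dS (symm_image_eq hS) (symm_image_eq hD)
  refine ⟨δ, h', hδ, fun p hp => ?_, ?_, ?_⟩
  · have hq : κ.symm p ∉ openCube := fun hq => hp (by
      rw [← κ.apply_symm_apply p]
      exact (squeezeHomeo_mem_core hδ.le d5 _).2 (openCube_subset_core hq))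
    change κ (g (κ.symm p)) = p
    rw [gf _ hq, κ.apply_symm_apply]
  · refine Set.Subset.antisymm ?_ fun p hp => ⟨κ (g.symm (κ.symm p)), s2.1 p hp, by simp [h']⟩
    rintro _ ⟨p, hp, rfl⟩
    exact s1.1 p hp
  · refine Set.Subset.antisymm ?_ fun p hp => ⟨κ (g.symm (κ.symm p)), s2.2 p hp, by simp [h']⟩
    rintro _ ⟨p, hp, rfl⟩
    exact s1.2 p hp

end

/-! ### Transport along homeomorphisms of the open cube -/

section Transport

variable {m n m' n' : ℕ} {a b : Diagram m n} {c d : Diagram m' n'}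

/-- `G` transports cobordisms along the homeomorphism `e` of the open cube. The boundary of the cube
plays no role, so the diagrams at the ends may change. -/
structure Transports (e : OpenPartialHomeomorph Space Space)
    (G : Cobordism a b → Cobordism c d) : Prop where
  source : e.source = openCube
  target : e.target = openCube
  carrier : ∀ S, ∀ p ∈ openCube, e p ∈ (G S).carrier ↔ p ∈ S.carrier
  dots : ∀ S, ∀ p ∈ openCube, e p ∈ (G S).dots ↔ p ∈ S.dots

variable {e : OpenPartialHomeomorph Space Space} {G : Cobordism a b → Cobordism c d}

theorem Transports.map_mem (hG : Transports e G) {p : Space} (hp : p ∈ openCube) :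
    e p ∈ openCube := hG.target ▸ e.map_source (hG.source.symm ▸ hp)

theorem Transports.symm_mem (hG : Transports e G) {p : Space} (hp : p ∈ openCube) :
    e.symm p ∈ openCube := hG.source ▸ e.map_target (hG.target.symm ▸ hp)

theorem Transports.left_inv (hG : Transports e G) {p : Space} (hp : p ∈ openCube) :
    e.symm (e p) = p := e.left_inv (hG.source.symm ▸ hp)

theorem Transports.right_inv (hG : Transports e G) {p : Space} (hp : p ∈ openCube) :
    e (e.symm p) = p := e.right_inv (hG.target.symm ▸ hp)

theorem Transports.isotopic (hG : Transports e G) {S S' : Cobordism a b} (h : Isotopic S S') :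
    Isotopic (G S) (G S') := by
  classical
  obtain ⟨δ, h, hδ, hfix, hS, hD⟩ := h.exists_homeo
  have hcube := core_subset hδ
  have ho : ∀ p ∉ openCube, h p = p := fun p hp => hfix p fun hp' => hp (hcube hp')
  -- the transported homeomorphism, extended by the identity
  let T : (Space ≃ₜ Space) → Space → Space := fun h p =>
    if p ∈ openCube then e (h (e.symm p)) else p
  have Tin : ∀ (h : Space ≃ₜ Space), ∀ p ∈ openCube, T h p = e (h (e.symm p)) := fun h p hp =>
    if_pos hp
  have Tout : ∀ (h : Space ≃ₜ Space), ∀ p ∉ openCube, T h p = p := fun h p hp => if_neg hp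
  have Tinv : ∀ h : Space ≃ₜ Space, (∀ p ∉ openCube, h p = p) → ∀ p, T h.symm (T h p) = p := by
    intro h ho p
    by_cases hp : p ∈ openCube
    · have h1 := mem_of_fix h ho (hG.symm_mem hp)
      rw [Tin h p hp, Tin _ _ (hG.map_mem h1), hG.left_inv h1, h.symm_apply_apply,
        hG.right_inv hp]
    · rw [Tout h p hp, Tout _ p hp]
  have hcont : Continuous (T h) := by
    have hK : IsClosed (e '' core δ) := by
      refine ((isCompact_core δ).image_of_continuousOn (e.continuousOn.mono ?_)).isClosed
      rw [hG.source]; exact hcube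
    rw [continuous_iff_continuousAt]
    intro p
    by_cases hp : p ∈ openCube
    · have : ContinuousOn (T h) openCube := by
        refine ContinuousOn.congr ?_ fun q hq => Tin h q hq
        refine e.continuousOn.comp (h.continuous.comp_continuousOn
          (hG.target ▸ e.continuousOn_symm)) fun q hq => ?_
        rw [hG.source]
        exact mem_of_fix h ho (hG.symm_mem hq)
      exact this.continuousAt (isOpen_openCube.mem_nhds hp)
    · have hpK : p ∉ e '' core δ := by
        rintro ⟨q, hq, rfl⟩
        exact hp (hG.map_mem (hcube hq))
      refine ContinuousAt.congr (f := id) continuousAt_id ?_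
      filter_upwards [hK.isOpen_compl.mem_nhds hpK] with q hq
      by_cases hq' : q ∈ openCube
      · have h1 : e.symm q ∉ core δ := fun h1 => hq ⟨_, h1, hG.right_inv hq'⟩
        rw [Tin h q hq', hfix _ h1, hG.right_inv hq', id]
      · rw [Tout h q hq', id]
  have himg : ∀ (h : Space ≃ₜ Space), (∀ p ∉ openCube, h p = p) → ∀ {S S' : Cobordism a b},
      h '' S.carrier = S'.carrier → h '' S.dots = S'.dots →
      (∀ p ∈ (G S).carrier, T h p ∈ (G S').carrier) ∧ ∀ p ∈ (G S).dots, T h p ∈ (G S').dots := by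
    intro h ho S S' hS hD
    constructor
    · intro p hp
      by_cases hpc : p ∈ openCube
      · have h1 := hG.symm_mem hpc
        have h2 : e.symm p ∈ S.carrier := by
          rw [← hG.carrier S _ h1, hG.right_inv hpc]; exact hp
        rw [Tin h p hpc, hG.carrier S' _ (mem_of_fix h ho h1), ← hS]
        exact ⟨_, h2, rfl⟩
      · rw [Tout h p hpc]
        exact (carrier_iff_off _ _ hpc).1 hp
    · intro p hp
      have hpc := (G S).dots_interior hp
      have h1 := hG.symm_mem hpc
      have h2 : e.symm p ∈ S.dots := by
        rw [← hG.dots S _ h1, hG.right_inv hpc]; exact hp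
      rw [Tin h p hpc, hG.dots S' _ (mem_of_fix h ho h1), ← hD]
      exact ⟨_, h2, rfl⟩
  have ho' := symm_fix h ho
  have i1 := himg h ho hS hD
  have i2 := himg h.symm ho' (symm_image_eq hS) (symm_image_eq hD)
  have inv1 := Tinv h ho
  have inv2 : ∀ p, T h (T h.symm p) = p := Tinv h.symm ho'
  refine isotopic_of_homeo (h := T h)
    (isHomeomorph_of_bijective hcont ⟨fun p q hpq => ?_, fun p => ⟨_, inv2 p⟩⟩ (Tout h)) (Tout h)
    ?_ ?_
  · rw [← inv1 p, hpq, inv1]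
  · refine Set.Subset.antisymm ?_ fun p hp => ⟨_, i2.1 p hp, inv2 p⟩
    rintro _ ⟨p, hp, rfl⟩
    exact i1.1 p hp
  · refine Set.Subset.antisymm ?_ fun p hp => ⟨_, i2.2 p hp, inv2 p⟩
    rintro _ ⟨p, hp, rfl⟩
    exact i1.2 p hp

theorem Transports.chart (hG : Transports e G) {f : Space → Space} (hf : IsBallChart f) :
    IsBallChart (e ∘ f) := by
  refine ⟨Topology.IsOpenEmbedding.of_continuous_injective_isOpenMap ?_ ?_ ?_, fun p =>
    hG.map_mem (hf.2 p)⟩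
  · exact e.continuousOn.comp_continuous hf.1.continuous fun p => hG.source.symm ▸ hf.2 p
  · intro p q hpq
    have := congrArg e.symm hpq
    simp only [Function.comp_apply, hG.left_inv (hf.2 _)] at this
    exact hf.1.injective this
  · intro U hU
    rw [Set.image_comp]
    refine e.isOpen_image_of_subset_source (hf.1.isOpenMap U hU) ?_
    rintro _ ⟨p, -, rfl⟩
    exact hG.source.symm ▸ hf.2 p

theorem Transports.looksLike (hG : Transports e G) {f : Space → Space} (hf : IsBallChart f)
    {S : Cobordism a b} {M D : Set Space} (h : LooksLike f S M D) : LooksLike (e ∘ f) (G S) M D :=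
  fun p hp => ⟨(hG.carrier S _ (hf.2 p)).trans (h p hp).1,
    (hG.dots S _ (hf.2 p)).trans (h p hp).2⟩

theorem Transports.agreeOff (hG : Transports e G) {f : Space → Space}
    {S S' : Cobordism a b} (h : AgreeOff f S S') : AgreeOff (e ∘ f) (G S) (G S') := by
  intro q hq
  by_cases hqc : q ∈ openCube
  · have h1 := hG.symm_mem hqc
    have h2 : e.symm q ∉ f '' modelBall := by
      rintro ⟨p, hp, hpq⟩
      exact hq ⟨p, hp, by rw [Function.comp_apply, hpq, hG.right_inv hqc]⟩
    have h3 := h _ h2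
    rw [← hG.carrier S _ h1, ← hG.carrier S' _ h1, ← hG.dots S _ h1, ← hG.dots S' _ h1,
      hG.right_inv hqc] at h3
    exact h3
  · exact ⟨carrier_iff_off _ _ hqc, iff_of_false (fun h' => hqc ((G S).dots_interior h'))
      fun h' => hqc ((G S').dots_interior h')⟩

theorem Transports.relations_le (hG : Transports e G) :
    relations a b ≤ (relations c d).comap (Finsupp.lmapDomain (Polynomial ℤ) (Polynomial ℤ) G) := by
  refine Submodule.span_le.2 fun r hr => Submodule.subset_span ?_
  change IsRelation (Finsupp.lmapDomain (Polynomial ℤ) (Polynomial ℤ) G r)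
  cases hr with
  | isotopy S S' h =>
    simp only [map_sub, Finsupp.lmapDomain_apply, Finsupp.mapDomain_single]
    exact .isotopy _ _ (hG.isotopic h)
  | sphere f hf S S' i D hD hi hS hS' h =>
    simp only [map_sub, Finsupp.lmapDomain_apply, Finsupp.mapDomain_single]
    exact .sphere (e ∘ f) (hG.chart hf) _ _ i D hD hi (hG.looksLike hf hS) (hG.looksLike hf hS')
      (hG.agreeOff h)
  | neck f hf S S₁ S₂ hS hS₁ hS₂ h₁ h₂ =>
    simp only [map_sub, Finsupp.lmapDomain_apply, Finsupp.mapDomain_single]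
    exact .neck (e ∘ f) (hG.chart hf) _ _ _ (hG.looksLike hf hS) (hG.looksLike hf hS₁)
      (hG.looksLike hf hS₂) (hG.agreeOff h₁) (hG.agreeOff h₂)
  | handle f hf S S' hS hS' h =>
    simp only [map_sub, Finsupp.lmapDomain_apply, Finsupp.mapDomain_single]
    exact .handle (e ∘ f) (hG.chart hf) _ _ (hG.looksLike hf hS) (hG.looksLike hf hS')
      (hG.agreeOff h)

/-- The linear map induced by transporting cobordisms. -/
def Transports.map (hG : Transports e G) : Skein a b →ₗ[Polynomial ℤ] Skein c d :=
  Submodule.mapQ _ _ (Finsupp.lmapDomain (Polynomial ℤ) (Polynomial ℤ) G) hG.relations_le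

theorem Transports.map_cls (hG : Transports e G) (S : Cobordism a b) :
    hG.map (cls S) = cls (G S) := by
  change (relations c d).mkQ (Finsupp.mapDomain G (Finsupp.single S 1)) = _
  rw [Finsupp.mapDomain_single]
  rfl

end Transport

end

end BarNatan

namespace BarNatan

noncomputable section

/-! ### The bending homeomorphism -/

theorem Inc.linear_add {k c M : ℝ} (hk : 0 < k) {f g : ℝ → ℝ} (hg : Monotone g)
    (hc : Continuous g) (hM : ∀ z, |g z| ≤ M) (hf : ∀ z, f z = k * z + c + g z) : Inc f := by
  have hl : Inc fun z => k * z + c := Inc.linear hk fun _ => rfl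
  have hfm : StrictMono f := fun a b h => by
    rw [hf, hf]; exact add_lt_add_of_lt_of_le (hl.1 h) (hg h.le)
  have hfc : Continuous f := by
    have : f = fun z => k * z + c + g z := funext hf
    rw [this]; fun_prop
  refine ⟨hfm, fun w => ?_⟩
  obtain ⟨u, hu⟩ := hl.2 (w - M)
  obtain ⟨v, hv⟩ := hl.2 (w + M)
  have hu' : f u ≤ w := by rw [hf]; have := (abs_le.1 (hM u)).2; simp only at hu; linarith
  have hv' : w ≤ f v := by rw [hf]; have := (abs_le.1 (hM v)).1; simp only at hv; linarith
  have huv : u ≤ v := hfm.le_iff_le.1 (hu'.trans hv')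
  obtain ⟨z, -, hz⟩ := intermediate_value_Icc huv hfc.continuousOn ⟨hu', hv'⟩
  exact ⟨z, hz⟩

/-- The truncation of `u` to the interval `[-c, c]`. -/
def clamp (c u : ℝ) : ℝ := max (-c) (min c u)

theorem monotone_clamp (c : ℝ) : Monotone (clamp c) := fun _ _ h =>
  max_le_max le_rfl (min_le_min le_rfl h)

theorem abs_clamp {c : ℝ} (hc : 0 ≤ c) (u : ℝ) : |clamp c u| ≤ c := by
  rw [abs_le]
  exact ⟨le_max_left _ _, max_le (by linarith) (min_le_left _ _)⟩

theorem clamp_neg {c : ℝ} (hc : 0 ≤ c) (u : ℝ) : clamp c (-u) = -clamp c u := by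
  unfold clamp
  rcases le_total c u with h | h <;> rcases le_total (-c) u with h' | h'
  · rw [min_eq_left h, min_eq_right (by linarith), max_eq_left (by linarith),
      max_eq_right (by linarith)]
  · rw [min_eq_left h, min_eq_right (by linarith), max_eq_left (by linarith),
      max_eq_right (by linarith)]
  · rw [min_eq_right h, min_eq_right (by linarith), max_eq_right (by linarith),
      max_eq_right (by linarith)]
  · rw [min_eq_right h, min_eq_left (by linarith), max_eq_right (by linarith),
      max_eq_left (by linarith), neg_neg]

/-- The piecewise linear bijection of the line which is `s ↦ k s` on `[-(1 - ε), 1 - ε]` and fixes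
`1` and `-1`. -/
def ramp (ε k s : ℝ) : ℝ := min (max (k * s) (1 - (1 - s) / ε)) (-1 + (1 + s) / ε)

section

variable {ε k : ℝ}

theorem inc_ramp (hε : 0 < ε) (hk : 0 < k) : Inc (ramp ε k) :=
  ((Inc.linear (c := 0) hk fun z => by ring).max
    (Inc.linear (k := 1 / ε) (c := 1 - 1 / ε) (by positivity) fun z => by ring)).min
    (Inc.linear (k := 1 / ε) (c := -1 + 1 / ε) (by positivity) fun z => by ring)

theorem ramp_eq (hε : 0 < ε) (hε' : ε ≤ 1) (hk : 0 < k) (hk' : k ≤ 1) {s : ℝ} (h0 : -(1 - ε) ≤ s)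
    (h1 : s ≤ 1 - ε) : ramp ε k s = k * s := by
  have e1 : 1 - (1 - s) / ε ≤ k * s := by
    rw [sub_le_iff_le_add, ← sub_le_iff_le_add', le_div_iff₀ hε]
    nlinarith [mul_nonneg hk.le hε.le, mul_nonneg (sub_nonneg.2 hk') hε.le]
  have e2 : k * s ≤ -1 + (1 + s) / ε := by
    have : (1 + k * s) ≤ (1 + s) / ε := by
      rw [le_div_iff₀ hε]
      nlinarith [mul_nonneg hk.le hε.le, mul_nonneg (sub_nonneg.2 hk') hε.le]
    linarith
  rw [ramp, max_eq_left e1, min_eq_left e2]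

theorem ramp_neg (hε : 0 < ε) (hε' : ε ≤ 1) (s : ℝ) : ramp ε k (-s) = -ramp ε k s := by
  have key : ∀ a b c : ℝ, b ≤ c → min (max (-a) (-c)) (-b) = -min (max a b) c := by
    intro a b c h
    rw [max_neg_neg, min_neg_neg]
    congr 1
    rcases le_total a b with h1 | h1
    · rw [max_eq_right h1, min_eq_left h, max_eq_right (min_le_left _ _ |>.trans h1)]
    · rw [max_eq_left h1, max_eq_left (le_min h1 h)]
  have e : 1 ≤ 1 / ε := by rw [le_div_iff₀ hε]; linarith
  have h : 1 - (1 - s) / ε ≤ -1 + (1 + s) / ε := by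
    have a1 : 1 - (1 - s) / ε = 1 - 1 / ε + s * (1 / ε) := by ring
    have a2 : -1 + (1 + s) / ε = -1 + 1 / ε + s * (1 / ε) := by ring
    linarith
  rw [ramp, ramp, ← key _ _ _ h]
  congr 1
  · congr 1 <;> ring
  · ring

theorem ramp_one (hε : 0 < ε) (hε' : ε ≤ 1) (hk' : k ≤ 1) : ramp ε k 1 = 1 := by
  have e2 : (1 : ℝ) ≤ (1 + 1) / ε - 1 := by
    have : (2 : ℝ) ≤ (1 + 1) / ε := by rw [le_div_iff₀ hε]; linarith
    linarith
  rw [ramp, sub_self, zero_div, sub_zero, mul_one, max_eq_right hk', min_eq_left (by linarith)]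

theorem ramp_neg_one (hε : 0 < ε) (hε' : ε ≤ 1) (hk' : k ≤ 1) : ramp ε k (-1) = -1 := by
  rw [ramp_neg hε hε', ramp_one hε hε' hk']


theorem ramp_zero (hε : 0 < ε) (hε' : ε ≤ 1) : ramp ε k 0 = 0 := by
  have h : (1 : ℝ) ≤ 1 / ε := by rw [le_div_iff₀ hε]; linarith
  rw [ramp, mul_zero, sub_zero, add_zero, max_eq_left (by linarith), min_eq_left (by linarith)]

end

/-! The square with coordinates `(y, z)` is mapped onto the half-disc `|s| ≤ 1`, `0 ≤ t ≤ 1` in such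
a way that `y` becomes the distance `max |s| t` from the origin, except near `y = 0`, and the
coordinate `z` the angle. -/

/-- The height of `(y, z)` on the half-line of `y`, see `halfS` and `halfT`. -/
def outer (ε y : ℝ) : ℝ := max y ((y + ε) / 2)

/-- An auxiliary angular coordinate. -/
def angle (ε y z : ℝ) : ℝ :=
  ε / 2 * (2 * z - 1) + (max (outer ε y) (ε / 2) - ε / 2) * clamp 1 (2 * (2 * z - 1))

/-- An auxiliary depth coordinate. -/
def depth₀ (ε y b : ℝ) : ℝ := min y (outer ε y - |b|)

/-- The first coordinate on the half-disc, in terms of the auxiliary coordinates. -/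
def spread (t₀ b : ℝ) : ℝ := b + clamp (max t₀ 0) b

/-- The second coordinate on the half-disc, in terms of the auxiliary depth. -/
def deepen (t₀ s : ℝ) : ℝ := t₀ + min (|s| / 2) (max t₀ 0)

/-- The first coordinate of the image of `(y, z)` in the half-disc. -/
def halfS (ε y z : ℝ) : ℝ := spread (depth₀ ε y (angle ε y z)) (angle ε y z)

/-- The second coordinate of the image of `(y, z)` in the half-disc. -/
def halfT (ε y z : ℝ) : ℝ := deepen (depth₀ ε y (angle ε y z)) (halfS ε y z)

theorem deepen_sign (t₀ s : ℝ) : (0 ≤ deepen t₀ s ↔ 0 ≤ t₀) ∧ (0 < deepen t₀ s ↔ 0 < t₀) := by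
  unfold deepen
  rcases le_total t₀ 0 with h | h
  · rw [max_eq_right h, min_eq_right (by positivity), add_zero]; simp
  · rw [max_eq_left h]
    have h1 : 0 ≤ min (|s| / 2) t₀ := le_min (by positivity) h
    have h2 := min_le_right (|s| / 2) t₀
    constructor <;> constructor <;> intro h' <;> linarith

theorem abs_spread {t₀ : ℝ} (h : 0 ≤ t₀) (b : ℝ) : |spread t₀ b| = |b| + min t₀ |b| := by
  have key : ∀ b : ℝ, 0 ≤ b → spread t₀ b = |b| + min t₀ |b| := by
    intro b hb
    rw [spread, clamp, max_eq_left h, abs_of_nonneg hb, max_eq_right]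
    have : 0 ≤ min t₀ b := le_min h hb
    linarith
  rcases le_total 0 b with hb | hb
  · rw [key b hb, abs_of_nonneg (add_nonneg (abs_nonneg b) (le_min h (abs_nonneg b)))]
  · have h1 := key (-b) (by linarith)
    have h2 : spread t₀ (-b) = -spread t₀ b := by
      rw [spread, spread, clamp_neg (le_max_right _ _)]; ring
    rw [abs_neg] at h1
    rw [← abs_neg, ← h2, h1, abs_of_nonneg (add_nonneg (abs_nonneg b) (le_min h (abs_nonneg b)))]

theorem deepen_spread {t₀ : ℝ} (h : 0 ≤ t₀) (b : ℝ) :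
    deepen t₀ (spread t₀ b) = t₀ + min t₀ |b| ∧
      max |spread t₀ b| (deepen t₀ (spread t₀ b)) = |b| + t₀ := by
  have e : deepen t₀ (spread t₀ b) = t₀ + min t₀ |b| := by
    rw [deepen, max_eq_left h, abs_spread h]
    congr 1
    rcases le_total t₀ |b| with h' | h'
    · rw [min_eq_left h', min_eq_right (by linarith)]
    · rw [min_eq_right h', min_eq_left (by linarith)]; ring
  refine ⟨e, ?_⟩
  rw [e, abs_spread h]
  rcases le_total t₀ |b| with h' | h'
  · rw [min_eq_left h', max_eq_left (by linarith)]
  · rw [min_eq_right h', max_eq_right (by linarith)]; ring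

theorem angle_symm (ε y z : ℝ) : angle ε y (1 - z) = -angle ε y z := by
  rw [angle, angle, show 2 * (2 * (1 - z) - 1) = -(2 * (2 * z - 1)) by ring, clamp_neg zero_le_one]
  ring

theorem depth₀_symm (ε y b : ℝ) : depth₀ ε y (-b) = depth₀ ε y b := by
  rw [depth₀, depth₀, abs_neg]

theorem halfS_symm (ε y z : ℝ) : halfS ε y (1 - z) = -halfS ε y z := by
  rw [halfS, halfS, angle_symm, depth₀_symm, spread, spread, clamp_neg (le_max_right _ _)]
  ring

theorem halfT_symm (ε y z : ℝ) : halfT ε y (1 - z) = halfT ε y z := by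
  rw [halfT, halfT, halfS_symm, angle_symm, depth₀_symm, deepen, deepen, abs_neg]

section

variable {ε y z : ℝ}

theorem outer_eq (h : ε ≤ y) : outer ε y = y := max_eq_left (by linarith)

theorem outer_le (h : y ≤ ε) : outer ε y ≤ ε := max_le h (by linarith)

theorem angle_bound (hε : 0 < ε) (hy : 0 ≤ y) (hz : 1 / 2 ≤ z) :
    0 ≤ angle ε y z ∧ angle ε y z ≤ outer ε y - ε * (1 - z) ∧
      (3 / 4 ≤ z → angle ε y z = outer ε y - ε * (1 - z)) := by
  have ho : ε / 2 ≤ outer ε y := le_max_of_le_right (by linarith)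
  rw [angle, max_eq_left ho]
  have hc0 : 0 ≤ clamp 1 (2 * (2 * z - 1)) :=
    le_max_of_le_right (le_min zero_le_one (by linarith))
  have hc1 := (abs_le.1 (abs_clamp zero_le_one (2 * (2 * z - 1)))).2
  have hm := mul_le_of_le_one_right (sub_nonneg.2 ho) hc1
  have hm0 := mul_nonneg (sub_nonneg.2 ho) hc0
  have hl : 0 ≤ ε / 2 * (2 * z - 1) := mul_nonneg (by linarith) (by linarith)
  refine ⟨by linarith, by nlinarith, fun h => ?_⟩
  have : clamp 1 (2 * (2 * z - 1)) = 1 := by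
    rw [clamp, min_eq_left (by linarith)]; norm_num
  rw [this]; ring

theorem abs_angle_le_iff (hε : 0 < ε) (hy : 0 ≤ y) :
    (|angle ε y z| ≤ outer ε y ↔ 0 ≤ z ∧ z ≤ 1) ∧
      (|angle ε y z| < outer ε y ↔ 0 < z ∧ z < 1) := by
  have key : ∀ z : ℝ, 1 / 2 ≤ z → (|angle ε y z| ≤ outer ε y ↔ 0 ≤ z ∧ z ≤ 1) ∧
      (|angle ε y z| < outer ε y ↔ 0 < z ∧ z < 1) := by
    intro z hz
    obtain ⟨h0, h1, h2⟩ := angle_bound hε hy hz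
    rw [abs_of_nonneg h0]
    constructor <;> constructor
    · intro h
      refine ⟨by linarith, ?_⟩
      by_contra hc
      have := h2 (by linarith)
      nlinarith
    · rintro ⟨-, h⟩; nlinarith
    · intro h
      refine ⟨by linarith, ?_⟩
      by_contra hc
      have := h2 (by linarith)
      nlinarith
    · rintro ⟨-, h⟩; nlinarith
  rcases le_total (1 / 2) z with h | h
  · exact key z h
  · have := key (1 - z) (by linarith)
    rw [angle_symm, abs_neg] at this
    refine ⟨this.1.trans ?_, this.2.trans ?_⟩ <;> constructor <;> intro h <;>
      constructor <;> linarith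

theorem depth₀_sign (hε : 0 < ε) :
    (0 ≤ depth₀ ε y (angle ε y z) ↔ 0 ≤ y ∧ 0 ≤ z ∧ z ≤ 1) ∧
      (0 < depth₀ ε y (angle ε y z) ↔ 0 < y ∧ 0 < z ∧ z < 1) := by
  unfold depth₀
  rw [le_min_iff, lt_min_iff, sub_nonneg, sub_pos]
  exact ⟨and_congr_right fun h => (abs_angle_le_iff hε h).1,
    and_congr_right fun h => (abs_angle_le_iff hε h.le).2⟩

theorem half_level (hε : 0 < ε) (hy : 0 ≤ y) (hz : 0 ≤ z ∧ z ≤ 1) :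
    max |halfS ε y z| (halfT ε y z) = min (y + |angle ε y z|) (outer ε y) := by
  have h0 := (depth₀_sign hε).1.2 ⟨hy, hz⟩
  refine (deepen_spread h0 _).2.trans ?_
  rw [depth₀, ← min_add_add_left]
  congr 1 <;> ring

theorem half_level_eq (hε : 0 < ε) (hy : ε ≤ y) (hz : 0 ≤ z ∧ z ≤ 1) :
    max |halfS ε y z| (halfT ε y z) = y := by
  rw [half_level hε (by linarith) hz, outer_eq hy,
    min_eq_right (by linarith [abs_nonneg (angle ε y z)])]

theorem half_level_le (hε : 0 < ε) (hy : 0 ≤ y) (hy' : y ≤ ε) (hz : 0 ≤ z ∧ z ≤ 1) :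
    max |halfS ε y z| (halfT ε y z) ≤ ε := by
  rw [half_level hε hy hz]
  exact (min_le_right _ _).trans (outer_le hy')

theorem halfT_nonneg (hε : 0 < ε) (hy : 0 ≤ y) (hz : 0 ≤ z ∧ z ≤ 1) : 0 ≤ halfT ε y z :=
  (deepen_sign _ _).1.2 ((depth₀_sign hε).1.2 ⟨hy, hz⟩)

/-- The closed unit square corresponds to the closed half-disc. -/
theorem half_closed_iff (hε : 0 < ε) (hε' : ε ≤ 1) :
    (|halfS ε y z| ≤ 1 ∧ 0 ≤ halfT ε y z ∧ halfT ε y z ≤ 1) ↔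
      (0 ≤ y ∧ y ≤ 1) ∧ 0 ≤ z ∧ z ≤ 1 := by
  constructor
  · rintro ⟨h1, h2, h3⟩
    obtain ⟨hy, hz⟩ := (depth₀_sign hε).1.1 ((deepen_sign _ _).1.1 h2)
    refine ⟨⟨hy, ?_⟩, hz⟩
    by_contra hc
    have h4 := half_level_eq (y := y) hε (by linarith) hz
    have := max_le h1 h3
    linarith
  · rintro ⟨⟨hy, hy1⟩, hz⟩
    have h0 := halfT_nonneg hε hy hz
    have : max |halfS ε y z| (halfT ε y z) ≤ 1 := by
      rw [half_level hε hy hz]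
      exact (min_le_right _ _).trans (max_le hy1 (by linarith))
    exact ⟨(le_max_left _ _).trans this, h0, (le_max_right _ _).trans this⟩

/-- The open unit square corresponds to the open half-disc. -/
theorem half_open_iff (hε : 0 < ε) (hε' : ε ≤ 1) :
    (|halfS ε y z| < 1 ∧ 0 < halfT ε y z ∧ halfT ε y z < 1) ↔
      (0 < y ∧ y < 1) ∧ 0 < z ∧ z < 1 := by
  constructor
  · rintro ⟨h1, h2, h3⟩
    obtain ⟨hy, hz⟩ := (depth₀_sign hε).2.1 ((deepen_sign _ _).2.1 h2)
    refine ⟨⟨hy, ?_⟩, hz⟩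
    by_contra hc
    have h4 := half_level_eq (y := y) hε (by linarith) ⟨hz.1.le, hz.2.le⟩
    have := max_lt h1 h3
    linarith
  · rintro ⟨⟨hy, hy1⟩, hz⟩
    have h0 := (deepen_sign _ (halfS ε y z)).2.2 ((depth₀_sign hε).2.2 ⟨hy, hz⟩)
    have : max |halfS ε y z| (halfT ε y z) < 1 := by
      rw [half_level hε hy.le ⟨hz.1.le, hz.2.le⟩]
      exact (min_le_right _ _).trans_lt (max_lt hy1 (by linarith))
    exact ⟨(le_max_left _ _).trans_lt this, h0, (le_max_right _ _).trans_lt this⟩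

/-- Near the top of the square, the map to the half-disc is affine. -/
theorem half_top (hε : 0 < ε) (hy : ε ≤ y) (hz : 3 / 4 ≤ z) (hz' : z ≤ 1) :
    halfS ε y z = y ∧ halfT ε y z = 2 * ε * (1 - z) := by
  obtain ⟨h0, -, h2⟩ := angle_bound hε (by linarith : 0 ≤ y) (by linarith : 1 / 2 ≤ z)
  have hb := h2 hz
  rw [outer_eq hy] at hb
  have ht : depth₀ ε y (angle ε y z) = ε * (1 - z) := by
    rw [depth₀, outer_eq hy, abs_of_nonneg h0, hb, min_eq_right (by linarith)]; ring
  have ht0 : 0 ≤ ε * (1 - z) := mul_nonneg hε.le (by linarith)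
  have hlt : ε * (1 - z) ≤ angle ε y z := by rw [hb]; nlinarith
  have hs : halfS ε y z = y := by
    rw [halfS, ht, spread, clamp, max_eq_left ht0, min_eq_left hlt, max_eq_right (by linarith), hb]
    ring
  refine ⟨hs, ?_⟩
  have := (deepen_spread ht0 (angle ε y z)).1
  rw [halfT, halfS, ht, this, abs_of_nonneg h0, min_eq_left hlt]
  ring

theorem half_bottom (hε : 0 < ε) (hy : ε ≤ y) (hz : 0 ≤ z) (hz' : z ≤ 1 / 4) :
    halfS ε y z = -y ∧ halfT ε y z = 2 * ε * z := by
  have := half_top (z := 1 - z) hε hy (by linarith) (by linarith)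
  rw [halfS_symm, halfT_symm] at this
  exact ⟨by linarith, by linarith⟩

theorem half_middle (hε : 0 < ε) (hy : ε ≤ y) (hz : 1 / 4 ≤ z) (hz' : z ≤ 3 / 4) :
    ε / 2 ≤ halfT ε y z := by
  have key : ∀ z : ℝ, 1 / 2 ≤ z → z ≤ 3 / 4 → ε / 2 ≤ halfT ε y z := by
    intro z hz hz'
    obtain ⟨h0, h1, -⟩ := angle_bound hε (by linarith : 0 ≤ y) hz
    rw [outer_eq hy] at h1
    have ht : depth₀ ε y (angle ε y z) = y - angle ε y z := by
      rw [depth₀, outer_eq hy, abs_of_nonneg h0, min_eq_right (by linarith)]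
    have h3 : ε / 4 ≤ y - angle ε y z := by nlinarith
    have := (deepen_spread (t₀ := y - angle ε y z) (by linarith) (angle ε y z)).1
    rw [halfT, halfS, ht, this, abs_of_nonneg h0]
    rcases le_total (y - angle ε y z) (angle ε y z) with h | h
    · rw [min_eq_left h]; linarith
    · rw [min_eq_right h]; linarith
  rcases le_total (1 / 2) z with h | h
  · exact key z h hz'
  · rw [← halfT_symm]; exact key _ (by linarith) (by linarith)

end

end

end BarNatan

namespace BarNatan

noncomputable section

/-- The first part of the bending homeomorphism, `((x, y), z) ↦ ((ρ, s), t)`, where `(s, t)` is the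
point of the half-disc that corresponds to `(y, z)`. -/
def fold {ε : ℝ} (hε : 0 < ε) : Space ≃ₜ Space :=
  have incρ : ∀ _ : Plane, Inc fun x => ramp ε (1 / 2) (2 * x - 1) := fun _ =>
    (inc_ramp hε (by norm_num)).comp (Inc.linear (k := 2) (c := -1) (by norm_num) fun z => by ring)
  have incb : ∀ q : Plane, Inc fun z => angle ε q.2 z := fun q =>
    Inc.linear_add (k := ε) (c := -(ε / 2)) (M := max (outer ε q.2) (ε / 2) - ε / 2)
      (g := fun z => (max (outer ε q.2) (ε / 2) - ε / 2) * clamp 1 (2 * (2 * z - 1))) hε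
      (fun a b h => mul_le_mul_of_nonneg_left (monotone_clamp 1 (by linarith))
        (sub_nonneg.2 (le_max_right _ _)))
      (by unfold clamp; fun_prop)
      (fun z => by
        rw [abs_mul, abs_of_nonneg (sub_nonneg.2 (le_max_right _ _))]
        exact mul_le_of_le_one_right (sub_nonneg.2 (le_max_right _ _)) (abs_clamp zero_le_one _))
      (fun z => by rw [angle]; ring)
  have inct : ∀ q : Plane, Inc fun y => depth₀ ε y q.2 := fun q =>
    Inc.id.min (f := fun z => z) (g := fun y => outer ε y - |q.2|)
      ((Inc.linear (k := 1) (c := -|q.2|) (f := fun y => y - |q.2|) one_pos fun z => by ring).comp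
        (Inc.id.max (Inc.linear (k := 1 / 2) (c := ε / 2) (by norm_num) fun z => by ring)))
  have incs : ∀ q : Plane, Inc fun b => spread q.2 b := fun q =>
    Inc.linear_add (k := 1) (c := 0) (M := max q.2 0) one_pos (monotone_clamp (max q.2 0))
      (by unfold clamp; fun_prop) (abs_clamp (le_max_right _ _)) fun z => by rw [spread]; ring
  have inct' : ∀ q : Plane, Inc fun t => deepen t q.2 := fun q =>
    Inc.linear_add (k := 1) (c := 0) (M := |q.2| / 2) (g := fun t => min (|q.2| / 2) (max t 0))
      one_pos (fun a b h => min_le_min le_rfl (max_le_max h le_rfl)) (by fun_prop)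
      (fun t => by
        rw [abs_of_nonneg (le_min (by positivity) (le_max_right _ _))]; exact min_le_left _ _)
      fun z => by rw [deepen]; ring
  swapXZ.trans <|
  (fiberHomeo (fun _ x => ramp ε (1 / 2) (2 * x - 1)) (by unfold ramp; fun_prop) incρ).trans <|
  swapXZ.trans <|
  (fiberHomeo (fun q z => angle ε q.2 z) (by unfold angle outer clamp; fun_prop) incb).trans <|
  swapYZ.trans <|
  (fiberHomeo (fun q y => depth₀ ε y q.2) (by unfold depth₀ outer; fun_prop) inct).trans <|
  swapYZ.trans <|
  (fiberHomeo (fun q b => spread q.2 b) (by unfold spread clamp; fun_prop) incs).trans <|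
  swapYZ.trans <|
  fiberHomeo (fun q t => deepen t q.2) (by unfold deepen; fun_prop) inct'

theorem fold_apply {ε : ℝ} (hε : 0 < ε) (p : Space) : fold hε p =
    ((ramp ε (1 / 2) (2 * p.1.1 - 1), halfS ε p.1.2 p.2), halfT ε p.1.2 p.2) := rfl

/-- The inverse of the size of the bowl at level `ρ`. -/
def gauge (ρ : ℝ) : ℝ := (max ((1 - ρ) / 4) (1 / 8))⁻¹

@[fun_prop]
theorem continuous_gauge : Continuous gauge :=
  Continuous.inv₀ (by fun_prop) fun _ => (lt_max_of_lt_right (by norm_num)).ne'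

theorem gauge_bounds (ρ : ℝ) : 0 < gauge ρ ∧ gauge ρ ≤ 8 := by
  have h : (1 / 8 : ℝ) ≤ max ((1 - ρ) / 4) (1 / 8) := le_max_right _ _
  refine ⟨inv_pos.2 (by linarith), ?_⟩
  rw [gauge, inv_le_comm₀ (by linarith) (by norm_num)]
  linarith

/-- The slope by which the first coordinate of the half-disc is rescaled. -/
def slope (ρ T : ℝ) : ℝ := (1 - 2 * max 0 (min (1 / 4) T)) * gauge ρ / 8

theorem slope_bounds (ρ T : ℝ) : 0 < slope ρ T ∧ slope ρ T ≤ 1 := by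
  obtain ⟨g0, g1⟩ := gauge_bounds ρ
  have h0 : 0 ≤ max 0 (min (1 / 4) T) := le_max_left _ _
  have h1 : max 0 (min (1 / 4) T) ≤ 1 / 4 := max_le (by norm_num) (min_le_left _ _)
  have h2 : 0 < (1 - 2 * max 0 (min (1 / 4) T)) * gauge ρ := mul_pos (by linarith) g0
  have h3 : (1 - 2 * max 0 (min (1 / 4) T)) * gauge ρ ≤ gauge ρ :=
    mul_le_of_le_one_left g0.le (by linarith)
  rw [slope]
  constructor <;> linarith

/-- The second part of the bending homeomorphism, `((ρ, s), t) ↦ ((ρ, T), S)`: the half-disc is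
rescaled to the rectangle `|S| ≤ 1`, `0 ≤ T ≤ 1`. -/
def rescale {ε : ℝ} (hε : 0 < ε) : Space ≃ₜ Space :=
  (fiberHomeo (fun q t => ramp ε (gauge q.1 / 64) t) (by unfold ramp; fun_prop)
    fun q => inc_ramp hε (by have := (gauge_bounds q.1).1; positivity)).trans <|
  swapYZ.trans <|
  fiberHomeo (fun q s => ramp ε (slope q.1 q.2) s) (by unfold ramp slope; fun_prop)
    fun q => inc_ramp hε (slope_bounds q.1 q.2).1

theorem rescale_apply {ε : ℝ} (hε : 0 < ε) (p : Space) : rescale hε p =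
    ((p.1.1, ramp ε (gauge p.1.1 / 64) p.2),
      ramp ε (slope p.1.1 (ramp ε (gauge p.1.1 / 64) p.2)) p.1.2) := rfl

/-- The size of the bowl through a given point. -/
def bowlRad (p : Space) : ℝ := max (rad p.1) ((1 - p.2) / 2)

theorem continuous_bowlRad : Continuous bowlRad := by
  have := continuous_rad
  unfold bowlRad; fun_prop

theorem abs_le_rad (q : Plane) : |q.1 - 1 / 2| ≤ rad q ∧ |q.2 - 1 / 2| ≤ rad q :=
  ⟨le_max_left _ _, le_max_right _ _⟩

/-- The distance in the maximum norm of the points of the rectangle from its centre. -/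
def rectRad (p : Space) : ℝ := max |-1 + 2 * p.1.2| |p.2|

/-- The points `((ρ, T), S)` for given `ρ` are mapped to a bowl: to the bottom and the four sides of
a box of height and radius proportional to `1 - ρ`. -/
def bowlFun (p : Space) : Space :=
  ((1 / 2 + (1 - p.1.1) / 4 * ((-1 + 2 * p.1.2) / max (rectRad p) (1 / 2)),
    1 / 2 + (1 - p.1.1) / 4 * (p.2 / max (rectRad p) (1 / 2))),
    1 - (1 - p.1.1) / 2 * min 1 (2 * (1 - rectRad p)))

/-- The inverse of `bowlFun`. -/
def bowlInv (p : Space) : Space :=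
  ((1 - 4 * bowlRad p,
    (1 + (p.1.1 - 1 / 2) * ((1 - (1 - p.2) / (4 * bowlRad p)) / bowlRad p)) / 2),
    (p.1.2 - 1 / 2) * ((1 - (1 - p.2) / (4 * bowlRad p)) / bowlRad p))

theorem rad_bowlFun {p : Space} (hp : p.1.1 < 1) :
    rad (bowlFun p).1 = (1 - p.1.1) / 4 * (rectRad p / max (rectRad p) (1 / 2)) := by
  have hM : 0 < max (rectRad p) (1 / 2) := lt_max_of_lt_right (by norm_num)
  have hr : 0 ≤ (1 - p.1.1) / 4 := by linarith
  simp only [rad, bowlFun, add_sub_cancel_left, abs_mul, abs_div, abs_of_pos hM, abs_of_nonneg hr]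
  rw [← mul_max_of_nonneg _ _ hr, max_div_div_right hM.le]
  rfl

theorem bowlRad_bowlFun {p : Space} (hp : p.1.1 < 1) : bowlRad (bowlFun p) = (1 - p.1.1) / 4 := by
  have hr : 0 < (1 - p.1.1) / 4 := by linarith
  have hM0 : 0 ≤ rectRad p := le_max_of_le_left (abs_nonneg _)
  rw [bowlRad, rad_bowlFun hp, bowlFun]
  simp only
  rcases le_total (rectRad p) (1 / 2) with h | h
  · rw [max_eq_right h, min_eq_left (by linarith), max_eq_right]
    · ring
    · have : rectRad p / (1 / 2) ≤ 1 := by rw [div_le_one (by norm_num)]; exact h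
      nlinarith
  · have hpos : 0 < rectRad p := by linarith
    rw [max_eq_left h, div_self hpos.ne', mul_one, max_eq_left]
    have : min 1 (2 * (1 - rectRad p)) ≤ 1 := min_le_left _ _
    nlinarith

theorem bowlInv_bowlFun {p : Space} (hp : p.1.1 < 1) : bowlInv (bowlFun p) = p := by
  have hr : 0 < (1 - p.1.1) / 4 := by linarith
  have hM0 : 0 ≤ rectRad p := le_max_of_le_left (abs_nonneg _)
  have hr' : 0 < 1 - p.1.1 := by linarith
  rw [bowlInv, bowlRad_bowlFun hp, bowlFun]
  simp only
  rcases le_total (rectRad p) (1 / 2) with h | h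
  · rw [max_eq_right h, min_eq_left (by linarith)]
    ext
    · simp only; ring
    · simp only; field_simp; ring
    · simp only; field_simp; ring
  · have hpos : 0 < rectRad p := by linarith
    rw [max_eq_left h, min_eq_right (by linarith)]
    ext
    · simp only; ring
    · simp only; field_simp; ring
    · simp only; field_simp; ring

theorem bowlFun_bowlInv {p : Space} (hp : 0 < bowlRad p) : bowlFun (bowlInv p) = p := by
  set R := bowlRad p with hR
  have hd : (1 - p.2) / 2 ≤ R := le_max_right _ _
  have hq : rad p.1 ≤ R := le_max_left _ _
  set k := (1 - (1 - p.2) / (4 * R)) / R with hk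
  have hk0 : 0 < k := by
    refine div_pos ?_ hp
    rw [sub_pos, div_lt_one (by linarith)]; linarith
  have hM : rectRad (bowlInv p) = rad p.1 * k := by
    rw [rectRad, rad]
    simp only [bowlInv, ← hR, ← hk]
    rw [max_mul_of_nonneg _ _ hk0.le]
    congr 1
    · rw [← abs_of_pos hk0, ← abs_mul, abs_of_pos hk0]; congr 1; ring
    · rw [abs_mul, abs_of_pos hk0]
  have hRk : R * k = 1 - (1 - p.2) / (4 * R) := by rw [hk]; field_simp
  have h4 : (1 - p.2) / (4 * R) ≤ 1 / 2 := by rw [div_le_iff₀ (by linarith)]; linarith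
  have hexp : bowlFun (bowlInv p) = ((1 / 2 + R * ((p.1.1 - 1 / 2) * k / max (rad p.1 * k) (1 / 2)),
      1 / 2 + R * ((p.1.2 - 1 / 2) * k / max (rad p.1 * k) (1 / 2))),
      1 - 2 * R * min 1 (2 * (1 - rad p.1 * k))) := by
    rw [bowlFun, hM]
    simp only [bowlInv, ← hR, ← hk]
    congr 1
    · congr 1
      · congr 1; rw [show (1 - (1 - 4 * R)) / 4 = R by ring]; congr 2; ring
      · congr 1; rw [show (1 - (1 - 4 * R)) / 4 = R by ring]
    · ring
  rw [hexp]
  rcases max_choice (rad p.1) ((1 - p.2) / 2) with h | h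
  · have hrad : rad p.1 = R := h.symm
    rw [hrad, hRk, max_eq_left (by linarith)]
    have h5 : 0 < 1 - (1 - p.2) / (4 * R) := by linarith
    rw [← hRk] at h5 ⊢
    have h6 : min 1 (2 * (1 - R * k)) = 2 * (1 - R * k) := by
      rw [min_eq_right]; rw [hRk]; linarith
    rw [h6, hRk]
    ext
    · simp only; rw [← hRk]; field_simp; ring
    · simp only; rw [← hRk]; field_simp; ring
    · simp only; field_simp; ring
  · have hrad : (1 - p.2) / 2 = R := h.symm
    have h5 : R * k = 1 / 2 := by
      rw [hRk, show 1 - p.2 = 2 * R by linarith]; field_simp; norm_num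
    have h6 : rad p.1 * k ≤ 1 / 2 := by
      rw [← h5]; exact mul_le_mul_of_nonneg_right hq hk0.le
    have h7 : ∀ u : ℝ, R * (u * k / (1 / 2)) = u := fun u => by
      rw [show R * (u * k / (1 / 2)) = 2 * u * (R * k) by ring, h5]; ring
    rw [max_eq_right h6, min_eq_left (by linarith), h7, h7]
    ext
    · simp only; ring
    · simp only; ring
    · simp only; linarith

/-- The third part of the bending homeomorphism: the rectangles at the levels `ρ` are bent to
bowls. -/
def bowl : OpenPartialHomeomorph Space Space where
  toFun := bowlFun
  invFun := bowlInv
  source := {p | p.1.1 < 1}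
  target := {p | 0 < bowlRad p}
  map_source' p hp := by
    have hp' : p.1.1 < 1 := hp
    change 0 < bowlRad (bowlFun p)
    rw [bowlRad_bowlFun hp]; linarith
  map_target' p hp := by
    have hp' : 0 < bowlRad p := hp
    change 1 - 4 * bowlRad p < 1
    linarith
  left_inv' _ hp := bowlInv_bowlFun hp
  right_inv' _ hp := bowlFun_bowlInv hp
  open_source := isOpen_Iio.preimage (continuous_fst.comp continuous_fst)
  open_target := isOpen_Ioi.preimage continuous_bowlRad
  continuousOn_toFun := by
    have hc : Continuous rectRad := by unfold rectRad; fun_prop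
    have hi : Continuous fun p : Space => (max (rectRad p) (1 / 2))⁻¹ :=
      Continuous.inv₀ (by fun_prop) fun _ => (lt_max_of_lt_right (by norm_num)).ne'
    refine Continuous.continuousOn ?_
    unfold bowlFun
    simp only [div_eq_mul_inv _ (max _ _)]
    fun_prop
  continuousOn_invFun := by
    have hc := continuous_bowlRad
    have h1 : ContinuousOn (fun p : Space => (1 - (1 - p.2) / (4 * bowlRad p)) / bowlRad p)
        {p | 0 < bowlRad p} := by
      refine ContinuousOn.div (continuousOn_const.sub (ContinuousOn.div (by fun_prop)
        (by fun_prop) fun p hp => ?_)) hc.continuousOn fun p hp => ?_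
      · have : 0 < bowlRad p := hp
        positivity
      · have : 0 < bowlRad p := hp
        positivity
    unfold bowlInv
    fun_prop

/-- The bending homeomorphism, defined for `x < 1`. It maps the region `0 < x < 1`, `0 ≤ y, z ≤ 1`
to the part of the cube below `z = 1`, the planes of constant `x` being bent to bowls. -/
def bend {ε : ℝ} (hε : 0 < ε) : OpenPartialHomeomorph Space Space :=
  ((fold hε).trans (rescale hε)).transOpenPartialHomeomorph bowl

theorem bend_apply {ε : ℝ} (hε : 0 < ε) (p : Space) :
    bend hε p = bowlFun (rescale hε (fold hε p)) := rfl

end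

end BarNatan

namespace BarNatan

noncomputable section

/-- The region that is filled by the images of the cobordisms under the bending homeomorphism. -/
def bowlRegion : Set Space := {p | (0 < bowlRad p ∧ bowlRad p < 1 / 2) ∧ p.2 ≤ 1}

/-- The cube without its faces `x = 0` and `x = 1`. -/
def slab : Set Space :=
  {p | (0 < p.1.1 ∧ p.1.1 < 1) ∧ (0 ≤ p.1.2 ∧ p.1.2 ≤ 1) ∧ 0 ≤ p.2 ∧ p.2 ≤ 1}

/-- The size of the bowl to which the plane through `x` is bent. -/
def bowlSize (ε x : ℝ) : ℝ := (1 - ramp ε (1 / 2) (2 * x - 1)) / 4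

/-- The distance from the origin of the point of the half-disc that corresponds to `(y, z)`. -/
def halfLevel (ε y z : ℝ) : ℝ := max |halfS ε y z| (halfT ε y z)

theorem rad_lt_half {q : Plane} :
    rad q < 1 / 2 ↔ (0 < q.1 ∧ q.1 < 1) ∧ 0 < q.2 ∧ q.2 < 1 := by
  rw [rad_lt]; norm_num

theorem mem_openCube_iff {p : Space} :
    p ∈ openCube ↔ (0 < bowlRad p ∧ bowlRad p < 1 / 2) ∧ p.2 < 1 := by
  constructor
  · rintro ⟨hx, hy, hz⟩
    refine ⟨⟨lt_max_of_lt_right (by linarith), max_lt (rad_lt_half.2 ⟨hx, hy⟩) (by linarith)⟩, hz.2⟩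
  · rintro ⟨⟨-, h⟩, hz⟩
    obtain ⟨hx, hy⟩ := rad_lt_half.1 ((le_max_left _ _).trans_lt h)
    have := (le_max_right _ _).trans_lt h
    exact ⟨hx, hy, by linarith, hz⟩

theorem openCube_subset_slab : openCube ⊆ slab := fun _ h =>
  ⟨h.1, ⟨h.2.1.1.le, h.2.1.2.le⟩, h.2.2.1.le, h.2.2.2.le⟩

section

variable {ε : ℝ}

theorem bowlSize_strictAnti (hε : 0 < ε) : StrictAnti (bowlSize ε) := fun x x' h => by
  have := (inc_ramp (k := 1 / 2) hε (by norm_num)).1 (show 2 * x - 1 < 2 * x' - 1 by linarith)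
  rw [bowlSize, bowlSize]; linarith

theorem bowlSize_zero (hε : 0 < ε) (hε' : ε ≤ 1 / 16) : bowlSize ε 0 = 1 / 2 := by
  rw [bowlSize, show (2 : ℝ) * 0 - 1 = -1 by norm_num, ramp_neg_one hε (by linarith) (by norm_num)]
  norm_num

theorem bowlSize_one (hε : 0 < ε) (hε' : ε ≤ 1 / 16) : bowlSize ε 1 = 0 := by
  rw [bowlSize, show (2 : ℝ) * 1 - 1 = 1 by norm_num, ramp_one hε (by linarith) (by norm_num)]
  norm_num

theorem bowlSize_eq (hε : 0 < ε) (hε' : ε ≤ 1 / 16) {x : ℝ} (h0 : ε ≤ x)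
    (h1 : x ≤ 1 - ε) : bowlSize ε x = 3 / 8 - x / 4 := by
  rw [bowlSize, ramp_eq hε (by linarith) (by norm_num) (by norm_num) (by linarith) (by linarith)]
  ring

theorem bowlSize_bounds (hε : 0 < ε) (hε' : ε ≤ 1 / 16) {x : ℝ} :
    (0 < bowlSize ε x ↔ x < 1) ∧ (bowlSize ε x < 1 / 2 ↔ 0 < x) := by
  have h := @StrictAnti.lt_iff_gt _ _ _ _ _ (bowlSize_strictAnti hε)
  have h0 := @h x 0
  have h1 := @h 1 x
  rw [bowlSize_zero hε hε'] at h0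
  rw [bowlSize_one hε hε'] at h1
  exact ⟨h1, h0⟩

/-- The position `3 / 2 - 4 r` that is read off from the size `r` of a bowl is that of the plane in
the interval `[ε, 1 - ε]`; a plane outside of this interval is read off to be outside of it. -/
theorem bowlSize_out (hε : 0 < ε) (hε' : ε ≤ 1 / 16) {x : ℝ} :
    (x < ε → 3 / 2 - 4 * bowlSize ε x < ε) ∧
    (1 - ε < x → 1 - ε < 3 / 2 - 4 * bowlSize ε x) := by
  constructor
  · intro h
    have h1 := bowlSize_strictAnti hε h
    rw [bowlSize_eq hε hε' le_rfl (by linarith)] at h1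
    linarith
  · intro h
    have h1 := bowlSize_strictAnti hε h
    rw [bowlSize_eq hε hε' (by linarith) le_rfl] at h1
    linarith

theorem mem_bend_source (hε : 0 < ε) (hε' : ε ≤ 1 / 16) {p : Space} :
    p ∈ (bend hε).source ↔ p.1.1 < 1 := by
  rw [← (bowlSize_bounds hε hε').1, bowlSize]
  change ramp ε (1 / 2) (2 * p.1.1 - 1) < 1 ↔ _
  constructor <;> intro h <;> linarith

theorem bowlRad_bend (hε : 0 < ε) (hε' : ε ≤ 1 / 16) {p : Space} (hp : p.1.1 < 1) :
    bowlRad (bend hε p) = bowlSize ε p.1.1 := by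
  rw [← mem_bend_source hε hε'] at hp
  exact bowlRad_bowlFun hp

theorem rectRad_bend_le (hε : 0 < ε) (hε' : ε ≤ 1 / 16) {p : Space} :
    (rectRad (rescale hε (fold hε p)) ≤ 1 ↔ (0 ≤ p.1.2 ∧ p.1.2 ≤ 1) ∧ 0 ≤ p.2 ∧ p.2 ≤ 1) ∧
    (rectRad (rescale hε (fold hε p)) < 1 ↔ (0 < p.1.2 ∧ p.1.2 < 1) ∧ 0 < p.2 ∧ p.2 < 1) := by
  rw [fold_apply, rescale_apply, rectRad]
  simp only
  set ρ := ramp ε (1 / 2) (2 * p.1.1 - 1)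
  set T := ramp ε (gauge ρ / 64) (halfT ε p.1.2 p.2) with hT
  set S := ramp ε (slope ρ T) (halfS ε p.1.2 p.2) with hS
  have hε1 : ε ≤ 1 := by linarith
  obtain ⟨g0, g1⟩ := gauge_bounds ρ
  obtain ⟨s0, s1⟩ := slope_bounds ρ T
  have mT := (inc_ramp (k := gauge ρ / 64) hε (by positivity)).1
  have mS := (inc_ramp hε s0).1
  have T0 := ramp_zero (k := gauge ρ / 64) hε hε1
  have T1 := ramp_one (k := gauge ρ / 64) hε hε1 (by linarith)
  have S1 := ramp_one hε hε1 s1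
  have S2 := ramp_neg_one hε hε1 s1
  rw [max_le_iff, max_lt_iff, abs_le, abs_le, abs_lt, abs_lt, ← half_closed_iff hε hε1,
    ← half_open_iff hε hε1, abs_le, abs_lt]
  have e1 : 0 ≤ T ↔ 0 ≤ halfT ε p.1.2 p.2 := by rw [hT]; nth_rewrite 1 [← T0]; exact mT.le_iff_le
  have e2 : T ≤ 1 ↔ halfT ε p.1.2 p.2 ≤ 1 := by rw [hT]; nth_rewrite 1 [← T1]; exact mT.le_iff_le
  have e3 : 0 < T ↔ 0 < halfT ε p.1.2 p.2 := by rw [hT]; nth_rewrite 1 [← T0]; exact mT.lt_iff_lt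
  have e4 : T < 1 ↔ halfT ε p.1.2 p.2 < 1 := by rw [hT]; nth_rewrite 1 [← T1]; exact mT.lt_iff_lt
  have e5 : -1 ≤ S ↔ -1 ≤ halfS ε p.1.2 p.2 := by
    rw [hS]; nth_rewrite 1 [← S2]; exact mS.le_iff_le
  have e6 : S ≤ 1 ↔ halfS ε p.1.2 p.2 ≤ 1 := by rw [hS]; nth_rewrite 1 [← S1]; exact mS.le_iff_le
  have e7 : -1 < S ↔ -1 < halfS ε p.1.2 p.2 := by
    rw [hS]; nth_rewrite 1 [← S2]; exact mS.lt_iff_lt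
  have e8 : S < 1 ↔ halfS ε p.1.2 p.2 < 1 := by rw [hS]; nth_rewrite 1 [← S1]; exact mS.lt_iff_lt
  rw [← e1, ← e2, ← e3, ← e4, ← e5, ← e6, ← e7, ← e8]
  constructor <;> constructor <;> rintro ⟨⟨h1, h2⟩, h3, h4⟩ <;> refine ⟨⟨?_, ?_⟩, ?_, ?_⟩ <;>
    linarith

theorem bend_le_one (hε : 0 < ε) (hε' : ε ≤ 1 / 16) {p : Space} (hp : p.1.1 < 1) :
    ((bend hε p).2 ≤ 1 ↔ (0 ≤ p.1.2 ∧ p.1.2 ≤ 1) ∧ 0 ≤ p.2 ∧ p.2 ≤ 1) ∧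
    ((bend hε p).2 < 1 ↔ (0 < p.1.2 ∧ p.1.2 < 1) ∧ 0 < p.2 ∧ p.2 < 1) := by
  obtain ⟨h1, h2⟩ := rectRad_bend_le (p := p) hε hε'
  have hr := (bowlSize_bounds hε hε').1.2 hp
  have e : (bend hε p).2 =
      1 - 2 * bowlSize ε p.1.1 * min 1 (2 * (1 - rectRad (rescale hε (fold hε p)))) := by
    rw [bend_apply, bowlFun, bowlSize]
    change 1 - (1 - ramp ε (1 / 2) (2 * p.1.1 - 1)) / 2 * _ = _
    ring
  rw [← h1, ← h2, e]
  generalize rectRad (rescale hε (fold hε p)) = M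
  have key : ∀ u : ℝ, (0 ≤ 2 * bowlSize ε p.1.1 * u ↔ 0 ≤ u) ∧
      (0 < 2 * bowlSize ε p.1.1 * u ↔ 0 < u) := fun u =>
    ⟨mul_nonneg_iff_of_pos_left (by linarith), mul_pos_iff_of_pos_left (by linarith)⟩
  obtain ⟨k1, k2⟩ := key (min 1 (2 * (1 - M)))
  rw [le_min_iff] at k1
  rw [lt_min_iff] at k2
  constructor
  · rw [sub_le_self_iff, k1]
    constructor
    · intro h; linarith [h.2]
    · intro h; exact ⟨zero_le_one, by linarith⟩
  · rw [sub_lt_self_iff, k2]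
    constructor
    · intro h; linarith [h.2]
    · intro h; exact ⟨zero_lt_one, by linarith⟩

theorem bend_mem_bowlRegion (hε : 0 < ε) (hε' : ε ≤ 1 / 16) {p : Space} (hp : p.1.1 < 1) :
    bend hε p ∈ bowlRegion ↔ p ∈ slab := by
  change (_ ∧ _) ∧ _ ↔ (_ ∧ _) ∧ _
  rw [bowlRad_bend hε hε' hp, (bowlSize_bounds hε hε').1, (bowlSize_bounds hε hε').2,
    (bend_le_one hε hε' hp).1, and_comm (a := p.1.1 < 1)]

theorem bend_mem_openCube (hε : 0 < ε) (hε' : ε ≤ 1 / 16) {p : Space} (hp : p.1.1 < 1) :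
    bend hε p ∈ openCube ↔ p ∈ openCube := by
  rw [mem_openCube_iff, bowlRad_bend hε hε' hp, (bowlSize_bounds hε hε').1,
    (bowlSize_bounds hε hε').2, (bend_le_one hε hε' hp).2, and_comm (a := p.1.1 < 1)]
  rfl

theorem bend_symm_mem_slab (hε : 0 < ε) (hε' : ε ≤ 1 / 16) {p : Space} (hp : p ∈ bowlRegion) :
    (bend hε).symm p ∈ slab ∧ bend hε ((bend hε).symm p) = p := by
  have ht : p ∈ (bend hε).target := hp.1.1
  have h1 := (bend hε).right_inv ht
  have h2 := (mem_bend_source hε hε').1 ((bend hε).map_target ht)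
  exact ⟨(bend_mem_bowlRegion hε hε' h2).1 (h1.symm ▸ hp), h1⟩

/-- The explicit form of the last two parts of the bending homeomorphism on the essential part of
the half-disc. -/
theorem bowl_rescale (hε : 0 < ε) {ρ s t : ℝ} (hε1 : ε ≤ 1) (h1 : 1 / 8 ≤ (1 - ρ) / 4)
    (h2 : (1 - ρ) / 4 ≤ 3 / 8)
    (hs : |s| ≤ 1 - ε) (ht : 0 ≤ t) (ht' : t ≤ 1 - ε) :
    bowlFun (rescale hε ((ρ, s), t)) =
      ((1 / 2 - (1 - ρ) / 4, 1 / 2 + s / 8), 1 - t / 8) := by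
  set r := (1 - ρ) / 4 with hr
  have r0 : 0 < r := by linarith
  have hg : gauge ρ = 1 / r := by rw [gauge, max_eq_left h1, one_div]
  obtain ⟨g0, g1⟩ := gauge_bounds ρ
  have hT : ramp ε (gauge ρ / 64) t = t / (64 * r) := by
    rw [ramp_eq hε hε1 (by positivity) (by linarith) (by linarith) ht', hg]
    field_simp
  have hT0 : 0 ≤ t / (64 * r) := by positivity
  have hT1 : t / (64 * r) ≤ 1 / 8 := by rw [div_le_iff₀ (by positivity)]; linarith
  obtain ⟨s0, s1⟩ := slope_bounds ρ (t / (64 * r))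
  have hS : ramp ε (slope ρ (t / (64 * r))) s = (1 - 2 * (t / (64 * r))) * (s / (8 * r)) := by
    rw [ramp_eq hε hε1 s0 s1 (abs_le.1 hs).1 (abs_le.1 hs).2, slope, hg,
      min_eq_right (by linarith), max_eq_right hT0]
    field_simp
  have hM : rectRad (rescale hε ((ρ, s), t)) = 1 - 2 * (t / (64 * r)) := by
    rw [rescale_apply, rectRad]
    simp only
    rw [hT, hS, abs_of_nonpos (by linarith), max_eq_left]
    · ring
    · rw [abs_mul, abs_of_nonneg (by linarith : 0 ≤ 1 - 2 * (t / (64 * r))), abs_div,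
        abs_of_pos (by linarith : 0 < 8 * r)]
      have : |s| / (8 * r) ≤ 1 := by rw [div_le_one (by linarith)]; linarith
      have := mul_le_of_le_one_right (by linarith : 0 ≤ 1 - 2 * (t / (64 * r))) this
      linarith
  rw [bowlFun, hM, max_eq_left (by linarith), min_eq_right (by linarith), rescale_apply]
  simp only
  rw [hT, hS, ← hr]
  have h3 : 1 - 2 * (t / (64 * r)) ≠ 0 := by linarith
  have h4 : (-1 + 2 * (t / (64 * r))) / (1 - 2 * (t / (64 * r))) = -1 := by
    rw [div_eq_iff h3]; ring
  rw [h4, mul_div_cancel_left₀ _ h3]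
  ext
  · simp only; ring
  · simp only; field_simp
  · simp only; rw [show (1 - ρ) / 2 = 2 * r by rw [hr]; ring]; field_simp; ring

/-- The explicit form of the bending homeomorphism away from the boundary. -/
theorem bend_eq (hε : 0 < ε) (hε' : ε ≤ 1 / 16) {p : Space} (h0 : ε ≤ p.1.1) (h1 : p.1.1 ≤ 1 - ε)
    (hl : halfLevel ε p.1.2 p.2 ≤ 1 - ε) (ht : 0 ≤ halfT ε p.1.2 p.2) :
    bend hε p = ((1 / 8 + p.1.1 / 4, 1 / 2 + halfS ε p.1.2 p.2 / 8),
      1 - halfT ε p.1.2 p.2 / 8) := by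
  have hb := bowlSize_eq hε hε' h0 h1
  rw [bowlSize] at hb
  rw [bend_apply, fold_apply, bowl_rescale hε (by linarith) (by rw [hb]; linarith)
    (by rw [hb]; linarith) ((le_max_left _ _).trans hl) ht ((le_max_right _ _).trans hl), hb]
  congr 2
  ring

/-- The level, at the points of the left sides of the bowls. -/
theorem halfLevel_of_bend (hε : 0 < ε) (hε' : ε ≤ 1 / 16) {p : Space} (h0 : ε ≤ p.1.1)
    (h1 : p.1.1 ≤ 1 - ε)
    (hd : (bend hε p).2 ≤ 1) (hx : (bend hε p).1.1 - 1 / 2 = -bowlSize ε p.1.1)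
    (hl : max (8 * |(bend hε p).1.2 - 1 / 2|) (8 * (1 - (bend hε p).2)) ≤ 1 - ε) :
    halfLevel ε p.1.2 p.2 =
      max (8 * |(bend hε p).1.2 - 1 / 2|) (8 * (1 - (bend hε p).2)) := by
  set q := bend hε p with hq
  obtain ⟨l1, l2⟩ := max_le_iff.1 hl
  have hb := bowlSize_eq hε hε' h0 h1
  -- the point with the same image that is provided by the explicit formula
  have e1 : bowlFun (rescale hε ((ramp ε (1 / 2) (2 * p.1.1 - 1), 8 * (q.1.2 - 1 / 2)),
      8 * (1 - q.2))) = q := by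
    have hb' := hb
    rw [bowlSize] at hb'
    rw [bowl_rescale hε (by linarith) (by rw [hb']; linarith) (by rw [hb']; linarith)
      (by rw [abs_mul, abs_of_pos (by norm_num : (0 : ℝ) < 8)]; exact l1) (by linarith) l2]
    rw [hb] at hx
    ext
    · simp only; rw [hb']; linarith
    · simp only; ring
    · simp only; ring
  have hsrc : (ramp ε (1 / 2) (2 * p.1.1 - 1)) < 1 := by
    have := bowlSize_eq hε hε' h0 h1
    rw [bowlSize] at this; linarith
  have e2 : rescale hε (fold hε p) = rescale hε ((ramp ε (1 / 2) (2 * p.1.1 - 1),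
      8 * (q.1.2 - 1 / 2)), 8 * (1 - q.2)) := by
    have i1 := bowlInv_bowlFun (p := rescale hε (fold hε p)) hsrc
    have i2 := bowlInv_bowlFun (p := rescale hε ((ramp ε (1 / 2) (2 * p.1.1 - 1),
      8 * (q.1.2 - 1 / 2)), 8 * (1 - q.2))) hsrc
    rw [e1] at i2
    rw [← i1, ← i2, hq, bend_apply]
  have e3 := (rescale hε).injective e2
  rw [fold_apply] at e3
  have e4 := congrArg (fun p : Space => p.1.2) e3
  have e5 := congrArg (fun p : Space => p.2) e3
  simp only at e4 e5
  rw [halfLevel, e4, e5, abs_mul, abs_of_pos (by norm_num : (0 : ℝ) < 8)]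

end

/-- The reflection of space in the second coordinate. -/
def reflY : Space ≃ₜ Space := thick flip

/-- The reflection of space in the third coordinate. -/
def reflZ : Space ≃ₜ Space where
  toFun p := (p.1, 1 - p.2)
  invFun p := (p.1, 1 - p.2)
  left_inv p := by ext <;> simp
  right_inv p := by ext <;> simp
  continuous_toFun := by fun_prop
  continuous_invFun := by fun_prop

theorem reflY_apply (p : Space) : reflY p = ((p.1.1, 1 - p.1.2), p.2) := rfl
theorem reflZ_apply (p : Space) : reflZ p = (p.1, 1 - p.2) := rfl

/-- The bending homeomorphism turns the reflection in the third coordinate into the reflection in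
the second one. -/
theorem bend_reflZ {ε : ℝ} (hε : 0 < ε) (hε' : ε ≤ 1) (p : Space) :
    bend hε (reflZ p) = reflY (bend hε p) := by
  rw [bend_apply, bend_apply, reflZ_apply, fold_apply, fold_apply, rescale_apply, rescale_apply]
  simp only
  rw [halfS_symm, halfT_symm, ramp_neg hε hε', reflY_apply, bowlFun, bowlFun, rectRad, rectRad]
  simp only [abs_neg]
  ext
  · rfl
  · simp only; ring
  · rfl

end

end BarNatan

namespace BarNatan

noncomputable section

/-! ### The image of the boundary of the cube -/

/-- The distance from the origin of the half-disc, read off from the image under the bending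
homeomorphism: the half-disc of radius less than one is mapped to the left side of the bowl. -/
def leftLevel (q : Space) : ℝ :=
  open scoped Classical in
  if q.1.1 - 1 / 2 = -bowlRad q ∧ max (8 * |q.1.2 - 1 / 2|) (8 * (1 - q.2)) < 1 then
    max (8 * |q.1.2 - 1 / 2|) (8 * (1 - q.2)) else 1

/-- A subset of the square is a product near the boundary of the square, like a diagram or a
horizontal slice of a cobordism. -/
structure IsSlice (ε : ℝ) (m n : ℕ) (A : Set Plane) : Prop where
  mem_square : ∀ p ∈ A, 0 ≤ p.2 ∧ p.2 ≤ 1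
  collar : ∀ p : Plane, ((p.1 < ε ∨ 1 - ε < p.1) → p ∉ A) ∧
    (0 ≤ p.2 → p.2 < ε → (p ∈ A ↔ p.1 ∈ pts n)) ∧ (1 - ε < p.2 → p.2 ≤ 1 → (p ∈ A ↔ p.1 ∈ pts m))

section

variable {ε : ℝ} {m n : ℕ} {A B : Set Plane}

theorem IsSlice.mono (h : IsSlice ε m n A) {δ : ℝ} (hδ : δ ≤ ε) : IsSlice δ m n A := by
  refine ⟨h.mem_square, fun p => ?_⟩
  obtain ⟨hx, hy, hy'⟩ := h.collar p
  refine ⟨fun hp => hx (hp.imp ?_ ?_), fun h0 h1 => hy h0 (by linarith),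
    fun h0 h1 => hy' (by linarith) h1⟩ <;> intro <;> linarith

theorem IsSlice.mem_x (h : IsSlice ε m n A) {p : Plane} (hp : p ∈ A) :
    ε ≤ p.1 ∧ p.1 ≤ 1 - ε := by
  constructor <;> by_contra hc <;> rw [not_le] at hc
  · exact (h.collar p).1 (Or.inl hc) hp
  · exact (h.collar p).1 (Or.inr hc) hp

theorem IsSlice.pts_bottom (h : IsSlice ε m n A) (hε : 0 < ε) {x : ℝ} (hx : x ∈ pts n) :
    ε ≤ x ∧ x ≤ 1 - ε :=
  h.mem_x (((h.collar (x, 0)).2.1 le_rfl hε).2 hx)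

theorem IsSlice.pts_top (h : IsSlice ε m n A) (hε : 0 < ε) {x : ℝ} (hx : x ∈ pts m) :
    ε ≤ x ∧ x ≤ 1 - ε :=
  h.mem_x (((h.collar (x, 1)).2.2 (by simp [hε]) le_rfl).2 hx)

theorem leftLevel_le (q : Space) : leftLevel q ≤ 1 := by
  unfold leftLevel
  split_ifs with h
  · exact h.2.le
  · exact le_rfl

theorem leftLevel_bend (hε : 0 < ε) (hε' : ε ≤ 1 / 16) {p : Space} (hp : p ∈ slab)
    (h0 : ε ≤ p.1.1) (h1 : p.1.1 ≤ 1 - ε) :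
    (p.1.2 ≤ ε → 0 ≤ leftLevel (bend hε p) ∧ leftLevel (bend hε p) ≤ ε) ∧
      (ε ≤ p.1.2 → p.1.2 ≤ 1 - ε → leftLevel (bend hε p) = p.1.2) ∧
      (1 - ε ≤ p.1.2 → 1 - ε ≤ leftLevel (bend hε p)) := by
  obtain ⟨hx, hy, hz⟩ := hp
  have hR := bowlRad_bend hε hε' hx.2
  have hb := bowlSize_eq hε hε' h0 h1
  have ht := halfT_nonneg hε hy.1 hz
  have exact_level : halfLevel ε p.1.2 p.2 ≤ 1 - ε →
      leftLevel (bend hε p) = halfLevel ε p.1.2 p.2 := by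
    intro hl
    have e := bend_eq hε hε' h0 h1 hl ht
    have e2 : max (8 * |(bend hε p).1.2 - 1 / 2|) (8 * (1 - (bend hε p).2)) =
        halfLevel ε p.1.2 p.2 := by
      rw [e, halfLevel]
      simp only
      congr 1
      · rw [add_sub_cancel_left, abs_div, abs_of_pos (by norm_num : (0 : ℝ) < 8)]; ring
      · ring
    rw [leftLevel, if_pos, e2]
    refine ⟨?_, by rw [e2]; linarith⟩
    rw [hR, hb, e]
    simp only
    ring
  refine ⟨fun h => ?_, fun h h' => ?_, fun h => ?_⟩
  · have hl := half_level_le hε hy.1 h hz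
    rw [exact_level (hl.trans (by linarith))]
    exact ⟨le_max_of_le_left (abs_nonneg _), hl⟩
  · have hl := half_level_eq hε h hz
    rw [exact_level (by rw [halfLevel, hl]; exact h')]
    exact hl
  · have hl : halfLevel ε p.1.2 p.2 = p.1.2 := half_level_eq hε (by linarith) hz
    by_contra hc
    rw [not_le, leftLevel] at hc
    split_ifs at hc with hi
    · have := halfLevel_of_bend hε hε' h0 h1 ((bend_le_one hε hε' hx.2).1.2 ⟨hy, hz⟩)
        (hR ▸ hi.1) hc.le
      linarith
    · linarith

/-- The image of `a × [0, 1]` under the bending homeomorphism, in terms that are independent of the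
parameter of the latter. -/
def coevSet (A : Set Plane) : Set Space :=
  {q | q ∈ bowlRegion ∧ (3 / 2 - 4 * bowlRad q, leftLevel q) ∈ A}

theorem bend_mem_coevSet (hε : 0 < ε) (hε' : ε ≤ 1 / 16) (hA : IsSlice (2 * ε) m n A) {p : Space}
    (hp : p ∈ slab) : bend hε p ∈ coevSet A ↔ p.1 ∈ A := by
  have hreg := (bend_mem_bowlRegion hε hε' hp.1.2).2 hp
  refine (and_iff_right hreg).trans ?_
  have hR := bowlRad_bend hε hε' hp.1.2
  obtain ⟨o1, o2⟩ := bowlSize_out (x := p.1.1) hε hε'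
  rw [hR]
  by_cases h0 : ε ≤ p.1.1
  swap
  · exact iff_of_false ((hA.collar _).1 (Or.inl (by simp only; linarith [o1 (by linarith)])))
      ((hA.collar _).1 (Or.inl (by linarith)))
  by_cases h1 : p.1.1 ≤ 1 - ε
  swap
  · exact iff_of_false ((hA.collar _).1 (Or.inr (by simp only; linarith [o2 (by linarith)])))
      ((hA.collar _).1 (Or.inr (by linarith)))
  rw [bowlSize_eq hε hε' h0 h1, show 3 / 2 - 4 * (3 / 8 - p.1.1 / 4) = p.1.1 by ring]
  obtain ⟨l1, l2, l3⟩ := leftLevel_bend hε hε' hp h0 h1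
  obtain ⟨-, hy, -⟩ := hp
  rcases le_total p.1.2 ε with h | h
  · rw [(hA.collar _).2.1 (l1 h).1 (by simp only; linarith [(l1 h).2]),
      (hA.collar p.1).2.1 hy.1 (by linarith)]
  rcases le_total p.1.2 (1 - ε) with h' | h'
  · rw [l2 h h']
  · rw [(hA.collar _).2.2 (by simp only; linarith [l3 h']) (leftLevel_le _),
      (hA.collar p.1).2.2 (by linarith) hy.2]

/-- The closed-up planar set that is made up from `B` on top of the reflection of `A`. -/
def glued (m : ℕ) (B A : Set Plane) : Set Plane :=
  box '' (up '' B ∪ dn '' (flip '' A)) ∪ arcs m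

/-- A subset of the cube with bottom `A` and top `B`, as seen near the boundary of the cube. -/
def Germ (ε : ℝ) (m n : ℕ) (A B : Set Plane) (p : Space) : Prop :=
  (p.2 < 1 / 4 ∧ p.1 ∈ A) ∨ (3 / 4 < p.2 ∧ p.1 ∈ B) ∨ (p.1.2 ≤ ε ∧ p.1.1 ∈ pts n) ∨
    (1 - ε ≤ p.1.2 ∧ p.1.1 ∈ pts m)

theorem germ_iff (hε : 0 < ε) (hε' : ε ≤ 1 / 16) (hA : IsSlice (2 * ε) m n A)
    (hB : IsSlice (2 * ε) m n B) {p : Space} (hp : p ∈ slab) :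
    (p.2 < 1 / 4 → (Germ ε m n A B p ↔ p.1 ∈ A)) ∧ (3 / 4 < p.2 → (Germ ε m n A B p ↔ p.1 ∈ B)) ∧
      (p.1.2 ≤ ε → (Germ ε m n A B p ↔ p.1.1 ∈ pts n)) ∧
      (1 - ε ≤ p.1.2 → (Germ ε m n A B p ↔ p.1.1 ∈ pts m)) ∧
      (Germ ε m n A B p → 2 * ε ≤ p.1.1 ∧ p.1.1 ≤ 1 - 2 * ε) := by
  obtain ⟨hx, hy, hz⟩ := hp
  obtain ⟨-, a1, a2⟩ := hA.collar p.1
  obtain ⟨-, b1, b2⟩ := hB.collar p.1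
  have hε2 : 0 < 2 * ε := by linarith
  refine ⟨fun h => ⟨?_, fun h' => Or.inl ⟨h, h'⟩⟩, fun h => ⟨?_, fun h' => Or.inr (Or.inl ⟨h, h'⟩)⟩,
    fun h => ⟨?_, fun h' => Or.inr (Or.inr (Or.inl ⟨h, h'⟩))⟩,
    fun h => ⟨?_, fun h' => Or.inr (Or.inr (Or.inr ⟨h, h'⟩))⟩, ?_⟩
  · rintro (⟨h1, h2⟩ | ⟨h1, h2⟩ | ⟨h1, h2⟩ | ⟨h1, h2⟩)
    · exact h2
    · linarith
    · exact (a1 hy.1 (by linarith)).2 h2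
    · exact (a2 (by linarith) hy.2).2 h2
  · rintro (⟨h1, h2⟩ | ⟨h1, h2⟩ | ⟨h1, h2⟩ | ⟨h1, h2⟩)
    · linarith
    · exact h2
    · exact (b1 hy.1 (by linarith)).2 h2
    · exact (b2 (by linarith) hy.2).2 h2
  · rintro (⟨h1, h2⟩ | ⟨h1, h2⟩ | ⟨h1, h2⟩ | ⟨h1, h2⟩)
    · exact (a1 hy.1 (by linarith)).1 h2
    · exact (b1 hy.1 (by linarith)).1 h2
    · exact h2
    · linarith
  · rintro (⟨h1, h2⟩ | ⟨h1, h2⟩ | ⟨h1, h2⟩ | ⟨h1, h2⟩)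
    · exact (a2 (by linarith) hy.2).1 h2
    · exact (b2 (by linarith) hy.2).1 h2
    · linarith
    · exact h2
  · rintro (⟨h1, h2⟩ | ⟨h1, h2⟩ | ⟨h1, h2⟩ | ⟨h1, h2⟩)
    · exact hA.mem_x h2
    · exact hB.mem_x h2
    · exact hA.pts_bottom hε2 h2
    · exact hA.pts_top hε2 h2

theorem mem_updn {q : Plane} : q ∈ up '' B ∪ dn '' (flip '' A) ↔
    (q.1, 2 * q.2 - 1) ∈ B ∨ (q.1, 1 - 2 * q.2) ∈ A := by
  rw [Set.mem_union, mem_up, mem_dn, mem_flip]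

theorem updn_bounds (hA : IsSlice (2 * ε) m n A) (hB : IsSlice (2 * ε) m n B) :
    ∀ p ∈ up '' B ∪ dn '' (flip '' A), (2 * ε ≤ p.1 ∧ p.1 ≤ 1 - 2 * ε) ∧ 0 ≤ p.2 ∧ p.2 ≤ 1 := by
  intro p hp
  rcases mem_updn.1 hp with h | h
  · have h1 := hB.mem_square _ h
    simp only at h1
    exact ⟨(hB.mem_x h :), by linarith, by linarith⟩
  · have h1 := hA.mem_square _ h
    simp only at h1
    exact ⟨(hA.mem_x h :), by linarith, by linarith⟩

theorem updn_collar (hε : 0 < ε) (hε' : ε ≤ 1 / 16) (hA : IsSlice (2 * ε) m n A)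
    (hB : IsSlice (2 * ε) m n B) (p : Plane) :
    ((p.1 < ε ∨ 1 - ε < p.1) → p ∉ up '' B ∪ dn '' (flip '' A)) ∧
      (0 ≤ p.2 → p.2 < ε → (p ∈ up '' B ∪ dn '' (flip '' A) ↔ p.1 ∈ pts m)) ∧
      (1 - ε < p.2 → p.2 ≤ 1 → (p ∈ up '' B ∪ dn '' (flip '' A) ↔ p.1 ∈ pts m)) := by
  refine ⟨fun h hm => ?_, fun h0 h1 => ?_, fun h0 h1 => ?_⟩
  · have := (updn_bounds hA hB p hm).1
    rcases h with h | h <;> linarith [this.1, this.2]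
  · rw [mem_updn, or_iff_right]
    · exact (hA.collar _).2.2 (by simp only; linarith) (by simp only; linarith)
    · intro h
      have := (hB.mem_square _ h).1
      simp only at this; linarith
  · rw [mem_updn, or_iff_left]
    · exact (hB.collar _).2.2 (by simp only; linarith) (by simp only; linarith)
    · intro h
      have := (hA.mem_square _ h).1
      simp only at this; linarith

/-- The points of the closed-up planar set lie on the boundaries of the squares to which the planes
through the points of `[2 ε, 1 - 2 ε]` are bent. -/
theorem exists_of_mem_glued (hε : 0 < ε) (hA : IsSlice (2 * ε) m n A) (hB : IsSlice (2 * ε) m n B)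
    {q : Plane} (hq : q ∈ glued m B A) :
    ∃ u : ℝ, (2 * ε ≤ u ∧ u ≤ 1 - 2 * ε) ∧ rad q = 3 / 8 - u / 4 := by
  rcases hq with hq | ⟨-, u, hu, hr⟩
  · rw [mem_box] at hq
    obtain ⟨hx, hy⟩ := updn_bounds hA hB _ hq
    simp only at hx hy
    refine ⟨_, hx, ?_⟩
    rw [rad_of_mem_box ⟨by linarith, by linarith⟩ ⟨by linarith, by linarith⟩]
    ring
  · exact ⟨u, hA.pts_top (by linarith) hu, hr⟩

/-- The image of the boundary of the cube under the bending homeomorphism. -/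
theorem bend_mem_glued_iff (hε : 0 < ε) (hε' : ε ≤ 1 / 16) (hA : IsSlice (2 * ε) m n A)
    (hB : IsSlice (2 * ε) m n B) {p : Space} (hp : p ∈ slab)
    (hd : 1 - (bend hε p).2 < ε / 16) :
    (bend hε p).1 ∈ glued m B A ↔ Germ ε m n A B p := by
  have hg := germ_iff hε hε' hA hB hp
  have hR := bowlRad_bend hε hε' hp.1.2
  have hrange : (bend hε p).1 ∈ glued m B A → 2 * ε ≤ p.1.1 ∧ p.1.1 ≤ 1 - 2 * ε := by
    intro h
    obtain ⟨u, hu, hr⟩ := exists_of_mem_glued hε hA hB h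
    rw [bowlRad, hr, max_eq_left (by linarith),
      ← bowlSize_eq hε hε' (by linarith) (by linarith)] at hR
    rw [← (bowlSize_strictAnti hε).injective hR]
    exact hu
  by_cases hx : 2 * ε ≤ p.1.1 ∧ p.1.1 ≤ 1 - 2 * ε
  swap
  · exact iff_of_false (fun h => hx (hrange h)) fun h => hx (hg.2.2.2.2 h)
  obtain ⟨h0, h1⟩ := hx
  have hx0 : ε ≤ p.1.1 := by linarith
  have hx1 : p.1.1 ≤ 1 - ε := by linarith
  obtain ⟨-, hy, hz⟩ := hp
  rw [bowlSize_eq hε hε' hx0 hx1] at hR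
  have hrad : rad (bend hε p).1 = 3 / 8 - p.1.1 / 4 := by
    rcases max_choice (rad (bend hε p).1) ((1 - (bend hε p).2) / 2) with h | h
    · rw [← hR]; exact h.symm
    · rw [bowlRad, h] at hR; linarith
  have ht := halfT_nonneg hε hy.1 hz
  -- the points of the left sides of the bowls, at the position `s` of the half-disc
  have left : halfLevel ε p.1.2 p.2 ≤ 1 - ε → ((bend hε p).1 ∈ glued m B A ↔
      (p.1.1, halfS ε p.1.2 p.2) ∈ B ∨ (p.1.1, -halfS ε p.1.2 p.2) ∈ A) := by
    intro hl
    have hs := abs_le.1 ((le_max_left _ _).trans hl : |halfS ε p.1.2 p.2| ≤ 1 - ε)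
    rw [bend_eq hε hε' hx0 hx1 hl ht]
    have hob : (1 / 8 + p.1.1 / 4, 1 / 2 + halfS ε p.1.2 p.2 / 8) ∈ openBox :=
      ⟨⟨by simp only; linarith, by simp only; linarith⟩, by simp only; linarith,
        by simp only; linarith⟩
    rw [glued, mem_box_openBox hob, mem_box, mem_updn]
    simp only
    rw [show 4 * (1 / 8 + p.1.1 / 4) - 1 / 2 = p.1.1 by ring,
      show 2 * (4 * (1 / 2 + halfS ε p.1.2 p.2 / 8) - 3 / 2) - 1 = halfS ε p.1.2 p.2 by ring,
      show 1 - 2 * (4 * (1 / 2 + halfS ε p.1.2 p.2 / 8) - 3 / 2) = -halfS ε p.1.2 p.2 by ring]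
  rcases le_total p.1.2 ε with hy1 | hy1
  · have hl := half_level_le hε hy.1 hy1 hz
    have hs := abs_le.1 ((le_max_left _ _).trans hl : |halfS ε p.1.2 p.2| ≤ ε)
    rw [left (hl.trans (by linarith)), hg.2.2.1 hy1]
    constructor
    · rintro (h | h)
      · exact ((hB.collar _).2.1 (hB.mem_square _ h).1 (by simp only; linarith)).1 h
      · exact ((hA.collar _).2.1 (hA.mem_square _ h).1 (by simp only; linarith)).1 h
    · intro h
      rcases le_total 0 (halfS ε p.1.2 p.2) with h' | h'
      · exact Or.inl (((hB.collar _).2.1 h' (by simp only; linarith)).2 h)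
      · exact Or.inr (((hA.collar _).2.1 (by simp only; linarith) (by simp only; linarith)).2 h)
  rcases le_total p.1.2 (1 - ε) with hy2 | hy2
  · have hl : halfLevel ε p.1.2 p.2 = p.1.2 := half_level_eq hε hy1 hz
    have hl' : halfLevel ε p.1.2 p.2 ≤ 1 - ε := hl.le.trans hy2
    have ht2 : halfT ε p.1.2 p.2 < ε / 2 := by
      rw [bend_eq hε hε' hx0 hx1 hl' ht] at hd
      simp only at hd
      linarith
    rw [left hl']
    rcases le_total p.2 (1 / 4) with hz1 | hz1
    · obtain ⟨e1, e2⟩ := half_bottom hε hy1 hz.1 hz1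
      rw [e2] at ht2
      rw [e1, hg.1 (by nlinarith), neg_neg, or_iff_right]
      intro h
      have := (hB.mem_square _ h).1
      simp only at this; linarith
    rcases le_total (3 / 4) p.2 with hz2 | hz2
    · obtain ⟨e1, e2⟩ := half_top hε hy1 hz2 hz.2
      rw [e2] at ht2
      rw [e1, hg.2.1 (by nlinarith), or_iff_left]
      intro h
      have := (hA.mem_square _ h).1
      simp only at this; linarith
    · have := half_middle hε hy1 hz1 hz2
      linarith
  · rw [hg.2.2.2.1 hy2, glued, closure_local hε
      (fun p hp => by
        have := updn_bounds hA hB p hp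
        exact ⟨⟨by linarith, by linarith⟩, this.2⟩) (updn_collar hε hε' hA hB), hrad]
    · constructor
      · rintro ⟨t, ht, he⟩
        rwa [show p.1.1 = t by linarith]
      · intro h
        exact ⟨_, h, rfl⟩
    · by_contra hc
      simp only [not_or, not_lt, not_not] at hc
      obtain ⟨c1, c2, c3⟩ := hc
      have hl3 := (leftLevel_bend hε hε' (p := p) ⟨⟨by linarith, by linarith⟩, hy, hz⟩
        hx0 hx1).2.2 hy2
      have e1 : (bend hε p).1.1 - 1 / 2 = -bowlRad (bend hε p) := by
        rw [hR, ← hrad, rad_of_mem_box ⟨c3.1.1.le, c3.1.2.le⟩ ⟨c3.2.1.le, c3.2.2.le⟩]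
        ring
      have e2 : 8 * |(bend hε p).1.2 - 1 / 2| ≤ 1 - 2 * ε := by
        have : |(bend hε p).1.2 - 1 / 2| ≤ (1 - 2 * ε) / 8 := by
          rw [abs_le]; constructor <;> linarith
        linarith
      have e3 : max (8 * |(bend hε p).1.2 - 1 / 2|) (8 * (1 - (bend hε p).2)) ≤ 1 - 2 * ε :=
        max_le e2 (by linarith)
      rw [leftLevel, if_pos ⟨e1, by linarith⟩] at hl3
      linarith

end

end

end BarNatan

namespace BarNatan

noncomputable section

/-! ### Bending cobordisms -/

theorem LocallyFlatAt.image_partial {S : Set Space} (f : OpenPartialHomeomorph Space Space)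
    (hS : S ⊆ f.source) {p : Space} (hp : p ∈ f.source) (h : LocallyFlatAt S p) :
    LocallyFlatAt (f '' S) (f p) := by
  obtain ⟨e, hpe, he⟩ := h
  refine ⟨f.symm.trans e, ?_, fun q hq => ?_⟩
  · rw [OpenPartialHomeomorph.trans_source]
    exact ⟨f.map_source hp, by rw [Set.mem_preimage, f.left_inv hp]; exact hpe⟩
  · rw [OpenPartialHomeomorph.trans_source] at hq
    obtain ⟨hq1, hq2⟩ := hq
    rw [OpenPartialHomeomorph.trans_apply, ← he _ hq2]
    constructor
    · rintro ⟨u, hu, rfl⟩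
      rwa [f.left_inv (hS hu)]
    · exact fun h => ⟨_, h, f.right_inv hq1⟩

section

variable {m n : ℕ} {a b : Diagram m n} {ε : ℝ}

theorem Cobordism.isCompact (S : Cobordism a b) : IsCompact S.carrier :=
  (isCompact_core 0).of_isClosed_subset S.isClosed S.subset_core

theorem Cobordism.subset_slab (S : Cobordism a b) : S.carrier ⊆ slab := fun p hp =>
  ⟨S.mem_x hp, S.mem_cube p hp⟩

theorem Diagram.isSlice_of_collar (a : Diagram m n) : ∃ ε : ℝ, 0 < ε ∧ IsSlice ε m n a.carrier := by
  obtain ⟨ε, hε, h⟩ := a.collar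
  exact ⟨ε, hε, a.mem_square, h⟩

/-- Close to the boundary of the cube, a cobordism is given by its ends. -/
theorem Cobordism.Collared.mem_iff_germ {S : Cobordism a b} {δ : ℝ} (hS : S.Collared δ)
    (hε : 0 < ε) (hε' : ε ≤ 1 / 16) (ha : IsSlice (2 * ε) m n a.carrier)
    (hb : IsSlice (2 * ε) m n b.carrier) (hδ : δ ≤ ε) {p : Space} (hp : p ∈ slab)
    (hc : p ∉ core δ) : p ∈ S.carrier ↔ Germ ε m n a.carrier b.carrier p := by
  obtain ⟨g1, g2, g3, g4, g5⟩ := germ_iff hε hε' ha hb hp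
  obtain ⟨h1, h2, h3, h4, h5⟩ := hS p
  obtain ⟨-, hy, hz⟩ := hp
  by_cases hx : p.1.1 < δ ∨ 1 - δ < p.1.1
  · refine iff_of_false (h1 hx) fun h => ?_
    have := g5 h
    rcases hx with hx | hx <;> linarith [this.1, this.2]
  by_cases hy0 : p.1.2 < δ
  · rw [h2 hz.1 hz.2 hy.1 hy0, g3 (by linarith)]
  by_cases hy1 : 1 - δ < p.1.2
  · rw [h3 hz.1 hz.2 hy1 hy.2, g4 (by linarith)]
  by_cases hz0 : p.2 < δ
  · rw [h4 hz.1 hz0, g1 (by linarith)]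
  by_cases hz1 : 1 - δ < p.2
  · rw [h5 hz1 hz.2, g2 (by linarith)]
  · simp only [not_or, not_lt] at hx hy0 hy1 hz0 hz1
    exact absurd ⟨hx, ⟨hy0, hy1⟩, hz0, hz1⟩ hc

theorem slab_subset_source (hε : 0 < ε) (hε' : ε ≤ 1 / 16) : slab ⊆ (bend hε).source :=
  fun _ hp => (mem_bend_source hε hε').2 hp.1.2

theorem bowlRegion_subset_target (hε : 0 < ε) : bowlRegion ⊆ (bend hε).target :=
  fun _ hp => hp.1.1

theorem rad_bounds_of_mem_glued (hε : 0 < ε) {A B : Set Plane} (hA : IsSlice (2 * ε) m n A)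
    (hB : IsSlice (2 * ε) m n B) {q : Plane} (hq : q ∈ glued m B A) :
    1 / 8 < rad q ∧ rad q < 3 / 8 := by
  obtain ⟨u, hu, hr⟩ := exists_of_mem_glued hε hA hB hq
  constructor <;> linarith [hu.1, hu.2]

/-- The closed-up diagram `Tr (b ⊗ aᵛ)`. -/
abbrev closeUp (a b : Diagram m n) : Diagram 0 0 := (b.tens a.dual).tr

/-- The image of a cobordism `a → b` under the bending homeomorphism, a cobordism
`∅ → Tr (b ⊗ aᵛ)`. -/
def push (hε : 0 < ε) (hε' : ε ≤ 1 / 16) (ha : IsSlice (2 * ε) m n a.carrier)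
    (hb : IsSlice (2 * ε) m n b.carrier) (S : Cobordism a b) :
    Cobordism Diagram.empty (closeUp a b) where
  carrier := bend hε '' S.carrier
  dots := bend hε '' S.dots
  isClosed := (S.isCompact.image_of_continuousOn ((bend hε).continuousOn.mono
    (S.subset_slab.trans (slab_subset_source hε hε')))).isClosed
  mem_cube := by
    rintro _ ⟨p, hp, rfl⟩
    have hs := S.subset_slab hp
    obtain ⟨⟨-, h⟩, hz⟩ := (bend_mem_bowlRegion hε hε' hs.1.2).2 hs
    obtain ⟨-, hy⟩ := rad_lt_half.1 ((le_max_left _ _).trans_lt h)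
    have := (le_max_right _ _).trans_lt h
    exact ⟨⟨hy.1.le, hy.2.le⟩, by linarith, hz⟩
  collar := by
    have hsrc := S.subset_slab.trans (slab_subset_source hε hε')
    have hK := S.isCompact.image_of_continuousOn ((bend hε).continuousOn.mono hsrc)
    have hreg : ∀ q ∈ bend hε '' S.carrier, q ∈ bowlRegion := by
      rintro _ ⟨p, hp, rfl⟩
      have hs := S.subset_slab hp
      exact (bend_mem_bowlRegion hε hε' hs.1.2).2 hs
    obtain ⟨η, hη, hm⟩ := exists_margin hK (f := fun q => 1 / 2 - bowlRad q)
      (continuous_const.sub continuous_bowlRad).continuousOn fun q hq => by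
        have := (hreg q hq).1.2
        linarith
    obtain ⟨δ₀, hδ₀, hc₀⟩ := S.collar
    obtain ⟨δ, hδ, d1, d2⟩ : ∃ δ : ℝ, 0 < δ ∧ δ ≤ δ₀ ∧ δ ≤ ε :=
      ⟨min δ₀ ε, lt_min hδ₀ hε, min_le_left _ _, min_le_right _ _⟩
    have hc : S.Collared δ := Cobordism.Collared.mono hc₀ d1
    have hcore : core δ ⊆ (bend hε).source := (core_subset hδ).trans
      (openCube_subset_slab.trans (slab_subset_source hε hε'))
    obtain ⟨η', hη', hm'⟩ := exists_margin ((isCompact_core δ).image_of_continuousOn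
      ((bend hε).continuousOn.mono hcore)) (f := fun q => 1 - q.2) (by fun_prop) (by
        rintro _ ⟨p, hp, rfl⟩
        have h1 := core_subset hδ hp
        have := ((bend_mem_openCube hε hε' h1.1.2).2 h1).2.2.2
        linarith)
    refine ⟨min η (min η' (ε / 16)), by positivity, fun q => ?_⟩
    have e1 := min_le_left η (min η' (ε / 16))
    have e2 := (min_le_right η (min η' (ε / 16))).trans (min_le_left _ _)
    have e3 := (min_le_right η (min η' (ε / 16))).trans (min_le_right _ _)
    have bd : q ∈ bend hε '' S.carrier → (η ≤ q.1.1 ∧ q.1.1 ≤ 1 - η) ∧ (η ≤ q.1.2 ∧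
        q.1.2 ≤ 1 - η) ∧ η ≤ q.2 := by
      intro hq
      have h1 := hm q hq
      have h2 := abs_le.1 ((abs_le_rad q.1).1.trans (le_max_left _ ((1 - q.2) / 2)))
      have h3 := abs_le.1 ((abs_le_rad q.1).2.trans (le_max_left _ ((1 - q.2) / 2)))
      have h4 : (1 - q.2) / 2 ≤ bowlRad q := le_max_right _ _
      change -bowlRad q ≤ _ ∧ _ ≤ bowlRad q at h2 h3
      refine ⟨⟨?_, ?_⟩, ⟨?_, ?_⟩, ?_⟩ <;> linarith [h2.1, h2.2, h3.1, h3.2]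
    refine ⟨fun h hq => ?_, fun _ _ h0 h1 => ?_, fun _ _ h0 h1 => ?_, fun h0 h1 => ?_,
      fun h0 h1 => ?_⟩
    · have := (bd hq).1
      rcases h with h | h <;> linarith [this.1, this.2]
    · exact iff_of_false (fun hq => by linarith [(bd hq).2.1.1]) (pts_zero _)
    · exact iff_of_false (fun hq => by linarith [(bd hq).2.1.2]) (pts_zero _)
    · exact iff_of_false (fun hq => by linarith [(bd hq).2.2]) id
    · change _ ↔ q.1 ∈ glued m b.carrier a.carrier
      have noncore : ∀ p, bend hε p = q → p ∉ core δ := by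
        rintro p hpq hpc
        have := hm' q ⟨p, hpc, hpq⟩
        linarith
      constructor
      · rintro ⟨p, hp, hpq⟩
        have hs := S.subset_slab hp
        rw [← hpq, bend_mem_glued_iff hε hε' ha hb hs (by rw [hpq]; linarith)]
        exact (hc.mem_iff_germ hε hε' ha hb d2 hs (noncore p hpq)).1 hp
      · intro hq
        have hr := rad_bounds_of_mem_glued hε ha hb hq
        have hqr : q ∈ bowlRegion :=
          ⟨⟨lt_max_of_lt_left (by linarith), max_lt (by linarith) (by linarith)⟩, h1⟩
        obtain ⟨hs, hpq⟩ := bend_symm_mem_slab hε hε' hqr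
        refine ⟨_, (hc.mem_iff_germ hε hε' ha hb d2 hs (noncore _ hpq)).2 ?_, hpq⟩
        rw [← bend_mem_glued_iff hε hε' ha hb hs (by rw [hpq]; linarith), hpq]
        exact hq
  flat := by
    rintro _ ⟨p, hp, rfl⟩ hc
    have hsrc := S.subset_slab.trans (slab_subset_source hε hε')
    exact (S.flat p hp ((bend_mem_openCube hε hε' (S.mem_x hp).2).1 hc)).image_partial _ hsrc
      (hsrc hp)
  dots_subset := Set.image_mono S.dots_subset
  dots_finite := S.dots_finite.image _
  dots_interior := by
    rintro _ ⟨p, hp, rfl⟩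
    have := S.dots_interior hp
    exact (bend_mem_openCube hε hε' this.1.2).2 this

theorem subset_bowlRegion (hε : 0 < ε) (ha : IsSlice (2 * ε) m n a.carrier)
    (hb : IsSlice (2 * ε) m n b.carrier) (T : Cobordism Diagram.empty (closeUp a b)) :
    T.carrier ⊆ bowlRegion := by
  intro q hq
  obtain ⟨δ, hδ, hc⟩ := T.collar
  obtain ⟨-, y0, y1, z0, z1⟩ := hc q
  have hx := T.mem_x hq
  obtain ⟨hy, hz⟩ := T.mem_cube q hq
  have hy0 : 0 < q.1.2 := by
    by_contra h
    exact pts_zero _ ((y0 hz.1 hz.2 hy.1 (by linarith)).1 hq)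
  have hy1 : q.1.2 < 1 := by
    by_contra h
    exact pts_zero _ ((y1 hz.1 hz.2 (by linarith) hy.2).1 hq)
  have hz0 : 0 < q.2 := by
    by_contra h
    exact (z0 hz.1 (by linarith)).1 hq
  refine ⟨⟨?_, max_lt (rad_lt_half.2 ⟨hx, hy0, hy1⟩) (by linarith)⟩, hz.2⟩
  rcases lt_or_ge q.2 1 with h | h
  · exact lt_max_of_lt_right (by linarith)
  · have h1 : q.1 ∈ glued m b.carrier a.carrier := (z1 (by linarith) hz.2).1 hq
    have := (rad_bounds_of_mem_glued hε ha hb h1).1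
    exact lt_max_of_lt_left (by linarith)

/-- The preimage of a cobordism `∅ → Tr (b ⊗ aᵛ)` under the bending homeomorphism, a cobordism
`a → b`. -/
def pull (hε : 0 < ε) (hε' : ε ≤ 1 / 16) (ha : IsSlice (2 * ε) m n a.carrier)
    (hb : IsSlice (2 * ε) m n b.carrier) (T : Cobordism Diagram.empty (closeUp a b)) :
    Cobordism a b where
  carrier := (bend hε).symm '' T.carrier
  dots := (bend hε).symm '' T.dots
  isClosed := (T.isCompact.image_of_continuousOn ((bend hε).continuousOn_symm.mono
    ((subset_bowlRegion hε ha hb T).trans (bowlRegion_subset_target hε)))).isClosed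
  mem_cube := by
    rintro _ ⟨q, hq, rfl⟩
    exact (bend_symm_mem_slab hε hε' (subset_bowlRegion hε ha hb T hq)).1.2
  collar := by
    have hreg := subset_bowlRegion hε ha hb T
    have hK := T.isCompact.image_of_continuousOn ((bend hε).continuousOn_symm.mono
      (hreg.trans (bowlRegion_subset_target hε)))
    have hmem : ∀ p ∈ slab, p ∈ (bend hε).symm '' T.carrier ↔ bend hε p ∈ T.carrier := by
      intro p hp
      constructor
      · rintro ⟨q, hq, rfl⟩
        rwa [(bend_symm_mem_slab hε hε' (hreg hq)).2]
      · exact fun h => ⟨_, h, (bend hε).left_inv (slab_subset_source hε hε' hp)⟩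
    have hslab : ∀ p ∈ (bend hε).symm '' T.carrier, p ∈ slab := by
      rintro _ ⟨q, hq, rfl⟩
      exact (bend_symm_mem_slab hε hε' (hreg hq)).1
    obtain ⟨η₀, hη₀, hm⟩ := exists_margin hK (f := fun p => min p.1.1 (1 - p.1.1)) (by fun_prop)
      fun p hp => lt_min (hslab p hp).1.1 (by linarith [(hslab p hp).1.2])
    obtain ⟨η, hη, e1, e2⟩ : ∃ η : ℝ, 0 < η ∧ η ≤ η₀ ∧ η ≤ ε :=
      ⟨min η₀ ε, lt_min hη₀ hε, min_le_left _ _, min_le_right _ _⟩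
    have hx : ∀ p ∈ (bend hε).symm '' T.carrier, η ≤ p.1.1 ∧ p.1.1 ≤ 1 - η := fun p hp => by
      have := hm p hp
      rw [le_min_iff] at this
      constructor <;> linarith [this.1, this.2]
    obtain ⟨εT, hεT, hcT⟩ := T.collar
    obtain ⟨κ, hκ, k1, k2⟩ : ∃ κ : ℝ, 0 < κ ∧ κ ≤ εT ∧ κ ≤ ε / 16 :=
      ⟨min εT (ε / 16), lt_min hεT (by linarith), min_le_left _ _, min_le_right _ _⟩
    -- the points that are not moved close to the top of the cube are in a compact part of its
    -- interior
    let C : Set Space := (Set.Icc η (1 - η) ×ˢ Set.Icc 0 1) ×ˢ Set.Icc 0 1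
    have hC : IsCompact C := (isCompact_Icc.prod isCompact_Icc).prod isCompact_Icc
    have hCs : C ⊆ slab := by
      rintro p ⟨⟨h1, h2⟩, h3⟩
      exact ⟨⟨by linarith [h1.1], by linarith [h1.2]⟩, h2, h3⟩
    have hcont : ContinuousOn (fun p => 1 - (bend hε p).2) C :=
      continuousOn_const.sub (continuous_snd.comp_continuousOn
        ((bend hε).continuousOn.mono (hCs.trans (slab_subset_source hε hε'))))
    have hN : IsCompact (C ∩ (fun p => 1 - (bend hε p).2) ⁻¹' Set.Ici κ) :=
      hC.of_isClosed_subset (hcont.preimage_isClosed_of_isClosed hC.isClosed isClosed_Ici)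
        Set.inter_subset_left
    obtain ⟨δ, hδ, hNδ⟩ := exists_subset_core hN (by
      rintro p ⟨hpC, hpκ⟩
      have h1 : κ ≤ 1 - (bend hε p).2 := hpκ
      have h2 := (hCs hpC).1
      exact ⟨h2, (bend_le_one hε hε' h2.2).2.1 (by linarith)⟩)
    have key : ∀ p ∈ slab, p ∉ core δ →
        (p ∈ (bend hε).symm '' T.carrier ↔ Germ ε m n a.carrier b.carrier p) := by
      intro p hp hpc
      have hg := germ_iff hε hε' ha hb hp
      by_cases hpx : η ≤ p.1.1 ∧ p.1.1 ≤ 1 - η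
      · have hpC : p ∈ C := ⟨⟨hpx, hp.2.1⟩, hp.2.2⟩
        have hd : 1 - (bend hε p).2 < κ := by
          by_contra h
          exact hpc (hNδ ⟨hpC, not_lt.1 h⟩)
        rw [hmem p hp, ← bend_mem_glued_iff hε hε' ha hb hp (by linarith)]
        exact (hcT _).2.2.2.2 (by linarith) ((bend_le_one hε hε' hp.1.2).1.2 hp.2)
      · refine iff_of_false (fun h => hpx (hx p h)) fun h => hpx ?_
        have := hg.2.2.2.2 h
        constructor <;> linarith [this.1, this.2]
    refine ⟨min (min η δ) (min ε (1 / 4)), by positivity, fun p => ?_⟩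
    have f1 := (min_le_left (min η δ) (min ε (1 / 4))).trans (min_le_left _ _)
    have f2 := (min_le_left (min η δ) (min ε (1 / 4))).trans (min_le_right _ _)
    have f3 := (min_le_right (min η δ) (min ε (1 / 4))).trans (min_le_left _ _)
    have f4 := (min_le_right (min η δ) (min ε (1 / 4))).trans (min_le_right _ _)
    have side : ∀ {Q : Prop}, (0 ≤ p.1.2 ∧ p.1.2 ≤ 1) → (0 ≤ p.2 ∧ p.2 ≤ 1) → p ∉ core δ →
        (p ∈ slab → (Germ ε m n a.carrier b.carrier p ↔ Q)) → (Q → 0 < p.1.1 ∧ p.1.1 < 1) →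
        (p ∈ (bend hε).symm '' T.carrier ↔ Q) := by
      intro Q hy hz hc h1 h2
      by_cases hpx : 0 < p.1.1 ∧ p.1.1 < 1
      · exact (key p ⟨hpx, hy, hz⟩ hc).trans (h1 ⟨hpx, hy, hz⟩)
      · exact iff_of_false (fun h => hpx (hslab p h).1) fun h => hpx (h2 h)
    refine ⟨fun h hp => ?_, fun h0 h1 h2 h3 => ?_, fun h0 h1 h2 h3 => ?_, fun h0 h1 => ?_,
      fun h0 h1 => ?_⟩
    · have := hx p hp
      rcases h with h | h <;> linarith [this.1, this.2]
    · refine side ⟨h2, by linarith⟩ ⟨h0, h1⟩ (fun hc => ?_) (fun hs => ?_) pts_pos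
      · linarith [hc.2.1.1]
      · exact (germ_iff hε hε' ha hb hs).2.2.1 (by linarith)
    · refine side ⟨by linarith, h3⟩ ⟨h0, h1⟩ (fun hc => ?_) (fun hs => ?_) pts_pos
      · linarith [hc.2.1.2]
      · exact (germ_iff hε hε' ha hb hs).2.2.2.1 (by linarith)
    · by_cases hy : 0 ≤ p.1.2 ∧ p.1.2 ≤ 1
      · refine side hy ⟨h0, by linarith⟩ (fun hc => ?_) (fun hs => ?_) a.mem_x
        · linarith [hc.2.2.1]
        · exact (germ_iff hε hε' ha hb hs).1 (by linarith)
      · exact iff_of_false (fun h => hy (hslab p h).2.1) fun h => hy (a.mem_square _ h)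
    · by_cases hy : 0 ≤ p.1.2 ∧ p.1.2 ≤ 1
      · refine side hy ⟨by linarith, h1⟩ (fun hc => ?_) (fun hs => ?_) b.mem_x
        · linarith [hc.2.2.2]
        · exact (germ_iff hε hε' ha hb hs).2.1 (by linarith)
      · exact iff_of_false (fun h => hy (hslab p h).2.1) fun h => hy (b.mem_square _ h)
  flat := by
    have hreg := (subset_bowlRegion hε ha hb T)
    have htgt : T.carrier ⊆ (bend hε).symm.source := hreg.trans (bowlRegion_subset_target hε)
    rintro _ ⟨q, hq, rfl⟩ hc
    obtain ⟨hs, e⟩ := bend_symm_mem_slab hε hε' (hreg hq)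
    refine (T.flat q hq ?_).image_partial _ htgt (htgt hq)
    rw [← e]
    exact (bend_mem_openCube hε hε' hs.1.2).2 hc
  dots_subset := Set.image_mono T.dots_subset
  dots_finite := T.dots_finite.image _
  dots_interior := by
    rintro _ ⟨q, hq, rfl⟩
    obtain ⟨hs, e⟩ := bend_symm_mem_slab hε hε' (subset_bowlRegion hε ha hb T (T.dots_subset hq))
    rw [← bend_mem_openCube hε hε' hs.1.2, e]
    exact T.dots_interior hq

variable (hε : 0 < ε) (hε' : ε ≤ 1 / 16) (ha : IsSlice (2 * ε) m n a.carrier)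
  (hb : IsSlice (2 * ε) m n b.carrier)

theorem pull_push (S : Cobordism a b) :
    pull hε hε' ha hb (push hε hε' ha hb S) = S := by
  have hinv : ∀ K ⊆ S.carrier, (bend hε).symm '' (bend hε '' K) = K := by
    intro K hK
    rw [Set.image_image]
    refine (Set.image_congr fun p hp => ?_).trans (Set.image_id' K)
    exact (bend hε).left_inv (slab_subset_source hε hε' (S.subset_slab (hK hp)))
  exact Cobordism.ext (hinv _ subset_rfl) (hinv _ S.dots_subset)

theorem push_pull (T : Cobordism Diagram.empty (closeUp a b)) :
    push hε hε' ha hb (pull hε hε' ha hb T) = T := by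
  have hinv : ∀ K ⊆ T.carrier, bend hε '' ((bend hε).symm '' K) = K := by
    intro K hK
    rw [Set.image_image]
    refine (Set.image_congr fun p hp => ?_).trans (Set.image_id' K)
    exact (bend_symm_mem_slab hε hε' (subset_bowlRegion hε ha hb T (hK hp))).2
  exact Cobordism.ext (hinv _ subset_rfl) (hinv _ T.dots_subset)

/-- The bending homeomorphism of the open cube. -/
def bendCube {ε : ℝ} (hε : 0 < ε) : OpenPartialHomeomorph Space Space :=
  (bend hε).restrOpen openCube isOpen_openCube

theorem push_transports : Transports (bendCube hε) (push hε hε' ha hb) where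
  source := by
    rw [bendCube, OpenPartialHomeomorph.restrOpen_source]
    exact Set.inter_eq_right.2 (openCube_subset_slab.trans (slab_subset_source hε hε'))
  target := by
    ext q
    change (q ∈ (bend hε).target ∧ (bend hε).symm q ∈ openCube) ↔ _
    constructor
    · rintro ⟨h1, h2⟩
      rw [← (bend hε).right_inv h1]
      exact (bend_mem_openCube hε hε' h2.1.2).2 h2
    · intro h
      have hr : q ∈ bowlRegion := by
        obtain ⟨h1, h2⟩ := mem_openCube_iff.1 h
        exact ⟨h1, h2.le⟩
      obtain ⟨hs, e⟩ := bend_symm_mem_slab hε hε' hr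
      refine ⟨hr.1.1, (bend_mem_openCube hε hε' hs.1.2).1 ?_⟩
      rwa [e]
  carrier S p hp := by
    refine (bend hε).injOn.mem_image_iff (S.subset_slab.trans (slab_subset_source hε hε')) ?_
    exact slab_subset_source hε hε' (openCube_subset_slab hp)
  dots S p hp := by
    refine (bend hε).injOn.mem_image_iff ((S.dots_subset.trans S.subset_slab).trans
      (slab_subset_source hε hε')) ?_
    exact slab_subset_source hε hε' (openCube_subset_slab hp)

theorem pull_transports : Transports (bendCube hε).symm (pull hε hε' ha hb) where
  source := (push_transports hε hε' ha hb).target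
  target := (push_transports hε hε' ha hb).source
  carrier T q hq := by
    have hr : q ∈ bowlRegion := by
      obtain ⟨h1, h2⟩ := mem_openCube_iff.1 hq
      exact ⟨h1, h2.le⟩
    exact (bend hε).symm.injOn.mem_image_iff ((subset_bowlRegion hε ha hb T).trans
      (bowlRegion_subset_target hε)) (bowlRegion_subset_target hε hr)
  dots T q hq := by
    have hr : q ∈ bowlRegion := by
      obtain ⟨h1, h2⟩ := mem_openCube_iff.1 hq
      exact ⟨h1, h2.le⟩
    exact (bend hε).symm.injOn.mem_image_iff ((T.dots_subset.trans
      (subset_bowlRegion hε ha hb T)).trans (bowlRegion_subset_target hε))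
      (bowlRegion_subset_target hε hr)

theorem push_homeomorph (S : Cobordism a b) :
    Nonempty (S.carrier ≃ₜ (push hε hε' ha hb S).carrier) :=
  ⟨(bend hε).homeomorphOfImageSubsetSource
    (S.subset_slab.trans (slab_subset_source hε hε')) rfl⟩

theorem push_dots_ncard (S : Cobordism a b) :
    (push hε hε' ha hb S).dots.ncard = S.dots.ncard :=
  Set.InjOn.ncard_image ((bend hε).injOn.mono
    ((S.dots_subset.trans S.subset_slab).trans (slab_subset_source hε hε')))

end

end

end BarNatan

namespace BarNatan

noncomputable section

/-! ### The coevaluation and the bending of compositions -/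

/-- The height function of the reparametrisation that turns a bent cobordism into a composition
with the coevaluation. The interval `[1 - ε / 16, 1]` is stretched to `[1 / 2, 1]`. -/
def stretch (ε z : ℝ) : ℝ := min z (max (z / 2) (max (z - 1 / 2 + ε / 16) (1 - 8 * (1 - z) / ε)))

section

variable {ε : ℝ}

theorem stretch_low {z : ℝ} (hε : 0 < ε) (h0 : 0 ≤ z) (h1 : z ≤ 1 - ε / 8) :
    stretch ε z = z / 2 := by
  have : 1 ≤ 8 * (1 - z) / ε := by rw [le_div_iff₀ hε]; linarith
  rw [stretch, max_eq_left, min_eq_right (by linarith)]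
  exact max_le (by linarith) (by linarith)

theorem stretch_mid {z : ℝ} (hε : 0 < ε) (hε' : ε ≤ 1) (h0 : 1 - ε / 8 ≤ z) (h1 : z ≤ 1 - ε / 16) :
    stretch ε z = z - 1 / 2 + ε / 16 := by
  obtain ⟨u, hu⟩ : ∃ u, z = 1 - ε * u := ⟨(1 - z) / ε, by field_simp; ring⟩
  have e : 8 * (1 - z) / ε = 8 * u := by rw [hu]; field_simp; ring
  have hu1 : 1 / 16 ≤ u := by
    by_contra h
    rw [not_le] at h
    nlinarith
  rw [stretch, e, max_eq_left (a := z - 1 / 2 + ε / 16), max_eq_right (by linarith),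
    min_eq_right (by linarith)]
  nlinarith

theorem stretch_high {z : ℝ} (hε : 0 < ε) (hε' : ε ≤ 1) (h0 : 1 - ε / 16 ≤ z) (h1 : z ≤ 1) :
    stretch ε z = 1 - 8 * (1 - z) / ε := by
  obtain ⟨u, hu⟩ : ∃ u, z = 1 - ε * u := ⟨(1 - z) / ε, by field_simp; ring⟩
  have e : 8 * (1 - z) / ε = 8 * u := by rw [hu]; field_simp; ring
  have hu0 : 0 ≤ u := by
    by_contra h
    rw [not_le] at h
    nlinarith
  have hu1 : u ≤ 1 / 16 := by
    by_contra h
    rw [not_le] at h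
    nlinarith
  rw [stretch, e, max_eq_right (a := z - 1 / 2 + ε / 16), max_eq_right, min_eq_right]
  · nlinarith
  · nlinarith
  · nlinarith

theorem exists_stretch (hε : 0 < ε) (hε' : ε ≤ 1) : ∃ ρ : ℝ ≃o ℝ, (∀ z, ρ z = stretch ε z) ∧
    (∀ z ≤ 0, ρ z = z) ∧ ∀ z, 1 ≤ z → ρ z = z := by
  have h0 : ∀ z ≤ 0, stretch ε z = z := fun z hz =>
    min_eq_left (le_max_of_le_left (by linarith))
  have h1 : ∀ z, 1 ≤ z → stretch ε z = z := fun z hz => by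
    refine min_eq_left (le_max_of_le_right (le_max_of_le_right ?_))
    have : z - 1 ≤ 8 * (z - 1) / ε := by rw [le_div_iff₀ hε]; nlinarith
    have e : 8 * (1 - z) / ε = -(8 * (z - 1) / ε) := by ring
    linarith
  have hm : StrictMono (stretch ε) :=
    (Inc.id.min ((Inc.linear (k := 1 / 2) (c := 0) (by norm_num) fun z => by ring).max
      ((Inc.linear (k := 1) (c := -1 / 2 + ε / 16) one_pos fun z => by ring).max
        (Inc.linear (k := 8 / ε) (c := 1 - 8 / ε) (by positivity) fun z => by ring)))).1
  obtain ⟨ρ, hρ⟩ := exists_orderIso hm (by unfold stretch; fun_prop) h0 h1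
  exact ⟨ρ, hρ, fun z hz => by rw [hρ, h0 z hz], fun z hz => by rw [hρ, h1 z hz]⟩

variable {m n : ℕ} {a b : Diagram m n} {A B : Set Plane}

/-- Near the top of the cube, the coevaluation is a product. -/
theorem mem_coevSet_iff (hε : 0 < ε) (hε' : ε ≤ 1 / 64) (hA : IsSlice (8 * ε) m n A) {q : Space}
    (h1 : q.2 ≤ 1) (hd : 1 - q.2 < ε / 4) : q ∈ coevSet A ↔ q.1 ∈ glued m A A := by
  have hδ : 0 < 4 * ε := by linarith
  have hδ' : 4 * ε ≤ 1 / 16 := by linarith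
  have hA' : IsSlice (2 * (4 * ε)) m n A := hA.mono (by linarith)
  by_cases hq : q ∈ bowlRegion
  swap
  · refine iff_of_false (fun h => hq h.1) fun h => hq ?_
    have hr := rad_bounds_of_mem_glued hδ hA' hA' h
    exact ⟨⟨lt_max_of_lt_left (by linarith), max_lt (by linarith) (by linarith)⟩, h1⟩
  obtain ⟨hp, e⟩ := bend_symm_mem_slab hδ hδ' hq
  rw [← e, bend_mem_coevSet hδ hδ' hA' hp, bend_mem_glued_iff hδ hδ' hA' hA' hp
    (by rw [e]; linarith)]
  have hdp : 1 - (bend hδ ((bend hδ).symm q)).2 < 4 * ε / 16 := by rw [e]; linarith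
  set p := (bend hδ).symm q
  obtain ⟨g1, g2, g3, g4, g5⟩ := germ_iff hδ hδ' hA' hA' hp
  obtain ⟨hpx, hy, hz⟩ := hp
  rcases le_total p.1.2 (4 * ε) with hy1 | hy1
  · rw [g3 hy1, (hA'.collar p.1).2.1 hy.1 (by linarith)]
  rcases le_total (1 - 4 * ε) p.1.2 with hy2 | hy2
  · rw [g4 hy2, (hA'.collar p.1).2.2 (by linarith) hy.2]
  rcases lt_or_ge p.2 (1 / 4) with hz1 | hz1
  · exact (g1 hz1).symm
  rcases lt_or_ge (3 / 4) p.2 with hz2 | hz2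
  · exact (g2 hz2).symm
  -- the remaining points are mapped to a lower height
  have far : ¬ (2 * (4 * ε) ≤ p.1.1 ∧ p.1.1 ≤ 1 - 2 * (4 * ε)) := by
    rintro ⟨hx0, hx1⟩
    have hl : halfLevel (4 * ε) p.1.2 p.2 = p.1.2 := half_level_eq hδ hy1 hz
    rw [bend_eq hδ hδ' (by linarith) (by linarith) (hl.le.trans hy2)
      (halfT_nonneg hδ hy.1 hz)] at hdp
    have := half_middle hδ hy1 hz1 hz2
    simp only at hdp
    linarith
  exact iff_of_false (fun h => far (hA'.mem_x h)) fun h => far (g5 h)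

/-- The horizontal section of a cobordism at the height `z`. -/
def Cobordism.section (S : Cobordism a b) (z : ℝ) : Set Plane := {q | (q, z) ∈ S.carrier}

/-- The result of adding two product cobordisms at the bottom of a cobordism. -/
theorem mem_refl_comp_refl_comp (Z : Cobordism a b) {p : Space} (hz : 0 ≤ p.2) :
    (p.2 ≤ 3 / 4 → (p ∈ ((Cobordism.refl a).comp ((Cobordism.refl a).comp Z)).carrier ↔
      p.1 ∈ a.carrier)) ∧
    (3 / 4 < p.2 → (p ∈ ((Cobordism.refl a).comp ((Cobordism.refl a).comp Z)).carrier ↔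
      p.1 ∈ Z.section (4 * p.2 - 3))) := by
  have e : p ∈ ((Cobordism.refl a).comp ((Cobordism.refl a).comp Z)).carrier ↔
      (p.1 ∈ a.carrier ∧ 0 ≤ 2 * p.2 ∧ 2 * p.2 ≤ 1) ∨
      (p.1 ∈ a.carrier ∧ 0 ≤ 2 * (2 * p.2 - 1) ∧ 2 * (2 * p.2 - 1) ≤ 1) ∨
      (p.1, 2 * (2 * p.2 - 1) - 1) ∈ Z.carrier := by
    change p ∈ lo '' _ ∪ hi '' (lo '' _ ∪ hi '' _) ↔ _
    rw [Set.mem_union, mem_lo, mem_hi, Set.mem_union, mem_lo, mem_hi]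
    rfl
  rw [e, show 2 * (2 * p.2 - 1) - 1 = 4 * p.2 - 3 by ring]
  have hZ := Z.mem_cube (p.1, 4 * p.2 - 3)
  simp only at hZ
  constructor
  · intro h
    constructor
    · rintro (h' | h' | h')
      · exact h'.1
      · exact h'.1
      · obtain ⟨δ, hδ, hc⟩ := Z.collar
        have := (hZ h').2.1
        exact ((hc (p.1, 4 * p.2 - 3)).2.2.2.1 (hZ h').2.1 (by simp only; linarith)).1 h'
    · intro h'
      rcases le_total p.2 (1 / 2) with h2 | h2
      · exact Or.inl ⟨h', by linarith, by linarith⟩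
      · exact Or.inr (Or.inl ⟨h', by linarith, by linarith⟩)
  · intro h
    constructor
    · rintro (h' | h' | h')
      · linarith [h'.2.2]
      · linarith [h'.2.2]
      · exact h'
    · exact fun h' => Or.inr (Or.inr h')

/-- A cobordism that is a product in a collar of the faces in the `x`- and `y`-directions whose
width is independent of the cobordism. -/
structure Cobordism.GoodPosition (Z : Cobordism a b) (ε : ℝ) : Prop where
  slice : ∀ z, 0 ≤ z → z ≤ 1 → IsSlice (2 * ε) m n (Z.section z)
  dots : ∀ p ∈ Z.dots, ε ≤ p.1.2 ∧ p.1.2 ≤ 1 - ε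

theorem mem_tr_tens_refl (Z : Cobordism a b) {q : Plane} {z : ℝ} (h0 : 0 ≤ z) (h1 : z ≤ 1) :
    (q, z) ∈ ((Z.tens (Cobordism.refl a.dual)).tr).carrier ↔
      q ∈ glued m (Z.section z) a.carrier := by
  refine (mem_closure_slice _ q z ⟨h0, h1⟩).trans ?_
  have : {r : Plane | (r, z) ∈ (Z.tens (Cobordism.refl a.dual)).carrier} =
      up '' Z.section z ∪ dn '' (flip '' a.carrier) := by
    ext r
    change (r, z) ∈ thick up '' _ ∪ thick dn '' _ ↔ _
    rw [Set.mem_union, mem_thick_up, mem_thick_dn, Set.mem_union, mem_up, mem_dn]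
    exact or_congr Iff.rfl (and_iff_left ⟨h0, h1⟩)
  rw [this]
  rfl

theorem mem_padded_of_low (hε : 0 < ε) (hε' : ε ≤ 1 / 16) (ha : IsSlice (2 * ε) m n a.carrier)
    {Z : Cobordism a b} (hZ : Z.GoodPosition ε) {p : Space} (hp : p ∈ slab)
    (hd : ε / 16 ≤ 1 - (bend hε p).2) :
    p ∈ ((Cobordism.refl a).comp ((Cobordism.refl a).comp Z)).carrier ↔ p.1 ∈ a.carrier := by
  obtain ⟨hx, hy, hz⟩ := hp
  obtain ⟨w1, w2⟩ := mem_refl_comp_refl_comp Z hz.1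
  rcases le_or_gt p.2 (3 / 4) with h | h
  · exact w1 h
  rw [w2 h]
  have hs := hZ.slice (4 * p.2 - 3) (by linarith) (by linarith)
  rcases lt_or_ge p.1.2 (2 * ε) with hy1 | hy1
  · rw [(hs.collar _).2.1 hy.1 hy1, (ha.collar _).2.1 hy.1 hy1]
  rcases lt_or_ge (1 - 2 * ε) p.1.2 with hy2 | hy2
  · rw [(hs.collar _).2.2 hy2 hy.2, (ha.collar _).2.2 hy2 hy.2]
  have far : ¬ (2 * ε ≤ p.1.1 ∧ p.1.1 ≤ 1 - 2 * ε) := by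
    rintro ⟨hx0, hx1⟩
    have hl : halfLevel ε p.1.2 p.2 = p.1.2 := half_level_eq hε (by linarith) hz
    rw [bend_eq hε hε' (by linarith) (by linarith) (hl.le.trans (by linarith))
      (halfT_nonneg hε hy.1 hz), (half_top hε (by linarith) h.le hz.2).2] at hd
    simp only at hd
    nlinarith
  exact iff_of_false (fun h => far (hs.mem_x h)) fun h => far (ha.mem_x h)

theorem mem_padded_of_high (hε : 0 < ε) (hε' : ε ≤ 1 / 16) (ha : IsSlice (2 * ε) m n a.carrier)
    {Z : Cobordism a b} (hZ : Z.GoodPosition ε) {p : Space} (hp : p ∈ slab)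
    (hd : 1 - (bend hε p).2 < ε / 16) {ζ : ℝ} (hζ : ζ = 1 - 16 * (1 - (bend hε p).2) / ε)
    (h0 : 0 ≤ ζ) (h1 : ζ ≤ 1) :
    p ∈ ((Cobordism.refl a).comp ((Cobordism.refl a).comp Z)).carrier ↔
      (bend hε p).1 ∈ glued m (Z.section ζ) a.carrier := by
  have hsζ := hZ.slice ζ h0 h1
  rw [bend_mem_glued_iff hε hε' ha hsζ hp hd]
  obtain ⟨g1, g2, g3, g4, g5⟩ := germ_iff hε hε' ha hsζ hp
  obtain ⟨hx, hy, hz⟩ := hp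
  obtain ⟨w1, w2⟩ := mem_refl_comp_refl_comp Z hz.1
  have hs : 3 / 4 < p.2 → IsSlice (2 * ε) m n (Z.section (4 * p.2 - 3)) := fun h =>
    hZ.slice (4 * p.2 - 3) (by linarith) (by linarith)
  rcases le_total p.1.2 ε with hy1 | hy1
  · rw [g3 hy1]
    rcases le_or_gt p.2 (3 / 4) with h | h
    · rw [w1 h, (ha.collar _).2.1 hy.1 (by linarith)]
    · rw [w2 h, ((hs h).collar _).2.1 hy.1 (by linarith)]
  rcases le_total (1 - ε) p.1.2 with hy2 | hy2
  · rw [g4 hy2]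
    rcases le_or_gt p.2 (3 / 4) with h | h
    · rw [w1 h, (ha.collar _).2.2 (by linarith) hy.2]
    · rw [w2 h, ((hs h).collar _).2.2 (by linarith) hy.2]
  by_cases hpx : 2 * ε ≤ p.1.1 ∧ p.1.1 ≤ 1 - 2 * ε
  swap
  · refine iff_of_false (fun h => hpx ?_) fun h => hpx (g5 h)
    rcases le_or_gt p.2 (3 / 4) with h' | h'
    · exact ha.mem_x ((w1 h').1 h)
    · exact (hs h').mem_x ((w2 h').1 h)
  have hl : halfLevel ε p.1.2 p.2 = p.1.2 := half_level_eq hε hy1 hz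
  rw [bend_eq hε hε' (by linarith [hpx.1]) (by linarith [hpx.2]) (hl.le.trans hy2)
    (halfT_nonneg hε hy.1 hz)] at hd hζ
  simp only at hd hζ
  rcases lt_or_ge p.2 (1 / 4) with hz1 | hz1
  · rw [g1 hz1, w1 (by linarith)]
  rcases le_or_gt p.2 (3 / 4) with hz2 | hz2
  · have := half_middle hε hy1 hz1 hz2
    linarith
  · have e : ζ = 4 * p.2 - 3 := by
      rw [hζ, (half_top hε hy1 hz2.le hz.2).2]
      field_simp
      ring
    rw [g2 hz2, w2 hz2, e]

/-- A bent cobordism is the composition of the coevaluation with the closed-up cobordism. After two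
product cobordisms have been added to it at the bottom, this is seen by stretching the cube in the
vertical direction. -/
theorem push_isotopic_comp (hε : 0 < ε) (hε' : ε ≤ 1 / 64) (ha : IsSlice (8 * ε) m n a.carrier)
    (ha' : IsSlice (2 * ε) m n a.carrier) (hb : IsSlice (2 * ε) m n b.carrier)
    (hε'' : ε ≤ 1 / 16) {Z : Cobordism a b}
    (hZ : Z.GoodPosition ε) {K : Cobordism Diagram.empty (closeUp a a)}
    (hK : K.carrier = coevSet a.carrier) (hKd : K.dots = ∅) :
    Isotopic (push hε hε'' ha' hb ((Cobordism.refl a).comp ((Cobordism.refl a).comp Z)))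
      (K.comp ((Z.tens (Cobordism.refl a.dual)).tr)) := by
  have hε1 : ε ≤ 1 := by linarith
  obtain ⟨ρ, hρ, hρ0, hρ1⟩ := exists_stretch hε hε1
  refine isotopic_of_reparam ρ hρ0 hρ1 (fun q z => ?_) (fun q z => ?_)
  · have r1 := subset_bowlRegion hε ha' hb
      (push hε hε'' ha' hb ((Cobordism.refl a).comp ((Cobordism.refl a).comp Z)))
    have r2 := subset_bowlRegion hε ha' hb (K.comp ((Z.tens (Cobordism.refl a.dual)).tr))
    by_cases hq : (q, z) ∈ bowlRegion
    swap
    · refine iff_of_false (fun h => hq (r1 h)) fun h => hq ?_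
      obtain ⟨⟨h0, h1⟩, h2⟩ := r2 h
      have hr := (le_max_left _ _).trans_lt h1
      have hz := (le_max_right _ _).trans_lt h1
      simp only at h2 hr hz
      have hz1 : z ≤ 1 := by
        by_contra hc
        rw [hρ1 z (by linarith)] at h2
        linarith
      have hz0 : 0 < z := by
        by_contra hc
        rw [hρ0 z (by linarith)] at hz
        linarith
      refine ⟨⟨?_, max_lt hr (by simp only; linarith)⟩, hz1⟩
      rcases hz1.lt_or_eq with h | h
      · exact lt_max_of_lt_right (by simp only; linarith)
      · rwa [hρ1 z h.ge] at h0
    obtain ⟨hs, e⟩ := bend_symm_mem_slab hε hε'' hq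
    have hz1 : z ≤ 1 := hq.2
    have hz0 : 0 < z := by
      have := (le_max_right _ _).trans_lt hq.1.2
      simp only at this; linarith
    have lhs : (q, z) ∈ (push hε hε'' ha' hb
        ((Cobordism.refl a).comp ((Cobordism.refl a).comp Z))).carrier ↔
        (bend hε).symm (q, z) ∈
          ((Cobordism.refl a).comp ((Cobordism.refl a).comp Z)).carrier := by
      constructor
      · rintro ⟨p, hp, hpe⟩
        rw [← hpe, (bend hε).left_inv (slab_subset_source hε hε'' (Cobordism.subset_slab _ hp))]
        exact hp
      · exact fun h => ⟨_, h, e⟩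
    rw [lhs]
    have rhs : (q, ρ z) ∈ (K.comp ((Z.tens (Cobordism.refl a.dual)).tr)).carrier ↔
        (q, 2 * ρ z) ∈ coevSet a.carrier ∨
          (q, 2 * ρ z - 1) ∈ ((Z.tens (Cobordism.refl a.dual)).tr).carrier := by
      change _ ∈ lo '' _ ∪ hi '' _ ↔ _
      rw [Set.mem_union, mem_lo, mem_hi, hK]
    rw [rhs, hρ]
    have ed : (bend hε ((bend hε).symm (q, z))).2 = z := by rw [e]
    rcases le_total z (1 - ε / 8) with h | h
    · rw [stretch_low hε hz0.le h, mul_div_cancel₀ _ two_ne_zero, or_iff_left,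
        mem_padded_of_low hε hε'' ha' hZ hs (by rw [ed]; linarith),
        ← bend_mem_coevSet hε hε'' ha' hs, e]
      intro h'
      have := (Cobordism.mem_cube _ _ h').2.1
      simp only at this; linarith
    rcases le_or_gt z (1 - ε / 16) with h' | h'
    · rw [stretch_mid hε hε1 h h', mem_padded_of_low hε hε'' ha' hZ hs (by rw [ed]; linarith),
        ← bend_mem_coevSet hε hε'' ha' hs, e,
        mem_coevSet_iff hε hε' ha hz1 (by simp only; linarith),
        mem_coevSet_iff hε hε' ha (by simp only; linarith) (by simp only; linarith)]
      refine (or_iff_left_of_imp fun h2 => ?_).symm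
      obtain ⟨δ, hδ, hc⟩ := ((Z.tens (Cobordism.refl a.dual)).tr).collar
      have h3 := (Cobordism.mem_cube _ _ h2).2.1
      simp only at h3
      exact ((hc (q, 2 * (z - 1 / 2 + ε / 16) - 1)).2.2.2.1 h3 (by simp only; linarith)).1 h2
    · rw [stretch_high hε hε1 h'.le hz1]
      have h2 : 16 * (1 - z) / ε < 1 := by rw [div_lt_one hε]; linarith
      have h3 : 0 ≤ 16 * (1 - z) / ε := div_nonneg (by linarith) hε.le
      have h4 : 2 * (1 - 8 * (1 - z) / ε) - 1 = 1 - 16 * (1 - z) / ε := by ring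
      rw [h4, or_iff_right, mem_tr_tens_refl Z (by linarith) (by linarith),
        mem_padded_of_high hε hε'' ha' hZ hs (by rw [ed]; linarith) (by rw [ed])
          (by linarith) (by linarith), e]
      intro h5
      have h6 : 2 * (1 - 8 * (1 - z) / ε) ≤ 1 := h5.1.2
      linarith
  · have key : ∀ p ∈ Z.dots, bend hε (hi (hi p)) =
        ((1 / 8 + p.1.1 / 4, 1 / 2 + p.1.2 / 8), 1 - ε * (1 - p.2) / 16) ∧
        ρ (1 - ε * (1 - p.2) / 16) = (p.2 + 1) / 2 := by
      intro p hp
      obtain ⟨-, -, hz⟩ := Z.dots_interior hp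
      have hy := hZ.dots p hp
      have hx := (hZ.slice p.2 hz.1.le hz.2.le).mem_x (Z.dots_subset hp : p.1 ∈ Z.section p.2)
      have ez : (hi (hi p)).2 = ((p.2 + 1) / 2 + 1) / 2 := rfl
      have hz' : 3 / 4 ≤ (hi (hi p)).2 ∧ (hi (hi p)).2 ≤ 1 := by
        rw [ez]; constructor <;> linarith
      have hl : halfLevel ε (hi (hi p)).1.2 (hi (hi p)).2 = (hi (hi p)).1.2 :=
        half_level_eq hε hy.1 ⟨by linarith, hz'.2⟩
      obtain ⟨e1, e2⟩ := half_top (y := (hi (hi p)).1.2) hε hy.1 hz'.1 hz'.2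
      constructor
      · rw [bend_eq hε hε'' (p := hi (hi p)) (by change ε ≤ p.1.1; linarith)
          (by change p.1.1 ≤ _; linarith) (hl.le.trans hy.2)
          (halfT_nonneg hε (by change 0 ≤ p.1.2; linarith) ⟨by linarith, hz'.2⟩), e1, e2, ez]
        change ((1 / 8 + p.1.1 / 4, 1 / 2 + p.1.2 / 8), _) = _
        congr 1
        ring
      · have h1 : 0 ≤ ε * (1 - p.2) := mul_nonneg hε.le (by linarith)
        have h2 : ε * (1 - p.2) ≤ ε := mul_le_of_le_one_right hε.le (by linarith)
        rw [hρ, stretch_high hε hε1 (by linarith) (by linarith)]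
        field_simp
        ring
    have lhs : (q, z) ∈ (push hε hε'' ha' hb
        ((Cobordism.refl a).comp ((Cobordism.refl a).comp Z))).dots ↔
        ∃ p ∈ Z.dots, bend hε (hi (hi p)) = (q, z) := by
      change _ ∈ bend hε '' (lo '' ∅ ∪ hi '' (lo '' ∅ ∪ hi '' Z.dots)) ↔ _
      simp only [Set.image_empty, Set.empty_union, Set.image_image]
      rfl
    have rhs : (q, ρ z) ∈ (K.comp ((Z.tens (Cobordism.refl a.dual)).tr)).dots ↔
        ∃ p ∈ Z.dots, hi (thick box (thick up p)) = (q, ρ z) := by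
      change _ ∈ lo '' K.dots ∪ hi '' (thick box '' (thick up '' Z.dots ∪ thick dn '' ∅)) ↔ _
      rw [hKd]
      simp only [Set.image_empty, Set.empty_union, Set.union_empty, Set.image_image]
      rfl
    rw [lhs, rhs]
    refine exists_congr fun p => and_congr_right fun hp => ?_
    obtain ⟨e1, e2⟩ := key p hp
    have e3 : hi (thick box (thick up p)) =
        ((1 / 8 + p.1.1 / 4, 1 / 2 + p.1.2 / 8), (p.2 + 1) / 2) := by
      change (((p.1.1 + 1 / 2) / 4, ((p.1.2 + 1) / 2 + 3 / 2) / 4), (p.2 + 1) / 2) = _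
      ext
      · simp only; ring
      · simp only; ring
      · rfl
    rw [e1, e3, ← e2]
    simp only [Prod.mk.injEq, ρ.injective.eq_iff]

end

end

end BarNatan

namespace BarNatan

noncomputable section

/-! ### Moving cobordisms into good position -/

/-- An increasing map of the line onto itself that fixes the points close to `0` and `1` and those
of `[2 c, 1 - 2 c]`, and moves the points of `[δ, 1 - δ]` into `[c, 1 - c]`. -/
def nudge (δ c t : ℝ) : ℝ :=
  min (max t (min (δ / 2 + 2 * c / δ * (t - δ / 2)) (c + t / 2)))
    (max (1 - (δ / 2 + 2 * c / δ * (1 - t - δ / 2))) (1 - (c + (1 - t) / 2)))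

section

variable {δ c : ℝ}

theorem nudge_symm (hc : c ≤ 1 / 4) (t : ℝ) : nudge δ c (1 - t) = 1 - nudge δ c t := by
  have key : ∀ u L U : ℝ, L ≤ U → min (max (1 - u) (1 - U)) (1 - L) = 1 - min (max u L) U := by
    intro u L U h
    rcases le_total u L with h1 | h1
    · rw [max_eq_right h1, min_eq_left h, min_eq_right]
      exact le_max_of_le_left (by linarith)
    · rw [max_eq_left h1]
      rcases le_total u U with h2 | h2
      · rw [min_eq_left h2, max_eq_left (by linarith), min_eq_left (by linarith)]
      · rw [min_eq_right h2, max_eq_right (by linarith), min_eq_left (by linarith)]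
  have hLU : min (δ / 2 + 2 * c / δ * (t - δ / 2)) (c + t / 2) ≤
      max (1 - (δ / 2 + 2 * c / δ * (1 - t - δ / 2))) (1 - (c + (1 - t) / 2)) :=
    (min_le_right _ _).trans (le_max_of_le_right (by linarith))
  have e1 : ∀ x y : ℝ, min x y = 1 - max (1 - x) (1 - y) := fun x y => by
    rcases le_total x y with h | h
    · rw [min_eq_left h, max_eq_left (by linarith)]; ring
    · rw [min_eq_right h, max_eq_right (by linarith)]; ring
  have e2 : ∀ x y : ℝ, max (1 - x) (1 - y) = 1 - min x y := fun x y => by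
    have := e1 x y
    linarith
  rw [nudge, nudge, ← key _ _ _ hLU, sub_sub_cancel]
  congr 1
  · congr 1
    rw [e1]
  · rw [e2]

theorem inc_nudge (hδ : 0 < δ) (hc : 0 < c) : Inc (nudge δ c) := by
  have hk : 0 < 2 * c / δ := by positivity
  exact (Inc.id.max ((Inc.linear (c := δ / 2 - 2 * c / δ * (δ / 2)) hk fun z => by ring).min
    (Inc.linear (k := 1 / 2) (c := c) (by norm_num) fun z => by ring))).min
    ((Inc.linear (c := 1 - (δ / 2 + 2 * c / δ * (1 - δ / 2))) hk fun z => by ring).max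
    (Inc.linear (k := 1 / 2) (c := 1 / 2 - c) (by norm_num) fun z => by ring))

/-- The values of `nudge` on the lower part of the line. -/
theorem nudge_low (hc : c ≤ 1 / 4) {t : ℝ} (ht : t ≤ 1 - 2 * c) :
    nudge δ c t = max t (min (δ / 2 + 2 * c / δ * (t - δ / 2)) (c + t / 2)) :=
  min_eq_left (le_max_of_le_right (max_le (by linarith) ((min_le_right _ _).trans (by linarith))))

theorem nudge_fix (hδ : 0 < δ) (hδc : δ ≤ c) (hc : c ≤ 1 / 4) {t : ℝ}
    (ht : t ≤ δ / 2 ∨ 1 - δ / 2 ≤ t ∨ 2 * c ≤ t ∧ t ≤ 1 - 2 * c) : nudge δ c t = t := by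
  have low : ∀ t : ℝ, t ≤ δ / 2 → nudge δ c t = t := by
    intro t h
    rw [nudge_low hc (by linarith), max_eq_left]
    refine (min_le_left _ _).trans ?_
    have h1 : 1 ≤ 2 * c / δ := by rw [le_div_iff₀ hδ]; linarith
    nlinarith
  rcases ht with h | h | ⟨h, h'⟩
  · exact low t h
  · have := low (1 - t) (by linarith)
    rw [nudge_symm hc] at this
    linarith
  · rw [nudge_low hc h', max_eq_left]
    exact (min_le_right _ _).trans (by linarith)

theorem le_nudge (hδ : 0 < δ) (hδc : δ ≤ c) (hc : c ≤ 1 / 4) {t : ℝ} (ht : δ ≤ t) :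
    c ≤ nudge δ c t := by
  refine le_trans ?_ ((inc_nudge hδ (by linarith)).1.monotone ht)
  rw [nudge_low hc (by linarith)]
  refine le_max_of_le_right (le_min ?_ (by linarith))
  have : 2 * c / δ * (δ - δ / 2) = c := by field_simp; ring
  linarith

theorem nudge_le (hδ : 0 < δ) (hδc : δ ≤ c) (hc : c ≤ 1 / 4) {t : ℝ} (ht : t ≤ 1 - δ) :
    nudge δ c t ≤ 1 - c := by
  have := le_nudge (t := 1 - t) hδ hδc hc (by linarith)
  rw [nudge_symm hc] at this
  linarith

/-- A function on the square that vanishes in the collar of width `δ / 2` and is `1` outside of the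
collar of width `δ`. -/
def plateau (δ : ℝ) (q : Plane) : ℝ :=
  max 0 (min 1 (2 * min (min q.1 (1 - q.1)) (min q.2 (1 - q.2)) / δ - 1))

theorem plateau_mem (δ : ℝ) (q : Plane) : 0 ≤ plateau δ q ∧ plateau δ q ≤ 1 :=
  ⟨le_max_left _ _, max_le zero_le_one (min_le_left _ _)⟩

theorem plateau_eq_one (hδ : 0 < δ) {q : Plane} (h : (δ ≤ q.1 ∧ q.1 ≤ 1 - δ) ∧ δ ≤ q.2 ∧
    q.2 ≤ 1 - δ) : plateau δ q = 1 := by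
  obtain ⟨⟨h1, h2⟩, h3, h4⟩ := h
  have : δ ≤ min (min q.1 (1 - q.1)) (min q.2 (1 - q.2)) :=
    le_min (le_min h1 (by linarith)) (le_min h3 (by linarith))
  have h5 : 2 ≤ 2 * min (min q.1 (1 - q.1)) (min q.2 (1 - q.2)) / δ := by
    rw [le_div_iff₀ hδ]; linarith
  rw [plateau, min_eq_left (by linarith), max_eq_right zero_le_one]

theorem plateau_eq_zero (hδ : 0 < δ) {q : Plane} (h : ¬ ((δ / 2 ≤ q.1 ∧ q.1 ≤ 1 - δ / 2) ∧
    δ / 2 ≤ q.2 ∧ q.2 ≤ 1 - δ / 2)) : plateau δ q = 0 := by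
  have : min (min q.1 (1 - q.1)) (min q.2 (1 - q.2)) ≤ δ / 2 := by
    by_contra hc
    simp only [not_le, lt_min_iff] at hc
    exact h ⟨⟨hc.1.1.le, by linarith [hc.1.2]⟩, hc.2.1.le, by linarith [hc.2.2]⟩
  have h5 : 2 * min (min q.1 (1 - q.1)) (min q.2 (1 - q.2)) / δ ≤ 1 := by
    rw [div_le_iff₀ hδ]; linarith
  rw [plateau, max_eq_left]
  exact (min_le_right _ _).trans (by linarith)

/-- The map `nudge` in the third coordinate, cut off near the boundary of the cube. -/
def nudgeHomeo (hδ : 0 < δ) (hδc : δ ≤ c) (hc : c ≤ 1 / 4) : Space ≃ₜ Space :=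
  fiberHomeo (fun q t => (1 - plateau δ q) * t + plateau δ q * nudge δ c t)
    (by unfold plateau nudge; fun_prop) fun q => by
      obtain ⟨w0, w1⟩ := plateau_mem δ q
      have hm := (inc_nudge hδ (hδ.trans_le hδc)).1
      refine Inc.of_fix (fun s t h => ?_) (by unfold nudge; fun_prop) (fun z hz => ?_)
        fun z hz => ?_
      · have h1 := hm h
        rcases w0.eq_or_lt with e | e
        · rw [← e]; linarith
        · nlinarith [mul_lt_mul_of_pos_left h1 e,
            mul_le_mul_of_nonneg_left h.le (sub_nonneg.2 w1)]
      · rw [nudge_fix hδ hδc hc (Or.inl (by linarith))]; ring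
      · rw [nudge_fix hδ hδc hc (Or.inr (Or.inl (by linarith)))]; ring

theorem nudgeHomeo_apply (hδ : 0 < δ) (hδc : δ ≤ c) (hc : c ≤ 1 / 4) (p : Space) :
    nudgeHomeo hδ hδc hc p =
      (p.1, (1 - plateau δ p.1) * p.2 + plateau δ p.1 * nudge δ c p.2) := rfl

theorem nudgeHomeo_fix (hδ : 0 < δ) (hδc : δ ≤ c) (hc : c ≤ 1 / 4) {p : Space}
    (hp : p ∉ core (δ / 2)) : nudgeHomeo hδ hδc hc p = p := by
  rw [nudgeHomeo_apply]
  refine Prod.ext rfl ?_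
  simp only
  by_cases h : (δ / 2 ≤ p.1.1 ∧ p.1.1 ≤ 1 - δ / 2) ∧ δ / 2 ≤ p.1.2 ∧ p.1.2 ≤ 1 - δ / 2
  · have h2 : ¬ (δ / 2 ≤ p.2 ∧ p.2 ≤ 1 - δ / 2) := fun h2 => hp ⟨h.1, h.2, h2⟩
    rw [nudge_fix hδ hδc hc]
    · ring
    · by_cases h3 : p.2 ≤ δ / 2
      · exact Or.inl h3
      · refine Or.inr (Or.inl ?_)
        by_contra h4
        exact h2 ⟨by linarith, by linarith⟩
  · rw [plateau_eq_zero hδ h]; ring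

end

section

variable {m n : ℕ} {a b : Diagram m n} {ε : ℝ}

/-- The image of a cobordism under a homeomorphism that is supported in the interior of the cube. -/
def Cobordism.move (S : Cobordism a b) {δ : ℝ} (hδ : 0 < δ) (h : Space ≃ₜ Space)
    (hf : ∀ p ∉ core δ, h p = p) : Cobordism a b where
  carrier := h '' S.carrier
  dots := h '' S.dots
  isClosed := h.isClosedMap _ S.isClosed
  mem_cube p hp := by
    by_cases hc : p ∈ core δ
    · obtain ⟨-, h2, h3⟩ := core_subset hδ hc
      exact ⟨⟨h2.1.le, h2.2.le⟩, h3.1.le, h3.2.le⟩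
    · rw [mem_img, symm_fix h hf p hc] at hp
      exact S.mem_cube p hp
  collar := by
    obtain ⟨ε, hε, hc⟩ := S.collar
    refine ⟨min ε δ, lt_min hε hδ, fun p => ?_⟩
    have e1 := min_le_left ε δ
    have e2 := min_le_right ε δ
    have hc' : S.Collared (min ε δ) := Cobordism.Collared.mono hc e1
    by_cases hp : p ∈ core δ
    · obtain ⟨⟨x0, x1⟩, ⟨y0, y1⟩, z0, z1⟩ := hp
      refine ⟨fun h => ?_, fun _ _ _ _ => ?_, fun _ _ _ _ => ?_, fun _ _ => ?_, fun _ _ => ?_⟩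
      · rcases h with h | h <;> linarith
      all_goals linarith
    · rw [mem_img, symm_fix h hf p hp]
      exact hc' p
  flat p hp hc := (S.flat _ ((mem_img h _ p).1 hp) (mem_of_fix h.symm
    (symm_fix h fun q hq => hf q fun hq' => hq (core_subset hδ hq')) hc)).image h
  dots_subset := Set.image_mono S.dots_subset
  dots_finite := S.dots_finite.image _
  dots_interior := by
    rintro _ ⟨p, hp, rfl⟩
    exact mem_of_fix h (fun q hq => hf q fun hq' => hq (core_subset hδ hq')) (S.dots_interior hp)

theorem Cobordism.isotopic_move (S : Cobordism a b) {δ : ℝ} (hδ : 0 < δ) (h : Space ≃ₜ Space)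
    (hf : ∀ p ∉ core δ, h p = p) : Isotopic S (S.move hδ h hf) :=
  isotopic_of_homeo h.isHomeomorph (fun p hp => hf p fun hp' => hp (core_subset hδ hp')) rfl rfl

theorem Isotopic.trans {S S' S'' : Cobordism a b} (h : Isotopic S S') (h' : Isotopic S' S'') :
    Isotopic S S'' := by
  obtain ⟨δ, g, hδ, hf, h1, h2⟩ := h.exists_homeo
  obtain ⟨δ', g', hδ', hf', h1', h2'⟩ := h'.exists_homeo
  refine isotopic_of_homeo (g.trans g').isHomeomorph (fun p hp => ?_) ?_ ?_
  · change g' (g p) = p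
    rw [hf p fun hp' => hp (core_subset hδ hp'), hf' p fun hp' => hp (core_subset hδ' hp')]
  · rw [← h1', ← h1, Set.image_image]; rfl
  · rw [← h2', ← h2, Set.image_image]; rfl

theorem exists_isotopic_x (hε : 0 < ε) (hε' : ε ≤ 1 / 64) (ha : IsSlice (8 * ε) m n a.carrier)
    (hb : IsSlice (8 * ε) m n b.carrier) (Z : Cobordism a b) :
    ∃ Z' : Cobordism a b, Isotopic Z Z' ∧
      ∀ p ∈ Z'.carrier, 2 * ε ≤ p.1.1 ∧ p.1.1 ≤ 1 - 2 * ε := by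
  obtain ⟨δ₀, hδ₀, hc₀⟩ := Z.collar
  obtain ⟨δ, hδ, d1, d2⟩ : ∃ δ : ℝ, 0 < δ ∧ δ ≤ δ₀ ∧ δ ≤ 2 * ε :=
    ⟨min δ₀ (2 * ε), by positivity, min_le_left _ _, min_le_right _ _⟩
  have hc : Z.Collared δ := Cobordism.Collared.mono hc₀ d1
  have h4 : 2 * ε ≤ 1 / 4 := by linarith
  let g := nudgeHomeo hδ d2 h4
  let h : Space ≃ₜ Space := swapXZ.trans (g.trans swapXZ)
  have hf : ∀ p ∉ core (δ / 2), h p = p := by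
    intro p hp
    have : g (swapXZ p) = swapXZ p := nudgeHomeo_fix hδ d2 h4 fun hq => hp ⟨hq.2.2, hq.2.1, hq.1⟩
    change swapXZ (g (swapXZ p)) = p
    rw [this]; rfl
  refine ⟨Z.move (by positivity) h hf, Z.isotopic_move _ h hf, ?_⟩
  rintro _ ⟨p, hp, rfl⟩
  change 2 * ε ≤ (1 - plateau δ (p.2, p.1.2)) * p.1.1 + plateau δ (p.2, p.1.2) *
    nudge δ (2 * ε) p.1.1 ∧ (1 - plateau δ (p.2, p.1.2)) * p.1.1 + plateau δ (p.2, p.1.2) *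
    nudge δ (2 * ε) p.1.1 ≤ 1 - 2 * ε
  obtain ⟨x, y0, y1, z0, z1⟩ := hc p
  obtain ⟨hy, hz⟩ := Z.mem_cube p hp
  have hx : δ ≤ p.1.1 ∧ p.1.1 ≤ 1 - δ := by
    constructor <;> by_contra hlt <;> rw [not_le] at hlt
    · exact x (Or.inl hlt) hp
    · exact x (Or.inr hlt) hp
  by_cases hin : (δ ≤ p.2 ∧ p.2 ≤ 1 - δ) ∧ δ ≤ p.1.2 ∧ p.1.2 ≤ 1 - δ
  · rw [plateau_eq_one hδ hin]
    have := le_nudge hδ d2 h4 hx.1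
    have := nudge_le hδ d2 h4 hx.2
    constructor <;> linarith
  · have hfar : 8 * ε ≤ p.1.1 ∧ p.1.1 ≤ 1 - 8 * ε := by
      by_contra hno
      refine hin ⟨⟨?_, ?_⟩, ?_, ?_⟩ <;> by_contra hlt <;> rw [not_le] at hlt <;> apply hno
      · exact ha.mem_x ((z0 hz.1 hlt).1 hp)
      · exact hb.mem_x ((z1 hlt hz.2).1 hp)
      · exact ha.pts_bottom (by linarith) ((y0 hz.1 hz.2 hy.1 hlt).1 hp)
      · exact ha.pts_top (by linarith) ((y1 hz.1 hz.2 hlt hy.2).1 hp)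
    rw [nudge_fix hδ d2 h4 (Or.inr (Or.inr ⟨by linarith, by linarith⟩))]
    constructor <;> linarith

/-- Every cobordism is isotopic to one in good position. -/
theorem exists_goodPosition (hε : 0 < ε) (hε' : ε ≤ 1 / 64) (ha : IsSlice (8 * ε) m n a.carrier)
    (hb : IsSlice (8 * ε) m n b.carrier) (Z : Cobordism a b) :
    ∃ Z' : Cobordism a b, Isotopic Z Z' ∧ Z'.GoodPosition ε := by
  obtain ⟨Z, hZ, hZx⟩ := exists_isotopic_x hε hε' ha hb Z
  suffices hs : ∃ Z' : Cobordism a b, Isotopic Z Z' ∧ Z'.GoodPosition ε by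
    obtain ⟨Z', h1, h2⟩ := hs
    exact ⟨Z', hZ.trans h1, h2⟩
  obtain ⟨δ₀, hδ₀, hc₀⟩ := Z.collar
  obtain ⟨δ₁, hδ₁, hd₁⟩ := exists_subset_core Z.dots_finite.isCompact Z.dots_interior
  obtain ⟨δ, hδ, d1, d2, d3⟩ : ∃ δ : ℝ, 0 < δ ∧ δ ≤ δ₀ ∧ δ ≤ 2 * ε ∧ δ ≤ δ₁ :=
    ⟨min (min δ₀ (2 * ε)) δ₁, by positivity, (min_le_left _ _).trans (min_le_left _ _),
      (min_le_left _ _).trans (min_le_right _ _), min_le_right _ _⟩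
  have hc : Z.Collared δ := Cobordism.Collared.mono hc₀ d1
  have h4 : 2 * ε ≤ 1 / 4 := by linarith
  let g := nudgeHomeo hδ d2 h4
  let h : Space ≃ₜ Space := swapYZ.trans (g.trans swapYZ)
  have hf : ∀ p ∉ core (δ / 2), h p = p := by
    intro p hp
    have : g (swapYZ p) = swapYZ p := nudgeHomeo_fix hδ d2 h4 fun hq => hp ⟨hq.1, hq.2.2, hq.2.1⟩
    change swapYZ (g (swapYZ p)) = p
    rw [this]; rfl
  have happ : ∀ p : Space, h p = ((p.1.1, (1 - plateau δ (p.1.1, p.2)) * p.1.2 +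
    plateau δ (p.1.1, p.2) * nudge δ (2 * ε) p.1.2), p.2) := fun p => rfl
  have hmono := inc_nudge (δ := δ) (c := 2 * ε) hδ (by linarith)
  -- membership in the image, near the bottom and the top of the square
  have side : ∀ (x y z : ℝ), 0 ≤ z → z ≤ 1 → 0 ≤ y → y ≤ 1 →
      (y < 2 * ε → (((x, y), z) ∈ h '' Z.carrier ↔ x ∈ pts n)) ∧
      (1 - 2 * ε < y → (((x, y), z) ∈ h '' Z.carrier ↔ x ∈ pts m)) := by
    intro x y z hz0 hz1 hy0 hy1
    obtain ⟨p, hp⟩ := h.surjective ((x, y), z)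
    have hp' := hp
    rw [happ] at hp'
    obtain ⟨⟨⟨px, py⟩, pz⟩, rfl⟩ : ∃ q : Space, q = p := ⟨p, rfl⟩
    simp only [Prod.mk.injEq] at hp'
    obtain ⟨⟨rfl, hpy⟩, rfl⟩ := hp'
    have hmem : ((px, y), pz) ∈ h '' Z.carrier ↔ ((px, py), pz) ∈ Z.carrier := by
      rw [← hp]; exact h.injective.mem_set_image
    rw [hmem]
    obtain ⟨cx, cy0, cy1, cz0, cz1⟩ := hc ((px, py), pz)
    obtain ⟨w0, w1⟩ := plateau_mem δ (px, pz)
    have hpy0 : 0 ≤ py := by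
      by_contra hneg
      rw [nudge_fix hδ d2 h4 (Or.inl (by linarith))] at hpy
      linarith
    have hpy1 : py ≤ 1 := by
      by_contra hneg
      rw [nudge_fix hδ d2 h4 (Or.inr (Or.inl (by linarith)))] at hpy
      linarith
    by_cases hin : (δ ≤ px ∧ px ≤ 1 - δ) ∧ δ ≤ pz ∧ pz ≤ 1 - δ
    · rw [plateau_eq_one hδ hin, sub_self, zero_mul, one_mul, zero_add] at hpy
      refine ⟨fun hy => cy0 hz0 hz1 hpy0 ?_, fun hy => cy1 hz0 hz1 ?_ hpy1⟩
      · by_contra hlt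
        have := le_nudge hδ d2 h4 (not_lt.1 hlt)
        linarith
      · by_contra hlt
        have := nudge_le hδ d2 h4 (not_lt.1 hlt)
        linarith
    by_cases hx : δ ≤ px ∧ px ≤ 1 - δ
    swap
    · have hno : ((px, py), pz) ∉ Z.carrier := by
        refine cx ?_
        by_contra hlt
        simp only [not_or, not_lt] at hlt
        exact hx hlt
      refine ⟨fun _ => iff_of_false hno fun hpt => hx ?_,
        fun _ => iff_of_false hno fun hpt => hx ?_⟩
      · have := ha.pts_bottom (by linarith) hpt
        constructor <;> linarith [this.1, this.2]
      · have := ha.pts_top (by linarith) hpt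
        constructor <;> linarith [this.1, this.2]
    have low : y < 2 * ε → py < 8 * ε := by
      intro hy
      by_contra hlt
      rw [not_lt] at hlt
      have h1 : 2 * ε ≤ nudge δ (2 * ε) py := le_nudge hδ d2 h4 (by linarith)
      nlinarith
    have high : 1 - 2 * ε < y → 1 - 8 * ε < py := by
      intro hy
      by_contra hlt
      rw [not_lt] at hlt
      have h1 : nudge δ (2 * ε) py ≤ 1 - 2 * ε := nudge_le hδ d2 h4 (by linarith)
      nlinarith
    have hzout : pz < δ ∨ 1 - δ < pz := by
      by_contra hlt
      simp only [not_or, not_lt] at hlt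
      exact hin ⟨hx, hlt⟩
    rcases hzout with hz | hz
    · rw [cz0 hz0 hz]
      exact ⟨fun hy => (ha.collar _).2.1 hpy0 (low hy), fun hy => (ha.collar _).2.2 (high hy) hpy1⟩
    · rw [cz1 hz hz1]
      exact ⟨fun hy => (hb.collar _).2.1 hpy0 (low hy), fun hy => (hb.collar _).2.2 (high hy) hpy1⟩
  refine ⟨Z.move (by positivity) h hf, Z.isotopic_move _ h hf, fun z hz0 hz1 => ⟨?_, ?_⟩, ?_⟩
  · exact fun p hp => ((Z.move (by positivity) h hf).mem_cube (p, z) hp).1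
  · rintro ⟨x, y⟩
    refine ⟨?_, fun h0 h1 => (side x y z hz0 hz1 h0 (by simp only at h1; linarith)).1 h1,
      fun h0 h1 => (side x y z hz0 hz1 (by simp only at h0; linarith) h1).2 h0⟩
    rintro hx ⟨p, hp, hpe⟩
    have hxp : p.1.1 = x := congrArg (fun q : Space => q.1.1) hpe
    have := hZx p hp
    rcases hx with hx | hx <;> simp only at hx <;> linarith [this.1, this.2]
  · rintro _ ⟨p, hp, rfl⟩
    obtain ⟨⟨x0, x1⟩, ⟨y0, y1⟩, z0, z1⟩ := core_mono d3 (hd₁ hp)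
    rw [happ, plateau_eq_one hδ (q := (p.1.1, p.2)) ⟨⟨x0, x1⟩, z0, z1⟩]
    have h1 := le_nudge hδ d2 h4 y0
    have h2 := nudge_le hδ d2 h4 y1
    simp only
    constructor <;> linarith

end

end

end BarNatan

namespace BarNatan

noncomputable section

/-! ### Bent morphisms as compositions with the coevaluation -/

section

variable {m n m' n' : ℕ} {a b : Diagram m n}

/-- Isotopies are transported by homeomorphisms that preserve the open cube. -/
theorem Isotopic.image {c d : Diagram m' n'} (E : Space ≃ₜ Space)
    (hE : ∀ p ∈ openCube, E p ∈ openCube) {S S' : Cobordism a b} (h : Isotopic S S')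
    {T T' : Cobordism c d} (hT : T.carrier = E '' S.carrier) (hTd : T.dots = E '' S.dots)
    (hT' : T'.carrier = E '' S'.carrier) (hTd' : T'.dots = E '' S'.dots) : Isotopic T T' := by
  obtain ⟨δ, g, hδ, hf, hS, hD⟩ := h.exists_homeo
  have key : ∀ X Y : Set Space, g '' X = Y →
      (E.symm.trans (g.trans E)) '' (E '' X) = E '' Y := by
    rintro X _ rfl
    simp only [Set.image_image]
    refine Set.image_congr fun p _ => ?_
    change E (g (E.symm (E p))) = _
    rw [E.symm_apply_apply]
  refine isotopic_of_homeo (E.symm.trans (g.trans E)).isHomeomorph (fun p hp => ?_) ?_ ?_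
  · change E (g (E.symm p)) = p
    rw [hf _ fun hp' => hp ?_, E.apply_symm_apply]
    rw [← E.apply_symm_apply p]
    exact hE _ (core_subset hδ hp')
  · rw [hT, hT', key _ _ hS]
  · rw [hTd, hTd', key _ _ hD]

theorem reflZ_mem {p : Space} (h : p ∈ openCube) : reflZ p ∈ openCube := by
  obtain ⟨h1, h2, h3, h4⟩ := h
  refine ⟨h1, h2, ?_, ?_⟩
  · change 0 < 1 - p.2; linarith
  · change 1 - p.2 < 1; linarith

theorem reflY_mem {p : Space} (h : p ∈ openCube) : reflY p ∈ openCube := by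
  obtain ⟨h1, ⟨h2, h3⟩, h4⟩ := h
  refine ⟨h1, ⟨?_, ?_⟩, h4⟩
  · change 0 < 1 - p.1.2; linarith
  · change 1 - p.1.2 < 1; linarith

theorem reflZ_reflZ (p : Space) : reflZ (reflZ p) = p := by
  rw [reflZ_apply, reflZ_apply]; ext <;> simp

theorem mem_reflZ (T : Set Space) (p : Space) : p ∈ reflZ '' T ↔ (p.1, 1 - p.2) ∈ T :=
  mem_img reflZ T p

theorem mem_reflY (T : Set Space) (p : Space) :
    p ∈ reflY '' T ↔ ((p.1.1, 1 - p.1.2), p.2) ∈ T := mem_img reflY T p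

/-- The cobordism `b → a` obtained from a cobordism `a → b` by reflection in the `z`-direction. -/
def Cobordism.rev (S : Cobordism a b) : Cobordism b a where
  carrier := reflZ '' S.carrier
  dots := reflZ '' S.dots
  isClosed := reflZ.isClosedMap _ S.isClosed
  mem_cube p hp := by
    rw [mem_reflZ] at hp
    obtain ⟨h1, h2⟩ := S.mem_cube _ hp
    simp only at h1 h2
    exact ⟨h1, by linarith, by linarith⟩
  collar := by
    obtain ⟨ε, hε, h⟩ := S.collar
    refine ⟨ε, hε, fun p => ?_⟩
    obtain ⟨hx, hy, hy', hz, hz'⟩ := h (p.1, 1 - p.2)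
    rw [mem_reflZ]
    simp only at hx hy hy' hz hz'
    refine ⟨hx, fun h0 h1 h2 h3 => hy ?_ ?_ ?_ ?_, fun h0 h1 h2 h3 => hy' ?_ ?_ ?_ ?_,
      fun h0 h1 => hz' ?_ ?_, fun h0 h1 => hz ?_ ?_⟩ <;> linarith
  flat p hp hc := (S.flat _ ((mem_img reflZ _ p).1 hp) (reflZ_mem hc)).image reflZ
  dots_subset := Set.image_mono S.dots_subset
  dots_finite := S.dots_finite.image _
  dots_interior := by
    rintro _ ⟨p, hp, rfl⟩
    exact reflZ_mem (S.dots_interior hp)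

theorem Cobordism.rev_rev (S : Cobordism a b) : S.rev.rev = S := by
  have (T : Set Space) : reflZ '' (reflZ '' T) = T := by
    simp only [Set.image_image, reflZ_reflZ, Set.image_id']
  exact Cobordism.ext (this _) (this _)

theorem Isotopic.rev {S S' : Cobordism a b} (h : Isotopic S S') : Isotopic S.rev S'.rev :=
  h.image reflZ (fun _ => reflZ_mem) rfl rfl rfl rfl

theorem rad_flip (q : Plane) : rad (q.1, 1 - q.2) = rad q := by
  rw [rad, rad, ← abs_neg (1 - q.2 - 1 / 2)]
  congr 2; ring

theorem mem_openBox_flip (q : Plane) : (q.1, 1 - q.2) ∈ openBox ↔ q ∈ openBox := by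
  constructor <;> rintro ⟨h, h1, h2⟩ <;> refine ⟨h, ?_, ?_⟩ <;> simp only at h1 h2 ⊢ <;> linarith

theorem mem_arcs_flip (q : Plane) : (q.1, 1 - q.2) ∈ arcs m ↔ q ∈ arcs m :=
  and_congr (not_congr (mem_openBox_flip q)) (by rw [rad_flip])

theorem reflY_image_comp (X Y : Set Space) :
    reflY '' (lo '' X ∪ hi '' Y) = lo '' (reflY '' X) ∪ hi '' (reflY '' Y) := by
  ext p
  simp only [Set.mem_union, mem_lo, mem_hi, mem_reflY]

theorem reflY_image_tens (X Y : Set Space) :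
    reflY '' (thick box '' (thick up '' X ∪ thick dn '' Y)) =
      thick box '' (thick up '' (reflY '' Y) ∪ thick dn '' (reflY '' X)) := by
  ext p
  simp only [Set.mem_union, mem_thick_box, mem_thick_up, mem_thick_dn, mem_reflY]
  rw [or_comm]
  refine or_congr ?_ ?_
  · have e : 2 * (4 * (1 - p.1.2) - 3 / 2) = 1 - (2 * (4 * p.1.2 - 3 / 2) - 1) := by ring
    rw [e]
  · have e : 2 * (4 * (1 - p.1.2) - 3 / 2) - 1 = 1 - 2 * (4 * p.1.2 - 3 / 2) := by ring
    rw [e]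

theorem reflY_image_arcs : reflY '' {p : Space | p.1 ∈ arcs m ∧ 0 ≤ p.2 ∧ p.2 ≤ 1} =
    {p : Space | p.1 ∈ arcs m ∧ 0 ≤ p.2 ∧ p.2 ≤ 1} := by
  ext p
  rw [mem_reflY]
  exact and_congr_left' (mem_arcs_flip p.1)

theorem turn_reflZ (X : Set Space) : turn '' (reflZ '' X) = reflY '' X := by
  ext p
  rw [mem_reflY, mem_turn, mem_reflZ]
  simp only [sub_sub_cancel]

theorem reflY_refl (a : Diagram m n) :
    reflY '' (Cobordism.refl a.dual).carrier = (Cobordism.refl a).carrier := by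
  ext p
  rw [mem_reflY]
  change ((p.1.1, 1 - p.1.2) ∈ flip '' a.carrier ∧ _) ↔ (p.1 ∈ a.carrier ∧ _)
  rw [mem_flip]
  simp only [sub_sub_cancel]

theorem reflZ_refl (a : Diagram m n) :
    reflZ '' (Cobordism.refl a).carrier = (Cobordism.refl a).carrier := by
  ext p
  rw [mem_reflZ]
  change (p.1 ∈ a.carrier ∧ _) ↔ (p.1 ∈ a.carrier ∧ _)
  refine and_congr_right fun _ => ?_
  simp only
  constructor <;> rintro ⟨h1, h2⟩ <;> constructor <;> linarith

variable {ε : ℝ}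

theorem bend_image_reflZ (hε : 0 < ε) (hε' : ε ≤ 1 / 16) (X : Set Space) :
    bend hε '' (reflZ '' X) = reflY '' (bend hε '' X) := by
  simp only [Set.image_image]
  exact Set.image_congr fun p _ => bend_reflZ hε (by linarith) p

theorem push_refl_carrier (hε : 0 < ε) (hε'' : ε ≤ 1 / 16)
    (ha' : IsSlice (2 * ε) m n a.carrier) :
     (push hε hε'' ha' ha' (Cobordism.refl a)).carrier =
    coevSet a.carrier := by
  ext q
  constructor
  · rintro ⟨p, hp, rfl⟩
    exact (bend_mem_coevSet hε hε'' ha' (Cobordism.subset_slab _ hp)).2 hp.1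
  · intro hq
    obtain ⟨hs, e⟩ := bend_symm_mem_slab hε hε'' hq.1
    refine ⟨_, ⟨?_, hs.2.2⟩, e⟩
    rwa [← bend_mem_coevSet hε hε'' ha' hs, e]

/-- A bent cobordism, as a morphism, is the coevaluation of its source followed by the closed-up
cobordism. -/
theorem cls_push_eq_left (hε : 0 < ε) (hε' : ε ≤ 1 / 64) (hε'' : ε ≤ 1 / 16)
    (ha : IsSlice (8 * ε) m n a.carrier) (hb : IsSlice (8 * ε) m n b.carrier)
    (ha' : IsSlice (2 * ε) m n a.carrier) (hb' : IsSlice (2 * ε) m n b.carrier)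
    {K : Cobordism Diagram.empty (closeUp a a)}
    (hK : K.carrier = coevSet a.carrier) (hKd : K.dots = ∅) (S : Cobordism a b) :
    cls (push hε hε'' ha' hb' S) =
      (cls K).comp (Skein.tr ((cls S).tens (cls (Cobordism.refl a.dual)))) := by
  obtain ⟨Z, hSZ, hZ⟩ := exists_goodPosition hε hε' ha hb S
  have h1 : cls S = cls ((Cobordism.refl a).comp ((Cobordism.refl a).comp Z)) := by
    rw [← Skein.comp_cls, ← Skein.comp_cls, Skein.refl_comp, Skein.refl_comp, cls_eq hSZ]
  have h2 : cls (push hε hε'' ha' hb' S) = cls (push hε hε'' ha' hb'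
      ((Cobordism.refl a).comp ((Cobordism.refl a).comp Z))) := by
    rw [← (push_transports hε hε'' ha' hb').map_cls, h1,
      (push_transports hε hε'' ha' hb').map_cls]
  rw [h2, cls_eq (push_isotopic_comp hε hε' ha ha' hb' hε'' hZ hK hKd), ← Skein.comp_cls,
    ← Skein.tr_cls, ← Skein.tens_cls, cls_eq hSZ]

/-- A bent cobordism is also the coevaluation of its target followed by the closure of the dual
cobordism: reflecting the source of the bending homeomorphism in the `z`-direction reflects its
target in the `y`-direction. -/
theorem cls_push_eq_right (hε : 0 < ε) (hε' : ε ≤ 1 / 64) (hε'' : ε ≤ 1 / 16)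
    (ha : IsSlice (8 * ε) m n a.carrier) (hb : IsSlice (8 * ε) m n b.carrier)
    (ha' : IsSlice (2 * ε) m n a.carrier) (hb' : IsSlice (2 * ε) m n b.carrier)
    {K : Cobordism Diagram.empty (closeUp b b)}
    (hK : K.carrier = coevSet b.carrier) (hKd : K.dots = ∅) (S : Cobordism a b) :
    cls (push hε hε'' ha' hb' S) =
      (cls K).comp (Skein.tr ((cls (Cobordism.refl b)).tens (cls S).dual)) := by
  obtain ⟨Z, hSZ, hZ⟩ := exists_goodPosition hε hε' hb ha S.rev
  have hS : Isotopic S Z.rev := by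
    have := hSZ.rev
    rwa [Cobordism.rev_rev] at this
  let W := (Cobordism.refl b).comp ((Cobordism.refl b).comp Z)
  have hW : Isotopic Z W := (refl_comp_isotopic Z).trans (refl_comp_isotopic _)
  have h1 : cls S = cls W.rev := cls_eq (hS.trans hW.rev)
  have main := push_isotopic_comp hε hε' hb hb' ha' hε'' hZ hK hKd
  have hKY : reflY '' K.carrier = K.carrier := by
    rw [hK, ← push_refl_carrier hε hε'' hb']
    change reflY '' (bend hε '' _) = bend hε '' _
    rw [← bend_image_reflZ hε hε'', reflZ_refl]
  have key : Isotopic (push hε hε'' ha' hb' W.rev)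
      (K.comp (((Cobordism.refl b).tens Z.rev.dual).tr)) := by
    refine main.image reflY (fun _ => reflY_mem) ?_ ?_ ?_ ?_
    · exact bend_image_reflZ hε hε'' _
    · exact bend_image_reflZ hε hε'' _
    · change lo '' K.carrier ∪ hi '' (thick box '' (thick up '' (Cobordism.refl b).carrier ∪
        thick dn '' (turn '' (reflZ '' Z.carrier))) ∪ {p | p.1 ∈ arcs m ∧ 0 ≤ p.2 ∧ p.2 ≤ 1}) =
        reflY '' (lo '' K.carrier ∪ hi '' (thick box '' (thick up '' Z.carrier ∪
        thick dn '' (Cobordism.refl b.dual).carrier) ∪ {p | p.1 ∈ arcs m ∧ 0 ≤ p.2 ∧ p.2 ≤ 1}))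
      rw [reflY_image_comp, hKY, Set.image_union reflY, reflY_image_tens, reflY_image_arcs,
        turn_reflZ, reflY_refl]
    · change lo '' K.dots ∪ hi '' (thick box '' (thick up '' ∅ ∪
        thick dn '' (turn '' (reflZ '' Z.dots)))) =
        reflY '' (lo '' K.dots ∪ hi '' (thick box '' (thick up '' Z.dots ∪ thick dn '' ∅)))
      rw [reflY_image_comp, hKd, reflY_image_tens, turn_reflZ]
      simp only [Set.image_empty]
  have h2 : cls (push hε hε'' ha' hb' S) = cls (push hε hε'' ha' hb' W.rev) := by
    rw [← (push_transports hε hε'' ha' hb').map_cls, h1,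
      (push_transports hε hε'' ha' hb').map_cls]
  rw [h2, cls_eq key, ← Skein.comp_cls, ← Skein.tr_cls, ← Skein.tens_cls, ← Skein.dual_cls,
    cls_eq hS]

end

end

end BarNatan

namespace BarNatan

noncomputable section

/-! ### The bending isomorphism of morphism modules -/

section

variable {m n : ℕ} {a a' b b' : Diagram m n}

theorem Diagram.exists_width (a : Diagram m n) :
    ∃ w : ℝ, 0 < w ∧ w ≤ 1 / 64 ∧ IsSlice (8 * w) m n a.carrier := by
  obtain ⟨ε, hε, h⟩ := a.isSlice_of_collar
  refine ⟨min (ε / 8) (1 / 64), by positivity, min_le_right _ _, h.mono ?_⟩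
  linarith [min_le_left (ε / 8) (1 / 64)]

/-- A fraction of the width of a collar of the diagram. -/
def Diagram.width (a : Diagram m n) : ℝ := a.exists_width.choose

/-- The parameter of the homeomorphism that is used for bending cobordisms `a → b`. -/
def bendWidth (a b : Diagram m n) : ℝ := min a.width b.width

theorem bendWidth_pos (a b : Diagram m n) : 0 < bendWidth a b :=
  lt_min a.exists_width.choose_spec.1 b.exists_width.choose_spec.1

theorem bendWidth_le (a b : Diagram m n) : bendWidth a b ≤ 1 / 64 :=
  (min_le_left _ _).trans a.exists_width.choose_spec.2.1

theorem bendWidth_le' (a b : Diagram m n) : bendWidth a b ≤ 1 / 16 :=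
  (bendWidth_le a b).trans (by norm_num)

theorem isSlice_left (a b : Diagram m n) : IsSlice (8 * bendWidth a b) m n a.carrier :=
  a.exists_width.choose_spec.2.2.mono (mul_le_mul_of_nonneg_left (min_le_left _ _) (by norm_num))

theorem isSlice_right (a b : Diagram m n) : IsSlice (8 * bendWidth a b) m n b.carrier :=
  b.exists_width.choose_spec.2.2.mono (mul_le_mul_of_nonneg_left (min_le_right _ _) (by norm_num))

theorem isSlice_left' (a b : Diagram m n) : IsSlice (2 * bendWidth a b) m n a.carrier :=
  (isSlice_left a b).mono (by linarith [bendWidth_pos a b])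

theorem isSlice_right' (a b : Diagram m n) : IsSlice (2 * bendWidth a b) m n b.carrier :=
  (isSlice_right a b).mono (by linarith [bendWidth_pos a b])

/-- The cobordism `∅ → Tr (b ⊗ aᵛ)` obtained by bending a cobordism `a → b`. -/
def Cobordism.bend (S : Cobordism a b) : Cobordism Diagram.empty (closeUp a b) :=
  push (bendWidth_pos a b) (bendWidth_le' a b) (isSlice_left' a b) (isSlice_right' a b) S

/-- Bending is an isomorphism of modules of morphisms. -/
def Skein.bend : Skein a b ≃ₗ[Polynomial ℤ] Skein Diagram.empty (closeUp a b) :=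
  LinearEquiv.ofLinearMap
    (push_transports (bendWidth_pos a b) (bendWidth_le' a b) (isSlice_left' a b)
      (isSlice_right' a b)).map
    (pull_transports (bendWidth_pos a b) (bendWidth_le' a b) (isSlice_left' a b)
      (isSlice_right' a b)).map
    (Skein.hom_ext fun S => by
      rw [LinearMap.comp_apply, Transports.map_cls, Transports.map_cls, push_pull,
        LinearMap.id_apply])
    (Skein.hom_ext fun S => by
      rw [LinearMap.comp_apply, Transports.map_cls, Transports.map_cls, pull_push,
        LinearMap.id_apply])

theorem Skein.bend_cls (S : Cobordism a b) : Skein.bend (cls S) = cls S.bend :=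
  (push_transports (bendWidth_pos a b) (bendWidth_le' a b) (isSlice_left' a b)
    (isSlice_right' a b)).map_cls S

theorem Skein.bend_smul_cls (r : Polynomial ℤ) (S : Cobordism a b) :
    Skein.bend (r • cls S) = r • cls S.bend := by rw [map_smul, Skein.bend_cls]

/-- The coevaluation `∅ → Tr (a ⊗ aᵛ)`: the bent product cobordism. -/
def coev (a : Diagram m n) : Cobordism Diagram.empty (closeUp a a) := (Cobordism.refl a).bend

theorem coev_carrier (a : Diagram m n) : (coev a).carrier = coevSet a.carrier :=
  push_refl_carrier (bendWidth_pos a a) (bendWidth_le' a a) (isSlice_left' a a)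

theorem coev_dots (a : Diagram m n) : (coev a).dots = ∅ := Set.image_empty _

theorem Skein.bend_eq_left (f : Skein a b) :
    Skein.bend f = (cls (coev a)).comp (Skein.tr (f.tens (cls (Cobordism.refl a.dual)))) := by
  induction f using Skein.induction with
  | h0 => simp
  | hadd f g hf hg => simp [hf, hg]
  | hsmul r f hf => simp [hf]
  | hc S =>
    rw [Skein.bend_cls]
    exact cls_push_eq_left _ (bendWidth_le a b) _ (isSlice_left a b) (isSlice_right a b) _ _
      (coev_carrier a) (coev_dots a) S

theorem Skein.bend_eq_right (f : Skein a b) :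
    Skein.bend f = (cls (coev b)).comp (Skein.tr ((cls (Cobordism.refl b)).tens f.dual)) := by
  induction f using Skein.induction with
  | h0 => simp
  | hadd f g hf hg => simp [hf, hg]
  | hsmul r f hf => simp [hf]
  | hc S =>
    rw [Skein.bend_cls]
    exact cls_push_eq_right _ (bendWidth_le a b) _ (isSlice_left a b) (isSlice_right a b) _ _
      (coev_carrier b) (coev_dots b) S

/-- Bending is natural. -/
theorem Skein.bend_comp (f : Skein a' a) (z : Skein a b) (g : Skein b b') :
    Skein.bend (f.comp (z.comp g)) = (Skein.bend z).comp (Skein.tr (g.tens f.dual)) := by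
  have e1 : (f.comp (z.comp g)).tens (cls (Cobordism.refl a'.dual)) =
      (f.tens (cls (Cobordism.refl a'.dual))).comp
        ((z.comp g).tens (cls (Cobordism.refl a'.dual))) := by
    rw [← Skein.tens_comp, Skein.refl_comp]
  have e2 : ((cls (Cobordism.refl a)).tens f.dual).comp
      ((z.comp g).tens (cls (Cobordism.refl a'.dual))) =
        (z.tens (cls (Cobordism.refl a.dual))).comp (g.tens f.dual) := by
    rw [← Skein.tens_comp, ← Skein.tens_comp, Skein.refl_comp, Skein.refl_comp, Skein.comp_refl]
  rw [Skein.bend_eq_left, e1, Skein.tr_comp, ← Skein.comp_assoc, ← Skein.bend_eq_left,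
    Skein.bend_eq_right, Skein.comp_assoc, ← Skein.tr_comp, e2, Skein.tr_comp, ← Skein.comp_assoc,
    ← Skein.bend_eq_left]

end

/-! ### Bending and the grading -/

section

variable {m n : ℕ}

theorem HasEulerChar.congr {E E' : Type} [TopologicalSpace E] [TopologicalSpace E'] {S : Set E}
    {T : Set E'} (e : Nonempty (S ≃ₜ T)) {χ : ℤ} (h : HasEulerChar S χ) : HasEulerChar T χ := by
  obtain ⟨N, K, F, h1, ⟨h2⟩, h3⟩ := h
  exact ⟨N, K, F, h1, ⟨e.some.symm.trans h2⟩, h3⟩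

/-- Bending does not change the surface, so it changes the `q`-degree by the contribution
`(m + n) / 2` of the corners only. -/
theorem map_homogeneous_bend (X Y : Cob m n) (l : ℤ) :
    (Cob.homogeneous X Y l).map
        (Skein.bend (a := X.diagram) (b := Y.diagram)).toLinearMap.toAddMonoidHom =
      Cob.homogeneous Cob.empty ((Cob.tr m).obj (Y.tens X.dual)) (l - ((m + n) / 2 : ℕ)) := by
  refine (AddMonoidHom.map_closure _ _).trans (congrArg AddSubgroup.closure ?_)
  have deg (χ d r : ℤ) : l = Y.shift - X.shift - χ + ((m + n) / 2 : ℕ) + 2 * d + 4 * r ↔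
      l - ((m + n) / 2 : ℕ) =
        (Y.shift + -X.shift) - 0 - χ + ((0 + 0) / 2 : ℕ) + 2 * d + 4 * r := by
    simp only [add_zero, Nat.zero_div, Nat.cast_zero]
    constructor <;> intro h <;> linarith
  ext g
  constructor
  · rintro ⟨_, ⟨S, χ, r, h1, h2, rfl⟩, rfl⟩
    refine ⟨S.bend, χ, r, h1.congr (push_homeomorph _ _ _ _ S), ?_, ?_⟩
    · rw [Cobordism.bend, push_dots_ncard]
      exact (deg _ _ _).1 h2
    · exact Skein.bend_smul_cls _ S
  · rintro ⟨T, χ, r, h1, h2, rfl⟩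
    obtain ⟨S, hS⟩ : ∃ S : Cobordism X.diagram Y.diagram, S.bend = T :=
      ⟨pull (bendWidth_pos _ _) (bendWidth_le' _ _) (isSlice_left' _ _) (isSlice_right' _ _) T,
        push_pull _ _ _ _ T⟩
    subst hS
    refine ⟨_, ⟨S, χ, r, ?_, ?_, rfl⟩, Skein.bend_smul_cls _ S⟩
    · exact h1.congr ((push_homeomorph _ _ _ _ S).map Homeomorph.symm)
    · rw [Cobordism.bend, push_dots_ncard] at h2
      exact (deg _ _ _).2 h2

theorem mem_homogeneous_iff_bend {X Y : Cob m n} (f : Skein X.diagram Y.diagram) (l : ℤ) :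
    (f : X ⟶ Y) ∈ Cob.homogeneous X Y l ↔
      (Skein.bend f : Cob.empty ⟶ (Cob.tr m).obj (Y.tens X.dual)) ∈
        Cob.homogeneous Cob.empty ((Cob.tr m).obj (Y.tens X.dual)) (l - ((m + n) / 2 : ℕ)) := by
  rw [← map_homogeneous_bend]
  exact (AddSubgroup.mem_map_iff_mem
    (Skein.bend (a := X.diagram) (b := Y.diagram)).injective).symm

end

end

end BarNatan

namespace BarNatan

noncomputable section

/-! ### Bending homogeneous maps of complexes -/

section

variable {m n : ℕ}

/-- Bending on morphisms of `Cob`. -/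
def Cob.bend {X Y : Cob m n} : (X ⟶ Y) ≃+ (Cob.empty ⟶ (Cob.tr m).obj (Y.tens X.dual)) :=
  (Skein.bend (a := X.diagram) (b := Y.diagram)).toAddEquiv

theorem Cob.bend_comp {X X' Y Y' : Cob m n} (e : ℤˣ) (f : X' ⟶ X) (z : X ⟶ Y) (g : Y ⟶ Y') :
    Cob.bend z ≫ (Cob.tr m).map (e • Cob.tensHom g (Cob.dualHom f)) =
      e • Cob.bend (f ≫ z ≫ g) := by
  have h : Cob.bend z ≫ (Cob.tr m).map (Cob.tensHom g (Cob.dualHom f)) = Cob.bend (f ≫ z ≫ g) :=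
    (Skein.bend_comp f z g).symm
  rcases Int.units_eq_one_or e with rfl | rfl
  · rw [one_smul, one_smul, h]
  · rw [Units.neg_smul, one_smul, Units.neg_smul, one_smul, Functor.map_neg,
      Preadditive.comp_neg, h]

theorem Cob.bend_units_smul {X Y : Cob m n} (e : ℤˣ) (z : X ⟶ Y) :
    Cob.bend (e • z) = e • Cob.bend z := by
  rw [Units.smul_def, Units.smul_def, map_zsmul]

variable {A A' B B' : CochainComplex (BN m n) ℤ} {a b c k : ℤ}

/-- The entries of a homogeneous map `z : A → B` of degree `k`, bent and arranged to a map of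
degree `k` from `∅` to `Tr (B ⊗ Aᵛ)`. Its entry at the summand `B^i ⊗ (A^{-j})ᵛ` with `i + j = k` is
the bent entry of `z : A^{-j} → B^i`; no sign is involved. -/
def bendCochain (z : Cochain A B k) : Cochain emptyComplex (dualityTarget A B) k :=
  Cochain.mk fun p q h => ProdMat.Hom.mk
    (fun (i : PLift (p = 0)) (x : (totX (toProd B) (toProd (dualComplex A)) q).ι) =>
      Cob.bend (z.v (-x.1.1.2) x.1.1.1 (by
        have := i.down
        have := x.1.2
        omega) x.2.2 x.2.1))
    fun _ => (Set.subsingleton_of_subsingleton (α := PLift (p = 0))).finite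

theorem bendCochain_entry (z : Cochain A B k) {q i j : ℤ} (h : 0 + k = q) (hij : i + j = q)
    (u : (B.X i).ι) (v : (A.X (-j)).ι) :
    ((bendCochain z).v 0 q h).entry ⟨rfl⟩ ⟨⟨(i, j), hij⟩, (u, v)⟩ =
      Cob.bend (z.v (-j) i (by omega) v u) := rfl

theorem bendCochain_ext {w w' : Cochain emptyComplex (dualityTarget A B) k}
    (h : ∀ (q i j : ℤ) (hq : 0 + k = q) (hij : i + j = q) (u : (B.X i).ι) (v : (A.X (-j)).ι),
      (w.v 0 q hq).entry ⟨rfl⟩ ⟨⟨(i, j), hij⟩, (u, v)⟩ =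
        (w'.v 0 q hq).entry ⟨rfl⟩ ⟨⟨(i, j), hij⟩, (u, v)⟩) : w = w' := by
  refine Cochain.ext _ _ fun p q hpq => ProdMat.hom_ext fun ⟨hp⟩ => ?_
  subst hp
  rintro ⟨⟨⟨i, j⟩, hij⟩, u, v⟩
  exact h q i j hpq hij u v

theorem bendCochain_add (z z' : Cochain A B k) :
    bendCochain (z + z') = bendCochain z + bendCochain z' :=
  bendCochain_ext fun _ _ _ _ _ _ _ => map_add Cob.bend _ _

theorem bendCochain_bijective :
    Function.Bijective
      (bendCochain : Cochain A B k → Cochain emptyComplex (dualityTarget A B) k) := by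
  constructor
  · intro z z' h
    refine Cochain.ext _ _ fun p q hpq => ?_
    obtain ⟨j, rfl⟩ : ∃ j, p = -j := ⟨-p, (neg_neg p).symm⟩
    refine Mat_.hom_ext _ _ fun v u => Cob.bend.injective ?_
    have := congrArg (fun w => (w.v 0 k (zero_add k)).entry ⟨rfl⟩
      ⟨⟨(q, j), by omega⟩, (u, v)⟩) h
    exact this
  · intro w
    have hex : ∀ p q (h : p + k = q), ∃ f : A.X p ⟶ B.X q, ∀ j (hj : A.X (-j) = A.X p)
        (hq : q + j = k) (u : (B.X q).ι) (v : (A.X (-j)).ι), p = -j →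
          Cob.bend ((eqToHom hj ≫ f) v u) =
            (w.v 0 k (zero_add k)).entry ⟨rfl⟩ ⟨⟨(q, j), hq⟩, (u, v)⟩ := by
      intro p q h
      obtain ⟨j, rfl⟩ : ∃ j, p = -j := ⟨-p, (neg_neg p).symm⟩
      let f : A.X (-j) ⟶ B.X q := fun v u => Cob.bend.symm ((w.v 0 k (zero_add k)).entry ⟨rfl⟩
        ⟨⟨(q, j), by omega⟩, (u, v)⟩)
      refine ⟨f, fun j' hj hq u v e => ?_⟩
      obtain rfl : j = j' := neg_injective e
      have he : eqToHom hj ≫ f = f := by rw [eqToHom_refl, Category.id_comp]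
      exact (congrArg (fun f : A.X (-j) ⟶ B.X q => Cob.bend (f v u)) he).trans
        (Cob.bend.apply_symm_apply _)
    choose f hf using hex
    refine ⟨Cochain.mk fun p q h => f p q h, bendCochain_ext fun q i j hq hij u v => ?_⟩
    obtain rfl : k = q := by omega
    rw [bendCochain_entry, Cochain.mk_v, ← hf (-j) i (by omega) j rfl hij u v rfl, eqToHom_refl,
      Category.id_comp]

theorem mat_units_smul {M N : BN m n} (e : ℤˣ) (f : M ⟶ N) (i : M.ι) (j : N.ι) :
    (e • f) i j = e • f i j := by
  rcases Int.units_eq_one_or e with rfl | rfl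
  · rw [one_smul, one_smul]
  · rw [Units.neg_smul, one_smul, Units.neg_smul, one_smul]; rfl

/-- The entries of `g ⊗ fᵛ`. -/
theorem totEntry_dual (f : Cochain A' A a) (g : Cochain B B' b) {i j i' j' : ℤ} (hi : i + b = i')
    (hj : j + a = j') (hij : i + j = k) (u : (B.X i).ι) (v : (A.X (-j)).ι) (u' : (B'.X i').ι)
    (v' : (A'.X (-j')).ι) :
    totEntry (g.map (ProdMat.incl (Cob m n))) ((dualCochain f).map (ProdMat.incl (Cob n m)))
        i j i' j' u v u' v' =
      (k * a).negOnePow •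
        Cob.tensHom (g.v i i' hi u u') (Cob.dualHom (f.v (-j') (-j) (by omega) v' v)) := by
  have h1 : (coeff (g.map (ProdMat.incl (Cob m n))) i i').entry u u' = g.v i i' hi u u' := by
    rw [coeff, dif_pos hi]; rfl
  have h2 : (coeff ((dualCochain f).map (ProdMat.incl (Cob n m))) j j').entry v v' =
      (j * a).negOnePow • Cob.dualHom (f.v (-j') (-j) (by omega) v' v) := by
    rw [coeff, dif_pos hj]
    exact mat_units_smul (M := BN.dual (A.X (-j))) (N := BN.dual (A'.X (-j'))) _ _ v v'
  refine (congrArg₂ (fun x y => (i * a).negOnePow • Cob.tensHom x y) h1 h2).trans ?_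
  rw [← hij, add_mul, Int.negOnePow_add, mul_smul]
  congr 1
  rcases Int.units_eq_one_or (j * a).negOnePow with h | h
  · rw [h, one_smul, one_smul]; rfl
  · rw [h, Units.neg_smul, one_smul, Units.neg_smul, one_smul]
    exact map_neg (AddMonoidHom.mk' (fun y => Cob.tensHom (g.v i i' hi u u') y)
      (Cob.tensHom_add _)) _

theorem dualityMap_entry_eq_zero (f : Cochain A' A a) (g : Cochain B B' b) (h : b + a = c)
    (p q : ℤ) (hpq : p + c = q) (x : (totX (toProd B) (toProd (dualComplex A)) p).ι)
    (y : (totX (toProd B') (toProd (dualComplex A')) q).ι) (hxy : x.1.1.1 + b ≠ y.1.1.1) :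
    ((dualityMap f g h).v p q hpq).entry x y = 0 :=
  (congrArg (Cob.tr m).map (totEntry_eq_zero_left _ _ _ _ _ _ _ _ _ _ (by
    rw [coeff_of_ne _ hxy]; rfl))).trans (Functor.map_zero _ _ _)

theorem bend_entry_comp {M N M' N' : BN m n} (e : ℤˣ) (f : M' ⟶ M) (z : M ⟶ N) (g : N ⟶ N')
    (v : M'.ι) (u : N'.ι) : Cob.bend ((e • (f ≫ z ≫ g)) v u) =
      ∑ w : N.ι × M.ι, e • Cob.bend (f v w.2 ≫ z w.2 w.1 ≫ g w.1 u) := by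
  rw [mat_units_smul, Cob.bend_units_smul, ← Finset.smul_sum, Fintype.sum_prod_type_right]
  simp only [Mat_.comp_apply, map_sum, Preadditive.comp_sum]

/-- Naturality of bending for homogeneous maps. The sign `(-1)^{i a}` of the tensor product and the
sign `(-1)^{j a}` of the dual combine to the sign `(-1)^{k a}` of precomposition. -/
theorem bendCochain_natural (f : Cochain A' A a) (g : Cochain B B' b) (z : Cochain A B k) {s t : ℤ}
    (hs : a + k = s) (ht : s + b = t) (hc : b + a = c) (hkc : k + c = t) :
    bendCochain (lMap g (rMap f z hs) ht) = (bendCochain z).comp (dualityMap f g hc) hkc := by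
  classical
  refine bendCochain_ext fun q i' j' hq hij u' v' => ?_
  obtain rfl : t = q := by omega
  obtain ⟨i, hi⟩ : ∃ i, i + b = i' := ⟨i' - b, by omega⟩
  obtain ⟨j, hj⟩ : ∃ j, j + a = j' := ⟨j' - a, by omega⟩
  have hij' : i + j = k := by omega
  let x₀ : {p : ℤ × ℤ // p.1 + p.2 = k} := ⟨(i, j), hij'⟩
  let S : Finset (totX (toProd B) (toProd (dualComplex A)) k).ι :=
    (Finset.univ : Finset ((B.X i).ι × (A.X (-j)).ι)).map ⟨Sigma.mk x₀, sigma_mk_injective⟩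
  let y : (totX (toProd B') (toProd (dualComplex A')) t).ι := ⟨⟨(i', j'), hij⟩, (u', v')⟩
  let F (x : (totX (toProd B) (toProd (dualComplex A)) k).ι) :
      Cob.empty ⟶ (Cob.tr m).obj ((totX (toProd B') (toProd (dualComplex A')) t).X y) :=
    ((bendCochain z).v 0 k (zero_add k)).entry ⟨rfl⟩ x ≫
      ((dualityMap f g hc).v k t hkc).entry x y
  have hF (w : (B.X i).ι × (A.X (-j)).ι) : F ⟨x₀, w⟩ = (k * a).negOnePow •
      Cob.bend (f.v (-j') (-j) (by omega) v' w.2 ≫ z.v (-j) i (by omega) w.2 w.1 ≫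
        g.v i i' hi w.1 u') := by
    rw [← Cob.bend_comp, ← totEntry_dual f g hi hj hij']
    rfl
  have hS : ∑ x ∈ S, F x = ∑ w : (B.X i).ι × (A.X (-j)).ι, F ⟨x₀, w⟩ := Finset.sum_map _ _ F
  have rhs : (((bendCochain z).comp (dualityMap f g hc) hkc).v 0 t hq).entry ⟨rfl⟩ y =
      ∑ x ∈ S, F x := by
    rw [Cochain.comp_v _ _ hkc 0 k t (zero_add k) hkc]
    refine ProdMat.comp_entry_of_subset ((bendCochain z).v 0 k (zero_add k))
      ((dualityMap f g hc).v k t hkc) ⟨rfl⟩ y S ?_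
    rintro ⟨⟨⟨i₁, j₁⟩, h₁⟩, w⟩ hx
    by_cases h : i₁ + b = i'
    · obtain rfl : i₁ = i := by omega
      have h₁' : i₁ + j₁ = k := h₁
      obtain rfl : j₁ = j := by omega
      exact Finset.mem_map.2 ⟨w, @Finset.mem_univ ((B.X _).ι × (A.X (-_)).ι) _ w, rfl⟩
    · exact absurd (dualityMap_entry_eq_zero f g hc _ _ _ _ _ h) hx
  have lhs : (lMap g (rMap f z hs) ht).v (-j') i' (by omega) = (k * a).negOnePow •
      (f.v (-j') (-j) (by omega) ≫ z.v (-j) i (by omega) ≫ g.v i i' hi) := by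
    rw [lMap, Cochain.comp_v _ _ ht (-j') i i' (by omega) hi, rMap, Cochain.units_smul_v,
      Cochain.comp_v _ _ hs (-j') (-j) i (by omega) (by omega), Linear.units_smul_comp,
      Category.assoc]
  refine Eq.trans ?_ ((rhs.trans hS).trans (Finset.sum_congr rfl fun w _ => hF w)).symm
  rw [bendCochain_entry, lhs]
  exact bend_entry_comp _ _ _ _ v' u'

end

end

end BarNatan

namespace BarNatan

noncomputable section

/-! ### The duality isomorphism -/

section

variable {m n : ℕ}

theorem Skein.dual_refl (a : Diagram m n) :
    Skein.dual (cls (Cobordism.refl a)) = cls (Cobordism.refl a.dual) := by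
  rw [Skein.dual_cls]
  refine congrArg cls (Cobordism.ext ?_ (Set.image_empty _))
  ext p
  change p ∈ turn '' _ ↔ p.1 ∈ flip '' a.carrier ∧ _
  rw [mem_turn, mem_flip]
  refine and_congr_right fun _ => ?_
  simp only
  constructor <;> rintro ⟨h1, h2⟩ <;> constructor <;> linarith

theorem BN.dualHom_id (M : BN m n) : BN.dualHom (𝟙 M) = 𝟙 (BN.dual M) := by
  refine Mat_.hom_ext _ _ fun (i : M.ι) (j : M.ι) => ?_
  by_cases h : i = j
  · subst h
    have e1 : (𝟙 M : M ⟶ M) i i = 𝟙 (M.X i) := Mat_.id_apply_self M i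
    exact (congrArg Cob.dualHom e1).trans
      ((Skein.dual_refl _).trans (Mat_.id_apply_self (BN.dual M) i).symm)
  · have e1 : (𝟙 M : M ⟶ M) j i = 0 := Mat_.id_apply_of_ne M j i (Ne.symm h)
    exact (congrArg Cob.dualHom e1).trans
      ((map_zero Skein.dual).trans (Mat_.id_apply_of_ne (BN.dual M) i j h).symm)

variable {A B : CochainComplex (BN m n) ℤ} {k : ℤ}

theorem dualCochain_id (A : CochainComplex (BN m n) ℤ) :
    dualCochain (Cochain.ofHom (𝟙 A)) = Cochain.ofHom (𝟙 (dualComplex A)) := by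
  refine Cochain.ext _ _ fun p q h => ?_
  obtain rfl : q = p := by omega
  have h1 : (Cochain.ofHom (𝟙 A)).v (-q) (-q) (add_zero _) = 𝟙 (A.X (-q)) := by
    rw [Cochain.ofHom_v]; rfl
  have h2 : (q * 0).negOnePow • BN.dualHom ((Cochain.ofHom (𝟙 A)).v (-q) (-q) (add_zero _)) =
      𝟙 (BN.dual (A.X (-q))) := by
    rw [h1, BN.dualHom_id, mul_zero, Int.negOnePow_zero, one_smul]
  refine Eq.trans h2 ?_
  rw [Cochain.ofHom_v]
  rfl

theorem totHom_neg_right {k : ℕ} {K K' : CochainComplex (BNProd m k) ℤ}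
    {L L' : CochainComplex (BNProd k n) ℤ} {a b : ℤ} (f : Cochain K K' a) (g : Cochain L L' b)
    (s t : ℤ) : totHom f (-g) s t = -totHom f g s t := by
  refine ProdMat.hom_ext fun (x : (totX K L s).ι) (y : (totX K' L' t).ι) => ?_
  have h : coeff (-g) x.1.1.2 y.1.1.2 = -coeff g x.1.1.2 y.1.1.2 := by
    unfold coeff
    split_ifs
    · rfl
    · rw [neg_zero]
  let T : ((L.X x.1.1.2).X x.2.2 ⟶ (L'.X y.1.1.2).X y.2.2) →+
      (((K.X x.1.1.1).X x.2.1).tens ((L.X x.1.1.2).X x.2.2) ⟶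
        ((K'.X y.1.1.1).X y.2.1).tens ((L'.X y.1.1.2).X y.2.2)) :=
    AddMonoidHom.mk' (Cob.tensHom ((coeff f x.1.1.1 y.1.1.1).entry x.2.1 y.2.1)) (Cob.tensHom_add _)
  have e : totEntry f (-g) x.1.1.1 x.1.1.2 y.1.1.1 y.1.1.2 x.2.1 x.2.2 y.2.1 y.2.2 =
      -totEntry f g x.1.1.1 x.1.1.2 y.1.1.1 y.1.1.2 x.2.1 x.2.2 y.2.1 y.2.2 := by
    rw [totEntry, totEntry, h, ← smul_neg]
    exact congrArg _ (map_neg T _)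
  exact e

/-- The differential of `Tr (B ⊗ Aᵛ)` in terms of the differentials of `A` and `B`. The minus sign
is that of the differential `-(d_A)ᵛ` of the dual complex. -/
theorem diff_dualityTarget (A B : CochainComplex (BN m n) ℤ) :
    Cochain.diff (dualityTarget A B) =
      dualityMap (Cochain.ofHom (𝟙 A)) (Cochain.diff B) (add_zero 1) -
        dualityMap (Cochain.diff A) (Cochain.ofHom (𝟙 B)) (zero_add 1) := by
  have h1 : (dualCochain (Cochain.ofHom (𝟙 A))).map (ProdMat.incl (Cob n m)) =
      Cochain.ofHom (𝟙 (toProd (dualComplex A))) := by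
    rw [dualCochain_id, Cochain.map_ofHom, CategoryTheory.Functor.map_id]
  have h2 : (Cochain.ofHom (𝟙 B)).map (ProdMat.incl (Cob m n)) =
      Cochain.ofHom (𝟙 (toProd B)) := by
    rw [Cochain.map_ofHom, CategoryTheory.Functor.map_id]
  have h3 : (dualCochain (Cochain.diff A)).map (ProdMat.incl (Cob n m)) =
      -Cochain.diff (toProd (dualComplex A)) := by
    rw [← neg_neg (dualCochain (Cochain.diff A)), ← dualComplex_diff, Cochain.map_neg]
    rfl
  refine Cochain.ext _ _ fun p q h => ?_
  let Φ := ProdMat.mapFunctor (Cob.tr m)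
  have e1 : (dualityMap (Cochain.ofHom (𝟙 A)) (Cochain.diff B) (add_zero 1)).v p q h =
      Φ.map (totHom (Cochain.diff (toProd B)) (Cochain.ofHom (𝟙 (toProd (dualComplex A)))) p q) :=
    congrArg (fun w => Φ.map (totHom (Cochain.diff (toProd B)) w p q)) h1
  have e2 : (dualityMap (Cochain.diff A) (Cochain.ofHom (𝟙 B)) (zero_add 1)).v p q h =
      -Φ.map (totHom (Cochain.ofHom (𝟙 (toProd B))) (Cochain.diff (toProd (dualComplex A))) p q) :=
    (congrArg₂ (fun w w' => Φ.map (totHom w w' p q)) h2 h3).trans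
      ((congrArg Φ.map (totHom_neg_right _ _ _ _)).trans Φ.map_neg)
  rw [Cochain.sub_v, e1, e2]
  exact Φ.map_add.trans (sub_neg_eq_add _ _).symm

theorem δ_eq_sub (z : Cochain A B k) : δ k (k + 1) z =
    lMap (Cochain.diff B) (rMap (Cochain.ofHom (𝟙 A)) z (zero_add k)) rfl -
      lMap (Cochain.ofHom (𝟙 B)) (rMap (Cochain.diff A) z (add_comm 1 k)) (add_zero _) := by
  refine Cochain.ext _ _ fun p q h => ?_
  rw [δ_v k (k + 1) rfl z p q h (q - 1) (p + 1) rfl rfl, Cochain.sub_v, lMap, lMap,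
    Cochain.comp_v _ _ rfl p (q - 1) q (by omega) (by omega), Cochain.comp_zero_cochain_v, rMap,
    rMap, Cochain.units_smul_v, Cochain.units_smul_v, Cochain.zero_cochain_comp_v,
    Cochain.comp_v _ _ (add_comm 1 k) p (p + 1) q rfl (by omega), Int.negOnePow_succ]
  simp [Cochain.diff, sub_eq_add_neg]

theorem δ_empty {K : CochainComplex (BNProd 0 0) ℤ} (w : Cochain emptyComplex K k) :
    δ k (k + 1) w = w.comp (Cochain.diff K) rfl := by
  refine Cochain.ext _ _ fun p q h => ?_
  rw [δ_v k (k + 1) rfl w p q h (q - 1) (p + 1) rfl rfl,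
    Cochain.comp_v _ _ rfl p (q - 1) q (by omega) (by omega)]
  have : emptyComplex.d p (p + 1) = 0 := rfl
  rw [this, Limits.zero_comp, smul_zero, add_zero]
  rfl

theorem bendCochain_δ (z : Cochain A B k) :
    bendCochain (δ k (k + 1) z) = δ k (k + 1) (bendCochain z) := by
  let bendHom : Cochain A B (k + 1) →+ Cochain emptyComplex (dualityTarget A B) (k + 1) :=
    AddMonoidHom.mk' bendCochain bendCochain_add
  rw [δ_eq_sub, δ_empty, diff_dualityTarget]
  refine (map_sub bendHom _ _).trans ?_
  rw [Cochain.comp_sub]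
  exact congrArg₂ (· - ·) (bendCochain_natural _ _ _ _ _ _ _) (bendCochain_natural _ _ _ _ _ _ _)

/-- The duality isomorphism. -/
def dualityIso (A B : CochainComplex (BN m n) ℤ) :
    CochainComplex.HomComplex A B ≅
      CochainComplex.HomComplex emptyComplex (dualityTarget A B) :=
  HomologicalComplex.Hom.isoOfComponents
    (fun k => (AddEquiv.ofBijective (AddMonoidHom.mk' (bendCochain (A := A) (B := B) (k := k))
      bendCochain_add) bendCochain_bijective).toAddCommGrpIso)
    (by
      rintro k _ rfl
      ext z
      exact (bendCochain_δ z).symm)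

theorem mem_bidegree_iff (z : Cochain A B k) (l : ℤ) : z ∈ bidegree A B k l ↔
    bendCochain z ∈ bidegreeProd emptyComplex (dualityTarget A B) k (l - ((m + n) / 2 : ℕ)) := by
  constructor
  · rintro h p q hpq ⟨hp⟩ ⟨⟨⟨i, j⟩, hij⟩, u, v⟩
    exact (mem_homogeneous_iff_bend _ l).1 (h _ _ _ v u)
  · intro h p q hpq
    obtain ⟨j, rfl⟩ : ∃ j, p = -j := ⟨-p, (neg_neg p).symm⟩
    intro v u
    exact (mem_homogeneous_iff_bend _ l).2
      (h 0 k (zero_add k) ⟨rfl⟩ ⟨⟨(q, j), by omega⟩, (u, v)⟩)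

theorem mem_iSup_bidegree_iff (z : Cochain A B k) : z ∈ ⨆ l, bidegree A B k l ↔
    bendCochain z ∈ ⨆ l, bidegreeProd emptyComplex (dualityTarget A B) k l := by
  let e : Cochain A B k ≃+ Cochain emptyComplex (dualityTarget A B) k :=
    AddEquiv.ofBijective (AddMonoidHom.mk' bendCochain bendCochain_add) bendCochain_bijective
  have h1 (l : ℤ) : (bidegree A B k l).map e.toAddMonoidHom =
      bidegreeProd emptyComplex (dualityTarget A B) k (l - ((m + n) / 2 : ℕ)) := by
    ext w
    obtain ⟨z, rfl⟩ := e.surjective w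
    exact (AddSubgroup.mem_map_iff_mem e.injective).trans (mem_bidegree_iff z l)
  have h2 : (⨆ l, bidegree A B k l).map e.toAddMonoidHom =
      ⨆ l, bidegreeProd emptyComplex (dualityTarget A B) k l := by
    rw [AddSubgroup.map_iSup]
    simp only [h1]
    exact (Equiv.subRight (((m + n) / 2 : ℕ) : ℤ)).iSup_comp
      (g := fun l => bidegreeProd emptyComplex (dualityTarget A B) k l)
  rw [← h2]
  exact (AddSubgroup.mem_map_iff_mem e.injective).symm

end

end

end BarNatan

theorem theorem4 (m n : ℕ) :
    ∃ φ : ∀ A B : CochainComplex (BN m n) ℤ,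
        CochainComplex.HomComplex A B ≅ CochainComplex.HomComplex emptyComplex (dualityTarget A B),
      (∀ (A B : CochainComplex (BN m n) ℤ) (k l : ℤ) (z : Cochain A B k),
        z ∈ bidegree A B k l ↔
          evalIso (φ A B) z ∈
            bidegreeProd emptyComplex (dualityTarget A B) k (l - ((m + n) / 2 : ℕ))) ∧
      (∀ (A B : CochainComplex (BN m n) ℤ) (k : ℤ) (z : Cochain A B k),
        z ∈ ⨆ l, bidegree A B k l ↔
          evalIso (φ A B) z ∈ ⨆ l, bidegreeProd emptyComplex (dualityTarget A B) k l) ∧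
      ∀ (A A' B B' : CochainComplex (BN m n) ℤ) (a b k s t c : ℤ) (f : Cochain A' A a)
        (g : Cochain B B' b) (z : Cochain A B k) (hs : a + k = s) (ht : s + b = t)
        (hc : b + a = c) (hkc : k + c = t),
        evalIso (φ A' B') (lMap g (rMap f z hs) ht) =
          (evalIso (φ A B) z).comp (dualityMap f g hc) hkc := by
  exact ⟨dualityIso, fun _ _ _ l z => mem_bidegree_iff z l, fun _ _ _ z => mem_iSup_bidegree_iff z,
    fun _ _ _ _ _ _ _ _ _ _ f g z hs ht hc hkc => bendCochain_natural f g z hs ht hc hkc⟩
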